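/- **Setting.** Let $c\neq 0$ and $$f(x,y)=\tfrac{x-y+ic}{x-y},\quad g(x,y)=\tfrac{ic}{x-y},\quad h(x,y)=\tfrac{x-y+ic}{ic},\quad t(x,y)=\tfrac{g(x,y)}{h(x,y)},\quad K(x,y)=\tfrac{2c^2}{(x-y)^2+c^2}.$$ For sets of variables, $F(\bar x,\bar y)=\prod_{j,k}F(x_j,y_k)$, $\Delta_F(\bar x)=\prod_{i>j}F(x_i,x_j)$, $\Delta'_F(\bar x)=\prod_{i<j}F(x_i,x_j)$. A $\mathfrak{gl}(2|1)$-related model is a monodromy matrix $T_{ij}(x)$, $1\le i,j\le 3$, with gradings $[1]=[2]=0$, $[3]=1$, that satisfies for $x\ne y$ the RTT relation of the graded $R$-matrix $1+ic\,\mathbb P/(x-y)$, i.e. $$T_{ij}(x)T_{kl}(y)-(-1)^{([i]+[j])([k]+[l])}T_{kl}(y)T_{ij}(x)=(-1)^{[i]([k]+[l])+[k][l]}g(x,y)\bigl(T_{kj}(y)T_{il}(x)-T_{kj}(x)T_{il}(y)\bigr),$$ with a vacuum and a dual vacuum: $T_{ii}(x)|0\rangle=\lambda_i(x)|0\rangle$,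 $T_{ij}(x)|0\rangle=0$ for $i>j$, $\langle0|T_{ii}(x)=\lambda_i(x)\langle0|$, $\langle0|T_{ij}(x)=0$ for $i<j$, $\langle0|0\rangle=1$. Put $r_1=\lambda_1/\lambda_2$, $r_3=\lambda_3/\lambda_2$. In the generalized model the vacuum eigenvalues at any finite set of points are free parameters: there is a model for every choice of them. With $\mathbb T_{j3}(\bar v)=\Delta_h(\bar v)^{-1}T_{j3}(v_1)T_{j3}(v_2)\cdots$ and $\mathbb T_{3j}(\bar v)=\Delta'_h(\bar v)^{-1}T_{3j}(v_1)T_{3j}(v_2)\cdots$, the Bethe vectors are $$|\bar u;\bar v\rangle=\sum\frac{g(\bar v_{I},\bar u_{I})f(\bar u_{I},\bar u_{II})g(\bar v_{II},\bar v_{I})h(\bar u_{I},\bar u_{I})}{\lambda_2(\bar u)\lambda_2(\bar v_{II})f(\bar v,\bar u)}\,\mathbb T_{13}(\bar u_{I})T_{12}(\bar u_{II})\mathbb T_{23}(\bar v_{II})|0\rangle ,$$ summed over partitions of $\bar u$ and of $\bar v$ into two parts with $\#\bar u_I=\#\bar v_I$; the dual vectors $\langle\bar u;\bar v|$ are $(-1)^{b(b-1)/2}$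 times the sum with the same coefficients and with $\langle0|\mathbb T_{32}(\bar v_{II})T_{21}(\bar u_{II})\mathbb T_{31}(\bar u_{I})$, where $b=\#\bar v$. **Data.** Fix a model, an operator $O=\sum\kappa_{i_1j_1\dots i_Nj_N}T_{i_1j_1}(w_1)\cdots T_{i_Nj_N}(w_N)$, and $\bar u=\{u_1,\dots,u_a\}$, $\bar v=\{v_1,\dots,v_b\}$. All the points $u_j,v_k,w_l$ are pairwise distinct and $u_j-u_k\ne ic$, $v_j-v_k\neq ic$, $v_j-u_k\ne -ic$, $w_j-u_k\ne-ic$, $v_j-w_k\ne-ic$; $\lambda_2\neq0$ near all $u_j,v_k$; $r_1$, $r_3$ are differentiable at the $u_j$, $v_k$ respectively; and the Bethe equations hold: $$r_1(u_j)=\prod_{k\ne j}\frac{f(u_j,u_k)}{f(u_k,u_j)}\prod_{k}f(v_k,u_j),\qquad r_3(v_j)=\prod_k f(v_j,u_k).$$ Put $Z_j=i\,(\log r_1)'(u_j)$, $Y_j=i\,(\log r_3)'(v_j)$. The diagonal form factor is $$F^O_{a,b}(\bar u;\bar v|\bar Z;\bar Y)=\lim_{\bar u^C\to\bar u,\ \bar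 v^C\to\bar v}\frac{\langle\bar u^C;\bar v^C|O|\bar u;\bar v\rangle}{f(\bar w,\bar u^C)f(\bar v^C,\bar w)}$$ (limit of the off-shell form factor of the given model, with $u^C_j\neq u_j$, $v^C_j\ne v_j$ for all $j$), and $\langle\bar u;\bar v|\bar u;\bar v\rangle$ is the same limit of the scalar product. For a partition $\bar u=\bar u_I\cup\bar u_{II}$, $\bar v=\bar v_I\cup\bar v_{II}$ with $\#\bar u_I=m$, $\#\bar v_I=n$, the symmetric form factor $\mathbb F_{a-m,b-n}(\bar u_{II};\bar v_{II})$ is the limit as $\varepsilon\to0$, $\varepsilon\ne0$, of $\langle\bar u_{II}+\varepsilon;\bar v_{II}+\varepsilon|O|\bar u_{II};\bar v_{II}\rangle/\bigl(f(\bar w,\bar u_{II}+\varepsilon)f(\bar v_{II}+\varepsilon,\bar w)\bigr)$ computed in the generalized model, where $r_1,r_3$ at the rapidities are given by the Bethe equations for $(\bar u_{II}+\varepsilon;\bar v_{II}+\varepsilon)$ and for $(\bar u_{II};\bar v_{II})$, and where the vacuum eigenvalues at the points $w_l$ are those of the given model modified by the presence of the other particles: $$\lambda_1(w)\mapsto\frac{\lambda_1(w)f(\bar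 u_I,w)}{f(w,\bar u_I)f(\bar v_I,w)},\qquad\lambda_2(w)\mapsto\lambda_2(w),\qquad\lambda_3(w)\mapsto\frac{\lambda_3(w)}{f(w,\bar u_I)}.$$ The Gaudin matrix $G(\bar u,\bar v)$ is the $(a+b)\times(a+b)$ matrix with the blocks $$G_{j,k}=\delta_{jk}\Bigl[cZ_k-\sum_{\ell}K(u_k,u_\ell)-\sum_m t(v_m,u_k)\Bigr]+K(u_k,u_j),\qquad G_{j+a,k+a}=\delta_{jk}\Bigl[cY_k+\sum_\ell t(v_k,u_\ell)\Bigr],$$ $$G_{j,k+a}=t(v_k,u_j),\qquad G_{j+a,k}=-t(v_j,u_k);$$ $G(\bar u_I,\bar v_I)$ is built in the same way from the subsets only. **Theorem.** All these limits exist, and $$F^O_{a,b}(\bar u;\bar v|\bar Z;\bar Y)=\sum S_{m,n}(\bar u_I;\bar v_I|\bar Z_I;\bar Y_I)\,\mathbb F_{a-m,b-n}(\bar u_{II};\bar v_{II}),$$ where the sum is over all partitions of $\bar u$ and $\bar v$ into two (possibly empty) parts and $$S_{m,n}=(-1)^{m+n}f(\bar v_I,\bar u)f(\bar v_{II},\bar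 u_I)\Delta_f(\bar u_I)\Delta_f'(\bar u_I)\Delta_g(\bar v_I)\Delta'_g(\bar v_I)f(\bar u_I,\bar u_{II})f(\bar u_{II},\bar u_I)g(\bar v_{II},\bar v_I)g(\bar v_I,\bar v_{II})\det G(\bar u_I,\bar v_I).$$ If $\det G(\bar u,\bar v)\ne0$, then $\langle\bar u;\bar v|\bar u;\bar v\rangle\neq0$ and the normalized mean value $\langle O\rangle_{a,b}=F^O_{a,b}/\langle\bar u;\bar v|\bar u;\bar v\rangle$ satisfies $$\langle O\rangle_{a,b}=\frac{\sum\det G(\bar u_I,\bar v_I)\,\mathfrak F_{a-m,b-n}(\bar u_{II};\bar v_{II})}{\det G(\bar u,\bar v)},$$ $$\mathfrak F_{p,q}(\bar u;\bar v)=\frac{\mathbb F_{p,q}(\bar u;\bar v)}{(-1)^{p+q}f(\bar v,\bar u)\Delta_f(\bar u)\Delta'_f(\bar u)\Delta_g(\bar v)\Delta'_g(\bar v)} .$$ -/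

import Mathlib

open Filter Topology

universe uM uG

namespace GL21

noncomputable section

/-! ### Rational functions and products over sets of rapidities -/

/-- `f(x,y) = (x - y + ic)/(x - y)`. -/
def f (c x y : ℂ) : ℂ := (x - y + Complex.I * c) / (x - y)

/-- `g(x,y) = ic/(x - y)`. -/
def g (c x y : ℂ) : ℂ := Complex.I * c / (x - y)

/-- `h(x,y) = (x - y + ic)/(ic)`. -/
def h (c x y : ℂ) : ℂ := (x - y + Complex.I * c) / (Complex.I * c)

/-- `t(x,y) = g(x,y)/h(x,y)`. -/
def t (c x y : ℂ) : ℂ := g c x y / h c x y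

/-- `K(x,y) = 2c²/((x - y)² + c²)`. -/
def K (c x y : ℂ) : ℂ := 2 * c ^ 2 / ((x - y) ^ 2 + c ^ 2)

/-- Double product `F(x̄_X, ȳ_Y) = ∏_{i ∈ X} ∏_{j ∈ Y} F(x_i, y_j)`. -/
def prod2 {a b : ℕ} (F : ℂ → ℂ → ℂ) (x : Fin a → ℂ) (X : Finset (Fin a))
    (y : Fin b → ℂ) (Y : Finset (Fin b)) : ℂ :=
  ∏ i ∈ X, ∏ j ∈ Y, F (x i) (y j)

/-- `Δ_F(x̄_X) = ∏_{i > j} F(x_i, x_j)`, with `i, j ∈ X`. -/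
def Delta {a : ℕ} (F : ℂ → ℂ → ℂ) (x : Fin a → ℂ) (X : Finset (Fin a)) : ℂ :=
  ∏ i ∈ X, ∏ j ∈ X with j < i, F (x i) (x j)

/-- `Δ'_F(x̄_X) = ∏_{i < j} F(x_i, x_j)`, with `i, j ∈ X`. -/
def Delta' {a : ℕ} (F : ℂ → ℂ → ℂ) (x : Fin a → ℂ) (X : Finset (Fin a)) : ℂ :=
  ∏ i ∈ X, ∏ j ∈ X with i < j, F (x i) (x j)

/-! ### `gl(2|1)`-related models -/

/-- The grading `[1] = [2] = 0`, `[3] = 1` (the indices are `0, 1, 2` here). -/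
def par : Fin 3 → ℕ := ![0, 0, 1]

/-- A `gl(2|1)`-related model: a monodromy matrix `T_{ij}(x)` acting in a quantum space `H`, with a
vacuum `|0⟩` and a dual vacuum `⟨0|`.  The field `rtt` is the relation
`R₁₂(x-y) T₀₁(x) T₀₂(y) = T₀₂(y) T₀₁(x) R₁₂(x-y)` for the graded `R`-matrix `R(x) = 1 + ic P / x`,
written in components:
`[T_{ij}(x), T_{kl}(y)} = (-1)^{[i]([k]+[l])+[k][l]} g(x,y) (T_{kj}(y)T_{il}(x) - T_{kj}(x)T_{il}(y))`,
where `[A, B} = AB - (-1)^{[A][B]} BA` and `[T_{ij}] = [i] + [j]`. -/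
structure Model (c : ℂ) where
  H : Type uM
  [addCommGroup : AddCommGroup H]
  [module : Module ℂ H]
  /-- entries of the monodromy matrix -/
  T : Fin 3 → Fin 3 → ℂ → Module.End ℂ H
  /-- the vacuum vector `|0⟩` -/
  vac : H
  /-- the dual vacuum `⟨0|` -/
  covac : Module.Dual ℂ H
  /-- vacuum eigenvalues `λ_i(x)` of the diagonal entries -/
  lam : Fin 3 → ℂ → ℂ
  rtt : ∀ (i j k l : Fin 3) (x y : ℂ), x ≠ y →
    T i j x * T k l y
        - (-1 : ℂ) ^ ((par i + par j) * (par k + par l)) • (T k l y * T i j x)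
      = ((-1 : ℂ) ^ (par i * (par k + par l) + par k * par l) * g c x y) •
          (T k j y * T i l x - T k j x * T i l y)
  T_diag_vac : ∀ i x, T i i x vac = lam i x • vac
  T_lower_vac : ∀ i j x, j < i → T i j x vac = 0
  covac_T_diag : ∀ i x, covac ∘ₗ T i i x = lam i x • covac
  covac_T_upper : ∀ i j x, i < j → covac ∘ₗ T i j x = 0
  covac_vac : covac vac = 1

attribute [instance] Model.addCommGroup Model.module

/-- `r₁ = λ₁/λ₂`. -/
def Model.r1 {c : ℂ} (M : Model.{uM} c) (x : ℂ) : ℂ := M.lam 0 x / M.lam 1 x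

/-- `r₃ = λ₃/λ₂`. -/
def Model.r3 {c : ℂ} (M : Model.{uM} c) (x : ℂ) : ℂ := M.lam 2 x / M.lam 1 x

/-- The generalized model: the vacuum eigenvalues are free parameters, that is, for every finite set
`P` of spectral parameters and arbitrary prescribed values there is a `gl(2|1)`-related model
whose vacuum eigenvalues take these values on `P`. -/
structure GeneralizedModel (c : ℂ) where
  model : Finset ℂ → (Fin 3 → ℂ → ℂ) → Model.{uG} c
  lam_model : ∀ (P : Finset ℂ) (l : Fin 3 → ℂ → ℂ) (i : Fin 3) (x : ℂ), x ∈ P →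
    (model P l).lam i x = l i x

/-! ### Bethe vectors -/

section BetheVectors

variable {c : ℂ} (M : Model.{uM} c) {a b : ℕ}

/-- The product `T_{ij}(x̄_X)`, the factors in increasing order of their labels. -/
def opProd (i j : Fin 3) (x : Fin a → ℂ) (X : Finset (Fin a)) : Module.End ℂ M.H :=
  (X.sort.map fun k => M.T i j (x k)).prod

/-- `𝕋_{j3}(x̄) = Δ_h(x̄)⁻¹ T_{j3}(x̄)`, for `j = 1, 2`. -/
def symT3 (j : Fin 3) (x : Fin a → ℂ) (X : Finset (Fin a)) : Module.End ℂ M.H :=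
  (Delta (h c) x X)⁻¹ • opProd M j 2 x X

/-- `𝕋_{3j}(x̄) = Δ'_h(x̄)⁻¹ T_{3j}(x̄)`, for `j = 1, 2`. -/
def symT3' (j : Fin 3) (x : Fin a → ℂ) (X : Finset (Fin a)) : Module.End ℂ M.H :=
  (Delta' (h c) x X)⁻¹ • opProd M 2 j x X

/-- The coefficient, common to Bethe vectors and dual Bethe vectors with rapidities `ū_A`, `v̄_B`,
that belongs to the partitions `A = A₁ ∪ (A \ A₁)` and `B = B₁ ∪ (B \ B₁)`. -/
def betheCoeff (u : Fin a → ℂ) (v : Fin b → ℂ) (A A₁ : Finset (Fin a)) (B B₁ : Finset (Fin b)) :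
    ℂ :=
  prod2 (g c) v B₁ u A₁ * prod2 (f c) u A₁ u (A \ A₁) * prod2 (g c) v (B \ B₁) v B₁ *
      prod2 (h c) u A₁ u A₁ /
    ((∏ j ∈ A, M.lam 1 (u j)) * (∏ j ∈ B \ B₁, M.lam 1 (v j)) * prod2 (f c) v B u A)

/-- The (off-shell) Bethe vector `|ū_A; v̄_B⟩`. -/
def ket (u : Fin a → ℂ) (v : Fin b → ℂ) (A : Finset (Fin a)) (B : Finset (Fin b)) : M.H :=
  ∑ A₁ ∈ A.powerset, ∑ B₁ ∈ B.powerset with B₁.card = A₁.card,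
    betheCoeff M u v A A₁ B B₁ •
      (symT3 M 0 u A₁ * opProd M 0 1 u (A \ A₁) * symT3 M 1 v (B \ B₁)) M.vac

/-- The (off-shell) dual Bethe vector `⟨ū_A; v̄_B|`. -/
def bra (u : Fin a → ℂ) (v : Fin b → ℂ) (A : Finset (Fin a)) (B : Finset (Fin b)) :
    Module.Dual ℂ M.H :=
  (-1 : ℂ) ^ (B.card * (B.card - 1) / 2) •
    ∑ A₁ ∈ A.powerset, ∑ B₁ ∈ B.powerset with B₁.card = A₁.card,
      betheCoeff M u v A A₁ B B₁ •
        M.covac ∘ₗ (symT3' M 1 v (B \ B₁) * opProd M 1 0 u (A \ A₁) * symT3' M 0 u A₁)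

end BetheVectors

/-- Right-hand side of the Bethe equation for `r₁(u_j)`, in the system with rapidities
`ū_A`, `v̄_B`. -/
def betheRhs1 (c : ℂ) {a b : ℕ} (u : Fin a → ℂ) (v : Fin b → ℂ) (A : Finset (Fin a))
    (B : Finset (Fin b)) (j : Fin a) : ℂ :=
  (∏ k ∈ A.erase j, f c (u j) (u k)) / (∏ k ∈ A.erase j, f c (u k) (u j)) *
    ∏ k ∈ B, f c (v k) (u j)

/-- Right-hand side of the Bethe equation for `r₃(v_j)`, in the system with rapidities `ū_A`. -/
def betheRhs3 (c : ℂ) {a b : ℕ} (u : Fin a → ℂ) (v : Fin b → ℂ) (A : Finset (Fin a))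
    (j : Fin b) : ℂ :=
  ∏ k ∈ A, f c (v j) (u k)

/-- The rapidities `ū`, `v̄` satisfy the (untwisted) Bethe equations of the model. -/
def Model.OnShell {c : ℂ} (M : Model.{uM} c) {a b : ℕ} (u : Fin a → ℂ) (v : Fin b → ℂ) : Prop :=
  (∀ j, M.r1 (u j) = betheRhs1 c u v Finset.univ Finset.univ j) ∧
    ∀ j, M.r3 (v j) = betheRhs3 c u v Finset.univ j

/-- The quantities `Z = i ∂ log r₁`. -/
def Model.Z {c : ℂ} (M : Model.{uM} c) (x : ℂ) : ℂ := Complex.I * logDeriv M.r1 x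

/-- The quantities `Y = i ∂ log r₃`. -/
def Model.Y {c : ℂ} (M : Model.{uM} c) (x : ℂ) : ℂ := Complex.I * logDeriv M.r3 x

/-! ### Form factors -/

section FormFactors

variable {c : ℂ} {a b N : ℕ}

/-- The operator `O(w̄) = ∑ κ_{i₁j₁,…,i_Nj_N} T_{i₁j₁}(w₁) ⋯ T_{i_Nj_N}(w_N)`. -/
def operator (M : Model.{uM} c) (w : Fin N → ℂ) (κ : (Fin N → Fin 3 × Fin 3) → ℂ) :
    Module.End ℂ M.H :=
  ∑ s : Fin N → Fin 3 × Fin 3, κ s • (List.ofFn fun k => M.T (s k).1 (s k).2 (w k)).prod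

/-- The scalar product `⟨ūᶜ; v̄ᶜ|ū; v̄⟩` of off-shell Bethe vectors. -/
def scalarProduct (M : Model.{uM} c) (uC : Fin a → ℂ) (vC : Fin b → ℂ) (u : Fin a → ℂ)
    (v : Fin b → ℂ) : ℂ :=
  bra M uC vC Finset.univ Finset.univ (ket M u v Finset.univ Finset.univ)

/-- The form factor `⟨ūᶜ_A; v̄ᶜ_B|O(w̄)|ū_A; v̄_B⟩ / (f(w̄, ūᶜ_A) f(v̄ᶜ_B, w̄))` between off-shell
Bethe vectors. -/
def formFactor (M : Model.{uM} c) (w : Fin N → ℂ) (κ : (Fin N → Fin 3 × Fin 3) → ℂ)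
    (A : Finset (Fin a)) (B : Finset (Fin b)) (uC : Fin a → ℂ) (vC : Fin b → ℂ) (u : Fin a → ℂ)
    (v : Fin b → ℂ) : ℂ :=
  bra M uC vC A B (operator M w κ (ket M u v A B)) /
    (prod2 (f c) w Finset.univ uC A * prod2 (f c) vC B w Finset.univ)

/-- The filter of the diagonal limit `ūᶜ → ū`, `v̄ᶜ → v̄`, taken along `uᶜ_j ≠ u_j`, `vᶜ_j ≠ v_j`. -/
def diagLimit (u : Fin a → ℂ) (v : Fin b → ℂ) : Filter ((Fin a → ℂ) × (Fin b → ℂ)) :=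
  𝓝[{p | (∀ j, p.1 j ≠ u j) ∧ ∀ j, p.2 j ≠ v j}] (u, v)

/-- The diagonal form factor `F^O_{a,b}(ū; v̄)`. -/
def diagFormFactor (M : Model.{uM} c) (w : Fin N → ℂ) (κ : (Fin N → Fin 3 × Fin 3) → ℂ)
    (u : Fin a → ℂ) (v : Fin b → ℂ) : ℂ :=
  limUnder (diagLimit u v) fun p => formFactor M w κ Finset.univ Finset.univ p.1 p.2 u v

/-- The squared norm `⟨ū; v̄|ū; v̄⟩`, the diagonal limit of the scalar product. -/
def normSq (M : Model.{uM} c) (u : Fin a → ℂ) (v : Fin b → ℂ) : ℂ :=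
  limUnder (diagLimit u v) fun p => scalarProduct M p.1 p.2 u v

/-- The vacuum eigenvalues modified by the presence of particles with rapidities `ū_I`, `v̄_J`:
`r₁(x)_mod = r₁(x) f(ū_I, x) / (f(x, ū_I) f(v̄_J, x))` and `r₃(x)_mod = r₃(x) / f(x, ū_I)`,
with `λ₂` unchanged. -/
def lamMod (c : ℂ) (l : Fin 3 → ℂ → ℂ) (u : Fin a → ℂ) (v : Fin b → ℂ) (I : Finset (Fin a))
    (J : Finset (Fin b)) : Fin 3 → ℂ → ℂ :=
  fun i x =>
    ![l 0 x * (∏ j ∈ I, f c (u j) x) / ((∏ j ∈ I, f c x (u j)) * ∏ k ∈ J, f c (v k) x),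
      l 1 x,
      l 2 x / ∏ j ∈ I, f c x (u j)] i

/-- Vacuum eigenvalues for which both `(ū_A + ε, v̄_B + ε)` and `(ū_A, v̄_B)` solve the Bethe
equations, and which agree with `l` at the points `w̄`. -/
def lamSym (c : ℂ) (l : Fin 3 → ℂ → ℂ) (w : Fin N → ℂ) (u : Fin a → ℂ) (v : Fin b → ℂ)
    (A : Finset (Fin a)) (B : Finset (Fin b)) (ε : ℂ) : Fin 3 → ℂ → ℂ :=
  fun i x =>
    if x ∈ Finset.univ.image w then l i x
    else
      ![∑ j ∈ A, ((if x = u j then betheRhs1 c u v A B j else 0) +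
          (if x = u j + ε then betheRhs1 c (fun k => u k + ε) (fun k => v k + ε) A B j else 0)),
        1,
        ∑ j ∈ B, ((if x = v j then betheRhs3 c u v A j else 0) +
          (if x = v j + ε then betheRhs3 c (fun k => u k + ε) (fun k => v k + ε) A j else 0))] i

/-- The spectral parameters that enter the form factor between `(ū_A + ε, v̄_B + ε)` and
`(ū_A, v̄_B)`. -/
def symPoints (w : Fin N → ℂ) (u : Fin a → ℂ) (v : Fin b → ℂ) (A : Finset (Fin a))
    (B : Finset (Fin b)) (ε : ℂ) : Finset ℂ :=
  Finset.univ.image w ∪ (A.image u ∪ A.image fun j => u j + ε) ∪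
    (B.image v ∪ B.image fun j => v j + ε)

/-- The form factor between the on-shell Bethe vectors `(ū_A + ε, v̄_B + ε)` and `(ū_A, v̄_B)`,
in the generalized model. -/
def shiftedFormFactor (𝒢 : GeneralizedModel.{uG} c) (l : Fin 3 → ℂ → ℂ) (w : Fin N → ℂ)
    (κ : (Fin N → Fin 3 × Fin 3) → ℂ) (u : Fin a → ℂ) (v : Fin b → ℂ) (A : Finset (Fin a))
    (B : Finset (Fin b)) (ε : ℂ) : ℂ :=
  formFactor (𝒢.model (symPoints w u v A B ε) (lamSym c l w u v A B ε)) w κ A B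
    (fun j => u j + ε) (fun j => v j + ε) u v

/-- The symmetric form factor `𝔽(ū_A; v̄_B)` of `O(w̄)`, where `l` gives the vacuum eigenvalues
at the points `w̄`. -/
def symFormFactor (𝒢 : GeneralizedModel.{uG} c) (l : Fin 3 → ℂ → ℂ) (w : Fin N → ℂ)
    (κ : (Fin N → Fin 3 × Fin 3) → ℂ) (u : Fin a → ℂ) (v : Fin b → ℂ) (A : Finset (Fin a))
    (B : Finset (Fin b)) : ℂ :=
  limUnder (𝓝[≠] (0 : ℂ)) (shiftedFormFactor 𝒢 l w κ u v A B)

end FormFactors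

/-! ### Gaudin matrix and the coefficients of the expansion -/

section Gaudin

variable (c : ℂ) {a b : ℕ}

/-- The Gaudin matrix `G(ū_I, v̄_J)` (for given values of `Z` and `Y`). -/
def gaudin (u : Fin a → ℂ) (v : Fin b → ℂ) (Z : Fin a → ℂ) (Y : Fin b → ℂ)
    (I : Finset (Fin a)) (J : Finset (Fin b)) : Matrix (I ⊕ J) (I ⊕ J) ℂ :=
  Matrix.fromBlocks
    (Matrix.of fun j k : I =>
      (if j = k then
        c * Z k - ∑ l ∈ I, K c (u k) (u l) - ∑ m ∈ J, t c (v m) (u k) else 0) + K c (u k) (u j))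
    (Matrix.of fun (j : I) (k : J) => t c (v k) (u j))
    (Matrix.of fun (j : J) (k : I) => -t c (v j) (u k))
    (Matrix.of fun j k : J =>
      if j = k then c * Y k + ∑ l ∈ I, t c (v k) (u l) else 0)

/-- The normalization factor
`(-1)^{#A+#B} f(v̄_B, ū_A) Δ_f(ū_A) Δ'_f(ū_A) Δ_g(v̄_B) Δ'_g(v̄_B)`. -/
def normFactor (u : Fin a → ℂ) (v : Fin b → ℂ) (A : Finset (Fin a)) (B : Finset (Fin b)) : ℂ :=
  (-1) ^ (A.card + B.card) * prod2 (f c) v B u A * Delta (f c) u A * Delta' (f c) u A *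
    Delta (g c) v B * Delta' (g c) v B

/-- The coefficient `S_{m,n}(ū_I; v̄_J | Z̄_I; Ȳ_J)`; the complements of `I` and `J` are the sets
`ū_II`, `v̄_II`. -/
def expansionCoeff (u : Fin a → ℂ) (v : Fin b → ℂ) (Z : Fin a → ℂ) (Y : Fin b → ℂ)
    (I : Finset (Fin a)) (J : Finset (Fin b)) : ℂ :=
  (-1) ^ (I.card + J.card) * prod2 (f c) v J u Finset.univ * prod2 (f c) v Jᶜ u I *
    Delta (f c) u I * Delta' (f c) u I * Delta (g c) v J * Delta' (g c) v J *
    prod2 (f c) u I u Iᶜ * prod2 (f c) u Iᶜ u I * prod2 (g c) v Jᶜ v J * prod2 (g c) v J v Jᶜ *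
    (gaudin c u v Z Y I J).det

/-- General position of the rapidities and of the arguments `w̄` of the operator: the points are
pairwise distinct, and none of the factors `f`, `h` in the denominators vanishes. -/
structure Generic {N : ℕ} (u : Fin a → ℂ) (v : Fin b → ℂ) (w : Fin N → ℂ) : Prop where
  u_inj : Function.Injective u
  v_inj : Function.Injective v
  w_inj : Function.Injective w
  v_ne_u : ∀ j k, v j ≠ u k
  w_ne_u : ∀ j k, w j ≠ u k
  w_ne_v : ∀ j k, w j ≠ v k
  u_sub_u : ∀ j k, u j - u k ≠ Complex.I * c
  v_sub_v : ∀ j k, v j - v k ≠ Complex.I * c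
  v_sub_u : ∀ j k, v j - u k ≠ -(Complex.I * c)
  w_sub_u : ∀ j k, w j - u k ≠ -(Complex.I * c)
  v_sub_w : ∀ j k, v j - w k ≠ -(Complex.I * c)

end Gaudin

end

end GL21

universe u₁ u₂

open Finset
open Complex (I)
open Module.End (mul_apply)
open LinearMap renaming smul_apply → lsmul_apply, add_apply → ladd_apply, sub_apply → lsub_apply,
  sum_apply → lsum_apply

namespace GL21

noncomputable section

/-! ### Words in the entries of the monodromy matrix -/

/-- A letter `(i, j, k)` stands for `T_{ij}` at the point with label `k`. -/
abbrev Letter (K : Type) := Fin 3 × Fin 3 × K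

abbrev Word (K : Type) := List (Letter K)

abbrev Coeffs (N : ℕ) := (Fin N → Fin 3 × Fin 3) → ℂ

abbrev Pts (n : ℕ) := Fin n → ℂ

abbrev FunAlg (Θ : Type) := Subalgebra ℂ (Θ → ℂ)

section Words

variable {K : Type}

/-- The word has pairwise distinct labels, all of which lie in `s`. -/
def Over (s : Set K) (W : Word K) : Prop := (W.map fun l => l.2.2).Nodup ∧ ∀ l ∈ W, l.2.2 ∈ s

lemma Over.mono {s t : Set K} {W : Word K} (h : Over s W) (hst : s ⊆ t) : Over t W :=
  ⟨h.1, fun l hl => hst (h.2 l hl)⟩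

lemma over_nil (s : Set K) : Over s ([] : Word K) := by simp [Over]

lemma over_cons {s : Set K} {a : Letter K} {W : Word K} :
    Over s (a :: W) ↔ a.2.2 ∈ s ∧ Over (s \ {a.2.2}) W := by
  simp only [Over, List.map_cons, List.nodup_cons, List.mem_map, List.mem_cons, forall_eq_or_imp,
    Set.mem_sdiff, Set.mem_singleton_iff, not_exists, not_and]
  constructor
  · rintro ⟨⟨h1, h2⟩, h3, h4⟩
    exact ⟨h3, h2, fun l hl => ⟨h4 l hl, fun h => h1 l hl h⟩⟩
  · rintro ⟨h3, h2, h4⟩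
    exact ⟨⟨fun l hl h => (h4 l hl).2 h, h2⟩, h3, fun l hl => (h4 l hl).1⟩

lemma Over.append {s t : Set K} {V W : Word K} (hV : Over s V) (hW : Over t W)
    (hd : Disjoint s t) : Over (s ∪ t) (V ++ W) := by
  refine ⟨?_, ?_⟩
  · rw [List.map_append]
    refine List.Nodup.append hV.1 hW.1 ?_
    intro x hx hy
    simp only [List.mem_map] at hx hy
    obtain ⟨l, hl, rfl⟩ := hx
    obtain ⟨m, hm, h⟩ := hy
    exact Set.disjoint_left.1 hd (hV.2 l hl) (h ▸ hW.2 m hm)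
  · intro l hl
    rcases List.mem_append.1 hl with h | h
    · exact .inl (hV.2 l h)
    · exact .inr (hW.2 l h)

def IsUpper (W : Word K) : Prop := ∀ l ∈ W, l.1 < l.2.1

/-- The height of a word, `∑ (j - i)`. -/
def height (W : Word K) : ℤ := (W.map fun l => (l.2.1 : ℤ) - (l.1 : ℤ)).sum

@[simp] theorem height_cons (a : Letter K) (W : Word K) :
    height (a :: W) = (a.2.1 : ℤ) - (a.1 : ℤ) + height W := by simp [height]

def exSign (i j k l : Fin 3) : ℤ := (-1) ^ ((par i + par j) * (par k + par l))

def rttSign (i k l : Fin 3) : ℤ := (-1) ^ (par i * (par k + par l) + par k * par l)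

variable {A : Type} [CommRing A]

/-- The `RTT` relation for a functional on words. -/
abbrev RTTRel {Q : Type} [AddCommGroup Q] [Module A Q] (g : K → K → A) (φ : Word K → Q)
    (i j k l : Fin 3) (x y : K) (V W : Word K) : Prop :=
  φ (V ++ (i, j, x) :: (k, l, y) :: W) = exSign i j k l • φ (V ++ (k, l, y) :: (i, j, x) :: W) +
      rttSign i k l • g x y • (φ (V ++ (k, j, y) :: (i, l, x) :: W) -
        φ (V ++ (k, j, x) :: (i, l, y) :: W))

/-- A functional on words over `s` with the properties of `W ↦ ⟨0|W|0⟩`: it respects the `RTT`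
relations and the vacuum conditions. -/
structure IsState {Q : Type} [AddCommGroup Q] [Module A Q] (s : Set K) (g : K → K → A)
    (lam : Fin 3 → K → A) (φ : Word K → Q) : Prop where
  rtt : ∀ (i j k l : Fin 3) (x y : K) (V W : Word K),
    Over s (V ++ (i, j, x) :: (k, l, y) :: W) → RTTRel g φ i j k l x y V W
  upper : ∀ (i j : Fin 3) (x : K) (W : Word K), i < j → Over s ((i, j, x) :: W) →
    φ ((i, j, x) :: W) = 0
  diag : ∀ (i : Fin 3) (x : K) (W : Word K), Over s (W ++ [(i, i, x)]) →
    φ (W ++ [(i, i, x)]) = lam i x • φ W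
  lower : ∀ (i j : Fin 3) (x : K) (W : Word K), j < i → Over s (W ++ [(i, j, x)]) →
    φ (W ++ [(i, j, x)]) = 0

abbrev Comb (K A : Type) [CommRing A] := Word K →₀ A

/-- The value of `φ` at a formal combination, with a word in front. -/
def evalC {Q : Type} [AddCommGroup Q] [Module A Q] (φ : Word K → Q)
    (V : Word K) : Comb K A →ₗ[A] Q :=
  Finsupp.linearCombination A fun W => φ (V ++ W)

/-- In front of all states, `c` can be replaced by a combination of upper words of height `n`
with labels in `t`. -/
def Reduces (s : Set K) (g : K → K → A) (lam : Fin 3 → K → A) (t : Set K) (n : ℤ)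
    (c : Comb K A) : Prop :=
  ∃ d : Comb K A, (∀ U ∈ d.support, IsUpper U ∧ Over t U ∧ height U = n) ∧
    ∀ (Q : Type) [AddCommGroup Q] [Module A Q] (φ : Word K → Q), IsState s g lam φ →
      ∀ V, Over (s \ t) V → evalC φ V c = evalC φ V d

section Reduces

variable {s t : Set K} {g : K → K → A} {lam : Fin 3 → K → A} {n : ℤ}

lemma Reduces.congr {c c' : Comb K A} (h : Reduces s g lam t n c')
    (hc : ∀ (Q : Type) [AddCommGroup Q] [Module A Q] (φ : Word K → Q),
      IsState s g lam φ → ∀ V, Over (s \ t) V → evalC φ V c = evalC φ V c') :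
    Reduces s g lam t n c := by
  obtain ⟨d, h1, h2⟩ := h
  exact ⟨d, h1, fun Q _ _ φ hφ V hV => (hc Q φ hφ V hV).trans (h2 Q φ hφ V hV)⟩

lemma Reduces.add {c c' : Comb K A} (h : Reduces s g lam t n c)
    (h' : Reduces s g lam t n c') : Reduces s g lam t n (c + c') := by
  classical
  obtain ⟨d, h1, h2⟩ := h
  obtain ⟨d', h1', h2'⟩ := h'
  refine ⟨d + d', fun U hU => ?_, fun Q _ _ φ hφ V hV => ?_⟩
  · rcases mem_union.1 (Finsupp.support_add hU) with h | h
    exacts [h1 U h, h1' U h]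
  · rw [map_add, map_add, h2 Q φ hφ V hV, h2' Q φ hφ V hV]

lemma Reduces.smul {c : Comb K A} (a : A) (h : Reduces s g lam t n c) :
    Reduces s g lam t n (a • c) := by
  obtain ⟨d, h1, h2⟩ := h
  refine ⟨a • d, fun U hU => h1 U (Finsupp.support_smul hU), fun Q _ _ φ hφ V hV => ?_⟩
  rw [map_smul, map_smul, h2 Q φ hφ V hV]

lemma reduces_zero : Reduces s g lam t n (0 : Comb K A) := ⟨0, by simp, fun Q _ _ φ hφ V hV => rfl⟩

lemma Reduces.sum {ι : Type*} (S : Finset ι) (c : ι → Comb K A)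
    (h : ∀ i ∈ S, Reduces s g lam t n (c i)) : Reduces s g lam t n (∑ i ∈ S, c i) := by
  classical
  induction S using Finset.induction_on with
  | empty => simpa using reduces_zero
  | insert i S hi ih =>
    rw [sum_insert hi]
    exact (h i (mem_insert_self _ _)).add
      (ih fun j hj => h j (mem_insert_of_mem hj))

def consC (a : Letter K) : Comb K A →ₗ[A] Comb K A := Finsupp.lmapDomain A A (List.cons a)

lemma evalC_consC {Q : Type} [AddCommGroup Q] [Module A Q] (φ : Word K → Q)
    (V : Word K) (a : Letter K) (c : Comb K A) : evalC φ V (consC a c) = evalC φ (V ++ [a]) c := by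
  rw [evalC, consC, Finsupp.lmapDomain_apply, Finsupp.linearCombination_mapDomain, evalC]
  congr 2
  funext W
  simp

@[simp] theorem evalC_single {Q : Type} [AddCommGroup Q] [Module A Q] (φ : Word K → Q)
    (V W : Word K) (a : A) : evalC φ V (Finsupp.single W a) = a • φ (V ++ W) := by
  simp [evalC]

lemma consC_single (a : Letter K) (W : Word K) (b : A) :
    consC a (Finsupp.single W b) = Finsupp.single (a :: W) b := by
  rw [consC, Finsupp.lmapDomain_apply, Finsupp.mapDomain_single]

/-- If the letter `a` can be put in front of upper words, it can be put in front of all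
reducible combinations. -/
lemma Reduces.consC {c : Comb K A} (a : Letter K) (t' : Set K) (hat : a.2.2 ∉ t)
    (hs : a.2.2 ∈ s) (ht' : insert a.2.2 t = t') (m : ℤ)
    (hU : ∀ U, IsUpper U → Over t U → height U = n →
      Reduces s g lam t' m (Finsupp.single (a :: U) 1))
    (h : Reduces s g lam t n c) : Reduces s g lam t' m (consC a c) := by
  obtain ⟨d, h1, h2⟩ := h
  refine Reduces.congr (c' := GL21.consC a d) ?_ ?_
  · have : GL21.consC a d = ∑ U ∈ d.support, d U • Finsupp.single (a :: U) (1 : A) := by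
      rw [GL21.consC, Finsupp.lmapDomain_apply, Finsupp.mapDomain, Finsupp.sum]
      simp
    rw [this]
    exact Reduces.sum _ _ fun U hUd => (hU U (h1 U hUd).1 (h1 U hUd).2.1 (h1 U hUd).2.2).smul _
  · intro Q _ _ φ hφ V hV
    rw [evalC_consC, evalC_consC]
    refine h2 Q φ hφ _ ?_
    have hd : Disjoint (s \ t') ({a.2.2} : Set K) := by
      rw [Set.disjoint_singleton_right]
      simp [← ht']
    refine (hV.append (W := [a]) (t := {a.2.2}) (by simp [Over]) hd).mono ?_
    rintro x (⟨hx, hx'⟩ | rfl)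
    · exact ⟨hx, fun h => hx' (ht' ▸ Set.mem_insert_of_mem _ h)⟩
    · exact ⟨hs, hat⟩

lemma reduces_upper {U : Word K} (h1 : IsUpper U) (h2 : Over t U) (h3 : height U = n) :
    Reduces s g lam t n (Finsupp.single U 1) := by
  classical
  refine ⟨Finsupp.single U 1, fun V hV => ?_, fun Q _ _ φ hφ V hV => rfl⟩
  have := Finsupp.support_single_subset hV
  simp only [mem_singleton] at this
  subst this
  exact ⟨h1, h2, h3⟩

lemma Reduces.consUpper {c : Comb K A} (a : Letter K) (ha : a.1 < a.2.1) (t' : Set K)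
    (hat : a.2.2 ∉ t) (hs : a.2.2 ∈ s) (ht' : insert a.2.2 t = t') (h : Reduces s g lam t n c) :
    Reduces s g lam t' ((a.2.1 : ℤ) - (a.1 : ℤ) + n) (GL21.consC a c) := by
  refine h.consC a t' hat hs ht' _ fun U h1 h2 h3 => reduces_upper ?_ ?_ (by simp [h3])
  · intro l hl
    rcases List.mem_cons.1 hl with rfl | h
    exacts [ha, h1 l h]
  · rw [over_cons, ← ht']
    refine ⟨Set.mem_insert _ _, h2.mono fun x hx => ⟨Set.mem_insert_of_mem _ hx, ?_⟩⟩
    rintro rfl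
    exact hat hx

lemma height_nonneg {U : Word K} (h : IsUpper U) : 0 ≤ height U := by
  refine List.sum_nonneg ?_
  simp only [List.mem_map]
  rintro _ ⟨l, hl, rfl⟩
  have : (l.1 : ℕ) < l.2.1 := h l hl
  omega

end Reduces

lemma over_pair_context {s t : Set K} {x y : K} (V U : Word K) (i j k l : Fin 3)
    (hV : Over (s \ t) V) (hx : x ∈ t) (hy : y ∈ t) (hxy : x ≠ y) (hts : t ⊆ s)
    (hU : Over (t \ {x, y}) U) : Over s (V ++ (i, j, x) :: (k, l, y) :: U) := by
  have h1 : Over t ((i, j, x) :: (k, l, y) :: U) := by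
    rw [over_cons, over_cons]
    refine ⟨hx, ⟨hy, fun h => hxy h.symm⟩, hU.mono ?_⟩
    rintro z ⟨hz, hz'⟩
    simp only [Set.mem_insert_iff, Set.mem_singleton_iff, not_or] at hz'
    exact ⟨⟨hz, hz'.1⟩, hz'.2⟩
  refine (hV.append h1 Set.disjoint_sdiff_left).mono ?_
  rintro z (hz | hz)
  exacts [hz.1, hts hz]

lemma exSign_mul_self (i j k l : Fin 3) : exSign i j k l * exSign i j k l = 1 := by
  rw [exSign, ← mul_pow]; simp

lemma exSign_comm (i j k l : Fin 3) : exSign k l i j = exSign i j k l := by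
  rw [exSign, exSign, mul_comm]

lemma RTTRel.symm {Q : Type} [AddCommGroup Q] [Module A Q] {g : K → K → A}
    {φ : Word K → Q} {i j k l : Fin 3} {x y : K} {V W : Word K}
    (this : RTTRel g φ k l i j y x V W) : φ (V ++ (i, j, x) :: (k, l, y) :: W) =
      exSign i j k l • φ (V ++ (k, l, y) :: (i, j, x) :: W) -
        (exSign i j k l * rttSign k i j) • g y x • (φ (V ++ (i, l, x) :: (k, j, y) :: W) -
          φ (V ++ (i, l, y) :: (k, j, x) :: W)) := by
  rw [this, exSign_comm, smul_add, smul_smul, smul_smul, exSign_mul_self, one_smul,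
    add_sub_cancel_right]

lemma reduces_cons_upper {s : Set K} (g : K → K → A) (lam : Fin 3 → K → A) (n : ℕ) :
    ∀ (U : Word K) (t t' : Set K) (i j : Fin 3) (x : K), IsUpper U → Over t' U →
      height U = n → j ≤ i → x ∉ t' → insert x t' = t → t ⊆ s →
      Reduces s g lam t ((j : ℤ) - (i : ℤ) + n) (Finsupp.single ((i, j, x) :: U) 1) := by
  induction n using Nat.strong_induction_on with
  | _ n ih =>
  intro U t t' i j x hU hUt hn hji hx ht hts
  have hxt : x ∈ t := ht ▸ Set.mem_insert _ _
  rcases U with _ | ⟨⟨k, l, y⟩, U⟩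
  · have hO : ∀ V, Over (s \ t) V → Over s (V ++ [(i, j, x)]) := by
      intro V hV
      refine (hV.append (W := [(i, j, x)]) (t := t) (by simp [Over, hxt])
        Set.disjoint_sdiff_left).mono ?_
      rintro z (hz | hz)
      exacts [hz.1, hts hz]
    rcases hji.lt_or_eq with h | h
    · refine reduces_zero.congr fun Q _ _ φ hφ V hV => ?_
      rw [evalC_single, one_smul, map_zero, hφ.lower _ _ _ _ h (hO V hV)]
    · subst h
      refine ((reduces_upper (U := []) (t := t) (n := (j : ℤ) - j + n) (by simp [IsUpper])
        (over_nil _) (by simpa [height] using hn)).smul (lam j x)).congr fun Q _ _ φ hφ V hV => ?_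
      rw [evalC_single, one_smul, map_smul, evalC_single, one_smul, List.append_nil,
        hφ.diag _ _ _ (hO V hV)]
  · have hkl : k < l := hU (k, l, y) List.mem_cons_self
    have hU' : IsUpper U := fun a ha => hU a (List.mem_cons_of_mem _ ha)
    obtain ⟨hy, hUt'⟩ := over_cons.1 hUt
    simp only at hy hUt'
    have hyt : y ∈ t := ht ▸ Set.mem_insert_of_mem _ hy
    have hxy : x ≠ y := fun h => hx (h ▸ hy)
    obtain ⟨n', hn'⟩ := Int.eq_ofNat_of_zero_le (height_nonneg hU')
    rw [height_cons, hn'] at hn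
    simp only at hn
    have hkl' : (k : ℕ) < l := hkl
    have hji' : (j : ℕ) ≤ i := hji
    have hlt : n' < n := by omega
    set r := t' \ {y} with hr
    have hxr : x ∉ r := fun h => hx h.1
    have hyr : y ∉ r := fun h => h.2 rfl
    have htx : insert x (insert y r) = t := by
      rw [hr, Set.insert_sdiff_singleton, Set.insert_eq_of_mem hy, ht]
    have hty : insert y (insert x r) = t := by rw [Set.insert_comm, htx]
    have hrO : Over (t \ {x, y}) U := hUt'.mono fun z hz => ⟨ht ▸ Set.mem_insert_of_mem _ hz.1, by
        rintro (rfl | h)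
        exacts [hx hz.1, hz.2 h]⟩
    have hrO' : Over (t \ {y, x}) U := by rwa [Set.pair_comm]
    have two : ∀ (k' l' i' j' : Fin 3) (x' y' : K), x' = x ∧ y' = y ∨ x' = y ∧ y' = x →
        k' < l' ∨ (j' : ℤ) - i' + n' < n → (l' : ℤ) - k' + (j' - i') = j - i + (l - k) →
        Reduces s g lam t ((j : ℤ) - i + n)
          (Finsupp.single ((k', l', y') :: (i', j', x') :: U) 1) := by
      intro k' l' i' j' x' y' hxy' hcase hsum
      obtain ⟨hx', hy', htt, hxs, hys⟩ : x' ∉ r ∧ y' ∉ insert x' r ∧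
          insert y' (insert x' r) = t ∧ x' ∈ s ∧ y' ∈ s := by
        rcases hxy' with ⟨h, h'⟩ | ⟨h, h'⟩ <;> rw [h, h']
        exacts [⟨hxr, by simp [hyr, hxy.symm], hty, hts hxt, hts hyt⟩,
          ⟨hyr, by simp [hxr, hxy], htx, hts hyt, hts hxt⟩]
      have h1 : Reduces s g lam (insert x' r) ((j' : ℤ) - i' + n')
          (Finsupp.single ((i', j', x') :: U) 1) := by
        by_cases h : j' ≤ i'
        · exact ih n' hlt U _ r i' j' x' hU' hUt' hn' h hx' rfl fun z hz =>
            hts (htt ▸ Set.mem_insert_of_mem _ hz)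
        · rw [← consC_single]
          exact (reduces_upper hU' hUt' hn').consUpper (i', j', x') (not_le.1 h) _ hx' hxs rfl
      rw [← consC_single]
      by_cases hup : k' < l'
      · rw [show (j : ℤ) - i + n = l' - k' + (j' - i' + n') by omega]
        exact h1.consUpper (k', l', y') hup t hy' hys htt
      · refine h1.consC (k', l', y') t hy' hys htt _ fun U₂ h1 h2 h3 => ?_
        obtain ⟨n₂, hn₂⟩ := Int.eq_ofNat_of_zero_le (height_nonneg h1)
        rw [show (j : ℤ) - i + n = l' - k' + n₂ by omega]
        exact ih n₂ (by have := hcase.resolve_left hup; omega) U₂ t _ k' l' y' h1 h2 hn₂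
          (not_lt.1 hup) hy' htt hts
    have hst : x = x ∧ y = y ∨ x = y ∧ y = x := .inl ⟨rfl, rfl⟩
    have hsw : y = x ∧ x = y ∨ y = y ∧ x = x := .inr ⟨rfl, rfl⟩
    have main := two k l i j x y hst (.inl hkl) (by ring)
    by_cases hcase : i < l ∧ j ≤ k
    · -- second form of the relation
      have e1 := two i l k j y x hsw (.inl hcase.1) (by ring)
      have e2 := two i l k j x y hst (.inl hcase.1) (by ring)
      refine ((main.smul (exSign i j k l : A)).add
        ((e1.add (e2.smul (-1))).smul (-((exSign i j k l * rttSign k i j : ℤ) : A) * g y x))).congr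
        fun Q _ _ φ hφ V hV => ?_
      simp only [map_add, map_smul, evalC_single, one_smul]
      rw [(hφ.rtt k l i j y x V U (over_pair_context V U k l i j hV hyt hxt hxy.symm hts hrO')).symm]
      simp only [smul_add, smul_smul, smul_sub, ← Int.cast_smul_eq_zsmul A]
      simp only [neg_mul, neg_smul, mul_neg, mul_one, neg_neg]
      abel
    · have hc : k < j ∨ (l : ℤ) - (i : ℤ) + n' < n := by
        by_cases h : k < j
        · exact .inl h
        · refine .inr ?_
          have h1 : ¬ i < l := fun h' => hcase ⟨h', not_lt.1 h⟩
          have h1' : ¬ (i : ℕ) < l := h1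
          omega
      have e1 := two k j i l x y hst hc (by ring)
      have e2 := two k j i l y x hsw hc (by ring)
      refine ((main.smul (exSign i j k l : A)).add
        ((e1.add (e2.smul (-1))).smul (((rttSign i k l : ℤ) : A) * g x y))).congr
        fun Q _ _ φ hφ V hV => ?_
      simp only [map_add, map_smul, evalC_single, one_smul]
      rw [hφ.rtt i j k l x y V U (over_pair_context V U i j k l hV hxt hyt hxy hts hrO)]
      simp only [smul_add, smul_smul, smul_sub, ← Int.cast_smul_eq_zsmul A]
      simp only [neg_smul, mul_neg, mul_one]
      abel

lemma reduces_word {s : Set K} (g : K → K → A) (lam : Fin 3 → K → A) (W : Word K) :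
    ∀ t : Set K, t ⊆ s → Over t W → Reduces s g lam t (height W) (Finsupp.single W 1) := by
  induction W with
  | nil => exact fun t _ _ => reduces_upper (by simp [IsUpper]) (over_nil _) rfl
  | cons a W ih =>
    intro t hts hW
    obtain ⟨ha, hW'⟩ := over_cons.1 hW
    have ht : insert a.2.2 (t \ {a.2.2}) = t := by
      rw [Set.insert_sdiff_singleton, Set.insert_eq_of_mem ha]
    have h1 := ih (t \ {a.2.2}) (fun z hz => hts hz.1) hW'
    have hna : a.2.2 ∉ t \ {a.2.2} := fun h => h.2 rfl
    rw [height_cons, ← consC_single]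
    by_cases hup : a.1 < a.2.1
    · exact h1.consUpper a hup t hna (hts ha) ht
    · refine h1.consC a t hna (hts ha) ht _ fun U h1 h2 h3 => ?_
      obtain ⟨n, hn⟩ := Int.eq_ofNat_of_zero_le (height_nonneg h1)
      rw [← h3, hn]
      exact reduces_cons_upper g lam n U t _ a.1 a.2.1 a.2.2 h1 h2 hn (not_lt.1 hup) hna ht hts

/-- **Universality of vacuum expectation values**: a state is determined by the vacuum
eigenvalues. -/
lemma exists_state_eq_smul {s : Set K} (g : K → K → A) (lam : Fin 3 → K → A)
    (W : Word K) (hW : Over s W) :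
    ∃ a : A, ∀ (Q : Type) [AddCommGroup Q] [Module A Q] (φ : Word K → Q),
      IsState s g lam φ → φ W = a • φ [] := by
  classical
  obtain ⟨d, h1, h2⟩ := reduces_word (s := s) g lam W s subset_rfl hW
  refine ⟨d [], fun Q _ _ φ hφ => ?_⟩
  have h3 := h2 Q φ hφ [] (over_nil _)
  rw [evalC_single, one_smul, List.nil_append] at h3
  rw [h3, evalC, Finsupp.linearCombination_apply, Finsupp.sum_eq_single []]
  · simp
  · intro U hU hne
    obtain ⟨hu, ho, -⟩ := h1 U (Finsupp.mem_support_iff.2 hU)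
    rcases U with _ | ⟨⟨i, j, x⟩, U⟩
    · exact absurd rfl hne
    · rw [List.nil_append, hφ.upper i j x U (hu (i, j, x) List.mem_cons_self) ho, smul_zero]
  · simp

end Words

/-! ### Vacuum expectation values -/

section Vev

variable {c : ℂ} {K : Type}

/-- The operator that belongs to a word. -/
def word (M : Model.{uM} c) (p : K → ℂ) (W : Word K) : Module.End ℂ M.H :=
  (W.map fun l => M.T l.1 l.2.1 (p l.2.2)).prod

def vev (M : Model.{uM} c) (p : K → ℂ) (W : Word K) : ℂ := M.covac (word M p W M.vac)

variable (M : Model.{uM} c) (p : K → ℂ)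

@[simp] theorem word_nil : word M p [] = 1 := rfl

@[simp] theorem word_cons (i j : Fin 3) (x : K) (W : Word K) :
    word M p ((i, j, x) :: W) = M.T i j (p x) * word M p W := by simp [word]

@[simp] theorem word_append (V W : Word K) :
    word M p (V ++ W) = word M p V * word M p W := by simp [word]

@[simp] theorem vev_nil : vev M p [] = 1 := by simp [vev, M.covac_vac]

lemma vev_rtt (i j k l : Fin 3) (x y : K) (hxy : p x ≠ p y) (V W : Word K) :
    RTTRel (fun k l => g c (p k) (p l)) (vev M p) i j k l x y V W := by
  have h := M.rtt i j k l (p x) (p y) hxy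
  rw [sub_eq_iff_eq_add] at h
  have h2 := congrArg (fun X => M.covac ((word M p V * X * word M p W) M.vac)) h
  simp only [RTTRel, vev, word_append, word_cons, exSign, rttSign]
  have e : ∀ X Y, word M p V * (X * (Y * word M p W)) = word M p V * (X * Y) * word M p W :=
    fun X Y => by simp only [mul_assoc]
  rw [e, e, e, e, h2]
  simp only [mul_add, add_mul, mul_sub, sub_mul, mul_smul_comm, smul_mul_assoc,
    ladd_apply, lsub_apply, lsmul_apply, map_add, map_sub, map_smul, smul_eq_mul, zsmul_eq_mul]
  push_cast
  ring

lemma vev_upper (i j : Fin 3) (x : K) (W : Word K) (h : i < j) : vev M p ((i, j, x) :: W) = 0 := by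
  have := congrArg (fun X => X (word M p W M.vac)) (M.covac_T_upper i j (p x) h)
  simpa [vev] using this

lemma vev_left_diag (i : Fin 3) (x : K) (W : Word K) :
    vev M p ((i, i, x) :: W) = M.lam i (p x) * vev M p W := by
  have := congrArg (fun X => X (word M p W M.vac)) (M.covac_T_diag i (p x))
  simpa [vev] using this

lemma vev_diag (i : Fin 3) (x : K) (W : Word K) :
    vev M p (W ++ [(i, i, x)]) = M.lam i (p x) * vev M p W := by
  simp [vev, M.T_diag_vac]

lemma vev_lower (i j : Fin 3) (x : K) (W : Word K) (h : j < i) :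
    vev M p (W ++ [(i, j, x)]) = 0 := by
  simp [vev, M.T_lower_vac i j (p x) h]

end Vev

/-! ### The dual model -/

/-- The model on the dual space with the transposed monodromy matrix. -/
def Model.dual {c : ℂ} (M : Model.{uM} c) : Model.{uM} c where
  H := Module.Dual ℂ M.H
  T i j x := (M.T j i x).dualMap
  vac := M.covac
  covac := Module.Dual.eval ℂ M.H M.vac
  lam := M.lam
  rtt i j k l x y hxy := by
    have h1 := M.rtt j i l k x y hxy
    refine LinearMap.ext fun ξ => LinearMap.ext fun m => ?_
    have h2 := congrArg (fun X => ξ (X m)) h1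
    simp only [lsub_apply, lsmul_apply, mul_apply, map_sub, map_smul,
      smul_eq_mul, LinearMap.dualMap_apply] at h2 ⊢
    have e1 : (-1 : ℂ) ^ ((par j + par i) * (par l + par k)) =
        (-1 : ℂ) ^ ((par i + par j) * (par k + par l)) := by ring_nf
    rw [e1] at h2
    have e2 : (-1 : ℂ) ^ ((par i + par j) * (par k + par l)) *
        (-1 : ℂ) ^ ((par i + par j) * (par k + par l)) = 1 := by rw [← mul_pow]; simp
    have e3 : (-1 : ℂ) ^ (par i * (par k + par l) + par k * par l) =
        (-1 : ℂ) ^ ((par i + par j) * (par k + par l)) *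
          (-1 : ℂ) ^ (par j * (par l + par k) + par l * par k) := by
      rw [← pow_add]
      have : (par i + par j) * (par k + par l) + (par j * (par l + par k) + par l * par k) =
        (par i * (par k + par l) + par k * par l) + 2 * (par j * (par k + par l)) := by ring
      rw [this, pow_add _ (par i * (par k + par l) + par k * par l),
        Even.neg_one_pow (even_two_mul _), mul_one]
    rw [e3]
    linear_combination (-(-1 : ℂ) ^ ((par i + par j) * (par k + par l))) * h2 +
      (-(ξ ((M.T l k y) ((M.T j i x) m)))) * e2
  T_diag_vac i x := M.covac_T_diag i x
  T_lower_vac i j x h := M.covac_T_upper j i x h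
  covac_T_diag i x := by
    refine LinearMap.ext fun ξ => ?_
    simp [LinearMap.dualMap_apply, M.T_diag_vac]
  covac_T_upper i j x h := by
    refine LinearMap.ext fun ξ => ?_
    simp [LinearMap.dualMap_apply, M.T_lower_vac j i x h]
  covac_vac := M.covac_vac

/-! ### Families of models -/

section Families

variable {c : ℂ} {K Θ : Type}

/-- The vacuum expectation values of a family of models, as functions of the parameter. -/
def vevF (M : Θ → Model.{uM} c) (p : Θ → K → ℂ) (W : Word K) (θ : Θ) : ℂ := vev (M θ) (p θ) W

/-- The points with labels in `s` are distinct, and `g` and the vacuum eigenvalues at these points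
are functions in `Ω` of the parameter. -/
structure RegOn (Ω : FunAlg Θ) (M : Θ → Model.{uM} c) (p : Θ → K → ℂ) (s : Set K) :
    Prop where
  inj : ∀ θ, Set.InjOn (p θ) s
  g_mem : ∀ k ∈ s, ∀ l ∈ s, k ≠ l → (fun θ => g c (p θ k) (p θ l)) ∈ Ω
  lam_mem : ∀ i, ∀ k ∈ s, (fun θ => (M θ).lam i (p θ k)) ∈ Ω

lemma RegOn.mono {Ω : FunAlg Θ} {M : Θ → Model.{uM} c} {p : Θ → K → ℂ}
    {s t : Set K} (h : RegOn Ω M p t) (hst : s ⊆ t) : RegOn Ω M p s :=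
  ⟨fun θ => (h.inj θ).mono hst, fun k hk l hl => h.g_mem k (hst hk) l (hst hl),
    fun i k hk => h.lam_mem i k (hst hk)⟩

variable {Ω : FunAlg Θ} {M : Θ → Model.{uM} c} {p : Θ → K → ℂ} {s : Set K}

open Classical in
def toSub (Ω : FunAlg Θ) (F : Θ → ℂ) : Ω := if h : F ∈ Ω then ⟨F, h⟩ else 0

lemma coe_toSub {F : Θ → ℂ} (h : F ∈ Ω) : (toSub Ω F : Θ → ℂ) = F := by simp [toSub, h]

lemma sub_smul_def (a : Ω) (F : Θ → ℂ) : a • F = (a : Θ → ℂ) * F := rfl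

def gF (c : ℂ) (Ω : FunAlg Θ) (p : Θ → K → ℂ) (k l : K) : Ω := toSub Ω fun θ => g c (p θ k) (p θ l)

def lamF (Ω : FunAlg Θ) (M : Θ → Model.{uM} c) (p : Θ → K → ℂ) (i : Fin 3) (k : K) :
    Ω := toSub Ω fun θ => (M θ).lam i (p θ k)

lemma over_pair_ne {s : Set K} {a b : Letter K} {V W : Word K}
    (h : Over s (V ++ a :: b :: W)) : a.2.2 ∈ s ∧ b.2.2 ∈ s ∧ a.2.2 ≠ b.2.2 := by
  refine ⟨h.2 a (by simp), h.2 b (by simp), ?_⟩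
  have := h.1
  rw [List.map_append, List.nodup_append] at this
  have h2 := this.2.1
  simp only [List.map_cons, List.nodup_cons, List.mem_cons, not_or] at h2
  exact h2.1.1

lemma vevF_rtt (h : RegOn Ω M p s) (i j k l : Fin 3) (x y : K) (hx : x ∈ s) (hy : y ∈ s)
    (hxy : x ≠ y) (V W : Word K) : RTTRel (gF c Ω p) (vevF M p) i j k l x y V W := by
  funext θ
  simp only [sub_smul_def, gF, coe_toSub (h.g_mem x hx y hy hxy), Pi.add_apply, Pi.smul_apply,
    Pi.mul_apply, Pi.sub_apply]
  exact vev_rtt (M θ) (p θ) i j k l x y (fun e => hxy (h.inj θ hx hy e)) V W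

lemma isState_vevF (h : RegOn Ω M p s) : IsState s (gF c Ω p) (lamF Ω M p) (vevF M p) where
  rtt i j k l x y V W hO := by
    obtain ⟨hx, hy, hxy⟩ := over_pair_ne hO
    exact vevF_rtt h i j k l x y hx hy hxy V W
  upper i j x W hij _ := funext fun θ => vev_upper (M θ) (p θ) i j x W hij
  diag i x W hO := by
    funext θ
    simp only [sub_smul_def, lamF, coe_toSub (h.lam_mem i x (hO.2 (i, i, x) (by simp))),
      Pi.mul_apply]
    exact vev_diag (M θ) (p θ) i x W
  lower i j x W hij _ := funext fun θ => vev_lower (M θ) (p θ) i j x W hij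

lemma vevF_nil : vevF M p [] = 1 := funext fun θ => by simp [vevF]

lemma vevF_mem (h : RegOn Ω M p s) {W : Word K} (hW : Over s W) : vevF M p W ∈ Ω := by
  obtain ⟨a, ha⟩ := exists_state_eq_smul (gF c Ω p) (lamF Ω M p) W hW
  rw [ha _ _ (isState_vevF h), vevF_nil, sub_smul_def, mul_one]
  exact a.2

end Families

/-! ### Absorbing a creation operator into the vacuum -/

section Absorb

variable {K : Type} {A : Type} [CommRing A] {Q : Type} [AddCommGroup Q] [Module A Q]

/-- The letter `T_{12}` (for `σ = 0`) or `T_{23}` (for `σ = 1`). -/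
def raise (σ : Fin 2) (y : K) : Letter K := (σ.castSucc, σ.succ, y)

/-- The letter `T_{21}` (for `σ = 0`) or `T_{32}` (for `σ = 1`). -/
def lowerL (σ : Fin 2) (x : K) : Letter K := (σ.succ, σ.castSucc, x)

/-- Modification of vacuum eigenvalues by a particle, in terms of `g(y, z)`. -/
def modG (σ : Fin 2) (gyz : A) : Fin 3 → A :=
  if σ = 0 then ![1 + gyz, 1 - gyz, 1] else ![1, 1 + gyz, 1 + gyz]

/-- Right vacuum conditions for a functional that vanishes on words without the label `y`. -/
structure RightVac (s : Set K) (y : K) (g : K → K → A) (lam : Fin 3 → K → A) (σ : Fin 2)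
    (Ψ : Word K → Q) : Prop where
  rtt : ∀ (i j k l : Fin 3) (x z : K) (V W : Word K),
    Over (insert y s) (V ++ (i, j, x) :: (k, l, z) :: W) → RTTRel g Ψ i j k l x z V W
  lower : ∀ (i j : Fin 3) (x : K) (W : Word K), j < i →
    Over (insert y s) (W ++ [(i, j, x)]) → Ψ (W ++ [(i, j, x)]) = 0
  diag : ∀ (i : Fin 3) (x : K) (W : Word K), x ∈ s →
    Over (insert y s) (W ++ [(i, i, x)]) → Ψ (W ++ [(i, i, x)]) = lam i x • Ψ W
  diag_y : ∀ (i : Fin 3) (W : Word K), (i = σ.castSucc ∨ i = σ.succ) → Over s W →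
    Ψ (W ++ [(i, i, y)]) = 0

variable {s : Set K} {y : K} {g : K → K → A} {lam : Fin 3 → K → A} {σ : Fin 2}
  {Ψ : Word K → Q}

lemma Over.snoc {s : Set K} {W : Word K} {x : K} (i j : Fin 3) (hW : Over s W)
    (hx : x ∉ s) : Over (insert x s) (W ++ [(i, j, x)]) := by
  refine (hW.append (W := [(i, j, x)]) (t := {x}) (by simp [Over]) (by simpa using hx)).mono ?_
  rintro z (hz | rfl)
  exacts [Set.mem_insert_of_mem _ hz, Set.mem_insert _ _]

lemma Over.snoc_congr {s : Set K} {W : Word K} {x : K} {i j : Fin 3} (i' j' : Fin 3)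
    (h : Over s (W ++ [(i, j, x)])) : Over s (W ++ [(i', j', x)]) := by
  obtain ⟨h1, h2⟩ := h
  refine ⟨by simpa using h1, fun l hl => ?_⟩
  rcases List.mem_append.1 hl with h | h
  · exact h2 l (List.mem_append_left _ h)
  · rw [List.mem_singleton.1 h]
    exact h2 (i, j, x) (by simp)

lemma Over.swap {s : Set K} {V W : Word K} {x z : K} {i j k l : Fin 3}
    (i' j' k' l' : Fin 3) (h : Over s (V ++ (i, j, x) :: (k, l, z) :: W)) :
    Over s (V ++ (k', l', z) :: (i', j', x) :: W) := by
  obtain ⟨h1, h2⟩ := h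
  refine ⟨?_, fun a ha => ?_⟩
  · have : List.Perm ((V ++ (k', l', z) :: (i', j', x) :: W).map fun l => l.2.2)
        ((V ++ (i, j, x) :: (k, l, z) :: W).map fun l => l.2.2) := by
      simp only [List.map_append, List.map_cons]
      exact (List.Perm.swap _ _ _).append_left _
    exact this.nodup_iff.2 h1
  · simp only [List.mem_append, List.mem_cons] at ha h2
    rcases ha with ha | rfl | rfl | ha
    · exact h2 a (.inl ha)
    · exact h2 (k, l, z) (by simp)
    · exact h2 (i, j, x) (by simp)
    · exact h2 a (by simp [ha])

lemma Over.congr_pair {s : Set K} {V W : Word K} {x z : K} {i j k l : Fin 3}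
    (i' j' k' l' : Fin 3) (h : Over s (V ++ (i, j, x) :: (k, l, z) :: W)) :
    Over s (V ++ (i', j', x) :: (k', l', z) :: W) := (h.swap k l i j).swap k' l' i' j'

lemma Over.of_append_left {s : Set K} {V W : Word K} (h : Over s (V ++ W)) : Over s V := by
  refine ⟨?_, fun l hl => h.2 l (List.mem_append_left _ hl)⟩
  have := h.1
  rw [List.map_append] at this
  exact this.of_append_left

lemma Over.snoc_mem {W : Word K} {z : K} {i j : Fin 3} (hO : Over s (W ++ [(i, j, z)])) :
    z ∈ s := hO.2 (i, j, z) (by simp)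

section Snoc

variable {W : Word K} {z : K} {i₀ j₀ : Fin 3}

lemma Over.snoc_pair (hO : Over s (W ++ [(i₀, j₀, z)])) (hy : y ∉ s) (i j k l : Fin 3) :
    Over (insert y s) (W ++ [(i, j, z), (k, l, y)]) := by
  simpa using (hO.snoc_congr i j).snoc k l hy

lemma Over.snoc_swap (hO : Over s (W ++ [(i₀, j₀, z)])) (hy : y ∉ s) (i j k l : Fin 3) :
    Over (insert y s) (W ++ [(i, j, y), (k, l, z)]) :=
  (hO.snoc_pair hy k l i j).swap k l i j

lemma RightVac.diag_snoc (h : RightVac s y g lam σ Ψ) (hy : y ∉ s)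
    (hO : Over s (W ++ [(i₀, j₀, z)])) (i k l : Fin 3) :
    Ψ (W ++ [(k, l, y), (i, i, z)]) = lam i z • Ψ (W ++ [(k, l, y)]) := by
  simpa using h.diag i z (W ++ [(k, l, y)]) hO.snoc_mem (by simpa using hO.snoc_swap hy k l i i)

lemma RightVac.diag_y_snoc (h : RightVac s y g lam σ Ψ)
    (hO : Over s (W ++ [(i₀, j₀, z)])) (i k l : Fin 3) (hi : i = σ.castSucc ∨ i = σ.succ) :
    Ψ (W ++ [(k, l, z), (i, i, y)]) = 0 := by
  simpa using h.diag_y i (W ++ [(k, l, z)]) hi (hO.snoc_congr k l)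

lemma RightVac.lower_snoc (h : RightVac s y g lam σ Ψ) (hy : y ∉ s)
    (hO : Over s (W ++ [(i₀, j₀, z)])) (i j k l : Fin 3) (hij : j < i) : Ψ (W ++ [(k, l, z), (i, j, y)]) = 0 := by
  simpa using h.lower i j y (W ++ [(k, l, z)]) hij (by simpa using hO.snoc_pair hy k l i j)

lemma RightVac.lower_snoc' (h : RightVac s y g lam σ Ψ) (hy : y ∉ s)
    (hO : Over s (W ++ [(i₀, j₀, z)])) (i j k l : Fin 3) (hij : j < i) : Ψ (W ++ [(k, l, y), (i, j, z)]) = 0 := by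
  simpa using h.lower i j z (W ++ [(k, l, y)]) hij (by simpa using hO.snoc_swap hy k l i j)

end Snoc

lemma RightVac.isState (h : RightVac s y g lam σ Ψ) (hy : y ∉ s)
    (hanti : ∀ z ∈ s, g z y = -g y z) {lam' : Fin 3 → K → A}
    (hlam' : ∀ i, ∀ z ∈ s, lam' i z = modG σ (g y z) i * lam i z)
    (hup : ∀ (i j : Fin 3) (z : K) (W : Word K), i < j → Over s ((i, j, z) :: W) →
      Ψ ((i, j, z) :: W ++ [raise σ y]) = 0) : IsState s g lam' fun W => Ψ (W ++ [raise σ y]) where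
  rtt i j k l x z V W hO := by
    have hO' : Over (insert y s) (V ++ (i, j, x) :: (k, l, z) :: (W ++ [raise σ y])) := by
      have := hO.snoc σ.castSucc σ.succ hy
      simpa [raise] using this
    simpa [RTTRel] using h.rtt i j k l x z V (W ++ [raise σ y]) hO'
  upper := hup
  diag i z W hO := by
    have hz := hO.snoc_mem
    have hg := hanti z hz
    rw [hlam' i z hz, List.append_assoc, List.singleton_append]
    fin_cases σ <;> fin_cases i <;>
      [have := (h.rtt 0 1 0 0 y z W [] (hO.snoc_swap hy _ _ _ _)).symm;
       have := h.rtt 1 1 0 1 z y W [] (hO.snoc_pair hy _ _ _ _);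
       have := h.rtt 2 2 0 1 z y W [] (hO.snoc_pair hy _ _ _ _);
       have := (h.rtt 1 2 0 0 y z W [] (hO.snoc_swap hy _ _ _ _)).symm;
       have := (h.rtt 1 2 1 1 y z W [] (hO.snoc_swap hy _ _ _ _)).symm;
       have := h.rtt 2 2 1 2 z y W [] (hO.snoc_pair hy _ _ _ _)] <;>
      simp only [RTTRel, raise, modG, exSign, rttSign, par] at this ⊢ <;> simp at this ⊢ <;>
      simp [this, h.diag_snoc hy hO, h.diag_y_snoc hO, h.lower_snoc hy hO, h.lower_snoc' hy hO, hg,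
        add_smul, mul_smul, sub_eq_add_neg]
  lower i j z W hij hO := by
    have hW := hO.of_append_left
    have hl := fun k l hkl => h.lower k l y W hkl (hW.snoc k l hy)
    rw [List.append_assoc, List.singleton_append]
    have h1 := h.rtt i j σ.castSucc σ.succ z y W [] (hO.snoc_pair hy _ _ _ _)
    have h2 := (h.rtt σ.castSucc σ.succ i j y z W [] (hO.snoc_swap hy _ _ _ _)).symm
    fin_cases σ <;> fin_cases i <;> fin_cases j <;> simp at hij <;>
      simp [RTTRel, raise, h.diag_snoc hy hO, h.diag_y_snoc hO, h.lower_snoc hy hO,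
        h.lower_snoc' hy hO, h.diag_y _ W _ hW, hl] at h1 h2 ⊢ <;>
      first | exact h1 | exact h2

end Absorb

section Residue

variable {c : ℂ} {K Θ : Type} {Ω : FunAlg Θ} {M : Θ → Model.{u₁} c}
  {M' : Θ → Model.{u₂} c} {p : Θ → K → ℂ} {s : Set K}

/-- `M'` has the vacuum eigenvalues of `M`, modified by a particle of type `σ` at `y`. -/
def IsModified (M : Θ → Model.{u₁} c) (M' : Θ → Model.{u₂} c) (p : Θ → K → ℂ) (s : Set K)
    (σ : Fin 2) (y : K) : Prop :=
  ∀ θ i, ∀ k ∈ s, (M' θ).lam i (p θ k) = modG σ (g c (p θ y) (p θ k)) i * (M θ).lam i (p θ k)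

lemma coe_modG (σ : Fin 2) (a : Ω) (i : Fin 3) :
    ((modG σ a i : Ω) : Θ → ℂ) = fun θ => modG σ ((a : Θ → ℂ) θ) i := by
  funext θ
  fin_cases σ <;> fin_cases i <;> simp [modG]

lemma modG_mem {F : Θ → ℂ} (hF : F ∈ Ω) (σ : Fin 2) (i : Fin 3) :
    (fun θ => modG σ (F θ) i) ∈ Ω := by
  have := coe_modG σ (⟨F, hF⟩ : Ω) i
  simp only at this
  rw [← this]
  exact (modG σ (⟨F, hF⟩ : Ω) i).2

lemma IsModified.regOn {σ : Fin 2} {y : K} (hM' : IsModified M M' p s σ y) (hy : y ∉ s)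
    (hY : RegOn Ω M p (insert y s)) : RegOn Ω M' p s where
  inj θ := (hY.inj θ).mono (Set.subset_insert _ _)
  g_mem := (hY.mono (Set.subset_insert _ _)).g_mem
  lam_mem i k hk := by
    have : (fun θ => (M' θ).lam i (p θ k)) =
        (fun θ => modG σ (g c (p θ y) (p θ k)) i) * fun θ => (M θ).lam i (p θ k) :=
      funext fun θ => hM' θ i k hk
    rw [this]
    refine mul_mem (modG_mem (hY.g_mem y (Set.mem_insert _ _) k (Set.mem_insert_of_mem _ hk) ?_) _ _)
      (hY.lam_mem i k (Set.mem_insert_of_mem _ hk))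
    rintro rfl
    exact hy hk

/-- **Poles of vacuum expectation values.**  Up to functions in `Ω`, a word between an annihilation
operator at `x` and a creation operator at `y` can be replaced by its vacuum expectation value
in the model that is modified by the particle at `y`. -/
lemma vevF_residue {x y : K} (hy : y ∉ s) (hX : RegOn Ω M p (insert x s))
    (hY : RegOn Ω M p (insert y s)) (hx : x ∉ s) (σ τ : Fin 2)
    (hM' : IsModified M M' p s σ y) {W : Word K} (hW : Over s W) :
    vevF M p (lowerL τ x :: W ++ [raise σ y]) -
      vevF M' p W * vevF M p [lowerL τ x, raise σ y] ∈ Ω := by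
  let N : Submodule Ω (Θ → ℂ) := LinearMap.range (Algebra.linearMap Ω (Θ → ℂ))
  have hmk : ∀ F : Θ → ℂ, N.mkQ F = 0 ↔ F ∈ Ω := fun F => by
    rw [Submodule.mkQ_apply, Submodule.Quotient.mk_eq_zero]
    exact ⟨by rintro ⟨a, rfl⟩; exact a.2, fun h => ⟨⟨F, h⟩, rfl⟩⟩
  let Ψ : Word K → (Θ → ℂ) ⧸ N := fun W => N.mkQ (vevF M p (lowerL τ x :: W))
  have hright : RightVac s y (gF c Ω p) (lamF Ω M p) σ Ψ := by
    constructor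
    · intro i j k l x' z V W hO
      obtain ⟨h1, h2, h3⟩ := over_pair_ne hO
      have := vevF_rtt hY i j k l x' z h1 h2 h3 (lowerL τ x :: V) W
      have h4 := congrArg N.mkQ this
      simp only [map_add, map_zsmul, map_smul, map_sub] at h4
      exact h4
    · intro i j x' W hij _
      have : vevF M p (lowerL τ x :: (W ++ [(i, j, x')])) = 0 :=
        funext fun θ => vev_lower (M θ) (p θ) i j x' (lowerL τ x :: W) hij
      simp only [Ψ, this, map_zero]
    · intro i x' W hx' _
      have : vevF M p (lowerL τ x :: (W ++ [(i, i, x')])) =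
          lamF Ω M p i x' • vevF M p (lowerL τ x :: W) := by
        funext θ
        simp only [sub_smul_def, lamF, coe_toSub (hY.lam_mem i x' (Set.mem_insert_of_mem _ hx')),
          Pi.mul_apply]
        exact vev_diag (M θ) (p θ) i x' (lowerL τ x :: W)
      simp only [Ψ, this, map_smul]
    · intro i W _ hW
      have : vevF M p (lowerL τ x :: (W ++ [(i, i, y)])) =
          (fun θ => (M θ).lam i (p θ y)) * vevF M p (lowerL τ x :: W) :=
        funext fun θ => vev_diag (M θ) (p θ) i y (lowerL τ x :: W)
      simp only [Ψ, this, hmk]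
      refine mul_mem (hY.lam_mem i y (Set.mem_insert _ _)) (vevF_mem hX ?_)
      rw [over_cons]
      exact ⟨Set.mem_insert _ _, hW.mono fun z hz => ⟨Set.mem_insert_of_mem _ hz, by
        rintro rfl
        exact hx hz⟩⟩
  have hMs := hM'.regOn hy hY
  have hgy : ∀ z ∈ s, (fun θ => g c (p θ y) (p θ z)) ∈ Ω := fun z hz =>
    hY.g_mem y (Set.mem_insert _ _) z (Set.mem_insert_of_mem _ hz) (by rintro rfl; exact hy hz)
  have hgy' : ∀ z ∈ s, (fun θ => g c (p θ z) (p θ y)) ∈ Ω := fun z hz =>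
    hY.g_mem z (Set.mem_insert_of_mem _ hz) y (Set.mem_insert _ _) (by rintro rfl; exact hy hz)
  have hleft : ∀ (i j : Fin 3) (z : K) (W : Word K), i < j → Over s ((i, j, z) :: W) →
      Ψ ((i, j, z) :: W ++ [raise σ y]) = 0 := by
    intro i j z W hij hO
    have hzs : z ∈ s := hO.2 (i, j, z) List.mem_cons_self
    have hxz : x ≠ z := by rintro rfl; exact hx hzs
    obtain ⟨-, hO'⟩ := over_cons.1 hO
    simp only at hO'
    have hOy : Over (insert y s \ {z}) (W ++ [raise σ y]) := by
      refine (hO'.snoc σ.castSucc σ.succ (fun h => hy h.1)).mono ?_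
      rintro k (rfl | hk)
      · exact ⟨Set.mem_insert _ _, by rintro rfl; exact hy hzs⟩
      · exact ⟨Set.mem_insert_of_mem _ hk.1, hk.2⟩
    have hzy : ∀ i j, vevF M p ((i, j, z) :: (W ++ [raise σ y])) ∈ Ω := fun i' j' =>
      vevF_mem hY (over_cons.2 ⟨Set.mem_insert_of_mem _ hzs, hOy⟩)
    have hy' : vevF M p (W ++ [raise σ y]) ∈ Ω := vevF_mem hY (hOy.mono Set.sdiff_subset)
    have hlam : ∀ i, ∀ k ∈ insert x s, (fun θ => (M θ).lam i (p θ k)) ∈ Ω := hX.lam_mem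
    have hup : ∀ (i j : Fin 3) (k : K) (V : Word K), i < j →
        vevF M p ((i, j, k) :: V) = 0 := fun i j k V h =>
      funext fun θ => vev_upper (M θ) (p θ) i j k V h
    have hdi : ∀ (i : Fin 3) (k : K) (V : Word K), vevF M p ((i, i, k) :: V) =
        (fun θ => (M θ).lam i (p θ k)) * vevF M p V := fun i k V =>
      funext fun θ => vev_left_diag (M θ) (p θ) i k V
    have hxs : x ∈ insert x s := Set.mem_insert _ _
    have hzs' : z ∈ insert x s := Set.mem_insert_of_mem _ hzs
    have hr := fun i j k l => vevF_rtt hX i j k l x z hxs hzs' hxz [] (W ++ [raise σ y])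
    have hr' := fun i j k l => vevF_rtt hX i j k l z x hzs' hxs hxz.symm [] (W ++ [raise σ y])
    simp only [RTTRel, List.nil_append] at hr hr'
    have hx' : ∀ i j k l, i ≤ j → vevF M p ((i, j, x) :: (k, l, z) :: (W ++ [raise σ y])) ∈ Ω := by
      intro i j k l h
      rcases h.lt_or_eq with h | rfl
      · exact hup i j x _ h ▸ zero_mem _
      · exact hdi i x _ ▸ mul_mem (hlam i x hxs) (hzy k l)
    have hz' : ∀ i j k l, i ≤ j → i < j ∨ k ≤ l →
        vevF M p ((i, j, z) :: (k, l, x) :: (W ++ [raise σ y])) ∈ Ω := by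
      intro i j k l h h'
      rcases h.lt_or_eq with h | rfl
      · exact hup i j z _ h ▸ zero_mem _
      rw [hdi]
      refine mul_mem (hlam i z hzs') ?_
      rcases (h'.resolve_left (lt_irrefl i)).lt_or_eq with h | rfl
      · exact hup k l x _ h ▸ zero_mem _
      · exact hdi k x _ ▸ mul_mem (hlam k x hxs) hy'
    simp only [Ψ, hmk]
    have hcase : ∀ (τ : Fin 2) (i j : Fin 3), i < j →
        i ≤ τ.castSucc ∧ (i < τ.castSucc ∨ τ.succ ≤ j) ∨ τ = 0 ∧ i = 1 ∧ j = 2 := by decide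
    change vevF M p ((τ.succ, τ.castSucc, x) :: (i, j, z) :: (W ++ [raise σ y])) ∈ Ω
    rcases hcase τ i j hij with ⟨h1, h2⟩ | ⟨rfl, rfl, rfl⟩
    · rw [hr, hup i j z _ hij, smul_zero, zero_add]
      exact zsmul_mem (mul_mem (Subtype.property _) (sub_mem (hz' _ _ _ _ h1 h2) (hx' _ _ _ _ h1))) _
    · have := hr' 1 2 1 0
      rw [hup 1 2 z _ hij, hup 1 2 x _ hij, sub_self, smul_zero, smul_zero, add_zero] at this
      have h3 := congrArg (fun F => exSign 1 2 1 0 • F) this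
      simp only [smul_smul, exSign_mul_self, one_smul, smul_zero] at h3
      exact h3 ▸ zero_mem _
  have hst : IsState s (gF c Ω p) (lamF Ω M' p) fun W => Ψ (W ++ [raise σ y]) := by
    refine hright.isState hy ?_ ?_ hleft
    · intro z hz
      refine Subtype.ext ?_
      simp only [gF, Subalgebra.coe_neg, coe_toSub (hgy z hz), coe_toSub (hgy' z hz)]
      funext θ
      simp only [g, Pi.neg_apply]
      rw [← neg_sub (p θ y) (p θ z), div_neg]
    · intro i z hz
      refine Subtype.ext ?_
      rw [Subalgebra.coe_mul, coe_modG]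
      simp only [gF, lamF, coe_toSub (hgy z hz), coe_toSub (hMs.lam_mem i z hz),
        coe_toSub (hY.lam_mem i z (Set.mem_insert_of_mem _ hz))]
      exact funext fun θ => hM' θ i z hz
  obtain ⟨a, ha⟩ := exists_state_eq_smul (gF c Ω p) (lamF Ω M' p) W hW
  have h1 := ha _ _ hst
  have h2 := ha _ _ (isState_vevF hMs)
  rw [vevF_nil, sub_smul_def, mul_one] at h2
  rw [h2, ← hmk, map_sub, sub_eq_zero]
  refine h1.trans ?_
  rw [← sub_smul_def, map_smul]
  simp [Ψ]

end Residue

section Independence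

variable {c : ℂ} {K : Type} {s : Set K}

lemma isState_vev (M : Model.{uM} c) {p : K → ℂ} (h : Set.InjOn p s) :
    IsState s (fun k l => g c (p k) (p l)) (fun i k => M.lam i (p k)) (vev M p) where
  rtt i j k l x y V W hO := by
    obtain ⟨hx, hy, hxy⟩ := over_pair_ne hO
    exact vev_rtt M p i j k l x y (fun e => hxy (h hx hy e)) V W
  upper i j x W hij _ := vev_upper M p i j x W hij
  diag i x W _ := vev_diag M p i x W
  lower i j x W hij _ := vev_lower M p i j x W hij

lemma vev_congr (M : Model.{u₁} c) (M' : Model.{u₂} c) {p : K → ℂ} (h : Set.InjOn p s)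
    (hlam : ∀ i, ∀ k ∈ s, M.lam i (p k) = M'.lam i (p k)) {W : Word K} (hW : Over s W) :
    vev M p W = vev M' p W := by
  obtain ⟨a, ha⟩ := exists_state_eq_smul (A := ℂ) (fun k l => g c (p k) (p l))
    (fun i k => M.lam i (p k)) W hW
  have h1 := ha _ _ (isState_vev M h)
  have h2 := isState_vev M' h
  have h3 : IsState s (fun k l => g c (p k) (p l)) (fun i k => M.lam i (p k)) (vev M' p) :=
    { h2 with
      diag := fun i x W hO => by
        rw [h2.diag i x W hO, hlam i x (hO.2 (i, i, x) (by simp))] }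
  rw [h1, ha _ _ h3, vev_nil, vev_nil]

/-- The vacuum expectation value of a word that ends with `T_{12}(y)` or `T_{23}(y)` depends on the
two vacuum eigenvalues with the indices of this operator only, and homogeneously. -/
lemma vev_raise_congr (M : Model.{u₁} c) (M' : Model.{u₂} c) {p : K → ℂ} {y : K} (hy : y ∉ s)
    (h : Set.InjOn p (insert y s)) (hlam : ∀ i, ∀ k ∈ s, M.lam i (p k) = M'.lam i (p k))
    (σ : Fin 2) (a a' : ℂ) (ha : ∀ i : Fin 3, (i = σ.castSucc ∨ i = σ.succ) →
      a * M.lam i (p y) = a' * M'.lam i (p y)) {W : Word K} (hW : Over s W) :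
    a * vev M p (W ++ [raise σ y]) = a' * vev M' p (W ++ [raise σ y]) := by
  let Ψ : Word K → ℂ := fun W => a * vev M p W - a' * vev M' p W
  have hs : Set.InjOn p s := h.mono (Set.subset_insert _ _)
  have hright : RightVac s y (fun k l => g c (p k) (p l)) (fun i k => M.lam i (p k)) σ Ψ := by
    constructor
    · intro i j k l x z V W hO
      obtain ⟨hx, hz, hxz⟩ := over_pair_ne hO
      have hne : p x ≠ p z := fun e => hxz (h hx hz e)
      simp only [RTTRel, Ψ, vev_rtt M p i j k l x z hne V W, vev_rtt M' p i j k l x z hne V W,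
        zsmul_eq_mul, smul_eq_mul]
      ring
    · intro i j x W hij _
      simp only [Ψ, vev_lower _ p i j x W hij, mul_zero, sub_zero]
    · intro i x W hx _
      simp only [Ψ, vev_diag, hlam i x hx, smul_eq_mul]
      ring
    · intro i W hi hW
      simp only [Ψ, vev_diag, vev_congr M M' hs hlam hW]
      linear_combination vev M' p W * ha i hi
  have hst : IsState s (fun k l => g c (p k) (p l))
      (fun i k => modG σ (g c (p y) (p k)) i * M.lam i (p k)) fun W => Ψ (W ++ [raise σ y]) := by
    refine hright.isState hy ?_ (fun _ _ _ => rfl) ?_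
    · intro z _
      simp only [g]
      rw [← neg_sub (p y) (p z), div_neg]
    · intro i j z W hij _
      simp only [Ψ, List.cons_append, vev_upper _ p i j z _ hij, mul_zero, sub_zero]
  obtain ⟨b, hb⟩ := exists_state_eq_smul (A := ℂ) (fun k l => g c (p k) (p l))
    (fun i k => modG σ (g c (p y) (p k)) i * M.lam i (p k)) W hW
  have h1 := hb _ _ hst
  have h2 : Ψ ([] ++ [raise σ y]) = 0 := by
    have h3 : σ.castSucc < σ.succ := Fin.castSucc_lt_succ
    simp only [Ψ, List.nil_append, raise, vev_upper _ p _ _ y [] h3, mul_zero, sub_zero]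
  rw [h2, smul_zero] at h1
  exact sub_eq_zero.1 h1

end Independence

/-! ### The rational functions -/

section Rational

variable {c : ℂ}

lemma f_eq {x y : ℂ} (h : x ≠ y) : f c x y = 1 + g c x y := by
  have : x - y ≠ 0 := sub_ne_zero.2 h
  simp only [f, g]
  field_simp

lemma g_swap (c x y : ℂ) : g c y x = -g c x y := by
  simp only [g]
  rw [← neg_sub x y, div_neg]

lemma ic_ne_zero (hc : c ≠ 0) : I * c ≠ 0 := mul_ne_zero Complex.I_ne_zero hc

lemma g_mul_h (hc : c ≠ 0) (x y : ℂ) : g c x y * h c x y = f c x y := by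
  have := ic_ne_zero hc
  simp only [g, h, f]
  rw [div_mul_div_comm, mul_comm, mul_div_mul_right _ _ this]

lemma h_self (hc : c ≠ 0) (x : ℂ) : h c x x = 1 := by
  have := ic_ne_zero hc
  simp [h, div_self this]

lemma g_three {x y z : ℂ} (hxy : x ≠ y) (hyz : y ≠ z) (hzx : z ≠ x) :
    g c x y * g c y z + g c y z * g c z x + g c z x * g c x y = 0 := by
  have h1 : x - y ≠ 0 := sub_ne_zero.2 hxy
  have h2 : y - z ≠ 0 := sub_ne_zero.2 hyz
  have h3 : z - x ≠ 0 := sub_ne_zero.2 hzx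
  simp only [g]
  field_simp
  ring

lemma g_ne_zero (hc : c ≠ 0) {x y : ℂ} (h : x ≠ y) : g c x y ≠ 0 :=
  div_ne_zero (ic_ne_zero hc) (sub_ne_zero.2 h)

lemma h_mul_g_swap (hc : c ≠ 0) {x y : ℂ} (hxy : x ≠ y) : g c x y * h c y x = g c x y - 1 := by
  have := g_mul_h hc y x
  rw [f_eq hxy.symm, g_swap c x y] at this
  linear_combination -this

end Rational

/-! ### Relations between the entries of the monodromy matrix -/

section Relations

variable {c : ℂ} (M : Model.{uM} c)

lemma T01_comm {x y : ℂ} (h : x ≠ y) : M.T 0 1 x * M.T 0 1 y = M.T 0 1 y * M.T 0 1 x := by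
  have h1 := M.rtt 0 1 0 1 x y h
  have h2 := M.rtt 0 1 0 1 y x h.symm
  simp only [par, Matrix.cons_val_zero, Matrix.cons_val_one, add_zero, mul_zero, pow_zero,
    one_smul, one_mul] at h1 h2
  rw [g_swap c x y] at h2
  have : (2 : ℂ) • (M.T 0 1 x * M.T 0 1 y - M.T 0 1 y * M.T 0 1 x) = 0 := by
    linear_combination (norm := module) h1 - h2
  exact sub_eq_zero.1 ((smul_eq_zero.1 this).resolve_left two_ne_zero)

lemma Tj2_swap (hc : c ≠ 0) (j : Fin 3) (hj : j ≠ 2) {x y : ℂ} (hxy : x ≠ y) :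
    h c x y • (M.T j 2 x * M.T j 2 y) = h c y x • (M.T j 2 y * M.T j 2 x) := by
  have h1 := M.rtt j 2 j 2 x y hxy
  have hp : par j = 0 := (by decide : ∀ j : Fin 3, j ≠ 2 → par j = 0) j hj
  have h3 : par 2 = 1 := rfl
  simp only [hp, h3, zero_add, mul_one, pow_one, neg_smul, one_smul, pow_zero, one_mul,
    add_zero] at h1
  have e1 := g_mul_h hc x y
  rw [f_eq hxy] at e1
  have e2 := h_mul_g_swap hc hxy
  have : g c x y • (h c x y • (M.T j 2 x * M.T j 2 y)) =
      g c x y • (h c y x • (M.T j 2 y * M.T j 2 x)) := by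
    rw [smul_smul, smul_smul, e1, e2]
    linear_combination (norm := module) h1
  exact smul_right_injective _ (g_ne_zero hc hxy) this

lemma T01_mul_T02 {x y : ℂ} (h : x ≠ y) : M.T 0 1 x * M.T 0 2 y =
    f c y x • (M.T 0 2 y * M.T 0 1 x) + g c x y • (M.T 0 2 x * M.T 0 1 y) := by
  have h1 := M.rtt 0 2 0 1 y x h.symm
  simp only [par, Matrix.cons_val_zero, Matrix.cons_val_one, add_zero, mul_zero, pow_zero,
    one_smul, one_mul] at h1
  rw [f_eq h.symm]
  rw [g_swap c x y] at h1 ⊢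
  linear_combination (norm := module) -h1

lemma T12_mul_T02 {z y : ℂ} (h : z ≠ y) : M.T 1 2 z * M.T 0 2 y =
    (g c z y - 1) • (M.T 0 2 y * M.T 1 2 z) - g c z y • (M.T 0 2 z * M.T 1 2 y) := by
  have h1 := M.rtt 1 2 0 2 z y h
  simp only [show par 0 = 0 from rfl, show par 1 = 0 from rfl, show par 2 = 1 from rfl, zero_add,
    mul_one, pow_one, pow_zero, neg_smul, one_smul, one_mul, add_zero] at h1
  linear_combination (norm := module) h1

lemma T01_mul_T12 {y z : ℂ} (h : y ≠ z) : M.T 0 1 y * M.T 1 2 z =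
    M.T 1 2 z * M.T 0 1 y + g c y z • (M.T 0 2 y * M.T 1 1 z) -
      g c y z • (M.T 0 2 z * M.T 1 1 y) := by
  have h1 := M.rtt 1 2 0 1 z y h.symm
  simp only [show par 0 = 0 from rfl, show par 1 = 0 from rfl, show par 2 = 1 from rfl, zero_add,
    mul_zero, pow_zero, one_smul, one_mul, add_zero] at h1
  rw [g_swap c y z] at h1
  linear_combination (norm := module) -h1

lemma T11_mul_T12 {z x : ℂ} (h : z ≠ x) : M.T 1 1 z * M.T 1 2 x =
    f c x z • (M.T 1 2 x * M.T 1 1 z) + g c z x • (M.T 1 2 z * M.T 1 1 x) := by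
  have h1 := M.rtt 1 2 1 1 x z h.symm
  simp only [show par 1 = 0 from rfl, show par 2 = 1 from rfl, zero_add,
    mul_zero, pow_zero, one_smul, one_mul, add_zero] at h1
  rw [f_eq h.symm]
  rw [g_swap c z x] at h1 ⊢
  linear_combination (norm := module) -h1

end Relations

/-! ### Ordered products -/

section Products

variable {c : ℂ} (M : Model.{uM} c) {a : ℕ} (x : Pts a)

lemma sort_insert_max {X : Finset (Fin a)} {k : Fin a} (hk : ∀ i ∈ X, i < k) :
    (insert k X).sort = X.sort ++ [k] := by
  have hkX : k ∉ X := fun h => lt_irrefl _ (hk k h)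
  refine List.Perm.eq_of_pairwise (le := (· ≤ ·)) (fun a b _ _ => le_antisymm)
    (pairwise_sort _ _) ?_ ?_
  · rw [List.pairwise_append]
    refine ⟨pairwise_sort _ _, List.pairwise_singleton _ _, fun i hi j hj => ?_⟩
    rw [List.mem_singleton.1 hj]
    exact (hk i ((mem_sort _).1 hi)).le
  · rw [List.perm_ext_iff_of_nodup (sort_nodup _ _)]
    · intro i
      simp [or_comm]
    · rw [List.nodup_append]
      refine ⟨sort_nodup _ _, by simp, fun i hi j hj => ?_⟩
      rw [List.mem_singleton.1 hj]
      rintro rfl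
      exact hkX ((mem_sort _).1 hi)

@[simp] theorem opProd_empty (i j : Fin 3) : opProd M i j x ∅ = 1 := by simp [opProd]

lemma opProd_insert_max (i j : Fin 3) {X : Finset (Fin a)} {k : Fin a} (hk : ∀ i ∈ X, i < k) :
    opProd M i j x (insert k X) = opProd M i j x X * M.T i j (x k) := by
  simp [opProd, sort_insert_max hk]

lemma Delta_insert_max (F : ℂ → ℂ → ℂ) {X : Finset (Fin a)} {k : Fin a} (hk : ∀ i ∈ X, i < k) :
    Delta F x (insert k X) = Delta F x X * ∏ i ∈ X, F (x k) (x i) := by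
  have hkX : k ∉ X := fun h => lt_irrefl _ (hk k h)
  simp only [Delta]
  rw [prod_insert hkX, mul_comm]
  congr 1
  · refine prod_congr rfl fun i hi => ?_
    rw [filter_insert, if_neg (not_lt.2 (hk i hi).le)]
  · rw [filter_insert, if_neg (lt_irrefl _), filter_true_of_mem hk]

@[simp] theorem symT3_empty (j : Fin 3) : symT3 M j x ∅ = 1 := by simp [symT3, Delta]

lemma symT3_insert_max (j : Fin 3) {X : Finset (Fin a)} {k : Fin a} (hk : ∀ i ∈ X, i < k) :
    symT3 M j x (insert k X) = (∏ i ∈ X, h c (x k) (x i))⁻¹ • (symT3 M j x X * M.T j 2 (x k)) := by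
  rw [symT3, symT3, Delta_insert_max x _ hk, opProd_insert_max M x _ _ hk, mul_inv, smul_mul_assoc,
    smul_smul, mul_comm]

lemma opProd01_insert {X : Finset (Fin a)} {k : Fin a} (hk : k ∉ X)
    (hx : Set.InjOn x (insert k X : Finset (Fin a))) :
    opProd M 0 1 x (insert k X) = opProd M 0 1 x X * M.T 0 1 (x k) := by
  induction X using induction_on_max with
  | empty => simp [opProd]
  | insert m X hm ih =>
    have hkm : k ≠ m := fun e => hk (e ▸ mem_insert_self _ _)
    have hkX : k ∉ X := fun e => hk (mem_insert_of_mem e)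
    rcases lt_or_gt_of_ne hkm with h | h
    · rw [insert_comm, opProd_insert_max M x 0 1 (X := insert k X), ih hkX,
        opProd_insert_max M x 0 1 hm, mul_assoc, mul_assoc, T01_comm]
      · intro e
        exact hkm (hx (by simp) (by simp) e)
      · exact hx.mono (by intro i; simp; tauto)
      · intro i hi
        rcases mem_insert.1 hi with rfl | hi
        exacts [h, hm i hi]
    · refine opProd_insert_max M x 0 1 fun i hi => ?_
      rcases mem_insert.1 hi with rfl | hi
      exacts [h, (hm i hi).trans h]

lemma symT3_insert (hc : c ≠ 0) (j : Fin 3) (hj : j ≠ 2) {X : Finset (Fin a)} {k : Fin a}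
    (hk : k ∉ X) (hx : Set.InjOn x (insert k X : Finset (Fin a)))
    (hh : ∀ i ∈ X, h c (x i) (x k) ≠ 0 ∧ h c (x k) (x i) ≠ 0) : symT3 M j x (insert k X) =
      (∏ i ∈ X, h c (x k) (x i))⁻¹ • (symT3 M j x X * M.T j 2 (x k)) := by
  induction X using induction_on_max with
  | empty => rw [symT3_insert_max M x _ (by simp)]
  | insert m X hm ih =>
    have hkm : k ≠ m := fun e => hk (e ▸ mem_insert_self _ _)
    have hkX : k ∉ X := fun e => hk (mem_insert_of_mem e)
    rcases lt_or_gt_of_ne hkm with h' | h'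
    · have hmX : m ∉ X := fun e => lt_irrefl _ (hm m e)
      have hm' : ∀ i ∈ insert k X, i < m := by
        intro i hi
        rcases mem_insert.1 hi with rfl | hi
        exacts [h', hm i hi]
      have hne : x k ≠ x m := fun e => hkm (hx (by simp) (by simp) e)
      rw [insert_comm, symT3_insert_max M x _ hm', ih hkX, symT3_insert_max M x _ hm,
        prod_insert hkX, prod_insert hmX]
      · have h1 := Tj2_swap M hc j hj hne
        obtain ⟨h2, h3⟩ := hh m (mem_insert_self _ _)
        have h4 : (h c (x m) (x k))⁻¹ • (M.T j 2 (x k) * M.T j 2 (x m)) =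
            (h c (x k) (x m))⁻¹ • (M.T j 2 (x m) * M.T j 2 (x k)) := by
          rw [inv_smul_eq_iff₀ h2, smul_comm, eq_inv_smul_iff₀ h3, h1]
        simp only [smul_mul_assoc, smul_smul, mul_assoc, mul_inv]
        have h5 := congrArg (fun Z => ((∏ i ∈ X, h c (x m) (x i))⁻¹ *
          (∏ i ∈ X, h c (x k) (x i))⁻¹) • (symT3 M j x X * Z)) h4
        simp only [mul_smul_comm, smul_smul] at h5
        convert h5 using 2 <;> ring
      · exact hx.mono (by intro i; simp; tauto)
      · exact fun i hi => hh i (mem_insert_of_mem hi)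
    · refine symT3_insert_max M x _ fun i hi => ?_
      rcases mem_insert.1 hi with rfl | hi
      exacts [h', (hm i hi).trans h']

lemma symT3_insert_left (hc : c ≠ 0) (j : Fin 3) (hj : j ≠ 2) {X : Finset (Fin a)} {k : Fin a}
    (hk : k ∉ X) (hx : Set.InjOn x (insert k X : Finset (Fin a)))
    (hh : ∀ i ∈ insert k X, ∀ l ∈ insert k X, h c (x i) (x l) ≠ 0) : symT3 M j x (insert k X) =
      (∏ i ∈ X, h c (x i) (x k))⁻¹ • (M.T j 2 (x k) * symT3 M j x X) := by
  induction X using induction_on_max with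
  | empty => rw [symT3_insert_max M x _ (by simp)]; simp
  | insert m X hm ih =>
    have hkm : k ≠ m := fun e => hk (e ▸ mem_insert_self _ _)
    have hkX : k ∉ X := fun e => hk (mem_insert_of_mem e)
    have hmX : m ∉ X := fun e => lt_irrefl _ (hm m e)
    have hmk : m ∉ insert k X := by simp [hkm.symm, hmX]
    rw [insert_comm, symT3_insert M x hc j hj hmk, ih hkX, symT3_insert_max M x _ hm,
      prod_insert hkX, prod_insert hmX]
    · simp only [smul_mul_assoc, mul_smul_comm, smul_smul, mul_assoc, mul_inv]
      congr 1
      ring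
    · exact hx.mono (by intro i; simp; tauto)
    · intro i hi l hl
      refine hh i ?_ l ?_ <;> simp at hi hl ⊢ <;> tauto
    · exact hx.mono (by intro i; simp; tauto)
    · intro i hi
      constructor <;> apply hh <;> simp at hi ⊢ <;> tauto

end Products

/-! ### Identities from partial fractions -/

section PartialFractions

open Polynomial in
lemma eval_eq_sum_nodes {ι : Type*} [DecidableEq ι] (s : Finset ι) (x : ι → ℂ)
    (hx : Set.InjOn x s) (p : ℂ[X]) (hp : p.degree < s.card) (y : ℂ) :
    p.eval y = ∑ k ∈ s, p.eval (x k) * ∏ i ∈ s.erase k, ((y - x i) / (x k - x i)) := by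
  have h := Lagrange.eq_interpolate_of_eval_eq (fun k => p.eval (x k)) hx hp (fun _ _ => rfl)
  conv_lhs => rw [h]
  rw [Lagrange.interpolate_apply, eval_finsetSum]
  refine sum_congr rfl fun k _ => ?_
  rw [eval_mul, eval_C, Lagrange.basis, eval_prod]
  congr 1
  refine prod_congr rfl fun i _ => ?_
  simp [Lagrange.basisDivisor, div_eq_inv_mul]

variable {c : ℂ} {ι κ : Type*}

open Polynomial in
lemma natDegree_prod_C_sub_X_le (s : Finset ι) (x : ι → ℂ) :
    (∏ i ∈ s, (C (x i) - X) : ℂ[X]).natDegree ≤ s.card :=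
  (natDegree_prod_le _ _).trans
    ((sum_le_card_nsmul _ _ 1 fun i _ => by compute_degree).trans (by simp))

open Polynomial in
lemma sum_g_mul_prod [DecidableEq ι] (hc : c ≠ 0) (s : Finset ι) (r : Finset κ) (x : ι → ℂ) (v : κ → ℂ) (y : ℂ)
    (hx : Set.InjOn x s) (hcard : s.card = r.card) (hxy : ∀ i ∈ s, x i ≠ y)
    (hvy : ∀ j ∈ r, v j ≠ y) (hvx : ∀ j ∈ r, ∀ i ∈ s, v j ≠ x i) :
    ∑ k ∈ s, g c (x k) y * (∏ i ∈ s.erase k, g c (x i) (x k) * h c (x i) y) *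
        ∏ j ∈ r, g c (v j) y / g c (v j) (x k) = ∏ i ∈ s, f c (x i) y - ∏ j ∈ r, f c (v j) y := by
  set η := I * c with hη
  have hη0 : η ≠ 0 := ic_ne_zero hc
  rcases s.eq_empty_or_nonempty with rfl | hs
  · have : r = ∅ := by simpa using hcard.symm
    simp [this]
  set C0 : ℂ := (∏ j ∈ r, (v j - y)) / ∏ i ∈ s, (x i - y) with hC0
  have hpx : ∏ i ∈ s, (x i - y) ≠ 0 := prod_ne_zero_iff.2 fun i hi => sub_ne_zero.2 (hxy i hi)
  have hpv : ∏ j ∈ r, (v j - y) ≠ 0 := prod_ne_zero_iff.2 fun j hj => sub_ne_zero.2 (hvy j hj)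
  set Q : ℂ[X] := ∏ j ∈ r, (C (v j) - X) - C C0 * ∏ i ∈ s, (C (x i) - X) with hQ
  have hQev : ∀ z, Q.eval z = ∏ j ∈ r, (v j - z) - C0 * ∏ i ∈ s, (x i - z) := by
    intro z
    simp [hQ, eval_prod]
  have hroot : Q.IsRoot y := by rw [IsRoot, hQev, hC0, div_mul_cancel₀ _ hpx, sub_self]
  have hQ1 := mul_divByMonic_eq_iff_isRoot.2 hroot
  set Q1 := Q /ₘ (X - C y) with hQ1d
  have hdegQ : Q.natDegree ≤ s.card := by
    exact (natDegree_sub_le _ _).trans (max_le (hcard ▸ natDegree_prod_C_sub_X_le r v)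
      ((natDegree_C_mul_le _ _).trans (natDegree_prod_C_sub_X_le s x)))
  have hdeg : Q1.degree < s.card := by
    refine degree_lt_iff_coeff_zero _ _ |>.2 fun m hm => ?_
    refine coeff_eq_zero_of_natDegree_lt ?_
    have h1 : Q1.natDegree = Q.natDegree - 1 := by
      rw [hQ1d, natDegree_divByMonic _ (monic_X_sub_C y), natDegree_X_sub_C]
    have h2 := hs.card_pos
    omega
  have hev : ∀ z, (z - y) * Q1.eval z = Q.eval z := by
    intro z
    rw [← hQ1]
    simp
  have key := eval_eq_sum_nodes s x hx Q1 hdeg (y - η)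
  have e1 : Q1.eval (y - η) = -(∏ j ∈ r, (v j - y + η) - C0 * ∏ i ∈ s, (x i - y + η)) / η := by
    have := hev (y - η)
    rw [hQev] at this
    rw [eq_div_iff hη0]
    simp only [sub_sub_eq_add_sub, add_sub_right_comm] at this ⊢
    linear_combination -this
  have e2 : ∀ k ∈ s, Q1.eval (x k) = (∏ j ∈ r, (v j - x k)) / (x k - y) := by
    intro k hk
    have := hev (x k)
    rw [hQev, prod_eq_zero (f := fun i => x i - x k) hk (sub_self _), mul_zero, sub_zero] at this
    rw [eq_div_iff (sub_ne_zero.2 (hxy k hk)), ← this, mul_comm]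
  have e3 : ∏ i ∈ s, f c (x i) y - ∏ j ∈ r, f c (v j) y =
      η / (∏ j ∈ r, (v j - y)) * Q1.eval (y - η) := by
    rw [e1]
    simp only [f, prod_div_distrib, ← hη, hC0]
    field_simp
    ring
  rw [e3, key, mul_sum]
  refine sum_congr rfl fun k hk => ?_
  rw [e2 k hk]
  have e4 : ∏ i ∈ s.erase k, g c (x i) (x k) * h c (x i) y =
      ∏ i ∈ s.erase k, ((y - η - x i) / (x k - x i)) := by
    refine prod_congr rfl fun i hi => ?_
    have hne : x i - x k ≠ 0 := sub_ne_zero.2 fun e =>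
      (mem_erase.1 hi).1 (hx (mem_of_mem_erase hi) hk e)
    have hne' : x k - x i ≠ 0 := fun e => hne (by linear_combination -e)
    simp only [g, h, ← hη]
    field_simp
    ring
  have e5 : ∏ j ∈ r, g c (v j) y / g c (v j) (x k) =
      (∏ j ∈ r, (v j - x k)) / ∏ j ∈ r, (v j - y) := by
    rw [← prod_div_distrib]
    refine prod_congr rfl fun j hj => ?_
    have h1 := sub_ne_zero.2 (hvy j hj)
    have h2 := sub_ne_zero.2 (hvx j hj k hk)
    simp only [g, ← hη]
    field_simp
  rw [e4, e5]
  have h1 := sub_ne_zero.2 (hxy k hk)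
  simp only [g, ← hη]
  ring

open Polynomial in
lemma sum_prod_g_mul_f [DecidableEq κ] (hc : c ≠ 0) (s : Finset ι) (r : Finset κ) (x : ι → ℂ) (v : κ → ℂ) (y : ℂ)
    (hv : Set.InjOn v r) (hcard : s.card + 1 = r.card)
    (hvy : ∀ j ∈ r, v j ≠ y) (hvx : ∀ j ∈ r, ∀ i ∈ s, v j ≠ x i) :
    ∑ j ∈ r, g c (v j) y * (∏ l ∈ r.erase j, g c (v j) (v l) * f c (v l) y *
        ∏ i ∈ s, g c (v l) (x i)) =
      (∏ j ∈ r, g c (v j) y * ∏ i ∈ s, g c (v j) (x i)) * ∏ i ∈ s, h c (x i) y := by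
  set η := I * c with hη
  have hη0 : η ≠ 0 := ic_ne_zero hc
  set Q : ℂ[X] := ∏ i ∈ s, (C (x i) - X) with hQ
  have hQev : ∀ z, Q.eval z = ∏ i ∈ s, (x i - z) := by
    intro z
    simp [hQ, eval_prod]
  have hdeg : Q.degree < r.card := by
    refine degree_lt_iff_coeff_zero _ _ |>.2 fun m hm => ?_
    refine coeff_eq_zero_of_natDegree_lt ?_
    have : Q.natDegree ≤ s.card := natDegree_prod_C_sub_X_le s x
    omega
  have key := eval_eq_sum_nodes r v hv Q hdeg (y - η)
  have e1 : ∏ i ∈ s, h c (x i) y = Q.eval (y - η) / η ^ s.card := by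
    rw [hQev, ← prod_const, ← prod_div_distrib]
    refine prod_congr rfl fun i _ => ?_
    simp only [h, ← hη]
    ring
  rw [e1, key, sum_div, mul_sum]
  refine sum_congr rfl fun j hj => ?_
  rw [hQev, ← mul_prod_erase _ _ hj]
  have e2 : (∏ i ∈ s, g c (v j) (x i)) * ∏ i ∈ s, (x i - v j) = (-η) ^ s.card := by
    rw [← prod_mul_distrib, ← prod_const]
    refine prod_congr rfl fun i hi => ?_
    have := sub_ne_zero.2 (hvx j hj i hi)
    simp only [g, ← hη]
    field_simp
    ring
  have e3 : ∏ l ∈ r.erase j, g c (v j) (v l) * f c (v l) y * ∏ i ∈ s, g c (v l) (x i) =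
      (∏ l ∈ r.erase j, g c (v l) y * ∏ i ∈ s, g c (v l) (x i)) *
        ((-1) ^ s.card * ∏ l ∈ r.erase j, ((y - η - v l) / (v j - v l))) := by
    have hcr : (r.erase j).card = s.card := by rw [card_erase_of_mem hj]; omega
    rw [← hcr, ← prod_const, ← prod_mul_distrib, ← prod_mul_distrib]
    refine prod_congr rfl fun l hl => ?_
    have h1 := sub_ne_zero.2 (hvy l (mem_of_mem_erase hl))
    have h2 : v j - v l ≠ 0 := sub_ne_zero.2 fun e =>
      (mem_erase.1 hl).1 (hv (mem_of_mem_erase hl) hj e.symm)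
    simp only [g, f, ← hη]
    field_simp
    ring
  rw [e3]
  have hη1 : η ^ s.card ≠ 0 := pow_ne_zero _ hη0
  rw [eq_comm]
  have e4 : (-η) ^ s.card = (-1) ^ s.card * η ^ s.card := by rw [← mul_pow]; simp
  rw [e4] at e2
  set P1 := ∏ l ∈ r.erase j, g c (v l) y * ∏ i ∈ s, g c (v l) (x i)
  set P2 := ∏ l ∈ r.erase j, ((y - η - v l) / (v j - v l))
  rw [mul_div_assoc', div_eq_iff hη1]
  linear_combination (g c (v j) y * P1 * P2) * e2

end PartialFractions

lemma sum_powerset_sdiff {α E : Type*} [DecidableEq α] [AddCommMonoid E] (A : Finset α)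
    (F : Finset α → α → E) :
    ∑ I ∈ A.powerset, ∑ i ∈ A \ I, F I i = ∑ I ∈ A.powerset, ∑ i ∈ I, F (I.erase i) i := by
  rw [sum_sigma', sum_sigma']
  refine sum_bij' (fun p _ => ⟨insert p.2 p.1, p.2⟩) (fun p _ => ⟨p.1.erase p.2, p.2⟩)
    ?_ ?_ ?_ ?_ ?_ <;> rintro ⟨I, i⟩ hp <;>
    simp only [mem_sigma, mem_powerset, Finset.mem_sdiff] at hp ⊢ <;>
  first | grind | simp [erase_insert hp.2.2] | simp [insert_erase hp.2]

section Prod2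

variable {a b : ℕ} (F : ℂ → ℂ → ℂ) (x : Pts a) (y : Pts b)

lemma prod2_insert_left {X : Finset (Fin a)} {k : Fin a} (hk : k ∉ X) (Y : Finset (Fin b)) :
    prod2 F x (insert k X) y Y = (∏ j ∈ Y, F (x k) (y j)) * prod2 F x X y Y := by
  simp [prod2, prod_insert hk]

lemma prod2_insert_right {Y : Finset (Fin b)} {k : Fin b} (hk : k ∉ Y) (X : Finset (Fin a)) :
    prod2 F x X y (insert k Y) = (∏ i ∈ X, F (x i) (y k)) * prod2 F x X y Y := by
  simp [prod2, prod_insert hk, prod_mul_distrib]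

end Prod2

/-! ### Peeling off a rapidity `u` -/

/-- The points of `X` are distinct and no factor `h` between them vanishes. -/
structure Admissible (c : ℂ) {a : ℕ} (x : Pts a) (X : Finset (Fin a)) : Prop where
  inj : Set.InjOn x X
  h_ne : ∀ i ∈ X, ∀ l ∈ X, h c (x i) (x l) ≠ 0

lemma Admissible.mono {c : ℂ} {a : ℕ} {x : Pts a} {X Y : Finset (Fin a)}
    (hY : Admissible c x Y) (hXY : X ⊆ Y) : Admissible c x X :=
  ⟨hY.inj.mono (by exact_mod_cast hXY), fun i hi l hl => hY.h_ne i (hXY hi) l (hXY hl)⟩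

lemma ne_of_injOn_insert {a : ℕ} {x : Pts a} {X : Finset (Fin a)} {k : Fin a} (hk : k ∉ X)
    (hx : Set.InjOn x (insert k X : Finset (Fin a))) : ∀ i ∈ X, x i ≠ x k := by
  intro i hi e
  exact hk (hx (mem_coe.2 (mem_insert_of_mem hi)) (mem_coe.2 (mem_insert_self k X)) e ▸ hi)

lemma prod_f_eq {c : ℂ} (hc : c ≠ 0) {a : ℕ} (X : Finset (Fin a)) {x y : Pts a} :
    ∏ l ∈ X, f c (x l) (y l) = (∏ l ∈ X, g c (x l) (y l)) * ∏ l ∈ X, h c (x l) (y l) := by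
  rw [← prod_mul_distrib]
  exact prod_congr rfl fun l _ => (g_mul_h hc _ _).symm

section PeelU

variable {c : ℂ} (M : Model.{uM} c) {a b : ℕ} {u : Pts a} {v : Pts b}

lemma opProd01_insert_left {X : Finset (Fin a)} {k : Fin a} (hk : k ∉ X)
    (hx : Set.InjOn u (insert k X : Finset (Fin a))) :
    opProd M 0 1 u (insert k X) = M.T 0 1 (u k) * opProd M 0 1 u X := by
  rw [opProd01_insert M u hk hx]
  have := ne_of_injOn_insert hk hx
  clear hx hk
  simp only [opProd]
  have h2 : ∀ L : List (Fin a), (∀ l ∈ L, u l ≠ u k) →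
      (L.map fun l => M.T 0 1 (u l)).prod * M.T 0 1 (u k) =
        M.T 0 1 (u k) * (L.map fun l => M.T 0 1 (u l)).prod := by
    intro L hL
    induction L with
    | nil => simp
    | cons l L ih =>
      simp only [List.mem_cons, forall_eq_or_imp] at hL
      rw [List.map_cons, List.prod_cons, mul_assoc, ih hL.2, ← mul_assoc, T01_comm M hL.1,
        mul_assoc]
  exact h2 _ fun l hl => this l ((mem_sort _).1 hl)

lemma opProd01_mul_T02 {X : Finset (Fin a)} {y : ℂ} (hx : Set.InjOn u X) (hy : ∀ i ∈ X, u i ≠ y) :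
    opProd M 0 1 u X * M.T 0 2 y = (∏ i ∈ X, f c y (u i)) • (M.T 0 2 y * opProd M 0 1 u X) +
      ∑ i ∈ X, (g c (u i) y * ∏ l ∈ X.erase i, f c (u i) (u l)) •
        (M.T 0 2 (u i) * opProd M 0 1 u (X.erase i) * M.T 0 1 y) := by
  induction X using Finset.induction_on generalizing y with
  | empty => simp
  | insert k X hk ih =>
    have hxX : Set.InjOn u X := hx.mono (by simp)
    have hky : u k ≠ y := hy k (by simp)
    have hne := ne_of_injOn_insert hk hx
    have hyX : ∀ i ∈ X, u i ≠ y := fun i hi => hy i (by simp [hi])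
    rw [opProd01_insert M u hk hx, mul_assoc, T01_mul_T02 M hky, prod_insert hk,
      sum_insert hk, erase_insert hk, mul_add, mul_smul_comm, mul_smul_comm,
      ← mul_assoc, ← mul_assoc, ih hxX hyX, ih hxX hne]
    have e1 : ∀ i ∈ X, (g c (u i) y * ∏ l ∈ (insert k X).erase i, f c (u i) (u l)) •
        (M.T 0 2 (u i) * opProd M 0 1 u ((insert k X).erase i) * M.T 0 1 y) =
        ((f c y (u k) * g c (u i) y + g c (u k) y * g c (u i) (u k)) *
          ∏ l ∈ X.erase i, f c (u i) (u l)) •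
          (M.T 0 2 (u i) * opProd M 0 1 u (X.erase i) * M.T 0 1 (u k) * M.T 0 1 y) := by
      intro i hi
      have hik : k ≠ i := by rintro rfl; exact hk hi
      have hk' : k ∉ X.erase i := fun e => hk (mem_of_mem_erase e)
      rw [erase_insert_of_ne hik, prod_insert hk', opProd01_insert M u hk',
        ← mul_assoc (M.T 0 2 (u i))]
      · congr 1
        have h3 := g_three (c := c) (hne i hi) hky (hyX i hi).symm
        rw [f_eq (hne i hi), f_eq hky.symm]
        rw [g_swap c (u i) y] at h3
        rw [g_swap c (u k) y]
        linear_combination -(∏ l ∈ X.erase i, f c (u i) (u l)) * h3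
      · refine hx.mono fun z => ?_
        simp only [coe_insert, Set.mem_insert_iff, coe_erase]
        exact fun h => h.imp_right And.left
    rw [sum_congr rfl e1]
    simp only [add_mul, add_smul, sum_add_distrib, smul_add, sum_mul,
      smul_sum, smul_smul, smul_mul_assoc, mul_assoc]
    simp only [T01_comm M hky.symm]
    abel

/-- The sum over the partitions of `ū_A` that enters the Bethe vector, for a given part `v̄_V`. -/
def partSum (u : Pts a) (v : Pts b) (A : Finset (Fin a)) (V : Finset (Fin b)) : Module.End ℂ M.H :=
  ∑ I ∈ A.powerset, if V.card = I.card then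
    (prod2 (g c) v V u I * prod2 (f c) u I u (A \ I) * prod2 (h c) u I u I) •
      (symT3 M 0 u I * opProd M 0 1 u (A \ I)) else 0

lemma partSum_insert (hc : c ≠ 0) {A : Finset (Fin a)} {V : Finset (Fin b)} {k : Fin a}
    (hk : k ∉ A) (hu : Admissible c u (insert k A)) (hv : Set.InjOn v V)
    (huv : ∀ j ∈ V, ∀ i ∈ insert k A, v j ≠ u i) : partSum M u v (insert k A) V =
      (∏ j ∈ V, f c (v j) (u k)) • (partSum M u v A V * M.T 0 1 (u k)) +
        ∑ j ∈ V, (g c (v j) (u k) * (∏ l ∈ V.erase j, g c (v j) (v l) * f c (v l) (u k))) •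
          (partSum M u v A (V.erase j) * M.T 0 2 (u k)) := by
  have huk := ne_of_injOn_insert hk hu.inj
  have huA : Set.InjOn u A := hu.inj.mono (by simp)
  have hvk : ∀ j ∈ V, v j ≠ u k := fun j hj => huv j hj k (by simp)
  set y := u k with hy
  set co : Finset (Fin a) → ℂ := fun I => prod2 (g c) v V u I * prod2 (f c) u I u (A \ I) *
    prod2 (h c) u I u I with hco
  set P : Finset (Fin a) → Module.End ℂ M.H := fun I => symT3 M 0 u I * opProd M 0 1 u (A \ I) with hP
  -- the parts that do not contain `k`
  have e1 : ∀ I ∈ A.powerset, (if V.card = I.card then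
      (prod2 (g c) v V u I * prod2 (f c) u I u (insert k A \ I) * prod2 (h c) u I u I) •
        (symT3 M 0 u I * opProd M 0 1 u (insert k A \ I)) else 0) =
      if V.card = I.card then (co I * ∏ i ∈ I, f c (u i) y) • (P I * M.T 0 1 y) else 0 := by
    intro I hI
    have hIA := mem_powerset.1 hI
    have hkI : k ∉ I := fun e => hk (hIA e)
    have hkAI : k ∉ A \ I := fun e => hk (sdiff_subset e)
    refine if_congr Iff.rfl ?_ rfl
    rw [insert_sdiff_of_notMem _ hkI, prod2_insert_right _ _ _ hkAI,
      opProd01_insert M u hkAI, ← mul_assoc]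
    · congr 1
      simp only [hco]
      ring
    · refine hu.inj.mono fun z => ?_
      simp only [coe_insert, Set.mem_insert_iff, coe_sdiff]
      exact fun h => h.imp_right And.left
  -- the parts that contain `k`
  have e2 : ∀ I ∈ A.powerset, (if V.card = (insert k I).card then
      (prod2 (g c) v V u (insert k I) * prod2 (f c) u (insert k I) u (insert k A \ insert k I) *
        prod2 (h c) u (insert k I) u (insert k I)) •
        (symT3 M 0 u (insert k I) * opProd M 0 1 u (insert k A \ insert k I)) else 0) =
      (if V.card = I.card + 1 then (co I * (∏ j ∈ V, g c (v j) y) * ∏ i ∈ I, h c (u i) y) •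
        (P I * M.T 0 2 y) else 0) -
      ∑ i ∈ A \ I, if V.card = I.card + 1 then
        (co (insert i I) * (g c (u i) y * (∏ l ∈ I, g c (u l) (u i) * h c (u l) y) *
          ∏ j ∈ V, g c (v j) y / g c (v j) (u i))) •
        (P (insert i I) * M.T 0 1 y) else 0 := by
    intro I hI
    have hIA := mem_powerset.1 hI
    have hkI : k ∉ I := fun e => hk (hIA e)
    have hkAI : k ∉ A \ I := fun e => hk (sdiff_subset e)
    have hAI : insert k A \ insert k I = A \ I := by
      rw [insert_sdiff_insert, sdiff_insert_of_notMem hk]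
    rw [card_insert_of_notMem hkI]
    split_ifs with hcard
    swap
    · simp
    have hT : ∀ z ∈ insert k A, z ∉ I → (∏ i ∈ I, h c (u z) (u i) ≠ 0) ∧ symT3 M 0 u (insert z I) =
          (∏ i ∈ I, h c (u z) (u i))⁻¹ • (symT3 M 0 u I * M.T 0 2 (u z)) := fun z hz hzI => by
      have hI := fun i hi => (mem_insert_of_mem (hIA hi) : i ∈ insert k A)
      refine ⟨prod_ne_zero_iff.2 fun i hi => hu.h_ne _ hz _ (hI i hi), symT3_insert M u hc 0
        (by decide) hzI (hu.mono (insert_subset hz hI)).inj fun i hi => ⟨hu.h_ne _ ?_ _ ?_, hu.h_ne _ ?_ _ ?_⟩⟩ <;>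
      first | exact hz | exact hI i hi
    obtain ⟨hPh, hTk⟩ := hT k (mem_insert_self k A) hkI
    rw [← hy] at hPh hTk
    have hX := opProd01_mul_T02 M (X := A \ I) (y := y) (huA.mono (by simp)) fun i hi =>
      huk i (sdiff_subset hi)
    replace hX := eq_sub_of_add_eq hX.symm
    rw [hAI, hTk, smul_mul_assoc, smul_smul, mul_assoc (symT3 M 0 u I)]
    have e3 : prod2 (g c) v V u (insert k I) * prod2 (f c) u (insert k I) u (A \ I) *
        prod2 (h c) u (insert k I) u (insert k I) * (∏ i ∈ I, h c y (u i))⁻¹ =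
        (co I * (∏ j ∈ V, g c (v j) y) * ∏ i ∈ I, h c (u i) y) * ∏ i ∈ A \ I, f c y (u i) := by
      rw [prod2_insert_right _ _ _ hkI, prod2_insert_left _ _ _ hkI, prod2_insert_left _ _ _ hkI,
        prod2_insert_right _ _ _ hkI, prod_insert hkI, ← hy, h_self hc]
      simp only [hco]
      field_simp
    rw [e3, mul_smul, ← mul_smul_comm, hX, mul_sub, smul_sub, ← mul_assoc, mul_sum, smul_sum]
    congr 1
    refine sum_congr rfl fun i hi => ?_
    obtain ⟨hiA, hiI⟩ := Finset.mem_sdiff.1 hi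
    obtain ⟨hPi, hTi⟩ := hT i (mem_insert_of_mem hiA) hiI
    have hAi : (A \ I).erase i = A \ insert i I := by rw [sdiff_insert]
    simp only [hP]
    rw [hTi, hAi, mul_smul_comm, smul_smul, smul_mul_assoc, smul_mul_assoc, smul_smul]
    simp only [mul_assoc]
    congr 1
    have hiAI : i ∉ A \ insert i I := by simp
    have hins : A \ I = insert i (A \ insert i I) := by rw [← hAi, insert_erase hi]
    have hgv : ∏ j ∈ V, g c (v j) (u i) ≠ 0 := prod_ne_zero_iff.2 fun j hj =>
      g_ne_zero hc (huv j hj i (by simp [hiA]))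
    simp only [hco]
    rw [prod2_insert_right _ _ _ hiI, prod2_insert_left _ _ _ hiI, prod2_insert_left _ _ _ hiI,
      prod2_insert_right _ _ _ hiI, prod_insert hiI, h_self hc, hins,
      prod2_insert_right _ _ _ hiAI, prod_f_eq hc I, prod_div_distrib, prod_mul_distrib]
    field_simp
  rw [partSum, sum_powerset_insert hk, sum_congr rfl e1, sum_congr rfl e2,
    sum_sub_distrib, sum_powerset_sdiff]
  -- collect the terms with `T_{12}(y)`
  have e4 : ∀ I ∈ A.powerset, ∑ i ∈ I, (if V.card = (I.erase i).card + 1 then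
        (co (insert i (I.erase i)) * (g c (u i) y * (∏ l ∈ I.erase i, g c (u l) (u i) * h c (u l) y) *
          ∏ j ∈ V, g c (v j) y / g c (v j) (u i))) •
        (P (insert i (I.erase i)) * M.T 0 1 y) else 0) =
      if V.card = I.card then (co I * (∏ i ∈ I, f c (u i) y - ∏ j ∈ V, f c (v j) y)) •
        (P I * M.T 0 1 y) else 0 := by
    intro I hI
    have hIA := mem_powerset.1 hI
    split_ifs with hcard
    · rw [← sum_g_mul_prod hc I V u v y (huA.mono (by exact_mod_cast hIA)) hcard.symm
        (fun i hi => huk i (hIA hi)) hvk fun j hj i hi => huv j hj i (by simp [hIA hi]),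
        mul_sum, sum_smul]
      refine sum_congr rfl fun i hi => ?_
      rw [insert_erase hi, card_erase_add_one hi, if_pos hcard]
    · exact sum_eq_zero fun i hi => if_neg (by rwa [card_erase_add_one hi])
  have e5 : ∀ I ∈ A.powerset, (if V.card = I.card + 1 then
        (co I * (∏ j ∈ V, g c (v j) y) * ∏ i ∈ I, h c (u i) y) • (P I * M.T 0 2 y) else 0) =
      ∑ j ∈ V, (g c (v j) y * ∏ l ∈ V.erase j, g c (v j) (v l) * f c (v l) y) •
        ((if (V.erase j).card = I.card then
          (prod2 (g c) v (V.erase j) u I * prod2 (f c) u I u (A \ I) * prod2 (h c) u I u I) • P I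
            else 0) * M.T 0 2 y) := by
    intro I hI
    have hIA := mem_powerset.1 hI
    split_ifs with hcard
    · have key := sum_prod_g_mul_f hc I V u v y hv hcard.symm hvk
        fun j hj i hi => huv j hj i (by simp [hIA hi])
      have e6 : co I * (∏ j ∈ V, g c (v j) y) * ∏ i ∈ I, h c (u i) y =
          prod2 (f c) u I u (A \ I) * prod2 (h c) u I u I *
          ((∏ j ∈ V, g c (v j) y * ∏ i ∈ I, g c (v j) (u i)) * ∏ i ∈ I, h c (u i) y) := by
        simp only [hco, prod_mul_distrib, prod2]
        ring
      rw [e6, ← key, mul_sum, sum_smul]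
      refine sum_congr rfl fun j hj => ?_
      have : (V.erase j).card = I.card := by have := card_erase_add_one hj; omega
      rw [if_pos this, smul_mul_assoc, smul_smul]
      congr 1
      simp only [prod_mul_distrib, prod2]
      ring
    · refine (sum_eq_zero fun j hj => ?_).symm
      have := card_erase_add_one hj
      rw [if_neg (by omega), zero_mul, smul_zero]
  rw [sum_congr rfl e4, sum_congr rfl e5, sum_comm]
  have e7 : ∀ I ∈ A.powerset, (if V.card = I.card then (co I * ∏ i ∈ I, f c (u i) y) •
        (P I * M.T 0 1 y) else 0) =
      (if V.card = I.card then (co I * (∏ i ∈ I, f c (u i) y - ∏ j ∈ V, f c (v j) y)) •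
        (P I * M.T 0 1 y) else 0) +
      (∏ j ∈ V, f c (v j) y) • ((if V.card = I.card then co I • P I else 0) * M.T 0 1 y) := by
    intro I _
    split_ifs
    · rw [smul_mul_assoc, smul_smul, ← add_smul]
      congr 1
      ring
    · simp
  rw [sum_congr rfl e7, sum_add_distrib, ← smul_sum, ← sum_mul]
  simp only [← smul_sum, ← sum_mul]
  simp only [partSum, hco, hP]
  abel

end PeelU

section VPart

variable {c : ℂ} (M : Model.{uM} c) {b : ℕ} {v : Pts b}

/-- `𝕋_{23}(v̄_X)|0⟩ / λ₂(v̄_X)`. -/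
def tVec (v : Pts b) (X : Finset (Fin b)) : M.H := (∏ j ∈ X, M.lam 1 (v j))⁻¹ • symT3 M 1 v X M.vac

/-- `T_{12}(y)` moved to the left of `𝕋_{23}(v̄_X)`, together with the correction terms
that produce a Bethe vector. -/
def eVec (v : Pts b) (y : ℂ) (X : Finset (Fin b)) : M.H :=
  M.T 0 1 y (tVec M v X) + ∑ j ∈ X, (g c (v j) y * ∏ l ∈ X.erase j, g c (v l) (v j)) •
    M.T 0 2 y (tVec M v (X.erase j))

variable {M}

lemma tVec_insert (hc : c ≠ 0) {X : Finset (Fin b)} {k : Fin b} (hk : k ∉ X)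
    (hv : Admissible c v (insert k X)) (hl : M.lam 1 (v k) ≠ 0) : M.T 1 2 (v k) (tVec M v X) =
      (M.lam 1 (v k) * ∏ i ∈ X, h c (v i) (v k)) • tVec M v (insert k X) := by
  have h1 : ∏ i ∈ X, h c (v i) (v k) ≠ 0 := prod_ne_zero_iff.2 fun i hi =>
    hv.h_ne _ (by simp [hi]) _ (by simp)
  have h2 := symT3_insert_left M v hc 1 (by decide) hk hv.inj hv.h_ne
  rw [tVec, tVec, h2, prod_insert hk, map_smul, lsmul_apply, mul_apply, smul_smul, smul_smul]
  congr 1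
  field_simp

lemma erase_insert_admissible {X : Finset (Fin b)} {k j : Fin b}
    (hv : Admissible c v (insert k X)) : Admissible c v (insert k (X.erase j)) :=
  hv.mono (insert_subset_insert _ (erase_subset _ _))

lemma Admissible.mul_prod_h_ne {X : Finset (Fin b)} {k : Fin b} {z : ℂ}
    (hv : Admissible c v (insert k X)) (hz : z ≠ 0) : z * ∏ i ∈ X, h c (v i) (v k) ≠ 0 :=
  mul_ne_zero hz (prod_ne_zero_iff.2 fun i hi => hv.h_ne _ (by simp [hi]) _ (by simp))

lemma tVec_insert_erase (hc : c ≠ 0) {X : Finset (Fin b)} {k j : Fin b} (hk : k ∉ X)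
    (hv : Admissible c v (insert k X)) (hl : M.lam 1 (v k) ≠ 0) (hj : j ∈ X) :
    (∏ l ∈ (insert k X).erase j, g c (v l) (v j)) • tVec M v ((insert k X).erase j) =
      (M.lam 1 (v k) * ∏ i ∈ X, h c (v i) (v k))⁻¹ • (∏ l ∈ X.erase j, g c (v l) (v j)) •
        (g c (v k) (v j) * h c (v j) (v k)) • M.T 1 2 (v k) (tVec M v (X.erase j)) := by
  have hkj : k ≠ j := by rintro rfl; exact hk hj
  have hk' : k ∉ X.erase j := fun e => hk (mem_of_mem_erase e)
  have hX := hv.mul_prod_h_ne hl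
  rw [← mul_prod_erase _ _ hj] at hX ⊢
  rw [erase_insert_of_ne hkj, prod_insert hk', tVec_insert hc hk' (erase_insert_admissible hv) hl]
  simp only [smul_smul]
  congr 1
  simp only [mul_ne_zero_iff] at hX
  obtain ⟨-, h2, h3⟩ := hX
  field_simp

lemma T11_tVec (hc : c ≠ 0) {X : Finset (Fin b)} (hv : Admissible c v X)
    (hl : ∀ j ∈ X, M.lam 1 (v j) ≠ 0) {z : ℂ} (hz : ∀ j ∈ X, z ≠ v j) :
    M.T 1 1 z (tVec M v X) = (M.lam 1 z * ∏ j ∈ X, f c (v j) z) • tVec M v X +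
      ∑ j ∈ X, (g c z (v j) * ∏ l ∈ X.erase j, g c (v l) (v j)) •
        M.T 1 2 z (tVec M v (X.erase j)) := by
  induction X using Finset.induction_on generalizing z with
  | empty => simp [tVec, M.T_diag_vac]
  | insert k X hk ih =>
    have hvX := hv.mono (subset_insert k X)
    have hlk := hl k (by simp)
    have hzk : z ≠ v k := hz k (by simp)
    have hlX : ∀ j ∈ X, M.lam 1 (v j) ≠ 0 := fun j hj => hl j (by simp [hj])
    have hzX : ∀ j ∈ X, z ≠ v j := fun j hj => hz j (by simp [hj])
    have hne := ne_of_injOn_insert hk hv.inj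
    have ht := tVec_insert hc hk hv hlk
    have hH : (M.lam 1 (v k) * ∏ i ∈ X, h c (v i) (v k)) ≠ 0 := hv.mul_prod_h_ne hlk
    refine smul_right_injective _ hH ?_
    simp only
    have h1 := congrArg (fun Z => Z (tVec M v X)) (T11_mul_T12 M hzk)
    simp only [ladd_apply, lsmul_apply, mul_apply] at h1
    rw [ih hvX hlX hzX, ih hvX hlX fun j hj => (hne j hj).symm, ht, map_smul] at h1
    rw [h1, smul_add, smul_comm _ _ (tVec M v (insert k X)), ← ht, sum_insert hk,
      erase_insert hk, prod_insert hk]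
    have e1 : ∀ j ∈ X, (g c z (v j) * ∏ l ∈ (insert k X).erase j, g c (v l) (v j)) •
        M.T 1 2 z (tVec M v ((insert k X).erase j)) =
        (M.lam 1 (v k) * ∏ i ∈ X, h c (v i) (v k))⁻¹ •
        (g c z (v j) * ∏ l ∈ X.erase j, g c (v l) (v j)) •
          (g c (v k) (v j) * h c (v j) (v k)) • M.T 1 2 z (M.T 1 2 (v k) (tVec M v (X.erase j))) := by
      intro j hj
      rw [mul_smul, ← map_smul, tVec_insert_erase hc hk hv hlk hj]
      simp only [map_smul]
      module
    rw [sum_congr rfl e1, smul_add, ← smul_sum, smul_inv_smul₀ hH]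
    simp only [map_add, map_sum, map_smul, smul_add, smul_sum]
    have e2 : ∀ j ∈ X, f c (v k) z • (g c z (v j) * ∏ l ∈ X.erase j, g c (v l) (v j)) •
          M.T 1 2 (v k) (M.T 1 2 z (tVec M v (X.erase j))) +
        g c z (v k) • (g c (v k) (v j) * ∏ l ∈ X.erase j, g c (v l) (v j)) •
          M.T 1 2 z (M.T 1 2 (v k) (tVec M v (X.erase j))) =
        (g c z (v j) * ∏ l ∈ X.erase j, g c (v l) (v j)) • (g c (v k) (v j) * h c (v j) (v k)) •
            M.T 1 2 z (M.T 1 2 (v k) (tVec M v (X.erase j))) := by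
      intro j hj
      have h2 := congrArg (fun Z => Z (tVec M v (X.erase j))) (Tj2_swap M hc 1 (by decide) hzk)
      simp only [lsmul_apply, mul_apply] at h2
      have h3 := g_three (c := c) (hzX j hj) (hne j hj) hzk.symm
      have h4 := g_mul_h hc (v k) z
      have h5 := h_mul_g_swap hc (hne j hj).symm
      have h6 := h_mul_g_swap hc hzk.symm
      rw [← h4, h5, g_swap c (v j) (v k), g_swap c (v k) z]
      linear_combination (norm := module)
        (-(g c (v k) z * g c z (v j) * ∏ l ∈ X.erase j, g c (v l) (v j))) • h2 +
        ((∏ l ∈ X.erase j, g c (v l) (v j)) * (g c z (v j) * h6 + h3)) •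
          (M.T 1 2 z (M.T 1 2 (v k) (tVec M v (X.erase j))))
    rw [← sum_congr rfl e2, sum_add_distrib]
    have e3 : g c z (v k) • (M.lam 1 (v k) * ∏ j ∈ X, f c (v j) (v k)) • M.T 1 2 z (tVec M v X) =
        (M.lam 1 (v k) * ∏ i ∈ X, h c (v i) (v k)) •
          (g c z (v k) * ∏ l ∈ X, g c (v l) (v k)) • M.T 1 2 z (tVec M v X) := by
      rw [smul_smul, smul_smul]
      congr 1
      rw [prod_f_eq hc]
      ring
    rw [e3]
    module

lemma eVec_insert (hc : c ≠ 0) {X : Finset (Fin b)} {k : Fin b} (hk : k ∉ X)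
    (hv : Admissible c v (insert k X)) (hl : ∀ j ∈ insert k X, M.lam 1 (v j) ≠ 0) {y : ℂ}
    (hy : ∀ j ∈ insert k X, y ≠ v j) :
    (M.lam 1 (v k) * ∏ i ∈ X, h c (v i) (v k)) • eVec M v y (insert k X) =
      M.T 1 2 (v k) (eVec M v y X) + (M.lam 1 y * g c (v k) y * ∏ j ∈ X, f c (v j) y) •
        M.T 0 2 (v k) (tVec M v X) := by
  have hvX := hv.mono (subset_insert k X)
  have hlk := hl k (by simp)
  have hyk : y ≠ v k := hy k (by simp)
  have hlX : ∀ j ∈ X, M.lam 1 (v j) ≠ 0 := fun j hj => hl j (by simp [hj])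
  have hyX : ∀ j ∈ X, y ≠ v j := fun j hj => hy j (by simp [hj])
  have hne := ne_of_injOn_insert hk hv.inj
  have ht := tVec_insert hc hk hv hlk
  have hH : (M.lam 1 (v k) * ∏ i ∈ X, h c (v i) (v k)) ≠ 0 := hv.mul_prod_h_ne hlk
  rw [eVec, eVec, smul_add, ← map_smul, ← ht, sum_insert hk, erase_insert hk]
  have e1 : ∀ j ∈ X, (g c (v j) y * ∏ l ∈ (insert k X).erase j, g c (v l) (v j)) •
      M.T 0 2 y (tVec M v ((insert k X).erase j)) =
      (M.lam 1 (v k) * ∏ i ∈ X, h c (v i) (v k))⁻¹ •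
      (g c (v j) y * ∏ l ∈ X.erase j, g c (v l) (v j)) •
        (g c (v k) (v j) * h c (v j) (v k)) • M.T 0 2 y (M.T 1 2 (v k) (tVec M v (X.erase j))) := by
    intro j hj
    rw [mul_smul, ← map_smul, tVec_insert_erase hc hk hv hlk hj]
    simp only [map_smul]
    module
  rw [sum_congr rfl e1, smul_add, ← smul_sum, smul_inv_smul₀ hH]
  have h1 := congrArg (fun Z => Z (tVec M v X)) (T01_mul_T12 M hyk)
  simp only [ladd_apply, lsub_apply, lsmul_apply, mul_apply] at h1
  rw [T11_tVec hc hvX hlX hyX, T11_tVec hc hvX hlX fun j hj => (hne j hj).symm] at h1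
  rw [h1]
  simp only [map_add, map_sum, map_smul, smul_add, smul_sum]
  have e2 : ∀ j ∈ X, g c y (v k) • (g c (v k) (v j) * ∏ l ∈ X.erase j, g c (v l) (v j)) •
        M.T 0 2 y (M.T 1 2 (v k) (tVec M v (X.erase j))) -
      g c y (v k) • (g c y (v j) * ∏ l ∈ X.erase j, g c (v l) (v j)) •
        M.T 0 2 (v k) (M.T 1 2 y (tVec M v (X.erase j))) +
      (g c (v j) y * ∏ l ∈ X.erase j, g c (v l) (v j)) • (g c (v k) (v j) * h c (v j) (v k)) •
          M.T 0 2 y (M.T 1 2 (v k) (tVec M v (X.erase j))) =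
      (g c (v j) y * ∏ l ∈ X.erase j, g c (v l) (v j)) •
        M.T 1 2 (v k) (M.T 0 2 y (tVec M v (X.erase j))) := by
    intro j hj
    have h2 := congrArg (fun Z => Z (tVec M v (X.erase j))) (T12_mul_T02 M hyk.symm)
    simp only [lsub_apply, lsmul_apply, mul_apply] at h2
    have h3 := g_three (c := c) (hyX j hj) (hne j hj) hyk.symm
    rw [h2, h_mul_g_swap hc (hne j hj).symm, g_swap c y (v k), g_swap c y (v j)]
    rw [g_swap c (v k) (v j), g_swap c y (v k)] at h3
    linear_combination (norm := module) ((∏ l ∈ X.erase j, g c (v l) (v j)) * h3) •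
      (M.T 0 2 y (M.T 1 2 (v k) (tVec M v (X.erase j))))
  rw [← sum_congr rfl e2, sum_add_distrib, sum_sub_distrib]
  have e3 : (M.lam 1 (v k) * ∏ i ∈ X, h c (v i) (v k)) •
      (g c (v k) y * ∏ l ∈ X, g c (v l) (v k)) • M.T 0 2 y (tVec M v X) =
      (g c (v k) y * (M.lam 1 (v k) * ∏ j ∈ X, f c (v j) (v k))) • M.T 0 2 y (tVec M v X) := by
    rw [smul_smul]
    congr 1
    rw [prod_f_eq hc]
    ring
  rw [e3, g_swap c (v k) y]
  module

variable (M)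

def eRest (v : Pts b) (y : ℂ) (X : Finset (Fin b)) : M.H := (M.lam 1 y)⁻¹ • (eVec M v y X -
    (∏ j ∈ X, M.lam 1 (v j))⁻¹ • symT3 M 1 v X (M.T 0 1 y M.vac))

variable {M}

lemma eRest_empty (y : ℂ) : eRest M v y ∅ = 0 := by simp [eRest, eVec, tVec]

lemma eVec_eq (y : ℂ) (hy : M.lam 1 y ≠ 0) (X : Finset (Fin b)) :
    eVec M v y X = (∏ j ∈ X, M.lam 1 (v j))⁻¹ • symT3 M 1 v X (M.T 0 1 y M.vac) +
      M.lam 1 y • eRest M v y X := by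
  rw [eRest, smul_inv_smul₀ hy]
  abel

lemma eRest_insert (hc : c ≠ 0) {X : Finset (Fin b)} {k : Fin b} (hk : k ∉ X)
    (hv : Admissible c v (insert k X)) (hl : ∀ j ∈ insert k X, M.lam 1 (v j) ≠ 0) {y : ℂ}
    (hly : M.lam 1 y ≠ 0) (hy : ∀ j ∈ insert k X, y ≠ v j) :
    eRest M v y (insert k X) = (M.lam 1 (v k) * ∏ i ∈ X, h c (v i) (v k))⁻¹ •
      (M.T 1 2 (v k) (eRest M v y X) +
        (g c (v k) y * ∏ j ∈ X, f c (v j) y) • M.T 0 2 (v k) (tVec M v X)) := by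
  have hlk := hl k (by simp)
  have hH : (M.lam 1 (v k) * ∏ i ∈ X, h c (v i) (v k)) ≠ 0 := hv.mul_prod_h_ne hlk
  rw [eq_inv_smul_iff₀ hH]
  refine smul_right_injective _ hly ?_
  simp only
  have h1 := eVec_insert hc hk hv hl hy
  rw [eVec_eq y hly, eVec_eq y hly] at h1
  have h2 := symT3_insert_left M v hc 1 (by decide) hk hv.inj hv.h_ne
  have h3 : (M.lam 1 (v k) * ∏ i ∈ X, h c (v i) (v k)) •
      (∏ j ∈ insert k X, M.lam 1 (v j))⁻¹ • symT3 M 1 v (insert k X) (M.T 0 1 y M.vac) =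
      M.T 1 2 (v k) ((∏ j ∈ X, M.lam 1 (v j))⁻¹ • symT3 M 1 v X (M.T 0 1 y M.vac)) := by
    rw [h2, prod_insert hk, map_smul, lsmul_apply, mul_apply, smul_smul, smul_smul]
    congr 1
    have := right_ne_zero_of_mul hH
    field_simp
  rw [smul_add, h3, map_add, map_smul _ (M.lam 1 y)] at h1
  linear_combination (norm := module) h1

end VPart

/-! ### Peeling a particle off a Bethe vector -/

section Peel

variable {c : ℂ} {a b : ℕ}

/-- The model-independent part of the coefficients of a Bethe vector. -/
def partCoeff (c : ℂ) (u : Pts a) (v : Pts b) (A A₁ : Finset (Fin a)) (B B₁ : Finset (Fin b)) : ℂ :=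
  prod2 (g c) v B₁ u A₁ * prod2 (f c) u A₁ u (A \ A₁) * prod2 (g c) v (B \ B₁) v B₁ *
    prod2 (h c) u A₁ u A₁ / prod2 (f c) v B u A

variable (M : Model.{uM} c) (u : Pts a) (v : Pts b)

/-- The operator that creates a Bethe vector, with weights `ψ` for the operators `T_{23}(v_j)`. -/
def ketOp (ψ : Pts b) (A : Finset (Fin a)) (B : Finset (Fin b)) : Module.End ℂ M.H :=
  ∑ A₁ ∈ A.powerset, ∑ B₁ ∈ B.powerset with B₁.card = A₁.card,
    (partCoeff c u v A A₁ B B₁ * ∏ j ∈ B \ B₁, ψ j) •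
      (symT3 M 0 u A₁ * opProd M 0 1 u (A \ A₁) * symT3 M 1 v (B \ B₁))

lemma ket_eq_ketOp (A : Finset (Fin a)) (B : Finset (Fin b)) : ket M u v A B =
      (∏ i ∈ A, M.lam 1 (u i))⁻¹ • ketOp M u v (fun j => (M.lam 1 (v j))⁻¹) A B M.vac := by
  simp only [ket, ketOp, lsum_apply, lsmul_apply, smul_sum, smul_smul]
  refine sum_congr rfl fun A₁ _ => sum_congr rfl fun B₁ _ => ?_
  congr 1
  simp only [betheCoeff, partCoeff, prod_inv_distrib, div_eq_mul_inv, mul_inv]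
  ring

lemma ketOp_eq_partSum (ψ : Pts b) (A : Finset (Fin a)) (B : Finset (Fin b)) :
    ketOp M u v ψ A B = (prod2 (f c) v B u A)⁻¹ • ∑ V ∈ B.powerset,
      (prod2 (g c) v (B \ V) v V * ∏ j ∈ B \ V, ψ j) •
        (partSum M u v A V * symT3 M 1 v (B \ V)) := by
  simp only [ketOp, sum_filter]
  rw [sum_comm, smul_sum]
  refine sum_congr rfl fun V _ => ?_
  rw [partSum, sum_mul, smul_sum, smul_sum]
  refine sum_congr rfl fun I _ => ?_
  split_ifs
  · simp only [smul_mul_assoc, smul_smul]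
    congr 1
    simp only [partCoeff, div_eq_mul_inv]
    ring
  · simp

lemma ket_eq_partSum (A : Finset (Fin a)) (B : Finset (Fin b)) :
    ket M u v A B = ((∏ i ∈ A, M.lam 1 (u i)) * prod2 (f c) v B u A)⁻¹ • ∑ V ∈ B.powerset,
      prod2 (g c) v (B \ V) v V • partSum M u v A V (tVec M v (B \ V)) := by
  rw [ket_eq_ketOp, ketOp_eq_partSum, lsmul_apply, smul_smul, mul_inv, lsum_apply]
  congr 1
  refine sum_congr rfl fun V _ => ?_
  simp only [tVec, map_smul, smul_smul, lsmul_apply, mul_apply, prod_inv_distrib]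

/-- The part of a Bethe vector that does not contain the operator `T_{12}(u_k)` acting on the
vacuum. -/
def ketRestU (A : Finset (Fin a)) (B : Finset (Fin b)) (k : Fin a) : M.H :=
  ((∏ i ∈ A, M.lam 1 (u i)) * prod2 (f c) v B u A * ∏ j ∈ B, f c (v j) (u k))⁻¹ •
    ∑ V ∈ B.powerset, (prod2 (g c) v (B \ V) v V * ∏ j ∈ V, f c (v j) (u k)) •
      partSum M u v A V (eRest M v (u k) (B \ V))

variable {M u v}

lemma ket_insert_u (hc : c ≠ 0) {A : Finset (Fin a)} {B : Finset (Fin b)} {k : Fin a}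
    (hk : k ∉ A) (hu : Admissible c u (insert k A)) (hv : Admissible c v B)
    (huv : ∀ j ∈ B, ∀ i ∈ insert k A, v j ≠ u i)
    (hlk : M.lam 1 (u k) ≠ 0) (hf : ∀ j ∈ B, f c (v j) (u k) ≠ 0) : ket M u v (insert k A) B =
      (M.lam 1 (u k) * ∏ i ∈ A, M.lam 1 (u i))⁻¹ •
        ketOp M u v (fun j => (M.lam 1 (v j) * f c (v j) (u k))⁻¹) A B (M.T 0 1 (u k) M.vac) +
      ketRestU M u v A B k := by
  set y := u k with hy
  have e1 : ∀ V ∈ B.powerset, prod2 (g c) v (B \ V) v V •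
      partSum M u v (insert k A) V (tVec M v (B \ V)) =
      (prod2 (g c) v (B \ V) v V * ∏ j ∈ V, f c (v j) y) •
        partSum M u v A V (M.T 0 1 y (tVec M v (B \ V))) +
      ∑ j ∈ V, (prod2 (g c) v (B \ insert j (V.erase j)) v (insert j (V.erase j)) *
        (g c (v j) y * ∏ l ∈ V.erase j, g c (v j) (v l) * f c (v l) y)) •
          partSum M u v A (V.erase j) (M.T 0 2 y (tVec M v (B \ insert j (V.erase j)))) := by
    intro V hV
    have hVB := mem_powerset.1 hV
    rw [partSum_insert M hc hk hu (hv.mono hVB).inj fun j hj => huv j (hVB hj)]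
    simp only [ladd_apply, lsmul_apply, lsum_apply, mul_apply, smul_add, smul_smul, smul_sum]
    congr 1
    refine sum_congr rfl fun j hj => ?_
    rw [insert_erase hj]
  have e2 : ∀ V ∈ B.powerset, (prod2 (g c) v (B \ V) v V * ∏ j ∈ V, f c (v j) y) •
        partSum M u v A V (M.T 0 1 y (tVec M v (B \ V))) +
      ∑ j ∈ B \ V, (prod2 (g c) v (B \ insert j V) v (insert j V) *
        (g c (v j) y * ∏ l ∈ V, g c (v j) (v l) * f c (v l) y)) •
          partSum M u v A V (M.T 0 2 y (tVec M v (B \ insert j V))) =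
      (prod2 (g c) v (B \ V) v V * ∏ j ∈ V, f c (v j) y) •
        partSum M u v A V (eVec M v y (B \ V)) := by
    intro V hV
    rw [eVec, map_add, smul_add, map_sum, smul_sum]
    congr 1
    refine sum_congr rfl fun j hj => ?_
    have hjV : j ∉ V := (Finset.mem_sdiff.1 hj).2
    rw [map_smul, smul_smul, ← sdiff_insert]
    congr 1
    rw [show B \ V = insert j (B \ insert j V) by rw [sdiff_insert, insert_erase hj],
      prod2_insert_left _ _ _ (by simp), prod2_insert_right _ _ _ hjV,
      prod_mul_distrib]
    ring
  have hlB : ∀ V ∈ B.powerset, (prod2 (g c) v (B \ V) v V * ∏ j ∈ V, f c (v j) y) •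
        partSum M u v A V (eVec M v y (B \ V)) =
      (∏ j ∈ B, f c (v j) y) • (prod2 (g c) v (B \ V) v V * ∏ j ∈ B \ V,
        (M.lam 1 (v j) * f c (v j) y)⁻¹) •
        partSum M u v A V (symT3 M 1 v (B \ V) (M.T 0 1 y M.vac)) +
      M.lam 1 y • (prod2 (g c) v (B \ V) v V * ∏ j ∈ V, f c (v j) y) •
        partSum M u v A V (eRest M v y (B \ V)) := by
    intro V hV
    rw [eVec_eq y hlk, map_add, map_smul, map_smul, smul_add, smul_smul, smul_smul, smul_smul,
      smul_smul]
    congr 2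
    · have : ∏ j ∈ B \ V, f c (v j) y ≠ 0 := prod_ne_zero_iff.2 fun j hj => hf j (sdiff_subset hj)
      rw [← prod_sdiff (mem_powerset.1 hV), prod_inv_distrib, prod_mul_distrib]
      field_simp
    · ring
  have hfB : ∏ j ∈ B, f c (v j) y ≠ 0 := prod_ne_zero_iff.2 hf
  rw [ket_eq_partSum, sum_congr rfl e1, sum_add_distrib,
    ← sum_powerset_sdiff B (fun V j => (prod2 (g c) v (B \ insert j V) v (insert j V) *
        (g c (v j) y * ∏ l ∈ V, g c (v j) (v l) * f c (v l) y)) •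
          partSum M u v A V (M.T 0 2 y (tVec M v (B \ insert j V)))),
    ← sum_add_distrib, sum_congr rfl e2, sum_congr rfl hlB,
    sum_add_distrib, ← smul_sum, ← smul_sum, smul_add, ketOp_eq_partSum,
    ketRestU, prod2_insert_right _ _ _ hk, prod_insert hk]
  simp only [lsmul_apply, lsum_apply, mul_apply, smul_smul, ← hy]
  congr 2 <;> field_simp

variable (M u v)

/-- The part of a Bethe vector without the operator `T_{23}(v_k)`. -/
def ketRestV (A : Finset (Fin a)) (B : Finset (Fin b)) (k : Fin b) : M.H :=
  (∏ i ∈ A, M.lam 1 (u i))⁻¹ • ∑ A₁ ∈ A.powerset, ∑ B₁ ∈ B.powerset with B₁.card + 1 = A₁.card,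
    (partCoeff c u v A A₁ (insert k B) (insert k B₁) * ∏ j ∈ B \ B₁, (M.lam 1 (v j))⁻¹) •
      (symT3 M 0 u A₁ * opProd M 0 1 u (A \ A₁) * symT3 M 1 v (B \ B₁)) M.vac

variable {M u v}

lemma ket_insert_v (hc : c ≠ 0) {A : Finset (Fin a)} {B : Finset (Fin b)} {k : Fin b}
    (hk : k ∉ B) (hv : Admissible c v (insert k B)) : ket M u v A (insert k B) =
      ((∏ j ∈ B, g c (v k) (v j)) /
        ((M.lam 1 (v k) * ∏ i ∈ A, f c (v k) (u i)) * ∏ i ∈ A, M.lam 1 (u i))) •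
        ketOp M u v (fun j => (M.lam 1 (v j) * f c (v k) (v j))⁻¹) A B (M.T 1 2 (v k) M.vac) +
      ketRestV M u v A B k := by
  rw [ket_eq_ketOp, ketOp, ketOp, ketRestV]
  simp only [lsum_apply, lsmul_apply]
  simp only [sum_filter]
  have e1 : ∀ A₁ ∈ A.powerset, ∑ B₁ ∈ (insert k B).powerset, (if B₁.card = A₁.card then
      (partCoeff c u v A A₁ (insert k B) B₁ * ∏ j ∈ insert k B \ B₁, (M.lam 1 (v j))⁻¹) •
      (symT3 M 0 u A₁ * opProd M 0 1 u (A \ A₁) * symT3 M 1 v (insert k B \ B₁)) M.vac else 0) =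
      ((∏ j ∈ B, g c (v k) (v j)) / (M.lam 1 (v k) * ∏ i ∈ A, f c (v k) (u i))) •
        ∑ B₁ ∈ B.powerset, (if B₁.card = A₁.card then
          (partCoeff c u v A A₁ B B₁ * ∏ j ∈ B \ B₁, (M.lam 1 (v j) * f c (v k) (v j))⁻¹) •
          (symT3 M 0 u A₁ * opProd M 0 1 u (A \ A₁) * symT3 M 1 v (B \ B₁))
            (M.T 1 2 (v k) M.vac) else 0) +
      ∑ B₁ ∈ B.powerset, (if B₁.card + 1 = A₁.card then
        (partCoeff c u v A A₁ (insert k B) (insert k B₁) * ∏ j ∈ B \ B₁, (M.lam 1 (v j))⁻¹) •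
        (symT3 M 0 u A₁ * opProd M 0 1 u (A \ A₁) * symT3 M 1 v (B \ B₁)) M.vac else 0) := by
    intro A₁ _
    rw [sum_powerset_insert hk, smul_sum]
    congr 1
    · refine sum_congr rfl fun B₁ hB₁ => ?_
      have hBB := mem_powerset.1 hB₁
      have hkB : k ∉ B₁ := fun e => hk (hBB e)
      have hkB' : k ∉ B \ B₁ := fun e => hk (sdiff_subset e)
      split_ifs
      · have hsub : insert k (B \ B₁) ⊆ insert k B := insert_subset_insert _ sdiff_subset
        have h2 := symT3_insert M v hc 1 (by decide) hkB' (hv.mono hsub).inj fun i hi =>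
          ⟨hv.h_ne _ (hsub (by simp [hi])) _ (by simp), hv.h_ne _ (by simp) _ (hsub (by simp [hi]))⟩
        rw [insert_sdiff_of_notMem _ hkB, h2, prod_insert hkB', mul_smul_comm,
          lsmul_apply, ← mul_assoc, mul_apply, smul_smul, smul_smul]
        congr 1
        have h3 : ∏ j ∈ B \ B₁, g c (v k) (v j) ≠ 0 := prod_ne_zero_iff.2 fun j hj =>
          g_ne_zero hc fun e => hk ((hv.inj (by simp) (by simp [sdiff_subset hj]) e) ▸
            (sdiff_subset hj))
        simp only [partCoeff, insert_sdiff_of_notMem _ hkB, prod2_insert_left _ _ _ hk,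
          prod2_insert_left _ _ _ hkB', prod_inv_distrib, prod_mul_distrib]
        rw [prod_f_eq hc (B \ B₁), ← prod_sdiff hBB (f := fun j => g c (v k) (v j))]
        simp only [div_eq_mul_inv, mul_inv]
        field_simp
      · simp
    · refine sum_congr rfl fun B₁ hB₁ => ?_
      have hBB := mem_powerset.1 hB₁
      have hkB : k ∉ B₁ := fun e => hk (hBB e)
      rw [card_insert_of_notMem hkB, insert_sdiff_insert, sdiff_insert_of_notMem hk]
  rw [sum_congr rfl e1, sum_add_distrib, smul_add, ← smul_sum, smul_smul]
  congr 2
  field_simp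

end Peel

/-! ### Operators that are given by the same words in two families of models -/

section FunctionMem

variable {Θ : Type} {Ω : FunAlg Θ}

lemma fun_mul_mem {φ χ : Θ → ℂ} (hφ : φ ∈ Ω) (hχ : χ ∈ Ω) : (fun θ => φ θ * χ θ) ∈ Ω :=
  mul_mem hφ hχ

lemma fun_add_mem {φ χ : Θ → ℂ} (hφ : φ ∈ Ω) (hχ : χ ∈ Ω) : (fun θ => φ θ + χ θ) ∈ Ω :=
  add_mem hφ hχ

lemma fun_sub_mem {φ χ : Θ → ℂ} (hφ : φ ∈ Ω) (hχ : χ ∈ Ω) : (fun θ => φ θ - χ θ) ∈ Ω :=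
  sub_mem hφ hχ

lemma const_mem (z : ℂ) : (fun _ : Θ => z) ∈ Ω := Ω.algebraMap_mem z

lemma fun_prod_mem {ι : Type*} (s : Finset ι) {φ : ι → Θ → ℂ} (h : ∀ i ∈ s, φ i ∈ Ω) :
    (fun θ => ∏ i ∈ s, φ i θ) ∈ Ω := by
  have := prod_mem h
  convert this using 1
  funext θ
  simp

lemma fun_prod2_mem {a b : ℕ} {F : ℂ → ℂ → ℂ} {x : Θ → Pts a} {X : Finset (Fin a)}
    {y : Θ → Pts b} {Y : Finset (Fin b)} (h : ∀ i ∈ X, ∀ j ∈ Y, (fun θ => F (x θ i) (y θ j)) ∈ Ω) :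
    (fun θ => prod2 F (x θ) X (y θ) Y) ∈ Ω :=
  fun_prod_mem X fun i hi => fun_prod_mem Y fun j hj => h i hi j hj

lemma fun_prod2_inv_mem {a b : ℕ} {F : ℂ → ℂ → ℂ} {x : Θ → Pts a} {X : Finset (Fin a)}
    {y : Θ → Pts b} {Y : Finset (Fin b)}
    (h : ∀ i ∈ X, ∀ j ∈ Y, (fun θ => (F (x θ i) (y θ j))⁻¹) ∈ Ω) :
    (fun θ => (prod2 F (x θ) X (y θ) Y)⁻¹) ∈ Ω := by
  simp only [prod2, ← prod_inv_distrib]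
  exact fun_prod_mem X fun i hi => fun_prod_mem Y fun j hj => h i hi j hj

lemma fun_prod_inv_mem {ι : Type*} (s : Finset ι) {φ : ι → Θ → ℂ}
    (h : ∀ i ∈ s, (fun θ => (φ i θ)⁻¹) ∈ Ω) : (fun θ => (∏ i ∈ s, φ i θ)⁻¹) ∈ Ω := by
  simp only [← prod_inv_distrib]
  exact fun_prod_mem s h

lemma fun_mul_inv_mem {φ χ : Θ → ℂ} (hφ : (fun θ => (φ θ)⁻¹) ∈ Ω)
    (hχ : (fun θ => (χ θ)⁻¹) ∈ Ω) : (fun θ => (φ θ * χ θ)⁻¹) ∈ Ω := by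
  simp only [mul_inv]
  exact fun_mul_mem hφ hχ

end FunctionMem

section Pair

variable {c : ℂ} {K Θ : Type} (Ω : FunAlg Θ) (M : Θ → Model.{u₁} c)
  (M' : Θ → Model.{u₂} c) (p : Θ → K → ℂ)

/-- A family of operators. -/
abbrev Ops (M : Θ → Model.{u₁} c) := ∀ θ, Module.End ℂ (M θ).H

/-- A family of vectors. -/
abbrev Vecs (M : Θ → Model.{u₁} c) := ∀ θ, (M θ).H

/-- Two families of operators, given by the same linear combination of words over `s`, with
coefficients in `Ω`, in two families of models. -/
inductive PairOp (s : Set K) :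
    Ops M → Ops M' → Prop
  | word (W : Word K) (hW : Over s W) :
      PairOp s (fun θ => word (M θ) (p θ) W) (fun θ => word (M' θ) (p θ) W)
  | add {N L : Ops M} {N' L' : Ops M'} :
      PairOp s N N' → PairOp s L L' → PairOp s (fun θ => N θ + L θ) (fun θ => N' θ + L' θ)
  | smul {N : Ops M} {N' : Ops M'} (φ : Θ → ℂ)
      (hφ : φ ∈ Ω) : PairOp s N N' → PairOp s (fun θ => φ θ • N θ) (fun θ => φ θ • N' θ)

variable {Ω M M' p} {s t : Set K} {N L : Ops M}
  {N' L' : Ops M'}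

lemma PairOp.one : PairOp Ω M M' p s (fun _ => 1) (fun _ => 1) := .word [] (over_nil _)

lemma PairOp.zero : PairOp Ω M M' p s (fun _ => 0) (fun _ => 0) := by
  simpa using PairOp.smul (Ω := Ω) (M := M) (M' := M') (p := p) (s := s) 0 (zero_mem _) .one

lemma PairOp.sum {ι : Type*} (S : Finset ι) {N : ι → Ops M}
    {N' : ι → Ops M'} (h : ∀ i ∈ S, PairOp Ω M M' p s (N i) (N' i)) :
    PairOp Ω M M' p s (fun θ => ∑ i ∈ S, N i θ) (fun θ => ∑ i ∈ S, N' i θ) := by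
  classical
  induction S using Finset.induction_on with
  | empty => simpa using PairOp.zero
  | insert i S hi ih =>
    simp only [sum_insert hi]
    exact .add (h i (by simp)) (ih fun j hj => h j (by simp [hj]))

lemma PairOp.ite {P : Prop} [Decidable P] (h : P → PairOp Ω M M' p s N N') :
    PairOp Ω M M' p s (fun θ => if P then N θ else 0) (fun θ => if P then N' θ else 0) := by
  split_ifs with hP
  exacts [h hP, .zero]

lemma PairOp.mono (h : PairOp Ω M M' p s N N') (hst : s ⊆ t) : PairOp Ω M M' p t N N' := by
  induction h with
  | word W hW => exact .word W (hW.mono hst)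
  | add _ _ ih1 ih2 => exact .add ih1 ih2
  | smul φ hφ _ ih => exact .smul φ hφ ih

lemma PairOp.mul (h : PairOp Ω M M' p s N N') (h' : PairOp Ω M M' p t L L') (hst : Disjoint s t) :
    PairOp Ω M M' p (s ∪ t) (fun θ => N θ * L θ) (fun θ => N' θ * L' θ) := by
  induction h with
  | word W hW =>
    induction h' with
    | word V hV =>
      have := PairOp.word (Ω := Ω) (M := M) (M' := M') (p := p) (W ++ V) (hW.append hV hst)
      simpa only [word_append] using this
    | add _ _ ih1 ih2 => simpa only [mul_add] using ih1.add ih2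
    | smul φ hφ _ ih => simpa only [mul_smul_comm] using ih.smul φ hφ
  | add _ _ ih1 ih2 => simpa only [add_mul] using ih1.add ih2
  | smul φ hφ _ ih => simpa only [smul_mul_assoc] using ih.smul φ hφ

lemma PairOp.letter {k : K} (hk : k ∈ s) (i j : Fin 3) :
    PairOp Ω M M' p s (fun θ => (M θ).T i j (p θ k)) (fun θ => (M' θ).T i j (p θ k)) := by
  have := PairOp.word (Ω := Ω) (M := M) (M' := M') (p := p) (s := s) [(i, j, k)]
    (by simp [Over, hk])
  simpa using this

lemma PairOp.left (h : PairOp Ω M M' p s N N') : PairOp Ω M M p s N N := by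
  induction h with
  | word W hW => exact .word W hW
  | add _ _ ih1 ih2 => exact .add ih1 ih2
  | smul φ hφ _ ih => exact .smul φ hφ ih

variable (Ω M M' p) in
/-- Two families of vectors, obtained from the vacua by the same linear combination of words. -/
def PairVec (s : Set K) (ζ : Vecs M) (ζ' : Vecs M') : Prop :=
  ∃ N N', PairOp Ω M M' p s N N' ∧ (∀ θ, ζ θ = N θ (M θ).vac) ∧ ∀ θ, ζ' θ = N' θ (M' θ).vac

variable {ζ ξ : Vecs M} {ζ' ξ' : Vecs M'}

lemma PairOp.vec (h : PairOp Ω M M' p s N N') :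
    PairVec Ω M M' p s (fun θ => N θ (M θ).vac) (fun θ => N' θ (M' θ).vac) :=
  ⟨N, N', h, fun _ => rfl, fun _ => rfl⟩

lemma PairVec.add (h : PairVec Ω M M' p s ζ ζ') (h' : PairVec Ω M M' p s ξ ξ') :
    PairVec Ω M M' p s (fun θ => ζ θ + ξ θ) (fun θ => ζ' θ + ξ' θ) := by
  obtain ⟨N, N', h1, h2, h3⟩ := h
  obtain ⟨L, L', h4, h5, h6⟩ := h'
  exact ⟨_, _, h1.add h4, fun θ => by simp [h2, h5], fun θ => by simp [h3, h6]⟩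

lemma PairVec.smul {φ : Θ → ℂ} (hφ : φ ∈ Ω) (h : PairVec Ω M M' p s ζ ζ') :
    PairVec Ω M M' p s (fun θ => φ θ • ζ θ) (fun θ => φ θ • ζ' θ) := by
  obtain ⟨N, N', h1, h2, h3⟩ := h
  exact ⟨_, _, h1.smul φ hφ, fun θ => by simp [h2], fun θ => by simp [h3]⟩

lemma PairVec.sum {ι : Type*} (S : Finset ι) {ζ : ι → Vecs M} {ζ' : ι → Vecs M'}
    (h : ∀ i ∈ S, PairVec Ω M M' p s (ζ i) (ζ' i)) :
    PairVec Ω M M' p s (fun θ => ∑ i ∈ S, ζ i θ) (fun θ => ∑ i ∈ S, ζ' i θ) := by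
  classical
  induction S using Finset.induction_on with
  | empty => exact ⟨_, _, PairOp.zero, fun _ => by simp, fun _ => by simp⟩
  | insert i S hi ih =>
    simp only [sum_insert hi]
    exact (h i (by simp)).add (ih fun j hj => h j (by simp [hj]))

lemma PairVec.mono (h : PairVec Ω M M' p s ζ ζ') (hst : s ⊆ t) : PairVec Ω M M' p t ζ ζ' := by
  obtain ⟨N, N', h1, h2⟩ := h
  exact ⟨N, N', h1.mono hst, h2⟩

lemma PairVec.left (h : PairVec Ω M M' p s ζ ζ') : PairVec Ω M M p s ζ ζ := by
  obtain ⟨N, N', h1, h2, h3⟩ := h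
  exact ⟨N, N, h1.left, h2, h2⟩

lemma PairOp.apply (h : PairOp Ω M M' p s N N') (h' : PairVec Ω M M' p t ζ ζ')
    (hst : Disjoint s t) :
    PairVec Ω M M' p (s ∪ t) (fun θ => N θ (ζ θ)) (fun θ => N' θ (ζ' θ)) := by
  obtain ⟨L, L', h4, h5, h6⟩ := h'
  exact ⟨_, _, h.mul h4 hst, fun θ => by simp [h5], fun θ => by simp [h6]⟩

lemma PairOp.vev_mem (h : PairOp Ω M M' p s N N') (hs : RegOn Ω M p s) :
    (fun θ => (M θ).covac (N θ (M θ).vac)) ∈ Ω := by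
  induction h with
  | word W hW => exact vevF_mem hs hW
  | add _ _ ih1 ih2 =>
    simp only [ladd_apply, map_add]
    exact fun_add_mem ih1 ih2
  | smul φ hφ _ ih =>
    simp only [lsmul_apply, map_smul, smul_eq_mul]
    exact fun_mul_mem hφ ih

lemma PairOp.vev_eq (h : PairOp Ω M M' p s N N') {θ : Θ} (hs : Set.InjOn (p θ) s)
    (hlam : ∀ i, ∀ k ∈ s, (M θ).lam i (p θ k) = (M' θ).lam i (p θ k)) :
    (M θ).covac (N θ (M θ).vac) = (M' θ).covac (N' θ (M' θ).vac) := by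
  induction h with
  | word W hW => exact vev_congr (M θ) (M' θ) hs hlam hW
  | add _ _ ih1 ih2 => simp only [ladd_apply, map_add, ih1, ih2]
  | smul φ hφ _ ih => simp only [lsmul_apply, map_smul, ih]

lemma PairOp.vev_raise_eq (h : PairOp Ω M M' p s N N') {θ : Θ} {y : K} (hy : y ∉ s)
    (hs : Set.InjOn (p θ) (insert y s))
    (hlam : ∀ i, ∀ k ∈ s, (M θ).lam i (p θ k) = (M' θ).lam i (p θ k)) (σ : Fin 2) (a a' : ℂ)
    (ha : ∀ i : Fin 3, (i = σ.castSucc ∨ i = σ.succ) →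
      a * (M θ).lam i (p θ y) = a' * (M' θ).lam i (p θ y)) :
    a * (M θ).covac (N θ ((M θ).T σ.castSucc σ.succ (p θ y) (M θ).vac)) =
      a' * (M' θ).covac (N' θ ((M' θ).T σ.castSucc σ.succ (p θ y) (M' θ).vac)) := by
  induction h with
  | word W hW =>
    have := vev_raise_congr (M θ) (M' θ) hy hs hlam σ a a' ha hW
    simpa [vev, raise] using this
  | add _ _ ih1 ih2 => simp only [ladd_apply, map_add, mul_add, ih1, ih2]
  | smul φ hφ _ ih => simp only [lsmul_apply, map_smul, smul_eq_mul, mul_left_comm _ (φ θ), ih]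

lemma PairOp.residue (h : PairOp Ω M M' p s N N') {x y : K} (hy : y ∉ s)
    (hX : RegOn Ω M p (insert x s)) (hY : RegOn Ω M p (insert y s)) (hx : x ∉ s) (σ τ : Fin 2)
    (hM' : IsModified M M' p s σ y) : (fun θ => (M θ).covac ((M θ).T τ.succ τ.castSucc (p θ x)
        (N θ ((M θ).T σ.castSucc σ.succ (p θ y) (M θ).vac))) -
      (M' θ).covac (N' θ (M' θ).vac) * (M θ).covac ((M θ).T τ.succ τ.castSucc (p θ x)
        ((M θ).T σ.castSucc σ.succ (p θ y) (M θ).vac))) ∈ Ω := by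
  induction h with
  | word W hW =>
    have := vevF_residue hy hX hY hx σ τ hM' hW
    convert this using 1
    funext θ
    simp [vevF, vev, raise, lowerL]
  | add _ _ ih1 ih2 =>
    simp only [ladd_apply, map_add, add_mul, add_sub_add_comm]
    exact fun_add_mem ih1 ih2
  | smul φ hφ _ ih =>
    simp only [lsmul_apply, map_smul, smul_eq_mul, mul_assoc, ← mul_sub]
    exact fun_mul_mem hφ ih

def Model.toDual {c : ℂ} (M : Model.{uM} c) : M.dual.H →ₗ[ℂ] Module.Dual ℂ M.H where
  toFun ξ := ξ
  map_add' _ _ := rfl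
  map_smul' _ _ := rfl

def transposeWord (W : Word K) : Word K := (W.map fun l => (l.2.1, l.1, l.2.2)).reverse

lemma Over.transpose {W : Word K} (h : Over s W) : Over s (transposeWord W) := by
  obtain ⟨h1, h2⟩ := h
  refine ⟨?_, ?_⟩
  · simpa [transposeWord, List.map_reverse, List.nodup_reverse, Function.comp_def] using h1
  · simp only [transposeWord, List.mem_reverse, List.mem_map]
    rintro l ⟨l', hl', rfl⟩
    exact h2 l' hl'

lemma word_dual (M : Model.{uM} c) (p : K → ℂ) (W : Word K) (ξ : M.dual.H) (m : M.H) :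
    M.toDual (word M.dual p W ξ) m = M.toDual ξ (word M p (transposeWord W) m) := by
  induction W generalizing m with
  | nil => rfl
  | cons l W ih =>
    have h1 : transposeWord (l :: W) = transposeWord W ++ [(l.2.1, l.1, l.2.2)] := by
      simp [transposeWord]
    rw [h1, word_append, mul_apply, ← ih]
    obtain ⟨i, j, k⟩ := l
    rw [word_cons, mul_apply]
    simp only [word_cons, word_nil, mul_one]
    rfl

lemma PairOp.transpose {N : ∀ θ, Module.End ℂ (M θ).dual.H} {N' : ∀ θ, Module.End ℂ (M' θ).dual.H}
    (h : PairOp Ω (fun θ => (M θ).dual) (fun θ => (M' θ).dual) p s N N') :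
    ∃ L L', PairOp Ω M M' p s L L' ∧ (∀ θ ξ m, (M θ).toDual (N θ ξ) m = (M θ).toDual ξ (L θ m)) ∧
      ∀ θ ξ m, (M' θ).toDual (N' θ ξ) m = (M' θ).toDual ξ (L' θ m) := by
  induction h with
  | word W hW => exact ⟨_, _, .word _ hW.transpose, fun θ ξ m => word_dual _ _ _ _ _,
      fun θ ξ m => word_dual _ _ _ _ _⟩
  | add _ _ ih1 ih2 =>
    obtain ⟨L1, L1', h1, h2, h3⟩ := ih1
    obtain ⟨L2, L2', h4, h5, h6⟩ := ih2
    refine ⟨_, _, h1.add h4, fun θ ξ m => ?_, fun θ ξ m => ?_⟩ <;>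
      simp only [ladd_apply, map_add, h2, h5, h3, h6]
  | smul φ hφ _ ih =>
    obtain ⟨L1, L1', h1, h2, h3⟩ := ih
    refine ⟨_, _, h1.smul φ hφ, fun θ ξ m => ?_, fun θ ξ m => ?_⟩ <;>
      simp only [lsmul_apply, map_smul, h2, h3]

end Pair

/-! ### Dual Bethe vectors -/

section Bra

variable {c : ℂ} (M : Model.{uM} c) {a b : ℕ}

lemma symT3_dual (hc : c ≠ 0) (j : Fin 3) (hj : j ≠ 2) {x : Pts a} {X : Finset (Fin a)}
    (hx : Admissible c x X) (ξ : M.dual.H) (m : M.H) : M.toDual (symT3 M.dual j x X ξ) m =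
      M.toDual ξ (symT3' M j x X m) := by
  induction X using induction_on_max generalizing m with
  | empty => simp [symT3', opProd, Delta']
  | insert k X hk ih =>
    have hkX : k ∉ X := fun h => lt_irrefl _ (hk k h)
    have hD : Delta' (h c) x (insert k X) = Delta' (h c) x X * ∏ i ∈ X, h c (x i) (x k) := by
      simp only [Delta']
      rw [prod_insert hkX]
      have h1 : (insert k X).filter (fun j => k < j) = ∅ := by
        refine filter_eq_empty_iff.2 fun i hi => ?_
        rcases mem_insert.1 hi with rfl | hi
        exacts [lt_irrefl _, (hk i hi).not_gt]
      rw [h1, prod_empty, one_mul, ← prod_mul_distrib]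
      refine prod_congr rfl fun i hi => ?_
      rw [filter_insert, if_pos (hk i hi), prod_insert, mul_comm]
      exact fun e => hkX (mem_filter.1 e).1
    have h1 : symT3' M j x (insert k X) = (∏ i ∈ X, h c (x i) (x k))⁻¹ •
        (symT3' M j x X * M.T 2 j (x k)) := by
      rw [symT3', symT3', hD, opProd_insert_max M x _ _ hk, mul_inv, smul_mul_assoc, smul_smul,
        mul_comm]
    rw [symT3_insert_left M.dual x hc j hj hkX hx.inj hx.h_ne, h1, lsmul_apply,
      lsmul_apply, map_smul, map_smul, mul_apply, mul_apply,
      lsmul_apply, ← ih (hx.mono (subset_insert _ _))]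
    rfl

lemma opProd_dual {x : Pts a} {X : Finset (Fin a)} (hx : Set.InjOn x X) (ξ : M.dual.H) (m : M.H) :
    M.toDual (opProd M.dual 0 1 x X ξ) m = M.toDual ξ (opProd M 1 0 x X m) := by
  induction X using induction_on_max generalizing m with
  | empty => simp
  | insert k X hk ih =>
    have hkX : k ∉ X := fun h => lt_irrefl _ (hk k h)
    rw [opProd01_insert_left M.dual hkX hx, opProd_insert_max M x _ _ hk, mul_apply,
      mul_apply, ← ih (hx.mono (by simp))]
    rfl

lemma bra_eq_ket_dual (hc : c ≠ 0) {u : Pts a} {v : Pts b} {A : Finset (Fin a)}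
    {B : Finset (Fin b)} (hu : Admissible c u A) (hv : Admissible c v B) :
    bra M u v A B = (-1 : ℂ) ^ (B.card * (B.card - 1) / 2) • M.toDual (ket M.dual u v A B) := by
  rw [bra, ket, map_sum]
  congr 1
  refine sum_congr rfl fun A₁ hA₁ => ?_
  rw [map_sum]
  refine sum_congr rfl fun B₁ hB₁ => ?_
  rw [map_smul]
  congr 1
  refine LinearMap.ext fun m => ?_
  have hA := mem_powerset.1 hA₁
  have hB := mem_powerset.1 (mem_filter.1 hB₁).1
  rw [mul_apply, mul_apply]
  have h1 := symT3_dual M hc 0 (by decide) (hu.mono hA) (opProd M.dual 0 1 u (A \ A₁)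
    (symT3 M.dual 1 v (B \ B₁) M.dual.vac)) m
  have h2 := opProd_dual M (hu.mono (sdiff_subset (s := A) (t := A₁))).inj
    (symT3 M.dual 1 v (B \ B₁) M.dual.vac) (symT3' M 0 u A₁ m)
  have h3 := symT3_dual M hc 1 (by decide) (hv.mono (sdiff_subset (s := B) (t := B₁))) M.covac
    (opProd M 1 0 u (A \ A₁) (symT3' M 0 u A₁ m))
  refine Eq.trans ?_ (h1.trans (h2.trans h3)).symm
  rfl

end Bra

/-! ### Bethe vectors as combinations of words -/

section KetPair

variable {c : ℂ} {K Θ : Type} {a b : ℕ}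

/-- The labels of a set of particles. -/
def labs (ku : Fin a → K) (kv : Fin b → K) (A : Finset (Fin a)) (B : Finset (Fin b)) : Set K :=
  ku '' A ∪ kv '' B

@[simp] theorem mem_labs {ku : Fin a → K} {kv : Fin b → K} {A : Finset (Fin a)}
    {B : Finset (Fin b)} {k : K} :
    k ∈ labs ku kv A B ↔ (∃ i ∈ A, ku i = k) ∨ ∃ j ∈ B, kv j = k := by simp [labs]

lemma labs_mono {ku : Fin a → K} {kv : Fin b → K} {A A' : Finset (Fin a)} {B B' : Finset (Fin b)}
    (hA : A ⊆ A') (hB : B ⊆ B') : labs ku kv A B ⊆ labs ku kv A' B' :=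
  Set.union_subset_union (Set.image_mono (by exact_mod_cast hA))
    (Set.image_mono (by exact_mod_cast hB))

lemma mem_labs_u {ku : Fin a → K} {kv : Fin b → K} {A : Finset (Fin a)} {B : Finset (Fin b)}
    {i : Fin a} (hi : i ∈ A) : ku i ∈ labs ku kv A B := .inl ⟨i, by simpa using hi, rfl⟩

lemma mem_labs_v {ku : Fin a → K} {kv : Fin b → K} {A : Finset (Fin a)} {B : Finset (Fin b)}
    {j : Fin b} (hj : j ∈ B) : kv j ∈ labs ku kv A B := .inr ⟨j, by simpa using hj, rfl⟩

structure IsLabelling (ku : Fin a → K) (kv : Fin b → K) : Prop where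
  u_inj : Function.Injective ku
  v_inj : Function.Injective kv
  u_ne_v : ∀ i j, ku i ≠ kv j

/-- The rational functions of the rapidities that enter a Bethe vector are functions in `Ω`. -/
structure PtReg (c : ℂ) (Ω : FunAlg Θ) (p : Θ → K → ℂ) (ku : Fin a → K)
    (kv : Fin b → K) (A : Finset (Fin a)) (B : Finset (Fin b)) : Prop where
  inj : ∀ θ, Set.InjOn (p θ) (labs ku kv A B)
  sub_mem : ∀ k ∈ labs ku kv A B, ∀ l ∈ labs ku kv A B, (fun θ => p θ k - p θ l) ∈ Ω
  g_mem : ∀ k ∈ labs ku kv A B, ∀ l ∈ labs ku kv A B, k ≠ l → (fun θ => g c (p θ k) (p θ l)) ∈ Ω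
  hu_ne : ∀ θ, ∀ i ∈ A, ∀ l ∈ A, h c (p θ (ku i)) (p θ (ku l)) ≠ 0
  hu_inv : ∀ i ∈ A, ∀ l ∈ A, (fun θ => (h c (p θ (ku i)) (p θ (ku l)))⁻¹) ∈ Ω
  hv_ne : ∀ θ, ∀ i ∈ B, ∀ l ∈ B, h c (p θ (kv i)) (p θ (kv l)) ≠ 0
  hv_inv : ∀ i ∈ B, ∀ l ∈ B, (fun θ => (h c (p θ (kv i)) (p θ (kv l)))⁻¹) ∈ Ω
  f_ne : ∀ θ, ∀ j ∈ B, ∀ i ∈ A, f c (p θ (kv j)) (p θ (ku i)) ≠ 0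
  f_inv : ∀ j ∈ B, ∀ i ∈ A, (fun θ => (f c (p θ (kv j)) (p θ (ku i)))⁻¹) ∈ Ω

variable {Ω : FunAlg Θ} {M : Θ → Model.{u₁} c} {M' : Θ → Model.{u₂} c}
  {p : Θ → K → ℂ} {ku : Fin a → K} {kv : Fin b → K} {A A' : Finset (Fin a)}
  {B B' : Finset (Fin b)}

lemma PtReg.mono (hp : PtReg c Ω p ku kv A B) (hA : A' ⊆ A) (hB : B' ⊆ B) :
    PtReg c Ω p ku kv A' B' where
  inj θ := (hp.inj θ).mono (labs_mono hA hB)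
  sub_mem k hk l hl := hp.sub_mem k (labs_mono hA hB hk) l (labs_mono hA hB hl)
  g_mem k hk l hl := hp.g_mem k (labs_mono hA hB hk) l (labs_mono hA hB hl)
  hu_ne θ i hi l hl := hp.hu_ne θ i (hA hi) l (hA hl)
  hu_inv i hi l hl := hp.hu_inv i (hA hi) l (hA hl)
  hv_ne θ i hi l hl := hp.hv_ne θ i (hB hi) l (hB hl)
  hv_inv i hi l hl := hp.hv_inv i (hB hi) l (hB hl)
  f_ne θ j hj i hi := hp.f_ne θ j (hB hj) i (hA hi)
  f_inv j hj i hi := hp.f_inv j (hB hj) i (hA hi)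

lemma PtReg.f_mem (hp : PtReg c Ω p ku kv A B) {k l : K} (hk : k ∈ labs ku kv A B)
    (hl : l ∈ labs ku kv A B) (hkl : k ≠ l) : (fun θ => f c (p θ k) (p θ l)) ∈ Ω := by
  have : (fun θ => f c (p θ k) (p θ l)) = fun θ => 1 + g c (p θ k) (p θ l) :=
    funext fun θ => f_eq fun e => hkl (hp.inj θ hk hl e)
  rw [this]
  exact fun_add_mem (const_mem 1) (hp.g_mem k hk l hl hkl)

lemma PtReg.h_mem (hp : PtReg c Ω p ku kv A B) {k l : K} (hk : k ∈ labs ku kv A B)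
    (hl : l ∈ labs ku kv A B) : (fun θ => h c (p θ k) (p θ l)) ∈ Ω := by
  have : (fun θ => h c (p θ k) (p θ l)) = fun θ => (p θ k - p θ l + I * c) * (I * c)⁻¹ :=
    funext fun θ => by rw [h, div_eq_mul_inv]
  rw [this]
  exact fun_mul_mem (fun_add_mem (hp.sub_mem k hk l hl) (const_mem _)) (const_mem _)

lemma PtReg.admissible_u (hp : PtReg c Ω p ku kv A B) (hk : IsLabelling ku kv) (θ : Θ) :
    Admissible c (fun i => p θ (ku i)) A :=
  ⟨fun _ hi _ hl e => hk.u_inj (hp.inj θ (mem_labs_u hi) (mem_labs_u hl) e), hp.hu_ne θ⟩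

lemma PtReg.admissible_v (hp : PtReg c Ω p ku kv A B) (hk : IsLabelling ku kv) (θ : Θ) :
    Admissible c (fun i => p θ (kv i)) B :=
  ⟨fun _ hi _ hl e => hk.v_inj (hp.inj θ (mem_labs_v hi) (mem_labs_v hl) e), hp.hv_ne θ⟩

lemma pair_opProd {k : Fin a → K} (hk : Function.Injective k) (i j : Fin 3) (X : Finset (Fin a)) :
    PairOp Ω M M' p (k '' X) (fun θ => opProd (M θ) i j (fun l => p θ (k l)) X)
      (fun θ => opProd (M' θ) i j (fun l => p θ (k l)) X) := by
  have := PairOp.word (Ω := Ω) (M := M) (M' := M') (p := p) (s := k '' X)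
    (X.sort.map fun l => (i, j, k l)) ⟨by
      simpa [Function.comp_def] using (sort_nodup X (· ≤ ·)).map hk, by simp [hk.eq_iff]⟩
  simpa [word, opProd, Function.comp_def] using this

lemma pair_symT3 {k : Fin a → K} (hk : Function.Injective k) (j : Fin 3) {X : Finset (Fin a)}
    (hh : ∀ i ∈ X, ∀ l ∈ X, (fun θ => (h c (p θ (k i)) (p θ (k l)))⁻¹) ∈ Ω) :
    PairOp Ω M M' p (k '' X) (fun θ => symT3 (M θ) j (fun l => p θ (k l)) X)
      (fun θ => symT3 (M' θ) j (fun l => p θ (k l)) X) := by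
  refine (pair_opProd hk j 2 X).smul (fun θ => (Delta (h c) (fun l => p θ (k l)) X)⁻¹) ?_
  exact fun_prod_inv_mem _ fun i hi => fun_prod_inv_mem _ fun l hl => hh i hi l (mem_filter.1 hl).1

local notation "U(" θ ")" => fun l => p θ (ku l)

local notation "V(" θ ")" => fun l => p θ (kv l)

lemma pair_symT3_opProd (hk : IsLabelling ku kv) (hp : PtReg c Ω p ku kv A B)
    {I : Finset (Fin a)} (hI : I ⊆ A) : PairOp Ω M M' p (ku '' A)
      (fun θ => symT3 (M θ) 0 U(θ) I * opProd (M θ) 0 1 U(θ) (A \ I))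
      (fun θ => symT3 (M' θ) 0 U(θ) I * opProd (M' θ) 0 1 U(θ) (A \ I)) := by
  refine (PairOp.mul (pair_symT3 hk.u_inj 0 fun i hi l hl => hp.hu_inv i (hI hi) l (hI hl))
    (pair_opProd hk.u_inj 0 1 (A \ I)) ?_).mono ?_
  · rw [Set.disjoint_image_iff hk.u_inj, disjoint_coe]
    exact disjoint_sdiff
  · rw [← Set.image_union]
    refine Set.image_mono ?_
    exact_mod_cast union_subset hI sdiff_subset

lemma PtReg.prod2_g_vu (hk : IsLabelling ku kv) (hp : PtReg c Ω p ku kv A B) :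
    (fun θ => prod2 (g c) V(θ) B U(θ) A) ∈ Ω :=
  fun_prod2_mem fun j hj i hi => hp.g_mem _ (mem_labs_v hj) _ (mem_labs_u hi) (hk.u_ne_v i j).symm

lemma PtReg.prod2_f_uu (hk : IsLabelling ku kv) (hp : PtReg c Ω p ku kv A B)
    {X Y : Finset (Fin a)} (hX : X ⊆ A) (hY : Y ⊆ A) (hXY : Disjoint X Y) :
    (fun θ => prod2 (f c) U(θ) X U(θ) Y) ∈ Ω :=
  fun_prod2_mem fun _ hi _ hl => hp.f_mem (mem_labs_u (hX hi)) (mem_labs_u (hY hl)) fun e =>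
    disjoint_left.1 hXY hi (hk.u_inj e ▸ hl)

lemma PtReg.prod2_g_vv (hk : IsLabelling ku kv) (hp : PtReg c Ω p ku kv A B)
    {X Y : Finset (Fin b)} (hX : X ⊆ B) (hY : Y ⊆ B) (hXY : Disjoint X Y) :
    (fun θ => prod2 (g c) V(θ) X V(θ) Y) ∈ Ω :=
  fun_prod2_mem fun _ hi _ hl => hp.g_mem _ (mem_labs_v (hX hi)) _ (mem_labs_v (hY hl)) fun e =>
    disjoint_left.1 hXY hi (hk.v_inj e ▸ hl)

lemma PtReg.prod2_h_uu (hp : PtReg c Ω p ku kv A B) : (fun θ => prod2 (h c) U(θ) A U(θ) A) ∈ Ω :=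
  fun_prod2_mem fun _ hi _ hl => hp.h_mem (mem_labs_u hi) (mem_labs_u hl)

lemma PtReg.partCoeff_mem (hk : IsLabelling ku kv) (hp : PtReg c Ω p ku kv A B)
    {A₁ : Finset (Fin a)} {B₁ : Finset (Fin b)} (hA : A₁ ⊆ A) (hB : B₁ ⊆ B) :
    (fun θ => partCoeff c U(θ) V(θ) A A₁ B B₁) ∈ Ω := by
  simp only [partCoeff, div_eq_mul_inv]
  refine fun_mul_mem (fun_mul_mem (fun_mul_mem (fun_mul_mem ?_ ?_) ?_) ?_) ?_
  · exact (hp.mono hA hB).prod2_g_vu hk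
  · exact hp.prod2_f_uu hk hA sdiff_subset disjoint_sdiff
  · exact hp.prod2_g_vv hk sdiff_subset hB sdiff_disjoint
  · exact (hp.mono hA hB).prod2_h_uu
  · exact fun_prod2_inv_mem fun j hj i hi => hp.f_inv j hj i hi

lemma labs_disjoint (hk : IsLabelling ku kv) (X : Finset (Fin a)) (Y : Finset (Fin b)) :
    Disjoint (ku '' X) (kv '' Y) := by
  rw [Set.disjoint_left]
  rintro _ ⟨i, _, rfl⟩ ⟨j, _, e⟩
  exact hk.u_ne_v i j e.symm

lemma pair_three (hk : IsLabelling ku kv) (hp : PtReg c Ω p ku kv A B) {I : Finset (Fin a)}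
    (hI : I ⊆ A) {X : Finset (Fin b)} (hX : X ⊆ B) : PairOp Ω M M' p (labs ku kv A B)
      (fun θ => symT3 (M θ) 0 U(θ) I * opProd (M θ) 0 1 U(θ) (A \ I) * symT3 (M θ) 1 V(θ) X)
      (fun θ => symT3 (M' θ) 0 U(θ) I * opProd (M' θ) 0 1 U(θ) (A \ I) * symT3 (M' θ) 1 V(θ) X) :=
  ((pair_symT3_opProd hk hp hI).mul (pair_symT3 hk.v_inj 1 fun i hi l hl =>
    hp.hv_inv i (hX hi) l (hX hl)) (labs_disjoint hk A X)).mono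
    (Set.union_subset_union_right _ (Set.image_mono (by exact_mod_cast hX)))

lemma pair_ketOp (hk : IsLabelling ku kv) (hp : PtReg c Ω p ku kv A B) {ψ : Θ → Pts b}
    (hψ : ∀ j ∈ B, (fun θ => ψ θ j) ∈ Ω) : PairOp Ω M M' p (labs ku kv A B)
      (fun θ => ketOp (M θ) U(θ) V(θ) (ψ θ) A B) (fun θ => ketOp (M' θ) U(θ) V(θ) (ψ θ) A B) := by
  refine PairOp.sum _ fun A₁ hA₁ => PairOp.sum _ fun B₁ hB₁ => ?_
  have hA := mem_powerset.1 hA₁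
  have hB := mem_powerset.1 (mem_filter.1 hB₁).1
  exact (pair_three hk hp hA sdiff_subset).smul _ (fun_mul_mem (hp.partCoeff_mem hk hA hB)
    (fun_prod_mem _ fun j hj => hψ j (sdiff_subset hj)))

lemma pair_partSum (hk : IsLabelling ku kv) (hp : PtReg c Ω p ku kv A B) {V : Finset (Fin b)}
    (hV : V ⊆ B) : PairOp Ω M M' p (ku '' A) (fun θ => partSum (M θ) U(θ) V(θ) A V)
      (fun θ => partSum (M' θ) U(θ) V(θ) A V) := by
  refine PairOp.sum _ fun I hI => PairOp.ite fun _ => ?_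
  have hA := mem_powerset.1 hI
  refine (pair_symT3_opProd hk hp hA).smul _ (fun_mul_mem (fun_mul_mem ?_ ?_) ?_)
  · exact (hp.mono hA hV).prod2_g_vu hk
  · exact hp.prod2_f_uu hk hA sdiff_subset disjoint_sdiff
  · exact (hp.mono hA hV).prod2_h_uu

/-- `λ₂` does not vanish at the points of `s`, its inverse belongs to `Ω`, and it is the same
in both families of models. -/
structure LamReg (Ω : FunAlg Θ) (M : Θ → Model.{u₁} c) (M' : Θ → Model.{u₂} c)
    (p : Θ → K → ℂ) (s : Set K) : Prop where
  ne : ∀ θ, ∀ k ∈ s, (M θ).lam 1 (p θ k) ≠ 0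
  inv_mem : ∀ k ∈ s, (fun θ => ((M θ).lam 1 (p θ k))⁻¹) ∈ Ω
  eq : ∀ θ, ∀ k ∈ s, (M θ).lam 1 (p θ k) = (M' θ).lam 1 (p θ k)

lemma LamReg.mono {s t : Set K} (hl : LamReg Ω M M' p t) (hst : s ⊆ t) : LamReg Ω M M' p s :=
  ⟨fun θ k hk => hl.ne θ k (hst hk), fun k hk => hl.inv_mem k (hst hk),
    fun θ k hk => hl.eq θ k (hst hk)⟩

lemma pair_tVec (hk : IsLabelling ku kv) (hp : PtReg c Ω p ku kv A B)
    (hl : LamReg Ω M M' p (kv '' B)) : PairVec Ω M M' p (kv '' B) (fun θ => tVec (M θ) V(θ) B)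
      (fun θ => tVec (M' θ) V(θ) B) := by
  have h1 : ∀ θ, ∏ j ∈ B, (M' θ).lam 1 (p θ (kv j)) = ∏ j ∈ B, (M θ).lam 1 (p θ (kv j)) :=
    fun θ => prod_congr rfl fun j hj => (hl.eq θ _ ⟨j, by simpa using hj, rfl⟩).symm
  simp only [tVec, h1]
  exact PairVec.smul (fun_prod_inv_mem _ fun j hj => hl.inv_mem _ ⟨j, by simpa using hj, rfl⟩)
    (pair_symT3 hk.v_inj 1 hp.hv_inv).vec

lemma pair_eRest (hc : c ≠ 0) (hk : IsLabelling ku kv) {k : Fin a}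
    (hp : PtReg c Ω p ku kv (insert k A) B)
    (hl : LamReg Ω M M' p (kv '' B)) (hly : ∀ θ, (M θ).lam 1 (p θ (ku k)) ≠ 0)
    (hly' : ∀ θ, (M' θ).lam 1 (p θ (ku k)) ≠ 0) :
    PairVec Ω M M' p (kv '' B) (fun θ => eRest (M θ) V(θ) (p θ (ku k)) B)
      (fun θ => eRest (M' θ) V(θ) (p θ (ku k)) B) := by
  induction B using Finset.induction_on with
  | empty => simpa only [eRest_empty] using ⟨_, _, .zero, fun _ => by simp, fun _ => by simp⟩
  | insert z X hz ih =>
    have hsub : kv '' X ⊆ kv '' (insert z X : Finset (Fin b)) := Set.image_mono (by simp)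
    have hzz : kv z ∈ kv '' (insert z X : Finset (Fin b)) := ⟨z, by simp, rfl⟩
    have hpX := hp.mono subset_rfl (subset_insert z X)
    have hlX := hl.mono hsub
    have hlj : ∀ j ∈ insert z X, kv j ∈ kv '' (insert z X : Finset (Fin b)) := fun j hj =>
      ⟨j, by exact_mod_cast hj, rfl⟩
    have hy : ∀ θ, ∀ j ∈ insert z X, p θ (ku k) ≠ p θ (kv j) := fun θ j hj e =>
      hk.u_ne_v k j (hp.inj θ (mem_labs_u (by simp)) (mem_labs_v hj) e)
    have e1 : (fun θ => eRest (M θ) V(θ) (p θ (ku k)) (insert z X)) = _ :=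
      funext fun θ => eRest_insert hc hz (hp.admissible_v hk θ) (fun j hj => hl.ne θ _ (hlj j hj))
        (hly θ) (hy θ)
    have e2 : (fun θ => eRest (M' θ) V(θ) (p θ (ku k)) (insert z X)) = _ :=
      funext fun θ => eRest_insert hc hz (hp.admissible_v hk θ)
        (fun j hj => by rw [← hl.eq θ _ (hlj j hj)]; exact hl.ne θ _ (hlj j hj)) (hly' θ) (hy θ)
    rw [e1, e2]
    simp only [← hl.eq _ _ hzz]
    have hins : kv '' (insert z X : Finset (Fin b)) = {kv z} ∪ kv '' X := by
      rw [coe_insert, Set.image_insert_eq, Set.insert_eq]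
    have hdis : Disjoint ({kv z} : Set K) (kv '' X) := by
      rw [Set.disjoint_singleton_left]
      rintro ⟨j, hj, e⟩
      exact hz (hk.v_inj e ▸ by simpa using hj)
    refine PairVec.smul (fun_mul_inv_mem (hl.inv_mem _ hzz) (fun_prod_inv_mem _ fun i hi =>
      hp.hv_inv i (by simp [hi]) z (by simp))) (PairVec.add ?_ (PairVec.smul ?_ ?_))
    · rw [hins]
      exact (PairOp.letter (by simp) 1 2).apply (ih hpX hlX) hdis
    · refine fun_mul_mem (hp.g_mem _ (mem_labs_v (by simp)) _ (mem_labs_u (by simp))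
        (hk.u_ne_v k z).symm) (fun_prod_mem _ fun j hj => hp.f_mem (mem_labs_v (by simp [hj]))
          (mem_labs_u (by simp)) (hk.u_ne_v k j).symm)
    · rw [hins]
      exact (PairOp.letter (by simp) 0 2).apply (pair_tVec hk hpX hlX) hdis

lemma LamReg.prod_u_eq (hl : LamReg Ω M M' p (labs ku kv A B)) (θ : Θ) :
    ∏ i ∈ A, (M' θ).lam 1 (p θ (ku i)) = ∏ i ∈ A, (M θ).lam 1 (p θ (ku i)) :=
  prod_congr rfl fun _ hi => (hl.eq θ _ (mem_labs_u hi)).symm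

lemma pair_ketRestU (hc : c ≠ 0) (hk : IsLabelling ku kv) {k : Fin a}
    (hp : PtReg c Ω p ku kv (insert k A) B) (hl : LamReg Ω M M' p (labs ku kv A B))
    (hly : ∀ θ, (M θ).lam 1 (p θ (ku k)) ≠ 0) (hly' : ∀ θ, (M' θ).lam 1 (p θ (ku k)) ≠ 0) :
    PairVec Ω M M' p (labs ku kv A B) (fun θ => ketRestU (M θ) U(θ) V(θ) A B k)
      (fun θ => ketRestU (M' θ) U(θ) V(θ) A B k) := by
  have hpA := hp.mono (subset_insert k A) subset_rfl
  simp only [ketRestU, hl.prod_u_eq]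
  refine PairVec.smul ?_ (PairVec.sum _ fun V hV => PairVec.smul ?_ ?_)
  · refine fun_mul_inv_mem (fun_mul_inv_mem ?_ ?_) ?_
    · exact fun_prod_inv_mem _ fun i hi => hl.inv_mem _ (mem_labs_u hi)
    · exact fun_prod2_inv_mem fun j hj i hi => hp.f_inv j hj i (by simp [hi])
    · exact fun_prod_inv_mem _ fun j hj => hp.f_inv j hj k (by simp)
  · have hVB := mem_powerset.1 hV
    refine fun_mul_mem (hp.prod2_g_vv hk sdiff_subset hVB sdiff_disjoint)
      (fun_prod_mem _ fun j hj => hp.f_mem (mem_labs_v (hVB hj)) (mem_labs_u (by simp))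
        (hk.u_ne_v k j).symm)
  · have hVB := mem_powerset.1 hV
    have hsub : kv '' (B \ V : Finset (Fin b)) ⊆ kv '' B := Set.image_mono (by simp)
    exact ((pair_partSum hk hpA hVB).apply (pair_eRest hc hk
      (hp.mono subset_rfl sdiff_subset) (hl.mono (hsub.trans Set.subset_union_right)) hly hly')
      (labs_disjoint hk _ _)).mono (Set.union_subset_union_right _ hsub)

lemma pair_ketRestV (hk : IsLabelling ku kv) {k : Fin b}
    (hp : PtReg c Ω p ku kv A (insert k B)) (hl : LamReg Ω M M' p (labs ku kv A B)) :
    PairVec Ω M M' p (labs ku kv A B) (fun θ => ketRestV (M θ) U(θ) V(θ) A B k)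
      (fun θ => ketRestV (M' θ) U(θ) V(θ) A B k) := by
  have hpB := hp.mono subset_rfl (subset_insert k B)
  simp only [ketRestV, hl.prod_u_eq]
  refine PairVec.smul (fun_prod_inv_mem _ fun i hi => hl.inv_mem _ (mem_labs_u hi))
    (PairVec.sum _ fun A₁ hA₁ => PairVec.sum _ fun B₁ hB₁ => ?_)
  have hA := mem_powerset.1 hA₁
  have hB := mem_powerset.1 (mem_filter.1 hB₁).1
  have e : ∀ θ, ∏ j ∈ B \ B₁, ((M' θ).lam 1 (p θ (kv j)))⁻¹ =
      ∏ j ∈ B \ B₁, ((M θ).lam 1 (p θ (kv j)))⁻¹ := fun θ =>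
    prod_congr rfl fun j hj => by rw [hl.eq θ _ (mem_labs_v (sdiff_subset hj))]
  simp only [e]
  exact PairVec.smul (fun_mul_mem (hp.partCoeff_mem hk hA (insert_subset_insert _ hB))
    (fun_prod_mem _ fun j hj => hl.inv_mem _ (mem_labs_v (sdiff_subset hj))))
    (pair_three hk hpB hA sdiff_subset).vec

lemma pair_ket (hk : IsLabelling ku kv) (hp : PtReg c Ω p ku kv A B)
    (hl : LamReg Ω M M' p (labs ku kv A B)) : PairVec Ω M M' p (labs ku kv A B)
      (fun θ => ket (M θ) U(θ) V(θ) A B) (fun θ => ket (M' θ) U(θ) V(θ) A B) := by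
  have e : ∀ θ, ketOp (M' θ) U(θ) V(θ)
      (fun j => ((M' θ).lam 1 (p θ (kv j)))⁻¹) A B =
      ketOp (M' θ) U(θ) V(θ)
        (fun j => ((M θ).lam 1 (p θ (kv j)))⁻¹) A B := by
    intro θ
    refine sum_congr rfl fun A₁ _ => sum_congr rfl fun B₁ _ => ?_
    congr 2
    exact prod_congr rfl fun j hj => by simp only [hl.eq θ _ (mem_labs_v (sdiff_subset hj))]
  simp only [ket_eq_ketOp, hl.prod_u_eq, e]
  exact PairVec.smul (fun_prod_inv_mem _ fun i hi => hl.inv_mem _ (mem_labs_u hi))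
    (pair_ketOp hk hp fun j hj => hl.inv_mem _ (mem_labs_v hj)).vec

end KetPair

/-! ### Matrix elements between vectors with a peeled particle -/

section Peeled

variable {c : ℂ} {K Θ : Type} {Ω : FunAlg Θ} {M : Θ → Model.{u₁} c}
  {M' : Θ → Model.{u₂} c} {p : Θ → K → ℂ} {s sK sB sO : Set K}

lemma PairVec.toDual {η : ∀ θ, (M θ).dual.H} {η' : ∀ θ, (M' θ).dual.H}
    (hη : PairVec Ω (fun θ => (M θ).dual) (fun θ => (M' θ).dual) p s η η') :
    ∃ L L', PairOp Ω M M' p s L L' ∧ (∀ θ m, (M θ).toDual (η θ) m = (M θ).covac (L θ m)) ∧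
      ∀ θ m, (M' θ).toDual (η' θ) m = (M' θ).covac (L' θ m) := by
  obtain ⟨N, N', h1, h2, h3⟩ := hη
  obtain ⟨L, L', h4, h5, h6⟩ := h1.transpose
  exact ⟨L, L', h4, fun θ m => by rw [h2, h5]; rfl, fun θ m => by rw [h3, h6]; rfl⟩

lemma PairOp.vev_lower_eq {N : Ops M} {N' : Ops M'}
    (h : PairOp Ω M M' p s N N') {θ : Θ} {x : K} (hx : x ∉ s) (hs : Set.InjOn (p θ) (insert x s))
    (hlam : ∀ i, ∀ k ∈ s, (M θ).lam i (p θ k) = (M' θ).lam i (p θ k)) (σ : Fin 2) (a a' : ℂ)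
    (ha : ∀ i : Fin 3, (i = σ.castSucc ∨ i = σ.succ) →
      a * (M θ).lam i (p θ x) = a' * (M' θ).lam i (p θ x)) :
    a * (M θ).covac ((M θ).T σ.succ σ.castSucc (p θ x) (N θ (M θ).vac)) =
      a' * (M' θ).covac ((M' θ).T σ.succ σ.castSucc (p θ x) (N' θ (M' θ).vac)) := by
  induction h with
  | word W hW =>
    have h1 := vev_raise_congr (M θ).dual (M' θ).dual hx hs hlam σ a a' ha hW.transpose
    have h2 : ∀ (v : Word K), transposeWord (transposeWord v) = v := fun v => by
      simp [transposeWord, Function.comp_def]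
    have h3 : transposeWord (transposeWord W ++ [raise σ x]) = lowerL σ x :: W := by
      rw [← h2 (lowerL σ x :: W)]
      congr 1
      simp [transposeWord, raise, lowerL]
    have h4 : ∀ (X : Model.{u₁} c), vev X.dual (p θ) (transposeWord W ++ [raise σ x]) =
        vev X (p θ) (lowerL σ x :: W) := fun X =>
      (word_dual X (p θ) (transposeWord W ++ [raise σ x]) X.dual.vac X.vac).trans (by rw [h3]; rfl)
    have h5 : ∀ (X : Model.{u₂} c), vev X.dual (p θ) (transposeWord W ++ [raise σ x]) =
        vev X (p θ) (lowerL σ x :: W) := fun X =>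
      (word_dual X (p θ) (transposeWord W ++ [raise σ x]) X.dual.vac X.vac).trans (by rw [h3]; rfl)
    rw [h4, h5] at h1
    simpa [vev, lowerL] using h1
  | add _ _ ih1 ih2 => simp only [ladd_apply, map_add, mul_add, ih1, ih2]
  | smul φ hφ _ ih => simp only [lsmul_apply, map_smul, smul_eq_mul, mul_left_comm _ (φ θ), ih]

variable {N : Ops M} {N' : Ops M'}
  {O : Ops M} {O' : Ops M'}
  {L : ∀ θ, Module.End ℂ (M θ).dual.H} {L' : ∀ θ, Module.End ℂ (M' θ).dual.H}

lemma toDual_peeled {M : Model.{u₁} c} {L P : Module.End ℂ _} {η R : M.dual.H} {β : ℂ} {τ : Fin 2}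
    {x : ℂ} {P₂ : Module.End ℂ M.H} (hP : ∀ ξ m, M.toDual (L ξ) m = M.toDual ξ (P m))
    (hR : ∀ m, M.toDual R m = M.covac (P₂ m))
    (hη : η = β • L (M.dual.T τ.castSucc τ.succ x M.dual.vac) + R) (m : M.H) :
    M.toDual η m = β * M.covac (M.T τ.succ τ.castSucc x (P m)) + M.covac (P₂ m) := by
  rw [hη, map_add, map_smul, ladd_apply, lsmul_apply, hP, hR]
  rfl

/-- **Residue of a matrix element** between a vector with a creation operator at `y` and a dual
vector with an annihilation operator at `x`. -/
lemma residue_of_peeled {x y : K} (σ τ : Fin 2)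
    (hBO : Disjoint sB sO) (hBK : Disjoint sB sK) (hOK : Disjoint sO sK)
    (hx : x ∉ sB ∪ (sO ∪ sK)) (hy : y ∉ sB ∪ (sO ∪ sK))
    (hX : RegOn Ω M p (insert x (sB ∪ (sO ∪ sK)))) (hY : RegOn Ω M p (insert y (sB ∪ (sO ∪ sK))))
    (hM' : IsModified M M' p (sB ∪ (sO ∪ sK)) σ y)
    (hN : PairOp Ω M M' p sK N N') (hO : PairOp Ω M M' p sO O O')
    (hL : PairOp Ω (fun θ => (M θ).dual) (fun θ => (M' θ).dual) p sB L L')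
    {R ζ : Vecs M} {R₂ η : ∀ θ, (M θ).dual.H} (hR : PairVec Ω M M p sK R R)
    (hR₂ : PairVec Ω (fun θ => (M θ).dual) (fun θ => (M θ).dual) p sB R₂ R₂)
    {α β : Θ → ℂ} (hα : α ∈ Ω) (hβ : β ∈ Ω)
    (hζ : ∀ θ, ζ θ = α θ • N θ ((M θ).T σ.castSucc σ.succ (p θ y) (M θ).vac) + R θ) (hη : ∀ θ, η θ =
      β θ • L θ ((M θ).dual.T τ.castSucc τ.succ (p θ x) (M θ).dual.vac) + R₂ θ) :
    (fun θ => (M θ).toDual (η θ) (O θ (ζ θ)) - α θ * β θ *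
      (M θ).covac ((M θ).T τ.succ τ.castSucc (p θ x)
        ((M θ).T σ.castSucc σ.succ (p θ y) (M θ).vac)) *
      (M' θ).toDual (L' θ (M' θ).dual.vac) (O' θ (N' θ (M' θ).vac))) ∈ Ω := by
  obtain ⟨P, P', hP, hP1, hP2⟩ := hL.transpose
  obtain ⟨P₂, _, hP₂, hP₂1, _⟩ := hR₂.toDual
  obtain ⟨Q, _, hQ, hQ1, _⟩ := hR
  have hLOK : Disjoint sB (sO ∪ sK) := Set.disjoint_union_right.2 ⟨hBO, hBK⟩
  have main := (hP.mul (hO.mul hN hOK) hLOK).residue hy hX hY hx σ τ hM'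
  have hyK : Disjoint (sB ∪ (sO ∪ sK)) {y} := Set.disjoint_singleton_right.2 hy
  have hxK : Disjoint {x} (sB ∪ (sO ∪ sK)) := Set.disjoint_singleton_left.2 hx
  have r1 := ((PairOp.letter (Set.mem_singleton x) τ.succ τ.castSucc).mul
    (hP.left.mul (hO.left.mul hQ hOK) hLOK) hxK).vev_mem (by rwa [← Set.insert_eq])
  have r2 := ((hP₂.mul (hO.left.mul hN.left hOK) hLOK).mul
    (PairOp.letter (Set.mem_singleton y) σ.castSucc σ.succ) hyK).vev_mem
    (by rwa [Set.union_singleton])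
  have r3 := (hP₂.mul (hO.left.mul hQ hOK) hLOK).vev_mem (hX.mono (Set.subset_insert _ _))
  simp only [mul_apply] at main r1 r2 r3
  have total := fun_add_mem (fun_add_mem (fun_mul_mem (fun_mul_mem hα hβ) main)
    (fun_mul_mem hβ r1)) (fun_add_mem (fun_mul_mem hα r2) r3)
  convert total using 1
  funext θ
  have e2 : ∀ m, (M' θ).toDual (L' θ (M' θ).dual.vac) m = (M' θ).covac (P' θ m) := fun m => by
    rw [hP2]
    rfl
  rw [toDual_peeled (hP1 θ) (hP₂1 θ) (hη θ), e2, hζ, hQ1]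
  simp only [map_add, map_smul, smul_eq_mul]
  ring

/-- A matrix element does not depend on the vacuum eigenvalues at the point of a peeled particle,
except through the ratio of the two eigenvalues of its creation operator. -/
lemma eq_of_peeled_ket {y : K} (σ : Fin 2) {θ : Θ}
    (hBO : Disjoint sB sO) (hBK : Disjoint sB sK) (hOK : Disjoint sO sK)
    (hy : y ∉ sB ∪ (sO ∪ sK)) (hs : Set.InjOn (p θ) (insert y (sB ∪ (sO ∪ sK))))
    (hlam : ∀ i, ∀ k ∈ sB ∪ (sO ∪ sK), (M θ).lam i (p θ k) = (M' θ).lam i (p θ k))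
    (hN : PairOp Ω M M' p sK N N') (hO : PairOp Ω M M' p sO O O')
    {R ζ : Vecs M} {R' ζ' : Vecs M'} {η : ∀ θ, (M θ).dual.H} {η' : ∀ θ, (M' θ).dual.H}
    (hR : PairVec Ω M M' p sK R R')
    (hη : PairVec Ω (fun θ => (M θ).dual) (fun θ => (M' θ).dual) p sB η η') {α α' : ℂ}
    (hζ : ζ θ = α • N θ ((M θ).T σ.castSucc σ.succ (p θ y) (M θ).vac) + R θ)
    (hζ' : ζ' θ = α' • N' θ ((M' θ).T σ.castSucc σ.succ (p θ y) (M' θ).vac) + R' θ)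
    (hα : ∀ i : Fin 3, (i = σ.castSucc ∨ i = σ.succ) →
      α * (M θ).lam i (p θ y) = α' * (M' θ).lam i (p θ y)) :
    (M θ).toDual (η θ) (O θ (ζ θ)) = (M' θ).toDual (η' θ) (O' θ (ζ' θ)) := by
  obtain ⟨P, P', hP, hP1, hP2⟩ := hη.toDual
  obtain ⟨Q, Q', hQ, hQ1, hQ2⟩ := hR
  have hLOK : Disjoint sB (sO ∪ sK) := Set.disjoint_union_right.2 ⟨hBO, hBK⟩
  have h1 := (hP.mul (hO.mul hN hOK) hLOK).vev_raise_eq hy hs hlam σ α α' hα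
  have h2 := (hP.mul (hO.mul hQ hOK) hLOK).vev_eq (hs.mono (Set.subset_insert _ _)) hlam
  simp only [mul_apply] at h1 h2
  rw [hP1, hP2, hζ, hζ', hQ1, hQ2]
  simp only [map_add, map_smul, smul_eq_mul, h1, h2]

lemma eq_of_peeled_bra {x : K} (τ : Fin 2) {θ : Θ}
    (hBO : Disjoint sB sO) (hBK : Disjoint sB sK) (hOK : Disjoint sO sK)
    (hx : x ∉ sB ∪ (sO ∪ sK)) (hs : Set.InjOn (p θ) (insert x (sB ∪ (sO ∪ sK))))
    (hlam : ∀ i, ∀ k ∈ sB ∪ (sO ∪ sK), (M θ).lam i (p θ k) = (M' θ).lam i (p θ k))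
    (hL : PairOp Ω (fun θ => (M θ).dual) (fun θ => (M' θ).dual) p sB L L')
    (hO : PairOp Ω M M' p sO O O') {ζ : Vecs M} {ζ' : Vecs M'} {R η : ∀ θ, (M θ).dual.H}
    {R' η' : ∀ θ, (M' θ).dual.H}
    (hR : PairVec Ω (fun θ => (M θ).dual) (fun θ => (M' θ).dual) p sB R R')
    (hζ : PairVec Ω M M' p sK ζ ζ') {β β' : ℂ}
    (hη : η θ = β • L θ ((M θ).dual.T τ.castSucc τ.succ (p θ x) (M θ).dual.vac) + R θ)
    (hη' : η' θ = β' • L' θ ((M' θ).dual.T τ.castSucc τ.succ (p θ x) (M' θ).dual.vac) + R' θ)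
    (hβ : ∀ i : Fin 3, (i = τ.castSucc ∨ i = τ.succ) →
      β * (M θ).lam i (p θ x) = β' * (M' θ).lam i (p θ x)) :
    (M θ).toDual (η θ) (O θ (ζ θ)) = (M' θ).toDual (η' θ) (O' θ (ζ' θ)) := by
  obtain ⟨P, P', hP, hP1, hP2⟩ := hL.transpose
  obtain ⟨P₂, P₂', hP₂, hP₂1, hP₂2⟩ := hR.toDual
  obtain ⟨Q, Q', hQ, hQ1, hQ2⟩ := hζ
  have hLOK : Disjoint sB (sO ∪ sK) := Set.disjoint_union_right.2 ⟨hBO, hBK⟩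
  have h1 := (hP.mul (hO.mul hQ hOK) hLOK).vev_lower_eq hx hs hlam τ β β' hβ
  have h2 := (hP₂.mul (hO.mul hQ hOK) hLOK).vev_eq (hs.mono (Set.subset_insert _ _)) hlam
  simp only [mul_apply] at h1 h2
  rw [toDual_peeled (hP1 θ) (hP₂1 θ) hη, toDual_peeled (hP2 θ) (hP₂2 θ) hη', hQ1, hQ2, h1, h2]

lemma mem_of_pairVec (hBO : Disjoint sB sO) (hBK : Disjoint sB sK) (hOK : Disjoint sO sK)
    (hs : RegOn Ω M p (sB ∪ (sO ∪ sK))) (hO : PairOp Ω M M p sO O O)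
    {ζ : Vecs M} {η : ∀ θ, (M θ).dual.H} (hζ : PairVec Ω M M p sK ζ ζ)
    (hη : PairVec Ω (fun θ => (M θ).dual) (fun θ => (M θ).dual) p sB η η) :
    (fun θ => (M θ).toDual (η θ) (O θ (ζ θ))) ∈ Ω := by
  obtain ⟨P, _, hP, hP1, _⟩ := hη.toDual
  obtain ⟨Q, _, hQ, hQ1, _⟩ := hζ
  have hLOK : Disjoint sB (sO ∪ sK) := Set.disjoint_union_right.2 ⟨hBO, hBK⟩
  have h := (hP.mul (hO.mul hQ hOK) hLOK).vev_mem hs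
  simpa only [hP1, hQ1, mul_apply] using h

lemma eq_of_pairVec {θ : Θ} (hBO : Disjoint sB sO) (hBK : Disjoint sB sK) (hOK : Disjoint sO sK)
    (hs : Set.InjOn (p θ) (sB ∪ (sO ∪ sK)))
    (hlam : ∀ i, ∀ k ∈ sB ∪ (sO ∪ sK), (M θ).lam i (p θ k) = (M' θ).lam i (p θ k))
    (hO : PairOp Ω M M' p sO O O')
    {ζ : Vecs M} {ζ' : Vecs M'} {η : ∀ θ, (M θ).dual.H} {η' : ∀ θ, (M' θ).dual.H}
    (hζ : PairVec Ω M M' p sK ζ ζ')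
    (hη : PairVec Ω (fun θ => (M θ).dual) (fun θ => (M' θ).dual) p sB η η') :
    (M θ).toDual (η θ) (O θ (ζ θ)) = (M' θ).toDual (η' θ) (O' θ (ζ' θ)) := by
  obtain ⟨P, P', hP, hP1, hP2⟩ := hη.toDual
  obtain ⟨Q, Q', hQ, hQ1, hQ2⟩ := hζ
  have hLOK : Disjoint sB (sO ∪ sK) := Set.disjoint_union_right.2 ⟨hBO, hBK⟩
  have h := (hP.mul (hO.mul hQ hOK) hLOK).vev_eq hs hlam
  simpa only [hP1, hP2, hQ1, hQ2, mul_apply] using h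

end Peeled

/-! ### Matrix elements of the operator between Bethe vectors -/

/-- Labels of the spectral parameters of a matrix element: rapidities of the Bethe vector and of
the dual Bethe vector, and arguments of the operator. -/
inductive Lbl (a b N : ℕ) : Type
  | u (i : Fin a)
  | v (j : Fin b)
  | uC (i : Fin a)
  | vC (j : Fin b)
  | w (l : Fin N)

section Melem

variable {c : ℂ} {a b N : ℕ}

/-- The matrix element of the operator `O(w̄)` between Bethe vectors. -/
def melem (M : Model.{uM} c) (p : Lbl a b N → ℂ) (κ : Coeffs N)
    (A : Finset (Fin a)) (B : Finset (Fin b)) (A' : Finset (Fin a)) (B' : Finset (Fin b)) : ℂ :=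
  bra M (fun i => p (.uC i)) (fun j => p (.vC j)) A' B'
    (operator M (fun l => p (.w l)) κ (ket M (fun i => p (.u i)) (fun j => p (.v j)) A B))

lemma isLabelling_ket : IsLabelling (Lbl.u : Fin a → Lbl a b N) Lbl.v :=
  ⟨fun _ _ => Lbl.u.inj, fun _ _ => Lbl.v.inj, fun _ _ => by simp⟩

lemma isLabelling_bra : IsLabelling (Lbl.uC : Fin a → Lbl a b N) Lbl.vC :=
  ⟨fun _ _ => Lbl.uC.inj, fun _ _ => Lbl.vC.inj, fun _ _ => by simp⟩

abbrev ketLabs (N : ℕ) (A : Finset (Fin a)) (B : Finset (Fin b)) : Set (Lbl a b N) :=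
  labs Lbl.u Lbl.v A B

abbrev braLabs (N : ℕ) (A : Finset (Fin a)) (B : Finset (Fin b)) : Set (Lbl a b N) :=
  labs Lbl.uC Lbl.vC A B

abbrev opLabs (a b N : ℕ) : Set (Lbl a b N) := Set.range Lbl.w

abbrev allLabs (N : ℕ) (A : Finset (Fin a)) (B : Finset (Fin b)) (A' : Finset (Fin a))
    (B' : Finset (Fin b)) : Set (Lbl a b N) :=
  braLabs N A' B' ∪ (opLabs a b N ∪ ketLabs N A B)

lemma disjoint_bra_op (A : Finset (Fin a)) (B : Finset (Fin b)) :
    Disjoint (braLabs N A B) (opLabs a b N) :=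
  Set.disjoint_left.2 (by rintro x hx ⟨l, rfl⟩; simp at hx)

lemma disjoint_op_ket (A : Finset (Fin a)) (B : Finset (Fin b)) :
    Disjoint (opLabs a b N) (ketLabs N A B) :=
  Set.disjoint_left.2 (by rintro x ⟨l, rfl⟩ hx; simp at hx)

lemma disjoint_bra_ket (A A' : Finset (Fin a)) (B B' : Finset (Fin b)) :
    Disjoint (braLabs N A' B') (ketLabs N A B) := by
  rw [Set.disjoint_left]
  rintro (i | i | i | i | i) h1 h2 <;> simp at h1 h2

variable {Θ : Type} {Ω : FunAlg Θ} {M : Θ → Model.{u₁} c} {M' : Θ → Model.{u₂} c}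
  {p : Θ → Lbl a b N → ℂ}

lemma pair_operator (κ : Coeffs N) :
    PairOp Ω M M' p (opLabs a b N) (fun θ => operator (M θ) (fun l => p θ (.w l)) κ)
      (fun θ => operator (M' θ) (fun l => p θ (.w l)) κ) := by
  refine PairOp.sum _ fun s _ => PairOp.smul _ (const_mem _) ?_
  have := PairOp.word (Ω := Ω) (M := M) (M' := M') (p := p) (s := opLabs a b N)
    (List.ofFn fun k => ((s k).1, (s k).2, Lbl.w k)) ⟨by
      rw [List.map_ofFn, List.nodup_ofFn]
      exact fun _ _ h => Lbl.w.inj h, by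
      simp only [List.mem_ofFn]
      rintro l ⟨k, rfl⟩
      exact ⟨k, rfl⟩⟩
  simpa [word, List.map_ofFn, Function.comp_def] using this

lemma melem_eq (hc : c ≠ 0) (M : Model.{uM} c) (p : Lbl a b N → ℂ)
    (κ : Coeffs N) (A : Finset (Fin a)) (B : Finset (Fin b))
    {A' : Finset (Fin a)} {B' : Finset (Fin b)}
    (hu : Admissible c (fun i => p (.uC i)) A') (hv : Admissible c (fun i => p (.vC i)) B') :
    melem M p κ A B A' B' = (-1) ^ (B'.card * (B'.card - 1) / 2) *
      M.toDual (ket M.dual (fun i => p (.uC i)) (fun j => p (.vC j)) A' B')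
        (operator M (fun l => p (.w l)) κ (ket M (fun i => p (.u i)) (fun j => p (.v j)) A B)) := by
  rw [melem, bra_eq_ket_dual M hc hu hv]
  rfl

lemma LamReg.dual {s : Set (Lbl a b N)} (h : LamReg Ω M M' p s) :
    LamReg Ω (fun θ => (M θ).dual) (fun θ => (M' θ).dual) p s := ⟨h.ne, h.inv_mem, h.eq⟩

lemma melem_mem (hc : c ≠ 0) (κ : Coeffs N) {A A' : Finset (Fin a)} {B B' : Finset (Fin b)}
    (hK : PtReg c Ω p .u .v A B) (hB : PtReg c Ω p .uC .vC A' B')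
    (hlK : LamReg Ω M M p (ketLabs N A B)) (hlB : LamReg Ω M M p (braLabs N A' B'))
    (hs : RegOn Ω M p (allLabs N A B A' B')) : (fun θ => melem (M θ) (p θ) κ A B A' B') ∈ Ω := by
  have h1 := mem_of_pairVec (disjoint_bra_op A' B') (disjoint_bra_ket A A' B B')
    (disjoint_op_ket A B) hs (pair_operator κ) (pair_ket isLabelling_ket hK hlK)
    (pair_ket isLabelling_bra hB hlB.dual)
  have h2 := fun_mul_mem (const_mem ((-1) ^ (B'.card * (B'.card - 1) / 2))) h1
  convert h2 using 1
  exact funext fun θ => melem_eq hc _ _ _ _ _ (hB.admissible_u isLabelling_bra θ)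
    (hB.admissible_v isLabelling_bra θ)

/-! #### Dependence on the vacuum eigenvalues -/

/-- General position of the rapidities of a Bethe vector. -/
structure KetRegular {K : Type} (c : ℂ) (p : K → ℂ) (ku : Fin a → K) (kv : Fin b → K)
    (A : Finset (Fin a)) (B : Finset (Fin b)) : Prop where
  inj : Set.InjOn p (labs ku kv A B)
  hu : ∀ i ∈ A, ∀ l ∈ A, h c (p (ku i)) (p (ku l)) ≠ 0
  hv : ∀ i ∈ B, ∀ l ∈ B, h c (p (kv i)) (p (kv l)) ≠ 0
  f_ne : ∀ j ∈ B, ∀ i ∈ A, f c (p (kv j)) (p (ku i)) ≠ 0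

lemma KetRegular.ptReg {K : Type} {p : K → ℂ} {ku : Fin a → K} {kv : Fin b → K}
    {A : Finset (Fin a)} {B : Finset (Fin b)} (hp : KetRegular c p ku kv A B) :
    PtReg c (⊤ : FunAlg Unit) (fun _ => p) ku kv A B where
  inj _ := hp.inj
  sub_mem _ _ _ _ := Algebra.mem_top
  g_mem _ _ _ _ _ := Algebra.mem_top
  hu_ne _ := hp.hu
  hu_inv _ _ _ _ := Algebra.mem_top
  hv_ne _ := hp.hv
  hv_inv _ _ _ _ := Algebra.mem_top
  f_ne _ := hp.f_ne
  f_inv _ _ _ _ := Algebra.mem_top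

lemma lamReg_unit {M : Model.{u₁} c} {M' : Model.{u₂} c} {p : Lbl a b N → ℂ}
    {s : Set (Lbl a b N)} (h0 : ∀ k ∈ s, M.lam 1 (p k) ≠ 0)
    (h1 : ∀ k ∈ s, M.lam 1 (p k) = M'.lam 1 (p k)) :
    LamReg (⊤ : FunAlg Unit) (fun _ => M) (fun _ => M') (fun _ => p) s :=
  ⟨fun _ => h0, fun _ _ => Algebra.mem_top, fun _ => h1⟩

/-- The vacuum eigenvalues of two models give the same matrix elements. -/
structure SameRatios (M : Model.{u₁} c) (M' : Model.{u₂} c) (p : Lbl a b N → ℂ)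
    (A : Finset (Fin a)) (B : Finset (Fin b)) (A' : Finset (Fin a)) (B' : Finset (Fin b)) :
    Prop where
  ne : ∀ k ∈ braLabs N A' B' ∪ ketLabs N A B, M.lam 1 (p k) ≠ 0 ∧ M'.lam 1 (p k) ≠ 0
  u : ∀ i ∈ A, M.r1 (p (.u i)) = M'.r1 (p (.u i))
  v : ∀ i ∈ B, M.r3 (p (.v i)) = M'.r3 (p (.v i))
  uC : ∀ i ∈ A', M.r1 (p (.uC i)) = M'.r1 (p (.uC i))
  vC : ∀ i ∈ B', M.r3 (p (.vC i)) = M'.r3 (p (.vC i))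
  w : ∀ i l, M.lam i (p (.w l)) = M'.lam i (p (.w l))

variable {M : Model.{u₁} c} {M' : Model.{u₂} c} {p : Lbl a b N → ℂ}
  {A A' : Finset (Fin a)} {B B' : Finset (Fin b)}

local notation "P(" k ")" => fun i => p (k i)

lemma melem_congr_of_lam_eq (hc : c ≠ 0) (κ : Coeffs N) (hinj : Set.InjOn p (allLabs N A B A' B'))
    (hK : KetRegular c p .u .v A B) (hB : KetRegular c p .uC .vC A' B')
    (hne : ∀ k ∈ braLabs N A' B' ∪ ketLabs N A B, M.lam 1 (p k) ≠ 0)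
    (hlam : ∀ i, ∀ k ∈ allLabs N A B A' B', M.lam i (p k) = M'.lam i (p k)) :
    melem M p κ A B A' B' = melem M' p κ A B A' B' := by
  have hlK := lamReg_unit (M := M) (M' := M') (s := ketLabs N A B) (p := p)
    (fun k hk => hne k (.inr hk)) fun k hk => hlam 1 k (.inr (.inr hk))
  have hlB := lamReg_unit (M := M) (M' := M') (s := braLabs N A' B') (p := p)
    (fun k hk => hne k (.inl hk)) fun k hk => hlam 1 k (.inl hk)
  rw [melem_eq hc _ _ _ _ _ (hB.ptReg.admissible_u isLabelling_bra ())
    (hB.ptReg.admissible_v isLabelling_bra ()), melem_eq hc _ _ _ _ _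
    (hB.ptReg.admissible_u isLabelling_bra ()) (hB.ptReg.admissible_v isLabelling_bra ())]
  congr 1
  exact eq_of_pairVec (θ := ()) (disjoint_bra_op A' B') (disjoint_bra_ket A A' B B')
    (disjoint_op_ket A B) hinj hlam (pair_operator κ) (pair_ket isLabelling_ket hK.ptReg hlK)
    (pair_ket isLabelling_bra hB.ptReg hlB.dual)

lemma ratio_smul {l₀ l₁ l₀' l₁' : ℂ} (h1 : l₁ ≠ 0) (h1' : l₁' ≠ 0) (hr : l₀ / l₁ = l₀' / l₁')
    (C : ℂ) : (C * l₁⁻¹) * l₀ = (C * l₁'⁻¹) * l₀' ∧ (C * l₁⁻¹) * l₁ = (C * l₁'⁻¹) * l₁' := by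
  rw [div_eq_div_iff h1 h1'] at hr
  constructor
  · field_simp
    linear_combination C * hr
  · field_simp

/-- Vectors of two models with the particle `y` peeled off, the eigenvalues of its creation
operator being proportional. -/
def Peeled {K : Type} (M : Model.{u₁} c) (M' : Model.{u₂} c) (p : K → ℂ) (s : Set K) (σ : Fin 2)
    (y : K) (ζ : M.H) (ζ' : M'.H) : Prop :=
  ∃ (N : Module.End ℂ M.H) (N' : Module.End ℂ M'.H) (R : M.H) (R' : M'.H) (α α' : ℂ),
    PairOp (⊤ : FunAlg Unit) (fun _ => M) (fun _ => M') (fun _ => p) s (fun _ => N)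
      (fun _ => N') ∧
    PairVec (⊤ : FunAlg Unit) (fun _ => M) (fun _ => M') (fun _ => p) s (fun _ => R)
      (fun _ => R') ∧
    ζ = α • N (M.T σ.castSucc σ.succ (p y) M.vac) + R ∧
    ζ' = α' • N' (M'.T σ.castSucc σ.succ (p y) M'.vac) + R' ∧
    ∀ i : Fin 3, (i = σ.castSucc ∨ i = σ.succ) → α * M.lam i (p y) = α' * M'.lam i (p y)

section

variable {K : Type} {ku : Fin a → K} {kv : Fin b → K} {q : K → ℂ}

lemma ketOp_congr (M : Model.{u₁} c) {u : Pts a} {v : Pts b} {ψ ψ' : Pts b}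
    {A : Finset (Fin a)} {B : Finset (Fin b)} (h : ∀ j ∈ B, ψ j = ψ' j) :
    ketOp M u v ψ A B = ketOp M u v ψ' A B := by
  refine sum_congr rfl fun A₁ _ => sum_congr rfl fun B₁ _ => ?_
  rw [prod_congr rfl fun j hj => h j (sdiff_subset hj)]

lemma peeled_ket_u (hc : c ≠ 0) (hk : IsLabelling ku kv) {k : Fin a} (hkA : k ∉ A)
    (hp : KetRegular c q ku kv (insert k A) B)
    (hl : LamReg (⊤ : FunAlg Unit) (fun _ => M) (fun _ => M') (fun _ => q) (labs ku kv A B))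
    (hne : M.lam 1 (q (ku k)) ≠ 0) (hne' : M'.lam 1 (q (ku k)) ≠ 0)
    (hr : M.r1 (q (ku k)) = M'.r1 (q (ku k))) : Peeled M M' q (labs ku kv A B) 0 (ku k)
      (ket M (fun i => q (ku i)) (fun j => q (kv j)) (insert k A) B)
      (ket M' (fun i => q (ku i)) (fun j => q (kv j)) (insert k A) B) := by
  have hp1 := hp.ptReg
  have huv : ∀ j ∈ B, ∀ i ∈ insert k A, q (kv j) ≠ q (ku i) := fun j hj i hi e =>
    hk.u_ne_v i j (hp.inj (mem_labs_v hj) (mem_labs_u hi) e).symm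
  have d1 := ket_insert_u (M := M) hc hkA (hp1.admissible_u hk ())
    (hp1.admissible_v hk ()) huv hne fun j hj => hp.f_ne j hj k (by simp)
  have d2 := ket_insert_u (M := M') hc hkA (hp1.admissible_u hk ())
    (hp1.admissible_v hk ()) huv hne' fun j hj => hp.f_ne j hj k (by simp)
  rw [ketOp_congr M' (ψ' := fun j => (M.lam 1 (q (kv j)) * f c (q (kv j)) (q (ku k)))⁻¹)
    fun j hj => by rw [hl.eq () _ (mem_labs_v hj)]] at d2
  refine ⟨_, _, _, _, _, _, pair_ketOp hk (hp1.mono (subset_insert k A) subset_rfl)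
    fun _ _ => Algebra.mem_top, pair_ketRestU hc hk hp1 hl (fun _ => hne) fun _ => hne', d1, d2, ?_⟩
  have e3 : ∏ i ∈ A, M'.lam 1 (q (ku i)) = ∏ i ∈ A, M.lam 1 (q (ku i)) := hl.prod_u_eq ()
  have h5 := ratio_smul hne hne' hr (∏ i ∈ A, M.lam 1 (q (ku i)))⁻¹
  rw [e3, mul_inv, mul_inv, mul_comm (M.lam 1 _)⁻¹, mul_comm (M'.lam 1 _)⁻¹]
  rintro i (rfl | rfl)
  exacts [h5.1, h5.2]

lemma peeled_ket_v (hc : c ≠ 0) (hk : IsLabelling ku kv) {k : Fin b} (hkB : k ∉ B)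
    (hp : KetRegular c q ku kv A (insert k B))
    (hl : LamReg (⊤ : FunAlg Unit) (fun _ => M) (fun _ => M') (fun _ => q) (labs ku kv A B))
    (hne : M.lam 1 (q (kv k)) ≠ 0) (hne' : M'.lam 1 (q (kv k)) ≠ 0)
    (hr : M.r3 (q (kv k)) = M'.r3 (q (kv k))) : Peeled M M' q (labs ku kv A B) 1 (kv k)
      (ket M (fun i => q (ku i)) (fun j => q (kv j)) A (insert k B))
      (ket M' (fun i => q (ku i)) (fun j => q (kv j)) A (insert k B)) := by
  have hp1 := hp.ptReg
  have d1 := ket_insert_v (M := M) (u := fun i => q (ku i)) (A := A) hc hkB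
    (hp1.admissible_v hk ())
  have d2 := ket_insert_v (M := M') (u := fun i => q (ku i)) (A := A) hc hkB
    (hp1.admissible_v hk ())
  rw [ketOp_congr M' (ψ' := fun j => (M.lam 1 (q (kv j)) * f c (q (kv k)) (q (kv j)))⁻¹)
    fun j hj => by rw [hl.eq () _ (mem_labs_v hj)]] at d2
  refine ⟨_, _, _, _, _, _, pair_ketOp hk (hp1.mono subset_rfl (subset_insert k B))
    fun _ _ => Algebra.mem_top, pair_ketRestV hk hp1 hl, d1, d2, ?_⟩
  have e3 : ∏ i ∈ A, M'.lam 1 (q (ku i)) = ∏ i ∈ A, M.lam 1 (q (ku i)) := hl.prod_u_eq ()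
  have h5 := ratio_smul hne hne' hr ((∏ j ∈ B, g c (q (kv k)) (q (kv j))) *
    (∏ i ∈ A, f c (q (kv k)) (q (ku i)))⁻¹ * (∏ i ∈ A, M.lam 1 (q (ku i)))⁻¹)
  rw [e3]
  simp only [div_eq_mul_inv, mul_inv]
  rintro i (rfl | rfl)
  · convert h5.2 using 1 <;>
      (simp only [Fin.isValue, show (1 : Fin 2).castSucc = (1 : Fin 3) from rfl]; ring)
  · convert h5.1 using 1 <;>
      (simp only [Fin.isValue, show (1 : Fin 2).succ = (2 : Fin 3) from rfl]; ring)

end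

lemma erase_decomp {α : Type*} [DecidableEq α] {A : Finset α} {k : α} (hk : k ∈ A) :
    ∃ A₀, k ∉ A₀ ∧ A = insert k A₀ :=
  ⟨A.erase k, notMem_erase _ _, (insert_erase hk).symm⟩

/-- Changing the vacuum eigenvalues at one point. -/
lemma melem_congr_single (hc : c ≠ 0) (κ : Coeffs N) (hinj : Set.InjOn p (allLabs N A B A' B'))
    (hK : KetRegular c p .u .v A B) (hB : KetRegular c p .uC .vC A' B')
    (hr : SameRatios M M' p A B A' B') (e : Lbl a b N)
    (hlam : ∀ i, ∀ k ∈ allLabs N A B A' B', k ≠ e → M.lam i (p k) = M'.lam i (p k)) :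
    melem M p κ A B A' B' = melem M' p κ A B A' B' := by
  by_cases he : e ∈ braLabs N A' B' ∪ ketLabs N A B
  swap
  · refine melem_congr_of_lam_eq hc κ hinj hK hB (fun k hk => (hr.ne k hk).1) fun i k hk => ?_
    rcases hk with hk | ⟨l, rfl⟩ | hk
    · exact hlam i k (.inl hk) (by rintro rfl; exact he (.inl hk))
    · exact hr.w i l
    · exact hlam i k (.inr (.inr hk)) (by rintro rfl; exact he (.inr hk))
  obtain ⟨hne, hne'⟩ := hr.ne e he
  have hadm := hB.ptReg.admissible_u isLabelling_bra ()
  have hadm' := hB.ptReg.admissible_v isLabelling_bra ()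
  rw [melem_eq hc _ _ _ _ _ hadm hadm', melem_eq hc _ _ _ _ _ hadm hadm']
  congr 1
  by_contra hcon
  have hlamReg : ∀ s ⊆ braLabs N A' B' ∪ ketLabs N A B, e ∉ s →
      LamReg (⊤ : FunAlg Unit) (fun _ => M) (fun _ => M') (fun _ => p) s :=
    fun s hs hes => lamReg_unit (fun k hk => (hr.ne k (hs hk)).1) fun k hk =>
      hlam 1 k ((hs hk).elim .inl fun h => .inr (.inr h)) fun h => hes (h ▸ hk)
  have fromKet : ∀ (s : Set (Lbl a b N)) (σ : Fin 2), s ⊆ ketLabs N A B → e ∈ ketLabs N A B →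
      e ∉ s → ¬ Peeled M M' p s σ e (ket M P(.u) P(.v) A B)
        (ket M' P(.u) P(.v) A B) := by
    rintro s σ hs hes hns ⟨N₁, N₁', R, R', α, α', hN, hR, h1, h2, h3⟩
    have hes' : e ∉ braLabs N A' B' := fun h =>
      Set.disjoint_left.1 (disjoint_bra_ket A A' B B') h hes
    have hsub : insert e (braLabs N A' B' ∪ (opLabs a b N ∪ s)) ⊆ allLabs N A B A' B' :=
      Set.insert_subset (.inr (.inr hes)) (Set.union_subset_union_right _
        (Set.union_subset_union_right _ hs))
    have hy : e ∉ braLabs N A' B' ∪ (opLabs a b N ∪ s) := fun h => h.elim hes' fun h =>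
      h.elim (fun h => Set.disjoint_left.1 (disjoint_op_ket A B) h hes) hns
    exact hcon (eq_of_peeled_ket (θ := ()) (M := fun _ => M) (M' := fun _ => M')
      (p := fun _ => p) (ζ := fun _ => ket M P(.u) P(.v) A B)
      (ζ' := fun _ => ket M' P(.u) P(.v) A B) σ
      (disjoint_bra_op A' B') ((disjoint_bra_ket A A' B B').mono_right hs)
      ((disjoint_op_ket A B).mono_right hs) hy (hinj.mono hsub)
      (fun i k hk => hlam i k (hsub (.inr hk)) fun h => hy (h ▸ hk)) hN
      (pair_operator κ) hR (pair_ket isLabelling_bra hB.ptReg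
        (hlamReg _ Set.subset_union_left hes').dual) h1 h2 h3)
  have fromBra : ∀ (s : Set (Lbl a b N)) (σ : Fin 2), s ⊆ braLabs N A' B' → e ∈ braLabs N A' B' →
      e ∉ s → ¬ Peeled M.dual M'.dual p s σ e
        (ket M.dual P(.uC) P(.vC) A' B')
        (ket M'.dual P(.uC) P(.vC) A' B') := by
    rintro s σ hs hes hns ⟨N₁, N₁', R, R', α, α', hN, hR, h1, h2, h3⟩
    have hes' : e ∉ ketLabs N A B := Set.disjoint_left.1 (disjoint_bra_ket A A' B B') hes
    have hsub : insert e (s ∪ (opLabs a b N ∪ ketLabs N A B)) ⊆ allLabs N A B A' B' :=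
      Set.insert_subset (.inl hes) (Set.union_subset_union_left _ hs)
    have hy : e ∉ s ∪ (opLabs a b N ∪ ketLabs N A B) := fun h => h.elim hns fun h =>
      h.elim (Set.disjoint_left.1 (disjoint_bra_op A' B') hes) hes'
    exact hcon (eq_of_peeled_bra (θ := ()) (M := fun _ => M) (M' := fun _ => M')
      (p := fun _ => p) (η := fun _ => ket M.dual P(.uC) P(.vC) A' B')
      (η' := fun _ => ket M'.dual P(.uC) P(.vC) A' B') σ
      ((disjoint_bra_op A' B').mono_left hs) ((disjoint_bra_ket A A' B B').mono_left hs)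
      (disjoint_op_ket A B) hy (hinj.mono hsub)
      (fun i k hk => hlam i k (hsub (.inr hk)) fun h => hy (h ▸ hk)) hN
      (pair_operator κ) hR (pair_ket isLabelling_ket hK.ptReg
        (hlamReg _ Set.subset_union_right hes')) h1 h2 h3)
  rcases e with k | k | k | k | k
  · obtain ⟨A₀, hk, rfl⟩ := erase_decomp (show k ∈ A by simpa using he)
    have hs : ketLabs N A₀ B ⊆ ketLabs N (insert k A₀) B := labs_mono (subset_insert _ _) subset_rfl
    exact fromKet (ketLabs N A₀ B) 0 hs (by simp) (by simp [hk]) (peeled_ket_u hc isLabelling_ket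
      hk hK (hlamReg _ (hs.trans Set.subset_union_right) (by simp [hk])) hne hne'
      (hr.u k (by simp)))
  · obtain ⟨B₀, hk, rfl⟩ := erase_decomp (show k ∈ B by simpa using he)
    have hs : ketLabs N A B₀ ⊆ ketLabs N A (insert k B₀) := labs_mono subset_rfl (subset_insert _ _)
    exact fromKet (ketLabs N A B₀) 1 hs (by simp) (by simp [hk]) (peeled_ket_v hc isLabelling_ket
      hk hK (hlamReg _ (hs.trans Set.subset_union_right) (by simp [hk])) hne hne'
      (hr.v k (by simp)))
  · obtain ⟨A₀, hk, rfl⟩ := erase_decomp (show k ∈ A' by simpa using he)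
    have hs : braLabs N A₀ B' ⊆ braLabs N (insert k A₀) B' :=
      labs_mono (subset_insert _ _) subset_rfl
    exact fromBra (braLabs N A₀ B') 0 hs (by simp) (by simp [hk]) (peeled_ket_u hc isLabelling_bra
      hk hB (hlamReg _ (hs.trans Set.subset_union_left) (by simp [hk])).dual hne hne'
      (hr.uC k (by simp)))
  · obtain ⟨B₀, hk, rfl⟩ := erase_decomp (show k ∈ B' by simpa using he)
    have hs : braLabs N A' B₀ ⊆ braLabs N A' (insert k B₀) :=
      labs_mono subset_rfl (subset_insert _ _)
    exact fromBra (braLabs N A' B₀) 1 hs (by simp) (by simp [hk]) (peeled_ket_v hc isLabelling_bra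
      hk hB (hlamReg _ (hs.trans Set.subset_union_left) (by simp [hk])).dual hne hne'
      (hr.vC k (by simp)))
  · simp at he

end Melem

section Congr

variable {c : ℂ} {a b N : ℕ} {p : Lbl a b N → ℂ} {A A' : Finset (Fin a)} {B B' : Finset (Fin b)}

def lblFinset (a b N : ℕ) : Finset (Lbl a b N) :=
  open Classical in
  univ.image Lbl.u ∪ univ.image Lbl.v ∪ univ.image Lbl.uC ∪
    univ.image Lbl.vC ∪ univ.image Lbl.w

lemma mem_lblFinset (k : Lbl a b N) : k ∈ lblFinset a b N := by
  rcases k with k | k | k | k | k <;> simp [lblFinset]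

def pts (p : Lbl a b N → ℂ) : Finset ℂ := (lblFinset a b N).image p

lemma mem_pts (p : Lbl a b N → ℂ) (k : Lbl a b N) : p k ∈ pts p :=
  mem_image_of_mem _ (mem_lblFinset k)

lemma GeneralizedModel.lam_pts (Γ : GeneralizedModel.{uG} c) (p : Lbl a b N → ℂ)
    (l : Fin 3 → ℂ → ℂ) (i : Fin 3) (k : Lbl a b N) :
    (Γ.model (pts p) l).lam i (p k) = l i (p k) := Γ.lam_model _ _ _ _ (mem_pts p k)

lemma SameRatios.mix {M₁ : Model.{u₁} c} {M₂ : Model.{u₁} c} {M₃ : Model.{u₁} c}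
    (h : SameRatios M₁ M₂ p A B A' B')
    (hM : ∀ k, (∀ i, M₃.lam i (p k) = M₁.lam i (p k)) ∨ ∀ i, M₃.lam i (p k) = M₂.lam i (p k)) :
    SameRatios M₁ M₃ p A B A' B' ∧ SameRatios M₃ M₂ p A B A' B' := by
  have key : ∀ (k : Lbl a b N) (i : Fin 3), M₁.lam i (p k) / M₁.lam 1 (p k) =
      M₂.lam i (p k) / M₂.lam 1 (p k) → M₃.lam i (p k) / M₃.lam 1 (p k) =
      M₂.lam i (p k) / M₂.lam 1 (p k) := by
    intro k i e
    rcases hM k with h1 | h1 <;> simp only [h1]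
    exact e
  have h2 : SameRatios M₃ M₂ p A B A' B' := by
    refine ⟨fun k hk => ⟨?_, (h.ne k hk).2⟩, fun i hi => key _ _ (h.u i hi),
      fun i hi => key _ _ (h.v i hi), fun i hi => key _ _ (h.uC i hi),
      fun i hi => key _ _ (h.vC i hi), fun i l => ?_⟩
    · rcases hM k with h1 | h1 <;> simp only [h1]
      exacts [(h.ne k hk).1, (h.ne k hk).2]
    · rcases hM (.w l) with h1 | h1 <;> simp only [h1]
      exact h.w i l
  exact ⟨⟨fun k hk => ⟨(h.ne k hk).1, (h2.ne k hk).1⟩, fun i hi => (h.u i hi).trans (h2.u i hi).symm,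
    fun i hi => (h.v i hi).trans (h2.v i hi).symm, fun i hi => (h.uC i hi).trans (h2.uC i hi).symm,
    fun i hi => (h.vC i hi).trans (h2.vC i hi).symm, fun i l => (h.w i l).trans (h2.w i l).symm⟩, h2⟩

lemma melem_congr_finset (hc : c ≠ 0) (Γ : GeneralizedModel.{uG} c)
    (κ : Coeffs N) (hinj : Set.InjOn p (allLabs N A B A' B'))
    (hK : KetRegular c p .u .v A B) (hB : KetRegular c p .uC .vC A' B') (T : Finset (Lbl a b N)) :
    ∀ M₁ M₂ : Model.{uG} c, SameRatios M₁ M₂ p A B A' B' →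
      (∀ i, ∀ k ∈ allLabs N A B A' B', k ∉ T → M₁.lam i (p k) = M₂.lam i (p k)) →
      melem M₁ p κ A B A' B' = melem M₂ p κ A B A' B' := by
  classical
  induction T using Finset.induction_on with
  | empty =>
    intro M₁ M₂ hr h
    exact melem_congr_of_lam_eq hc κ hinj hK hB (fun k hk => (hr.ne k hk).1)
      fun i k hk => h i k hk (by simp)
  | insert e T _ ih =>
    intro M₁ M₂ hr h
    by_cases he : e ∈ allLabs N A B A' B'
    swap
    · exact ih M₁ M₂ hr fun i k hk hkT => h i k hk fun h' =>
        (mem_insert.1 h').elim (fun h => he (h ▸ hk)) hkT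
    set M₃ := Γ.model (pts p) fun i x => if x = p e then M₂.lam i x else M₁.lam i x with hM₃
    have h3 : ∀ i k, M₃.lam i (p k) = if p k = p e then M₂.lam i (p k) else M₁.lam i (p k) :=
      fun i k => Γ.lam_pts p _ i k
    obtain ⟨h4, h5⟩ := hr.mix (M₃ := M₃) fun k => by
      by_cases hk : p k = p e
      · exact .inr fun i => by rw [h3, if_pos hk]
      · exact .inl fun i => by rw [h3, if_neg hk]
    rw [melem_congr_single hc κ hinj hK hB h4 e fun i k hk hke => by
      rw [h3, if_neg fun e' => hke (hinj hk he e')]]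
    refine ih M₃ M₂ h5 fun i k hk hkT => ?_
    rw [h3]
    split_ifs with hke
    · rfl
    · exact h i k hk fun h' => (mem_insert.1 h').elim (fun h => hke (h ▸ rfl)) hkT

/-- A matrix element depends on the vacuum eigenvalues only through the values of `r₁` at the
rapidities `ū`, of `r₃` at the rapidities `v̄`, and of `λ_i` at the arguments of the operator. -/
lemma melem_congr (hc : c ≠ 0) (Γ : GeneralizedModel.{uG} c) {M : Model.{u₁} c}
    {M' : Model.{u₂} c} (κ : Coeffs N) (hinj : Set.InjOn p (allLabs N A B A' B'))
    (hK : KetRegular c p .u .v A B) (hB : KetRegular c p .uC .vC A' B')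
    (hr : SameRatios M M' p A B A' B') : melem M p κ A B A' B' = melem M' p κ A B A' B' := by
  have e1 : ∀ i k, M.lam i (p k) = (Γ.model (pts p) M.lam).lam i (p k) :=
    fun i k => (Γ.lam_pts p _ i k).symm
  have e2 : ∀ i k, M'.lam i (p k) = (Γ.model (pts p) M'.lam).lam i (p k) :=
    fun i k => (Γ.lam_pts p _ i k).symm
  rw [melem_congr_of_lam_eq hc κ hinj hK hB (fun k hk => (hr.ne k hk).1) fun i k _ => e1 i k,
    melem_congr_of_lam_eq hc κ hinj hK hB (fun k hk => (hr.ne k hk).2) fun i k _ => e2 i k]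
  refine melem_congr_finset hc Γ κ hinj hK hB (lblFinset a b N) _ _ ?_
    fun i k _ hk => absurd (mem_lblFinset k) hk
  refine ⟨fun k hk => ⟨e1 1 k ▸ (hr.ne k hk).1, e2 1 k ▸ (hr.ne k hk).2⟩, ?_, ?_, ?_, ?_, ?_⟩
  · simpa only [Model.r1, e1, e2] using hr.u
  · simpa only [Model.r3, e1, e2] using hr.v
  · simpa only [Model.r1, e1, e2] using hr.uC
  · simpa only [Model.r3, e1, e2] using hr.vC
  · intro i l
    rw [← e1, ← e2]
    exact hr.w i l

/-! #### Rescaling the monodromy matrix -/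

/-- The model with the monodromy matrix multiplied by a scalar function. -/
def Model.scale (M : Model.{uM} c) (s : ℂ → ℂ) : Model.{uM} c where
  H := M.H
  T i j x := s x • M.T i j x
  vac := M.vac
  covac := M.covac
  lam i x := s x * M.lam i x
  rtt i j k l x y hxy := by
    have := congrArg (fun X => (s x * s y) • X) (M.rtt i j k l x y hxy)
    simp only [smul_sub, smul_smul] at this
    simp only [smul_mul_smul_comm, smul_sub, smul_smul]
    convert this using 3 <;> ring
  T_diag_vac i x := by simp [M.T_diag_vac, smul_smul]
  T_lower_vac i j x hij := by simp [M.T_lower_vac i j x hij]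
  covac_T_diag i x := by rw [LinearMap.comp_smul, M.covac_T_diag, smul_smul]
  covac_T_upper i j x hij := by rw [LinearMap.comp_smul, M.covac_T_upper i j x hij, smul_zero]
  covac_vac := M.covac_vac

lemma opProd_scale (M : Model.{uM} c) {s : ℂ → ℂ} {i j : Fin 3} {x : Pts a}
    {X : Finset (Fin a)} (h : ∀ k ∈ X, s (x k) = 1) :
    opProd (M.scale s) i j x X = opProd M i j x X := by
  unfold opProd
  congr 1
  refine List.map_congr_left fun k hk => ?_
  show s (x k) • M.T i j (x k) = _
  rw [h k (by simpa using hk), one_smul]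

lemma betheCoeff_scale (M : Model.{uM} c) {s : ℂ → ℂ} {u : Pts a} {v : Pts b}
    {A₁ : Finset (Fin a)} {B₁ : Finset (Fin b)}
    (hu : ∀ k ∈ A, s (u k) = 1) (hv : ∀ k ∈ B \ B₁, s (v k) = 1) :
    betheCoeff (M.scale s) u v A A₁ B B₁ = betheCoeff M u v A A₁ B B₁ := by
  have e1 : ∏ j ∈ A, (M.scale s).lam 1 (u j) = ∏ j ∈ A, M.lam 1 (u j) :=
    prod_congr rfl fun j hj => by show s (u j) * _ = _; rw [hu j hj, one_mul]
  have e2 : ∏ j ∈ B \ B₁, (M.scale s).lam 1 (v j) = ∏ j ∈ B \ B₁, M.lam 1 (v j) :=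
    prod_congr rfl fun j hj => by show s (v j) * _ = _; rw [hv j hj, one_mul]
  rw [betheCoeff, betheCoeff, e1, e2]

lemma ket_scale (M : Model.{uM} c) {s : ℂ → ℂ} {u : Pts a} {v : Pts b}
    (hu : ∀ k ∈ A, s (u k) = 1) (hv : ∀ k ∈ B, s (v k) = 1) :
    ket (M.scale s) u v A B = ket M u v A B := by
  refine sum_congr rfl fun A₁ hA₁ => sum_congr rfl fun B₁ hB₁ => ?_
  have hA := mem_powerset.1 hA₁
  rw [betheCoeff_scale M hu fun k hk => hv k (sdiff_subset hk)]
  unfold symT3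
  rw [opProd_scale M fun k hk => hu k (hA hk), opProd_scale M fun k hk => hu k (sdiff_subset hk),
    opProd_scale M fun k hk => hv k (sdiff_subset hk)]
  rfl

lemma bra_scale (M : Model.{uM} c) {s : ℂ → ℂ} {u : Pts a} {v : Pts b}
    (hu : ∀ k ∈ A, s (u k) = 1) (hv : ∀ k ∈ B, s (v k) = 1) :
    bra (M.scale s) u v A B = bra M u v A B := by
  unfold bra
  congr 1
  refine sum_congr rfl fun A₁ hA₁ => sum_congr rfl fun B₁ hB₁ => ?_
  have hA := mem_powerset.1 hA₁
  rw [betheCoeff_scale M hu fun k hk => hv k (sdiff_subset hk)]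
  unfold symT3'
  rw [opProd_scale M fun k hk => hu k (hA hk), opProd_scale M fun k hk => hu k (sdiff_subset hk),
    opProd_scale M fun k hk => hv k (sdiff_subset hk)]
  rfl

lemma operator_scale (M : Model.{uM} c) (s : ℂ → ℂ) (w : Pts N) (κ : Coeffs N) :
    operator (M.scale s) w κ = (∏ l, s (w l)) • operator M w κ := by
  unfold operator
  rw [smul_sum]
  refine sum_congr rfl fun q _ => ?_
  rw [smul_comm]
  congr 1
  have : ∀ (n : ℕ) (z : Pts n) (q : Fin n → Fin 3 × Fin 3),
      (List.ofFn fun k => s (z k) • M.T (q k).1 (q k).2 (z k)).prod =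
        (∏ l, s (z l)) • (List.ofFn fun k => M.T (q k).1 (q k).2 (z k)).prod := by
    intro n
    induction n with
    | zero => simp
    | succ n ih =>
      intro z q
      rw [List.ofFn_succ, List.ofFn_succ, List.prod_cons, List.prod_cons,
        ih (fun i => z i.succ) fun i => q i.succ, smul_mul_smul_comm, Fin.prod_univ_succ]
  exact this N w q

lemma melem_scale (M : Model.{uM} c) (κ : Coeffs N) {s : ℂ → ℂ}
    (h : ∀ k ∈ braLabs N A' B' ∪ ketLabs N A B, s (p k) = 1) :
    melem (M.scale s) p κ A B A' B' = (∏ l, s (p (.w l))) * melem M p κ A B A' B' := by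
  unfold melem
  rw [ket_scale M (fun k hk => h _ (by simp [hk])) fun k hk => h _ (by simp [hk]),
    bra_scale M (fun k hk => h _ (by simp [hk])) fun k hk => h _ (by simp [hk]),
    operator_scale]
  exact map_smul (bra M (fun i => p (.uC i)) (fun j => p (.vC j)) A' B') _ _

/-- Matrix elements of models whose eigenvalues at the arguments of the operator are
proportional. -/
lemma melem_congr_smul (hc : c ≠ 0) (Γ : GeneralizedModel.{uG} c) {M : Model.{u₁} c}
    {M' : Model.{u₂} c} (κ : Coeffs N) (hinj : Set.InjOn p (allLabs N A B A' B'))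
    (hK : KetRegular c p .u .v A B) (hB : KetRegular c p .uC .vC A' B') (z : Pts N)
    (hne : ∀ k ∈ braLabs N A' B' ∪ ketLabs N A B, M.lam 1 (p k) ≠ 0 ∧ M'.lam 1 (p k) ≠ 0)
    (hu : ∀ i ∈ A, M.r1 (p (.u i)) = M'.r1 (p (.u i)))
    (hv : ∀ i ∈ B, M.r3 (p (.v i)) = M'.r3 (p (.v i)))
    (huC : ∀ i ∈ A', M.r1 (p (.uC i)) = M'.r1 (p (.uC i)))
    (hvC : ∀ i ∈ B', M.r3 (p (.vC i)) = M'.r3 (p (.vC i)))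
    (hw : ∀ i l, M.lam i (p (.w l)) = z l * M'.lam i (p (.w l))) :
    melem M p κ A B A' B' = (∏ l, z l) * melem M' p κ A B A' B' := by
  classical
  have hwinj : ∀ l l', p (.w l) = p (.w l') → l = l' := fun l l' e => by
    have := hinj (.inr (.inl ⟨l, rfl⟩)) (.inr (.inl ⟨l', rfl⟩)) e
    exact Lbl.w.inj this
  set s : ℂ → ℂ := fun x => if hx : ∃ l, p (.w l) = x then z hx.choose else 1 with hs
  have hsw : ∀ l, s (p (.w l)) = z l := fun l => by
    have hx : ∃ l', p (.w l') = p (.w l) := ⟨l, rfl⟩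
    simp only [hs, dif_pos hx, hwinj _ _ hx.choose_spec]
  have hs1 : ∀ k ∈ braLabs N A' B' ∪ ketLabs N A B, s (p k) = 1 := fun k hk => by
    have hk' : k ∈ allLabs N A B A' B' := by
      rcases hk with h | h
      exacts [.inl h, .inr (.inr h)]
    refine dif_neg ?_
    rintro ⟨l, hl⟩
    have := hinj (.inr (.inl ⟨l, rfl⟩)) hk' hl
    subst this
    simp at hk
  have hls : ∀ i, ∀ k ∈ braLabs N A' B' ∪ ketLabs N A B,
      (M'.scale s).lam i (p k) = M'.lam i (p k) := fun i k hk => by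
    show s (p k) * _ = _
    rw [hs1 k hk, one_mul]
  have main := melem_congr (M := M) (M' := M'.scale s) hc Γ κ hinj hK hB
    ⟨fun k hk => ⟨(hne k hk).1, by rw [hls 1 k hk]; exact (hne k hk).2⟩,
    fun i hi => by rw [hu i hi, Model.r1, Model.r1, hls, hls] <;> simp [hi],
    fun i hi => by rw [hv i hi, Model.r3, Model.r3, hls, hls] <;> simp [hi],
    fun i hi => by rw [huC i hi, Model.r1, Model.r1, hls, hls] <;> simp [hi],
    fun i hi => by rw [hvC i hi, Model.r3, Model.r3, hls, hls] <;> simp [hi],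
    fun i l => by
      rw [hw]
      show _ = s (p (.w l)) * _
      rw [hsw]⟩
  rw [main, melem_scale M' κ hs1]
  simp only [hsw]

end Congr

/-! ### Residues of matrix elements -/

section Pairing

variable {c : ℂ} (M : Model.{uM} c)

lemma vac_pairing_zero {x y : ℂ} (h : x ≠ y) : M.covac (M.T 1 0 x (M.T 0 1 y M.vac)) =
      g c x y * (M.lam 0 y * M.lam 1 x - M.lam 0 x * M.lam 1 y) := by
  have := congrArg (fun X => M.covac (X M.vac)) (M.rtt 1 0 0 1 x y h)
  simp [par, M.T_lower_vac, M.T_diag_vac, M.covac_vac] at this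
  rw [this]
  ring

lemma vac_pairing_one {x y : ℂ} (h : x ≠ y) : M.covac (M.T 2 1 x (M.T 1 2 y M.vac)) =
      g c x y * (M.lam 1 x * M.lam 2 y - M.lam 1 y * M.lam 2 x) := by
  have := congrArg (fun X => M.covac (X M.vac)) (M.rtt 2 1 1 2 x y h)
  simp [par, M.T_lower_vac, M.T_diag_vac, M.covac_vac] at this
  rw [this]
  ring

lemma vac_pairing_zero_one {x y : ℂ} (h : x ≠ y) : M.covac (M.T 1 0 x (M.T 1 2 y M.vac)) = 0 := by
  have := congrArg (fun X => M.covac (X M.vac)) (M.rtt 1 2 1 0 y x h.symm)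
  simp [par, M.T_lower_vac] at this
  exact this

lemma vac_pairing_one_zero {x y : ℂ} (h : x ≠ y) : M.covac (M.T 2 1 x (M.T 0 1 y M.vac)) = 0 := by
  have := congrArg (fun X => M.covac (X M.vac)) (M.rtt 2 1 0 1 x y h)
  simp [par, M.T_lower_vac] at this
  exact this

end Pairing

section Residue

variable {c : ℂ}

lemma mul_prod_sub_prod_mem {Θ ι : Type} {Ω : FunAlg Θ} {φ : Θ → ℂ}
    {ψ ψ' : Θ → ι → ℂ} (X : Finset ι) (hψ : ∀ j ∈ X, (fun θ => ψ θ j) ∈ Ω)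
    (hψ' : ∀ j ∈ X, (fun θ => ψ' θ j) ∈ Ω) (h : ∀ j ∈ X, (fun θ => φ θ * (ψ θ j - ψ' θ j)) ∈ Ω) :
    (fun θ => φ θ * (∏ j ∈ X, ψ θ j - ∏ j ∈ X, ψ' θ j)) ∈ Ω := by
  classical
  induction X using Finset.induction_on with
  | empty => simpa using const_mem (Ω := Ω) 0
  | insert j X hj ih =>
    have h1 := ih (fun i hi => hψ i (by simp [hi])) (fun i hi => hψ' i (by simp [hi]))
      fun i hi => h i (by simp [hi])
    have h2 := fun_add_mem (fun_mul_mem (h j (by simp)) (fun_prod_mem X (φ := fun i θ => ψ θ i)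
      fun i hi => hψ i (by simp [hi]))) (fun_mul_mem (hψ' j (by simp)) h1)
    convert h2 using 1
    funext θ
    rw [prod_insert hj, prod_insert hj]
    ring

variable {a b N : ℕ}

lemma pair_ketOp_sub {K Θ : Type} {Ω : FunAlg Θ} {M : Θ → Model.{u₁} c}
    {M' : Θ → Model.{u₂} c} {p : Θ → K → ℂ} {ku : Fin a → K} {kv : Fin b → K}
    {A : Finset (Fin a)} {B : Finset (Fin b)} (hk : IsLabelling ku kv)
    (hp : PtReg c Ω p ku kv A B) {φ : Θ → ℂ} {ψ ψ' : Θ → Pts b}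
    (hψ : ∀ j ∈ B, (fun θ => ψ θ j) ∈ Ω) (hψ' : ∀ j ∈ B, (fun θ => ψ' θ j) ∈ Ω)
    (h : ∀ j ∈ B, (fun θ => φ θ * (ψ θ j - ψ' θ j)) ∈ Ω) : PairOp Ω M M' p (labs ku kv A B)
      (fun θ => φ θ • (ketOp (M θ) (fun l => p θ (ku l)) (fun l => p θ (kv l)) (ψ θ) A B -
        ketOp (M θ) (fun l => p θ (ku l)) (fun l => p θ (kv l)) (ψ' θ) A B))
      (fun θ => φ θ • (ketOp (M' θ) (fun l => p θ (ku l)) (fun l => p θ (kv l)) (ψ θ) A B -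
        ketOp (M' θ) (fun l => p θ (ku l)) (fun l => p θ (kv l)) (ψ' θ) A B)) := by
  simp only [ketOp, ← sum_sub_distrib, ← sub_smul, ← mul_sub, smul_sum, smul_smul]
  refine PairOp.sum _ fun A₁ hA₁ => PairOp.sum _ fun B₁ hB₁ => ?_
  have hA := mem_powerset.1 hA₁
  have hB := mem_powerset.1 (mem_filter.1 hB₁).1
  refine (pair_three hk hp hA sdiff_subset).smul (fun θ => φ θ * (_ * _)) ?_
  simp only [mul_left_comm (φ _)]
  exact fun_mul_mem (hp.partCoeff_mem hk hA hB) (mul_prod_sub_prod_mem _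
    (fun j hj => hψ j (sdiff_subset hj)) (fun j hj => hψ' j (sdiff_subset hj))
    fun j hj => h j (sdiff_subset hj))

lemma ketOp_vac (M : Model.{uM} c) {u : Pts a} {v : Pts b} {ψ : Pts b}
    {A : Finset (Fin a)} {B : Finset (Fin b)} (hA : ∀ i ∈ A, M.lam 1 (u i) ≠ 0)
    (hψ : ∀ j ∈ B, ψ j = (M.lam 1 (v j))⁻¹) :
    ketOp M u v ψ A B M.vac = (∏ i ∈ A, M.lam 1 (u i)) • ket M u v A B := by
  rw [ket_eq_ketOp, smul_smul, mul_inv_cancel₀ (prod_ne_zero_iff.2 hA), one_smul, ketOp_congr M hψ]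

lemma one_sub_g {x y : ℂ} (h : x ≠ y) : 1 - g c x y = f c y x := by
  rw [f_eq h.symm, g_swap c x y]
  ring

lemma neg_one_pow_choose_succ (n : ℕ) :
    (-1 : ℂ) ^ ((n + 1) * (n + 1 - 1) / 2) = (-1) ^ n * (-1) ^ (n * (n - 1) / 2) := by
  rw [← pow_add, ← sum_range_id, ← sum_range_id, sum_range_succ, add_comm]

section Peeling

variable {K Θ : Type} {Ω : FunAlg Θ} {M : Θ → Model.{u₁} c} {q : Θ → K → ℂ}
  {ku : Fin a → K} {kv : Fin b → K} {A A₁ : Finset (Fin a)} {B B₁ : Finset (Fin b)}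

/-- Decomposition of Bethe vectors with respect to the creation operator at `y`; `A` and `B` are the
other particles. -/
structure Peeling (Ω : FunAlg Θ) (M : Θ → Model.{u₁} c) (q : Θ → K → ℂ)
    (ku : Fin a → K) (kv : Fin b → K) (σ : Fin 2) (y : K) (A A₁ : Finset (Fin a))
    (B B₁ : Finset (Fin b)) (ψ : Θ → Pts b) (α : Θ → ℂ) : Prop where
  pt : PtReg c Ω q ku kv A B
  pt₁ : PtReg c Ω q ku kv A₁ B₁
  ψ_mem : ∀ j ∈ B, (fun θ => ψ θ j) ∈ Ω
  α_mem : α ∈ Ω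
  eq : ∃ R, PairVec Ω M M q (labs ku kv A B) R R ∧ ∀ θ,
    ket (M θ) (fun l => q θ (ku l)) (fun l => q θ (kv l)) A₁ B₁ =
      α θ • ketOp (M θ) (fun l => q θ (ku l)) (fun l => q θ (kv l)) (ψ θ) A B
        ((M θ).T σ.castSucc σ.succ (q θ y) (M θ).vac) + R θ

lemma lamReg_of_eq_one {s : Set K} (h : ∀ θ, ∀ m ∈ s, (M θ).lam 1 (q θ m) = 1) :
    LamReg Ω M M q s where
  ne θ m hm := by rw [h θ m hm]; exact one_ne_zero
  inv_mem m hm := by simpa only [h _ m hm] using const_mem _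
  eq _ _ _ := rfl

lemma peeling_u (hc : c ≠ 0) (hk : IsLabelling ku kv) {k : Fin a} (hkA : k ∉ A)
    (hp : PtReg c Ω q ku kv (insert k A) B)
    (h1 : ∀ θ, ∀ z ∈ labs ku kv (insert k A) B, (M θ).lam 1 (q θ z) = 1) :
    Peeling Ω M q ku kv 0 (ku k) A (insert k A) B B
      (fun θ j => (f c (q θ (kv j)) (q θ (ku k)))⁻¹) 1 := by
  have hy : ∀ θ, (M θ).lam 1 (q θ (ku k)) ≠ 0 := fun θ => by
    simp [h1 θ _ (mem_labs_u (mem_insert_self k A))]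
  refine ⟨hp.mono (subset_insert k A) subset_rfl, hp, fun j hj => hp.f_inv j hj k (by simp),
    one_mem _, _, pair_ketRestU hc hk hp (lamReg_of_eq_one fun θ m hm => h1 θ m
      (labs_mono (subset_insert k A) subset_rfl hm)) hy hy, fun θ => ?_⟩
  rw [ket_insert_u hc hkA (hp.admissible_u hk θ) (hp.admissible_v hk θ) (fun j hj i hi e =>
    hk.u_ne_v i j (hp.inj θ (mem_labs_v hj) (mem_labs_u hi) e).symm) (hy θ)
    fun j hj => hp.f_ne θ j hj k (by simp), h1 θ _ (mem_labs_u (by simp)),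
    prod_eq_one fun i hi => h1 θ _ (mem_labs_u (by simp [hi])),
    ketOp_congr _ fun j hj => by rw [h1 θ _ (mem_labs_v hj), one_mul], mul_one, inv_one]
  rfl

lemma peeling_v (hc : c ≠ 0) (hk : IsLabelling ku kv) {k : Fin b} (hkB : k ∉ B)
    (hp : PtReg c Ω q ku kv A (insert k B))
    (h1 : ∀ θ, ∀ z ∈ labs ku kv A (insert k B), (M θ).lam 1 (q θ z) = 1)
    (hf : ∀ j ∈ B, (fun θ => (f c (q θ (kv k)) (q θ (kv j)))⁻¹) ∈ Ω) :
    Peeling Ω M q ku kv 1 (kv k) A A B (insert k B)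
      (fun θ j => (f c (q θ (kv k)) (q θ (kv j)))⁻¹) fun θ =>
        (∏ j ∈ B, g c (q θ (kv k)) (q θ (kv j))) / ∏ i ∈ A, f c (q θ (kv k)) (q θ (ku i)) := by
  refine ⟨hp.mono subset_rfl (subset_insert k B), hp, hf, ?_, _, pair_ketRestV hk hp
    (lamReg_of_eq_one fun θ m hm => h1 θ m (labs_mono subset_rfl (subset_insert k B) hm)),
    fun θ => ?_⟩
  · simp only [div_eq_mul_inv]
    exact fun_mul_mem (fun_prod_mem _ fun j hj => hp.g_mem _ (mem_labs_v (by simp)) _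
      (mem_labs_v (by simp [hj])) fun e => hkB (hk.v_inj e ▸ hj))
      (fun_prod_inv_mem _ fun i hi => hp.f_inv k (by simp) i hi)
  · rw [ket_insert_v hc hkB (hp.admissible_v hk θ), h1 θ _ (mem_labs_v (by simp)),
      prod_eq_one fun i hi => h1 θ _ (mem_labs_u hi),
      ketOp_congr _ fun j hj => by rw [h1 θ _ (mem_labs_v (by simp [hj])), one_mul], mul_one,
      one_mul]
    rfl

end Peeling

variable {Θ : Type} {Ω : FunAlg Θ} {M : Θ → Model.{u₁} c} {M' : Θ → Model.{u₂} c}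
  {p : Θ → Lbl a b N → ℂ} {A A' A₁ A₁' : Finset (Fin a)} {B B' B₁ B₁' : Finset (Fin b)}
  {x y : Lbl a b N} {ψ ψ' : Θ → Pts b} {α β : Θ → ℂ}

local notation "𝓛" => allLabs N A B A' B'

/-- **Residue of a matrix element** between a vector with a creation operator at `y` and a dual
vector with an annihilation operator at `x`. -/
lemma melem_residue_of_peeling (hc : c ≠ 0) (κ : Coeffs N) {σ τ : Fin 2}
    (hK : Peeling Ω M p .u .v σ y A A₁ B B₁ ψ α)
    (hB : Peeling Ω (fun θ => (M θ).dual) p .uC .vC τ x A' A₁' B' B₁' ψ' β)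
    (hx : x ∉ 𝓛) (hy : y ∉ 𝓛)
    (hX : RegOn Ω M p (insert x 𝓛))
    (hY : RegOn Ω M p (insert y 𝓛))
    (hM' : IsModified M M' p 𝓛 σ y) :
    (fun θ => melem (M θ) (p θ) κ A₁ B₁ A₁' B₁' - (-1) ^ (B₁'.card * (B₁'.card - 1) / 2) *
      (α θ * β θ * (M θ).covac ((M θ).T τ.succ τ.castSucc (p θ x)
        ((M θ).T σ.castSucc σ.succ (p θ y) (M θ).vac)) *
      (M' θ).toDual (ketOp (M' θ).dual (fun i => p θ (.uC i)) (fun i => p θ (.vC i)) (ψ' θ) A' B'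
        (M' θ).dual.vac) (operator (M' θ) (fun l => p θ (.w l)) κ (ketOp (M' θ)
          (fun i => p θ (.u i)) (fun i => p θ (.v i)) (ψ θ) A B (M' θ).vac)))) ∈ Ω := by
  obtain ⟨R, hR, hζ⟩ := hK.eq
  obtain ⟨R₂, hR₂, hη⟩ := hB.eq
  convert fun_mul_mem (const_mem ((-1) ^ (B₁'.card * (B₁'.card - 1) / 2)))
    (residue_of_peeled σ τ (disjoint_bra_op A' B') (disjoint_bra_ket A A' B B')
      (disjoint_op_ket A B) hx hy hX hY hM' (pair_ketOp isLabelling_ket hK.pt hK.ψ_mem)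
      (pair_operator κ) (pair_ketOp isLabelling_bra hB.pt hB.ψ_mem) hR hR₂ hK.α_mem hB.α_mem
      hζ hη) using 1
  funext θ
  rw [melem_eq hc (M θ) _ _ _ _ (hB.pt₁.admissible_u isLabelling_bra θ)
    (hB.pt₁.admissible_v isLabelling_bra θ), mul_sub]

/-- The residue in terms of the matrix element without the two particles, if the difference of the
dual vectors cancels the pole. -/
lemma melem_residue (hc : c ≠ 0) (κ : Coeffs N) {σ : Fin 2}
    (hK : Peeling Ω M p .u .v σ y A A₁ B B₁ ψ α)
    (hB : Peeling Ω (fun θ => (M θ).dual) p .uC .vC σ x A' A₁' B' B₁' ψ' β)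
    (hx : x ∉ 𝓛) (hy : y ∉ 𝓛)
    (hX : RegOn Ω M p (insert x 𝓛))
    (hY : RegOn Ω M p (insert y 𝓛))
    (hM' : IsModified M M' p 𝓛 σ y) {φ γ : Θ → ℂ} (hγ : γ ∈ Ω)
    (hφ : ∀ θ, (M θ).covac ((M θ).T σ.succ σ.castSucc (p θ x)
        ((M θ).T σ.castSucc σ.succ (p θ y) (M θ).vac)) = φ θ * γ θ)
    (hψ : ∀ θ, ∀ j ∈ B, ψ θ j = ((M' θ).lam 1 (p θ (.v j)))⁻¹)
    (hu : ∀ θ, ∀ i ∈ A, (M' θ).lam 1 (p θ (.u i)) ≠ 0)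
    (huC : ∀ θ, ∀ i ∈ A', (M' θ).lam 1 (p θ (.uC i)) ≠ 0)
    (hvC : ∀ j ∈ B', (fun θ => ((M' θ).lam 1 (p θ (.vC j)))⁻¹) ∈ Ω)
    (hmis : ∀ j ∈ B', (fun θ => φ θ * (ψ' θ j - ((M' θ).lam 1 (p θ (.vC j)))⁻¹)) ∈ Ω)
    {m : ℂ} (hm : (-1) ^ (B₁'.card * (B₁'.card - 1) / 2) =
      m * (-1) ^ (B'.card * (B'.card - 1) / 2)) :
    (fun θ => melem (M θ) (p θ) κ A₁ B₁ A₁' B₁' - m * (α θ * β θ * (φ θ * γ θ) *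
      (∏ i ∈ A, (M' θ).lam 1 (p θ (.u i))) * ∏ i ∈ A', (M' θ).lam 1 (p θ (.uC i))) *
        melem (M' θ) (p θ) κ A B A' B') ∈ Ω := by
  have h1 := melem_residue_of_peeling hc κ hK hB hx hy hX hY hM'
  have h2 := mem_of_pairVec (disjoint_bra_op A' B') (disjoint_bra_ket A A' B B')
    (disjoint_op_ket A B) (hM'.regOn hy hY) (pair_operator κ)
    (pair_ketOp isLabelling_ket hK.pt hK.ψ_mem).vec
    (pair_ketOp_sub isLabelling_bra hB.pt hB.ψ_mem hvC hmis).vec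
  convert fun_add_mem h1 (fun_mul_mem (fun_mul_mem (fun_mul_mem hK.α_mem hB.α_mem)
    (fun_mul_mem (const_mem ((-1) ^ (B₁'.card * (B₁'.card - 1) / 2))) hγ)) h2) using 1
  funext θ
  have n1 := ketOp_vac (M' θ) (v := fun j => p θ (.v j)) (hu θ) (hψ θ)
  have n2 := ketOp_vac (M' θ).dual (u := fun i => p θ (.uC i)) (huC θ)
    (B := B') fun j _ => (rfl : _ = ((M' θ).lam 1 (p θ (.vC j)))⁻¹)
  simp only [lsmul_apply, lsub_apply, map_smul, map_sub]
  rw [n1, n2, melem_eq hc (M' θ) _ _ _ _ (hB.pt.admissible_u isLabelling_bra θ)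
    (hB.pt.admissible_v isLabelling_bra θ), hφ, hm]
  simp only [map_smul, smul_eq_mul, lsmul_apply]
  simp only [Model.dual]
  ring

end Residue

/-! ### Algebras of rational functions -/

section RatAlg

/-- The functions of the form `P / T` with `T ∈ S`, `T` without zeros. -/
def ratAlg {R Θ : Type} [CommRing R] [Algebra ℂ R] (ev : Θ → R →ₐ[ℂ] ℂ) (S : Submonoid R) :
    FunAlg Θ where
  carrier := {φ | ∃ P, ∃ T ∈ S, ∀ θ, ev θ T ≠ 0 ∧ φ θ * ev θ T = ev θ P}
  mul_mem' := by
    rintro φ χ ⟨P, T, hT, h⟩ ⟨P', T', hT', h'⟩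
    refine ⟨P * P', T * T', mul_mem hT hT', fun θ => ⟨?_, ?_⟩⟩
    · rw [map_mul]
      exact mul_ne_zero (h θ).1 (h' θ).1
    · rw [map_mul, map_mul, ← (h θ).2, ← (h' θ).2, Pi.mul_apply]
      ring
  add_mem' := by
    rintro φ χ ⟨P, T, hT, h⟩ ⟨P', T', hT', h'⟩
    refine ⟨P * T' + P' * T, T * T', mul_mem hT hT', fun θ => ⟨?_, ?_⟩⟩
    · rw [map_mul]
      exact mul_ne_zero (h θ).1 (h' θ).1
    · rw [map_add, map_mul, map_mul, map_mul, ← (h θ).2, ← (h' θ).2, Pi.add_apply]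
      ring
  algebraMap_mem' z := ⟨algebraMap ℂ R z, 1, one_mem _, fun θ => by simp⟩

variable {R Θ : Type} [CommRing R] [Algebra ℂ R] {ev : Θ → R →ₐ[ℂ] ℂ} {S S' : Submonoid R}

lemma ev_mem_ratAlg (P : R) : (fun θ => ev θ P) ∈ ratAlg ev S := ⟨P, 1, one_mem _, fun θ => by simp⟩

lemma inv_mem_ratAlg {T : R} (hT : T ∈ S) (h : ∀ θ, ev θ T ≠ 0) :
    (fun θ => (ev θ T)⁻¹) ∈ ratAlg ev S :=
  ⟨1, T, hT, fun θ => ⟨h θ, by rw [map_one, inv_mul_cancel₀ (h θ)]⟩⟩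

/-- A rational function that is regular at each of a family of primes has a representation without
these primes in the denominator. -/
lemma exists_eq_of_forall_not_dvd [IsDomain R] [DecompositionMonoid R] {κ : Type*}
    [DecidableEq κ] {D : Finset κ} {π : κ → R} (hπ : ∀ e ∈ D, Prime (π e))
    (hrel : ∀ e ∈ D, ∀ k ∈ D, e ≠ k → ¬ π e ∣ π k)
    (hev : ∀ P Q, (∀ θ, ev θ P = ev θ Q) → P = Q) {φ : Θ → ℂ} {P T : R} {m : κ → ℕ}
    (h : ∀ θ, ev θ (T * ∏ e ∈ D, π e ^ m e) ≠ 0 ∧ φ θ * ev θ (T * ∏ e ∈ D, π e ^ m e) = ev θ P)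
    (he : ∀ e ∈ D, ∃ P' T', ¬ π e ∣ T' ∧ ∀ θ, φ θ * ev θ T' = ev θ P') :
    ∃ Q, ∀ θ, ev θ T ≠ 0 ∧ φ θ * ev θ T = ev θ Q := by
  have key : ∀ e ∈ D, π e ^ m e ∣ P := by
    intro e heD
    obtain ⟨P', T', hT', h'⟩ := he e heD
    have e1 : P * T' = P' * (T * ∏ k ∈ D, π k ^ m k) := by
      refine hev _ _ fun θ => ?_
      rw [map_mul, map_mul _ P', ← (h θ).2, ← h' θ]
      ring
    refine (hπ e heD).pow_dvd_of_dvd_mul_right _ hT' ?_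
    rw [e1]
    exact Dvd.dvd.mul_left (Dvd.dvd.mul_left (dvd_prod_of_mem (fun k => π k ^ m k) heD) _) _
  have h2 : (∏ e ∈ D, π e ^ m e) ∣ P := prod_dvd_of_isRelPrime (fun i hi j hj hij => IsRelPrime.pow
      ((hπ i hi).irreducible.isRelPrime_iff_not_dvd.2 (hrel i hi j hj hij))) key
  obtain ⟨Q, rfl⟩ := h2
  refine ⟨Q, fun θ => ?_⟩
  have h3 := (h θ).2
  have h4 := (h θ).1
  simp only [map_mul] at h3 h4
  refine ⟨left_ne_zero_of_mul h4, mul_right_cancel₀ (right_ne_zero_of_mul h4) ?_⟩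
  rw [mul_assoc, h3, mul_comm]

/-- Pairs of functions in `Ω` that coincide modulo `d`. -/
def pairAlg {Θ : Type} (Ω : FunAlg Θ) (d : Θ → ℂ) : Subalgebra ℂ (Θ × Bool → ℂ) where
  carrier := {φ | (fun θ => φ (θ, true)) ∈ Ω ∧ (fun θ => φ (θ, false)) ∈ Ω ∧
    ∃ ψ ∈ Ω, ∀ θ, φ (θ, true) - φ (θ, false) = d θ * ψ θ}
  mul_mem' := by
    rintro φ χ ⟨h1, h2, ψ, hψ, h3⟩ ⟨k1, k2, ω, hω, k3⟩
    refine ⟨mul_mem h1 k1, mul_mem h2 k2, _, fun_add_mem (fun_mul_mem h1 hω)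
      (fun_mul_mem k2 hψ), fun θ => ?_⟩
    simp only [Pi.mul_apply]
    linear_combination φ (θ, true) * k3 θ + χ (θ, false) * h3 θ
  add_mem' := by
    rintro φ χ ⟨h1, h2, ψ, hψ, h3⟩ ⟨k1, k2, ω, hω, k3⟩
    refine ⟨add_mem h1 k1, add_mem h2 k2, _, fun_add_mem hψ hω, fun θ => ?_⟩
    simp only [Pi.add_apply]
    linear_combination k3 θ + h3 θ
  algebraMap_mem' z := ⟨const_mem z, const_mem z, _, const_mem 0, fun θ => by simp⟩

lemma mem_pairAlg_of_mem {Ω : FunAlg Θ} {d : Θ → ℂ} {φ : Θ → ℂ} (h : φ ∈ Ω) :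
    (fun x : Θ × Bool => φ x.1) ∈ pairAlg Ω d :=
  ⟨h, h, _, const_mem 0, fun θ => by simp⟩

end RatAlg

section Poles

open MvPolynomial

variable {ι : Type}

/-- Denominators that may vanish at `z₀` only because of the factors `X_e`, `e ∈ D`. -/
def poleMonoid (z₀ : ι → ℂ) (D : Finset ι) : Submonoid (MvPolynomial ι ℂ) where
  carrier := {T | ∃ (T₀ : MvPolynomial ι ℂ) (m : ℕ), eval z₀ T₀ ≠ 0 ∧ T = T₀ * (∏ e ∈ D, X e) ^ m}
  one_mem' := ⟨1, 0, by simp, by simp⟩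
  mul_mem' := by
    rintro _ _ ⟨T, m, hT, rfl⟩ ⟨T', m', hT', rfl⟩
    refine ⟨T * T', m + m', ?_, by ring⟩
    rw [map_mul]
    exact mul_ne_zero hT hT'

variable {z₀ : ι → ℂ} {D : Finset ι}

lemma mem_poleMonoid_of_eval_ne {T : MvPolynomial ι ℂ} (h : eval z₀ T ≠ 0) :
    T ∈ poleMonoid z₀ D := ⟨T, 0, h, by simp⟩

lemma poleMonoid_mono [DecidableEq ι] {D' : Finset ι} (h : D ⊆ D') (z₀ : ι → ℂ) {Θ : Type}
    {ev : Θ → MvPolynomial ι ℂ →ₐ[ℂ] ℂ} (hD : ∀ θ, ∀ e ∈ D', ev θ (X e) ≠ 0) :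
    ratAlg ev (poleMonoid z₀ D) ≤ ratAlg ev (poleMonoid z₀ D') := by
  rintro φ ⟨P, _, ⟨T, m, hT, rfl⟩, h'⟩
  refine ⟨P * (∏ e ∈ D' \ D, X e) ^ m, _, ⟨T, m, hT, rfl⟩, fun θ => ?_⟩
  have h1 := (h' θ).2
  have h2 := (h' θ).1
  rw [← prod_sdiff h]
  simp only [map_mul, map_pow, map_prod, mul_pow, ← h1] at h2 ⊢
  refine ⟨mul_ne_zero (left_ne_zero_of_mul h2) (mul_ne_zero (pow_ne_zero _
    (prod_ne_zero_iff.2 fun e he => hD θ e (sdiff_subset he))) (right_ne_zero_of_mul h2)), by ring⟩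

lemma X_mem_poleMonoid [DecidableEq ι] {e : ι} (he : e ∈ D) {Θ : Type}
    {ev : Θ → MvPolynomial ι ℂ →ₐ[ℂ] ℂ} (hD : ∀ θ, ∀ e ∈ D, ev θ (X e) ≠ 0) :
    (fun θ => (ev θ (X e))⁻¹) ∈ ratAlg ev (poleMonoid z₀ D) := by
  refine ⟨∏ k ∈ D.erase e, X k, _, ⟨1, 1, by simp, rfl⟩, fun θ => ?_⟩
  rw [← mul_prod_erase D _ he]
  simp only [one_mul, pow_one, map_mul, map_prod]
  refine ⟨mul_ne_zero (hD θ e he) (prod_ne_zero_iff.2 fun k hk => hD θ k (mem_of_mem_erase hk)), ?_⟩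
  rw [← mul_assoc, inv_mul_cancel₀ (hD θ e he), one_mul]

lemma not_X_dvd_of_eval {e : ι} (he : z₀ e = 0) {T : MvPolynomial ι ℂ} (h : eval z₀ T ≠ 0) :
    ¬ (X e : MvPolynomial ι ℂ) ∣ T := by
  rintro ⟨Q, rfl⟩
  simp [he] at h

lemma not_X_dvd_prod {e : ι} (he : e ∉ D) (m : ℕ) :
    ¬ (X e : MvPolynomial ι ℂ) ∣ (∏ k ∈ D, X k) ^ m := by
  intro h
  have h1 := (X_prime (R := ℂ) (i := e)).dvd_of_dvd_pow h
  obtain ⟨k, hk, h2⟩ := ((X_prime (R := ℂ) (i := e)).dvd_finsetProd_iff _).1 h1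
  rw [X_dvd_X] at h2
  exact he (h2 ▸ hk)

variable {Θ : Type} {ev : Θ → MvPolynomial ι ℂ →ₐ[ℂ] ℂ}

/-- A function without poles at any of the hyperplanes `X_e = 0` is regular. -/
lemma mem_regular_of_forall_erase [DecidableEq ι] (hz : ∀ e ∈ D, z₀ e = 0)
    (hev : ∀ P Q, (∀ θ, ev θ P = ev θ Q) → P = Q) {φ : Θ → ℂ} (h : φ ∈ ratAlg ev (poleMonoid z₀ D))
    (he : ∀ e ∈ D, φ ∈ ratAlg ev (poleMonoid z₀ (D.erase e))) :
    φ ∈ ratAlg ev (poleMonoid z₀ ∅) := by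
  obtain ⟨P, _, ⟨T, m, hT, rfl⟩, h⟩ := h
  simp only [← prod_pow] at h
  obtain ⟨Q, hQ⟩ := exists_eq_of_forall_not_dvd (π := X) (fun e _ => X_prime)
    (fun e _ k _ hek => by rwa [X_dvd_X]) hev h fun e heD => by
      obtain ⟨P', _, ⟨T', m', hT', rfl⟩, h'⟩ := he e heD
      refine ⟨P', _, fun h3 => ?_, fun θ => (h' θ).2⟩
      rcases X_prime.dvd_or_dvd h3 with h4 | h4
      · exact not_X_dvd_of_eval (hz e heD) hT' h4
      · exact not_X_dvd_prod (notMem_erase _ _) _ h4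
  exact ⟨Q, T, mem_poleMonoid_of_eval_ne hT, hQ⟩

lemma exists_tendsto_of_mem_regular {l : Filter Θ}
    (hl : ∀ P, Tendsto (fun θ => ev θ P) l (𝓝 (eval z₀ P))) {φ : Θ → ℂ}
    (h : φ ∈ ratAlg ev (poleMonoid z₀ ∅)) : ∃ z, Tendsto φ l (𝓝 z) := by
  obtain ⟨P, _, ⟨T, m, hT, rfl⟩, h⟩ := h
  refine ⟨eval z₀ P / eval z₀ T, ((hl P).div (hl T) hT).congr fun θ => ?_⟩
  have h1 := h θ
  simp only [prod_empty, one_pow, mul_one] at h1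
  simp only [Pi.div_apply]
  rw [← h1.2, mul_div_cancel_right₀ _ h1.1]

lemma tendsto_zero_of_mem_regular [DecidableEq ι] {l : Filter Θ}
    (hl : ∀ P, Tendsto (fun θ => ev θ P) l (𝓝 (eval z₀ P)))
    (hev : ∀ P Q, (∀ θ, ev θ P = ev θ Q) → P = Q) {φ ψ : Θ → ℂ} {e : ι} (hz : z₀ e = 0)
    (h : φ ∈ ratAlg ev (poleMonoid z₀ ∅)) (hψ : ψ ∈ ratAlg ev (poleMonoid z₀ (D.erase e)))
    (hφ : ∀ θ, φ θ = ev θ (X e) * ψ θ) : Tendsto φ l (𝓝 0) := by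
  obtain ⟨P, _, ⟨T, m, hT, rfl⟩, h⟩ := h
  obtain ⟨P', _, ⟨T', m', hT', rfl⟩, h'⟩ := hψ
  have e1 : P * (T' * (∏ k ∈ D.erase e, X k) ^ m') = X e * (P' * T) := by
    refine hev _ _ fun θ => ?_
    have h1 := (h θ).2
    simp only [prod_empty, one_pow, mul_one] at h1
    rw [map_mul, map_mul _ (X e), map_mul _ P', ← h1, ← (h' θ).2, hφ]
    ring
  have e2 : (X e : MvPolynomial ι ℂ) ∣ P := by
    rcases (X_prime (R := ℂ) (i := e)).dvd_or_dvd ⟨_, e1⟩ with h4 | h4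
    · exact h4
    rcases (X_prime (R := ℂ) (i := e)).dvd_or_dvd h4 with h4 | h4
    · exact absurd h4 (not_X_dvd_of_eval hz hT')
    · exact absurd h4 (not_X_dvd_prod (notMem_erase _ _) _)
  obtain ⟨Q, rfl⟩ := e2
  have h2 := (hl (X e * Q)).div (hl T) hT
  simp only [map_mul, eval_X, hz, zero_mul, zero_div] at h2
  refine h2.congr fun θ => ?_
  have h1 := h θ
  simp only [prod_empty, one_pow, mul_one] at h1
  simp only [Pi.div_apply]
  rw [← map_mul, ← h1.2, mul_div_cancel_right₀ _ h1.1]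

end Poles

/-! ### Residues for models with `λ₂ = 1` at the rapidities -/

section Reg

/-- `φ` has no zeros and its inverse belongs to `Ω`. -/
def InvIn {Θ : Type} (Ω : FunAlg Θ) (φ : Θ → ℂ) : Prop := (∀ θ, φ θ ≠ 0) ∧ (fun θ => (φ θ)⁻¹) ∈ Ω

variable {c : ℂ} {a b N : ℕ} {Θ : Type} {Ω : FunAlg Θ}

lemma InvIn.g_mem {x y : Θ → ℂ} (h : InvIn Ω fun θ => x θ - y θ) :
    (fun θ => g c (x θ) (y θ)) ∈ Ω := fun_mul_mem (const_mem (I * c)) h.2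

lemma InvIn.f_ne {x y : Θ → ℂ} (h : InvIn Ω fun θ => x θ - y θ + I * c) {θ : Θ}
    (hxy : x θ ≠ y θ) : f c (x θ) (y θ) ≠ 0 := div_ne_zero (h.1 θ) (sub_ne_zero.2 hxy)

lemma InvIn.f_inv {x y : Θ → ℂ} (h : InvIn Ω fun θ => x θ - y θ + I * c) (hx : x ∈ Ω)
    (hy : y ∈ Ω) : (fun θ => (f c (x θ) (y θ))⁻¹) ∈ Ω := by
  simp only [f, inv_div]
  exact fun_mul_mem (fun_sub_mem hx hy) h.2

lemma InvIn.h_ne (hc : c ≠ 0) {x y : Θ → ℂ} (h : InvIn Ω fun θ => x θ - y θ + I * c)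
    (θ : Θ) : GL21.h c (x θ) (y θ) ≠ 0 := div_ne_zero (h.1 θ) (ic_ne_zero hc)

lemma InvIn.h_inv {x y : Θ → ℂ} (h : InvIn Ω fun θ => x θ - y θ + I * c) :
    (fun θ => (GL21.h c (x θ) (y θ))⁻¹) ∈ Ω := by
  simp only [GL21.h, inv_div]
  exact fun_mul_mem (const_mem _) h.2

lemma inv_f_eq {x y : ℂ} (h : x - y + I * c ≠ 0) : (f c x y)⁻¹ = 1 - I * c * (x - y + I * c)⁻¹ := by
  rw [f, inv_div]
  field_simp
  ring

lemma mismatch_right {x y z : Θ → ℂ} (hxy : ∀ θ, x θ ≠ y θ)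
    (hx : InvIn Ω fun θ => z θ - x θ + I * c) (hy : InvIn Ω fun θ => z θ - y θ + I * c) :
    (fun θ => g c (x θ) (y θ) * ((f c (z θ) (x θ))⁻¹ - (f c (z θ) (y θ))⁻¹)) ∈ Ω := by
  convert fun_mul_mem (fun_mul_mem (const_mem (c ^ 2)) hx.2) hy.2 using 1
  funext θ
  have h1 := hx.1 θ
  have h2 := hy.1 θ
  have h3 := sub_ne_zero.2 (hxy θ)
  rw [inv_f_eq h1, inv_f_eq h2, g]
  field_simp
  ring_nf
  simp only [Complex.I_sq]
  ring

lemma mismatch_left {x y z : Θ → ℂ} (hxy : ∀ θ, x θ ≠ y θ) (hx : InvIn Ω fun θ => x θ - z θ + I * c)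
    (hy : InvIn Ω fun θ => y θ - z θ + I * c) :
    (fun θ => g c (x θ) (y θ) * ((f c (x θ) (z θ))⁻¹ - (f c (y θ) (z θ))⁻¹)) ∈ Ω := by
  convert fun_mul_mem (fun_mul_mem (const_mem (-c ^ 2)) hx.2) hy.2 using 1
  funext θ
  have h1 := hx.1 θ
  have h2 := hy.1 θ
  have h3 := sub_ne_zero.2 (hxy θ)
  rw [inv_f_eq h1, inv_f_eq h2, g]
  field_simp
  ring_nf
  simp only [Complex.I_sq]
  ring

/-- Regularity of the spectral parameters of a matrix element, except for the differences of the
pairs of labels related by `Q`. -/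
structure Reg (c : ℂ) (Ω : FunAlg Θ) (p : Θ → Lbl a b N → ℂ) (A : Finset (Fin a))
    (B : Finset (Fin b)) (A' : Finset (Fin a)) (B' : Finset (Fin b))
    (Q : Lbl a b N → Lbl a b N → Prop) : Prop where
  pos_mem : ∀ m ∈ allLabs N A B A' B', (fun θ => p θ m) ∈ Ω
  inj : ∀ θ, Set.InjOn (p θ) (allLabs N A B A' B')
  sub : ∀ m ∈ allLabs N A B A' B', ∀ z ∈ allLabs N A B A' B', m ≠ z → ¬ Q m z →
    (fun θ => (p θ m - p θ z)⁻¹) ∈ Ω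
  uu : ∀ i ∈ A, ∀ l ∈ A, InvIn Ω fun θ => p θ (.u i) - p θ (.u l) + I * c
  vv : ∀ i ∈ B, ∀ l ∈ B, InvIn Ω fun θ => p θ (.v i) - p θ (.v l) + I * c
  vu : ∀ i ∈ B, ∀ l ∈ A, InvIn Ω fun θ => p θ (.v i) - p θ (.u l) + I * c
  uuC : ∀ i ∈ A', ∀ l ∈ A', InvIn Ω fun θ => p θ (.uC i) - p θ (.uC l) + I * c
  vvC : ∀ i ∈ B', ∀ l ∈ B', InvIn Ω fun θ => p θ (.vC i) - p θ (.vC l) + I * c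
  vuC : ∀ i ∈ B', ∀ l ∈ A', InvIn Ω fun θ => p θ (.vC i) - p θ (.uC l) + I * c

variable {p : Θ → Lbl a b N → ℂ} {A A' : Finset (Fin a)} {B B' : Finset (Fin b)}
  {Q : Lbl a b N → Lbl a b N → Prop} {M : Θ → Model.{u₁} c} {M' : Θ → Model.{u₂} c}

lemma allLabs_mono {A₁ A₁' : Finset (Fin a)} {B₁ B₁' : Finset (Fin b)} (h1 : A ⊆ A₁)
    (h2 : B ⊆ B₁) (h3 : A' ⊆ A₁') (h4 : B' ⊆ B₁') : allLabs N A B A' B' ⊆ allLabs N A₁ B₁ A₁' B₁' :=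
  Set.union_subset_union (labs_mono h3 h4)
    (Set.union_subset_union_right _ (labs_mono h1 h2))

lemma Reg.mono (hR : Reg c Ω p A B A' B' Q) {A₁ A₁' : Finset (Fin a)} {B₁ B₁' : Finset (Fin b)}
    {Q₁ : Lbl a b N → Lbl a b N → Prop} (h1 : A₁ ⊆ A) (h2 : B₁ ⊆ B) (h3 : A₁' ⊆ A') (h4 : B₁' ⊆ B')
    (hQ : ∀ m ∈ allLabs N A₁ B₁ A₁' B₁', ∀ z ∈ allLabs N A₁ B₁ A₁' B₁', Q m z → Q₁ m z) :
    Reg c Ω p A₁ B₁ A₁' B₁' Q₁ where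
  pos_mem m hm := hR.pos_mem m (allLabs_mono h1 h2 h3 h4 hm)
  inj θ := (hR.inj θ).mono (allLabs_mono h1 h2 h3 h4)
  sub m hm z hz hmz hq := hR.sub m (allLabs_mono h1 h2 h3 h4 hm) z (allLabs_mono h1 h2 h3 h4 hz)
    hmz fun h => hq (hQ m hm z hz h)
  uu i hi l hl := hR.uu i (h1 hi) l (h1 hl)
  vv i hi l hl := hR.vv i (h2 hi) l (h2 hl)
  vu i hi l hl := hR.vu i (h2 hi) l (h1 hl)
  uuC i hi l hl := hR.uuC i (h3 hi) l (h3 hl)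
  vvC i hi l hl := hR.vvC i (h4 hi) l (h4 hl)
  vuC i hi l hl := hR.vuC i (h4 hi) l (h3 hl)

local notation "𝓛" => allLabs N A B A' B'

lemma Reg.invIn_sub (hR : Reg c Ω p A B A' B' Q) {m z : Lbl a b N}
    (hm : m ∈ 𝓛) (hz : z ∈ 𝓛) (hmz : m ≠ z) (hq : ¬ Q m z) : InvIn Ω fun θ => p θ m - p θ z :=
  ⟨fun θ => sub_ne_zero.2 fun e => hmz (hR.inj θ hm hz e), hR.sub m hm z hz hmz hq⟩

lemma ketLabs_subset : ketLabs N A B ⊆ 𝓛 := fun _ h => .inr (.inr h)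

lemma braLabs_subset : braLabs N A' B' ⊆ 𝓛 := fun _ h => .inl h

lemma Reg.ptReg (hc : c ≠ 0) (hR : Reg c Ω p A B A' B' Q) {ku : Fin a → Lbl a b N}
    {kv : Fin b → Lbl a b N} {X : Finset (Fin a)} {Y : Finset (Fin b)} (hk : IsLabelling ku kv)
    (hs : labs ku kv X Y ⊆ 𝓛)
    (uu : ∀ i ∈ X, ∀ l ∈ X, InvIn Ω fun θ => p θ (ku i) - p θ (ku l) + I * c)
    (vv : ∀ i ∈ Y, ∀ l ∈ Y, InvIn Ω fun θ => p θ (kv i) - p θ (kv l) + I * c)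
    (vu : ∀ i ∈ Y, ∀ l ∈ X, InvIn Ω fun θ => p θ (kv i) - p θ (ku l) + I * c)
    (hQ : ∀ m ∈ labs ku kv X Y, ∀ z ∈ labs ku kv X Y, ¬ Q m z) : PtReg c Ω p ku kv X Y where
  inj θ := (hR.inj θ).mono hs
  sub_mem m hm z hz := fun_sub_mem (hR.pos_mem m (hs hm)) (hR.pos_mem z (hs hz))
  g_mem m hm z hz hmz := (hR.invIn_sub (hs hm) (hs hz) hmz (hQ m hm z hz)).g_mem
  hu_ne θ i hi l hl := (uu i hi l hl).h_ne hc θ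
  hu_inv i hi l hl := (uu i hi l hl).h_inv
  hv_ne θ i hi l hl := (vv i hi l hl).h_ne hc θ
  hv_inv i hi l hl := (vv i hi l hl).h_inv
  f_ne θ j hj i hi := (vu j hj i hi).f_ne fun e => hk.u_ne_v i j
    (hR.inj θ (hs (mem_labs_u hi)) (hs (mem_labs_v hj)) e.symm)
  f_inv j hj i hi := (vu j hj i hi).f_inv (hR.pos_mem _ (hs (mem_labs_v hj)))
    (hR.pos_mem _ (hs (mem_labs_u hi)))

lemma Reg.ptReg_ket (hc : c ≠ 0) (hR : Reg c Ω p A B A' B' Q)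
    (hQ : ∀ m ∈ ketLabs N A B, ∀ z ∈ ketLabs N A B, ¬ Q m z) : PtReg c Ω p .u .v A B :=
  hR.ptReg hc isLabelling_ket ketLabs_subset hR.uu hR.vv hR.vu hQ

lemma Reg.ptReg_bra (hc : c ≠ 0) (hR : Reg c Ω p A B A' B' Q)
    (hQ : ∀ m ∈ braLabs N A' B', ∀ z ∈ braLabs N A' B', ¬ Q m z) : PtReg c Ω p .uC .vC A' B' :=
  hR.ptReg hc isLabelling_bra braLabs_subset hR.uuC hR.vvC hR.vuC hQ

lemma Reg.regOn (hR : Reg c Ω p A B A' B' Q)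
    (hlam : ∀ i, ∀ m ∈ 𝓛, (fun θ => (M θ).lam i (p θ m)) ∈ Ω)
    {s : Set (Lbl a b N)} (hs : s ⊆ 𝓛) (hQ : ∀ m ∈ s, ∀ z ∈ s, ¬ Q m z) : RegOn Ω M p s where
  inj θ := (hR.inj θ).mono hs
  g_mem m hm z hz hmz := (hR.invIn_sub (hs hm) (hs hz) hmz (hQ m hm z hz)).g_mem
  lam_mem i m hm := hlam i m (hs hm)

lemma Reg.melem_mem (hc : c ≠ 0) (κ : Coeffs N) (hR : Reg c Ω p A B A' B' Q) (hQ : ∀ m z, ¬ Q m z)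
    (h1 : ∀ θ, ∀ m ∈ braLabs N A' B' ∪ ketLabs N A B, (M θ).lam 1 (p θ m) = 1)
    (hlam : ∀ i, ∀ m ∈ 𝓛, (fun θ => (M θ).lam i (p θ m)) ∈ Ω) :
    (fun θ => melem (M θ) (p θ) κ A B A' B') ∈ Ω :=
  GL21.melem_mem hc κ (hR.ptReg_ket hc fun m _ z _ => hQ m z)
    (hR.ptReg_bra hc fun m _ z _ => hQ m z)
    (lamReg_of_eq_one fun θ m hm => h1 θ m (.inr hm))
    (lamReg_of_eq_one fun θ m hm => h1 θ m (.inl hm))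
    (hR.regOn hlam subset_rfl fun m _ z _ => hQ m z)

def OnlyPair (x y : Lbl a b N) (m z : Lbl a b N) : Prop := m = x ∧ z = y ∨ m = y ∧ z = x

lemma not_onlyPair {x y : Lbl a b N} {s : Set (Lbl a b N)} (h : x ∉ s ∨ y ∉ s) :
    ∀ m ∈ s, ∀ z ∈ s, ¬ OnlyPair x y m z := by
  rintro m hm z hz (⟨rfl, rfl⟩ | ⟨rfl, rfl⟩)
  · exact h.elim (fun h => h hm) fun h => h hz
  · exact h.elim (fun h => h hz) fun h => h hm

/-- `λ₂ = 1` at the rapidities, and the vacuum eigenvalues are functions in `Ω`. -/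
structure Normalized (Ω : FunAlg Θ) (M : Θ → Model.{u₁} c) (p : Θ → Lbl a b N → ℂ)
    (A : Finset (Fin a)) (B : Finset (Fin b)) (A' : Finset (Fin a)) (B' : Finset (Fin b)) :
    Prop where
  one : ∀ θ, ∀ m ∈ braLabs N A' B' ∪ ketLabs N A B, (M θ).lam 1 (p θ m) = 1
  mem : ∀ i, ∀ m ∈ allLabs N A B A' B', (fun θ => (M θ).lam i (p θ m)) ∈ Ω

section

variable {A₁ A₁' : Finset (Fin a)} {B₁ B₁' : Finset (Fin b)} {x y : Lbl a b N}

lemma Reg.regOn_left (hR : Reg c Ω p A₁ B₁ A₁' B₁' (OnlyPair x y))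
    (hl : Normalized Ω M p A₁ B₁ A₁' B₁') (hx : x ∈ allLabs N A₁ B₁ A₁' B₁')
    (hsub : 𝓛 ⊆ allLabs N A₁ B₁ A₁' B₁') (hy : y ∉ 𝓛) (hxy : x ≠ y) : RegOn Ω M p (insert x 𝓛) :=
  hR.regOn hl.mem (Set.insert_subset hx hsub) (not_onlyPair (.inr fun h => h.elim hxy.symm hy))

lemma Reg.regOn_right (hR : Reg c Ω p A₁ B₁ A₁' B₁' (OnlyPair x y))
    (hl : Normalized Ω M p A₁ B₁ A₁' B₁') (hy : y ∈ allLabs N A₁ B₁ A₁' B₁')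
    (hsub : 𝓛 ⊆ allLabs N A₁ B₁ A₁' B₁') (hx : x ∉ 𝓛) (hxy : x ≠ y) : RegOn Ω M p (insert y 𝓛) :=
  hR.regOn hl.mem (Set.insert_subset hy hsub) (not_onlyPair (.inl fun h => h.elim hxy hx))

lemma Reg.ne (hR : Reg c Ω p A B A' B' Q) (hx : x ∈ 𝓛)
    (hy : y ∈ 𝓛) (hxy : x ≠ y) (θ : Θ) : p θ x ≠ p θ y :=
  fun e => hxy (hR.inj θ hx hy e)

lemma Reg.peeling_ket_u (hc : c ≠ 0) {k : Fin a} (hkA : k ∉ A)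
    (hR : Reg c Ω p (insert k A) B A' B' (OnlyPair x y))
    (hl : Normalized Ω M p (insert k A) B A' B') (hx : x ∉ ketLabs N (insert k A) B) :
    Peeling Ω M p .u .v 0 (.u k) A (insert k A) B B
      (fun θ j => (f c (p θ (.v j)) (p θ (.u k)))⁻¹) 1 :=
  peeling_u hc isLabelling_ket hkA (hR.ptReg_ket hc (not_onlyPair (.inl hx)))
    fun θ m hm => hl.one θ m (.inr hm)

lemma Reg.peeling_bra_u (hc : c ≠ 0) {k : Fin a} (hkA : k ∉ A')
    (hR : Reg c Ω p A B (insert k A') B' (OnlyPair x y))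
    (hl : Normalized Ω M p A B (insert k A') B') (hy : y ∉ braLabs N (insert k A') B') :
    Peeling Ω (fun θ => (M θ).dual) p .uC .vC 0 (.uC k) A' (insert k A') B' B'
      (fun θ j => (f c (p θ (.vC j)) (p θ (.uC k)))⁻¹) 1 :=
  peeling_u hc isLabelling_bra hkA (hR.ptReg_bra hc (not_onlyPair (.inr hy)))
    fun θ m hm => hl.one θ m (.inl hm)

lemma Reg.peeling_ket_v (hc : c ≠ 0) {k : Fin b} (hkB : k ∉ B)
    (hR : Reg c Ω p A (insert k B) A' B' (OnlyPair x y))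
    (hl : Normalized Ω M p A (insert k B) A' B') (hx : x ∉ ketLabs N A (insert k B)) :
    Peeling Ω M p .u .v 1 (.v k) A A B (insert k B)
      (fun θ j => (f c (p θ (.v k)) (p θ (.v j)))⁻¹) fun θ =>
        (∏ j ∈ B, g c (p θ (.v k)) (p θ (.v j))) / ∏ i ∈ A, f c (p θ (.v k)) (p θ (.u i)) :=
  peeling_v hc isLabelling_ket hkB (hR.ptReg_ket hc (not_onlyPair (.inl hx)))
    (fun θ m hm => hl.one θ m (.inr hm)) fun j hj => (hR.vv k (by simp) j (by simp [hj])).f_inv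
      (hR.pos_mem _ (by simp)) (hR.pos_mem _ (by simp [hj]))

lemma Reg.peeling_bra_v (hc : c ≠ 0) {k : Fin b} (hkB : k ∉ B')
    (hR : Reg c Ω p A B A' (insert k B') (OnlyPair x y))
    (hl : Normalized Ω M p A B A' (insert k B')) (hy : y ∉ braLabs N A' (insert k B')) :
    Peeling Ω (fun θ => (M θ).dual) p .uC .vC 1 (.vC k) A' A' B' (insert k B')
      (fun θ j => (f c (p θ (.vC k)) (p θ (.vC j)))⁻¹) fun θ =>
        (∏ j ∈ B', g c (p θ (.vC k)) (p θ (.vC j))) / ∏ i ∈ A', f c (p θ (.vC k)) (p θ (.uC i)) :=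
  peeling_v hc isLabelling_bra hkB (hR.ptReg_bra hc (not_onlyPair (.inr hy)))
    (fun θ m hm => hl.one θ m (.inl hm)) fun j hj => (hR.vvC k (by simp) j (by simp [hj])).f_inv
      (hR.pos_mem _ (by simp)) (hR.pos_mem _ (by simp [hj]))

end

lemma Reg.residue_u (hc : c ≠ 0) (κ : Coeffs N) {k l : Fin a} (hkA : k ∉ A) (hlA : l ∉ A')
    (hR : Reg c Ω p (insert k A) B (insert l A') B' (OnlyPair (.uC l) (.u k)))
    (hl : Normalized Ω M p (insert k A) B (insert l A') B') (hM' : IsModified M M' p 𝓛 0 (.u k))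
    (huC : ∀ θ, ∀ i ∈ A', p θ (.uC i) - p θ (.u k) + I * c ≠ 0)
    (hvC : ∀ j ∈ B', InvIn Ω fun θ => p θ (.vC j) - p θ (.u k) + I * c) :
    (fun θ => melem (M θ) (p θ) κ (insert k A) B (insert l A') B' - g c (p θ (.uC l)) (p θ (.u k)) *
        ((M θ).lam 0 (p θ (.u k)) - (M θ).lam 0 (p θ (.uC l))) *
        (∏ i ∈ A, f c (p θ (.u i)) (p θ (.u k))) * (∏ i ∈ A', f c (p θ (.uC i)) (p θ (.u k))) *
        melem (M' θ) (p θ) κ A B A' B') ∈ Ω := by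
  have hsub : 𝓛 ⊆ allLabs N (insert k A) B (insert l A') B' :=
    allLabs_mono (subset_insert _ _) subset_rfl (subset_insert _ _) subset_rfl
  have hk : Lbl.u k ∉ 𝓛 := by simp [hkA]
  have hne : ∀ {z}, z ∈ 𝓛 → ∀ θ, p θ z ≠ p θ (.u k) := fun hz =>
    hR.ne (hsub hz) (by simp) fun e => hk (e ▸ hz)
  have hlam1 : ∀ θ, ∀ z ∈ braLabs N A' B' ∪ ketLabs N A B,
      (M' θ).lam 1 (p θ z) = f c (p θ z) (p θ (.u k)) := fun θ z hz' => by
    have hz : z ∈ 𝓛 := hz'.imp_right .inr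
    rw [hM' θ 1 z hz, hl.one θ z (Set.union_subset_union (labs_mono (subset_insert _ _)
      subset_rfl) (labs_mono (subset_insert _ _) subset_rfl) hz'), ← one_sub_g (hne hz θ).symm]
    simp [modG]
  have hxy := hR.ne (x := .uC l) (y := .u k) (by simp) (by simp) (by simp)
  convert melem_residue hc κ (φ := fun θ => g c (p θ (.uC l)) (p θ (.u k))) (hR.peeling_ket_u hc hkA hl (by simp))
    (hR.peeling_bra_u hc hlA hl (by simp)) (by simp [hlA]) hk
    (hR.regOn_left hl (by simp) hsub hk (by simp)) (hR.regOn_right hl (by simp) hsub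
      (by simp [hlA]) (by simp)) hM' (fun_sub_mem (hl.mem 0 (.u k) (by simp))
      (hl.mem 0 (.uC l) (by simp))) (fun θ => ?_) (fun θ j hj => ?_) (fun θ i hi => ?_)
    (fun θ i hi => ?_) (fun j hj => ?_) (fun j hj => ?_) (one_mul _).symm using 1
  · funext θ
    rw [prod_congr rfl fun i hi => hlam1 θ (.u i) (by simp [hi]),
      prod_congr rfl fun i hi => hlam1 θ (.uC i) (by simp [hi])]
    simp only [Pi.one_apply]
    ring
  · refine (vac_pairing_zero (M θ) (hxy θ)).trans ?_
    rw [hl.one θ _ (by simp), hl.one θ _ (by simp), mul_one, mul_one]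
  · rw [hlam1 θ _ (by simp [hj])]
  · rw [hlam1 θ _ (by simp [hi])]
    exact (hR.uu i (by simp [hi]) k (by simp)).f_ne (hne (by simp [hi]) θ)
  · rw [hlam1 θ _ (by simp [hi])]
    exact div_ne_zero (huC θ i hi) (sub_ne_zero.2 (hne (by simp [hi]) θ))
  · simp only [hlam1 _ (.vC j) (by simp [hj])]
    exact (hvC j hj).f_inv (hR.pos_mem _ (by simp [hj])) (hR.pos_mem _ (by simp))
  · simp only [hlam1 _ (.vC j) (by simp [hj])]
    exact mismatch_right hxy (hR.vuC j hj l (by simp)) (hvC j hj)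

lemma Reg.residue_v (hc : c ≠ 0) (κ : Coeffs N) {k l : Fin b} (hkB : k ∉ B) (hlB : l ∉ B')
    (hR : Reg c Ω p A (insert k B) A' (insert l B') (OnlyPair (.vC l) (.v k)))
    (hl : Normalized Ω M p A (insert k B) A' (insert l B')) (hM' : IsModified M M' p 𝓛 1 (.v k))
    (huC : ∀ θ, ∀ i ∈ A', p θ (.v k) - p θ (.uC i) + I * c ≠ 0)
    (hvC : ∀ j ∈ B', InvIn Ω fun θ => p θ (.v k) - p θ (.vC j) + I * c) :
    (fun θ => melem (M θ) (p θ) κ A (insert k B) A' (insert l B') -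
      (-1) ^ B'.card * g c (p θ (.vC l)) (p θ (.v k)) *
        ((M θ).lam 2 (p θ (.v k)) - (M θ).lam 2 (p θ (.vC l))) *
        (∏ j ∈ B, g c (p θ (.v k)) (p θ (.v j))) * (∏ j ∈ B', g c (p θ (.vC l)) (p θ (.vC j))) *
        ((∏ i ∈ A', f c (p θ (.v k)) (p θ (.uC i))) / ∏ i ∈ A', f c (p θ (.vC l)) (p θ (.uC i))) *
        melem (M' θ) (p θ) κ A B A' B') ∈ Ω := by
  have hsub : 𝓛 ⊆ allLabs N A (insert k B) A' (insert l B') :=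
    allLabs_mono subset_rfl (subset_insert _ _) subset_rfl (subset_insert _ _)
  have hk : Lbl.v k ∉ 𝓛 := by simp [hkB]
  have hne : ∀ {z}, z ∈ 𝓛 → ∀ θ, p θ (.v k) ≠ p θ z := fun hz =>
    hR.ne (by simp) (hsub hz) fun e => hk (e ▸ hz)
  have hlam1 : ∀ θ, ∀ z ∈ braLabs N A' B' ∪ ketLabs N A B,
      (M' θ).lam 1 (p θ z) = f c (p θ (.v k)) (p θ z) := fun θ z hz' => by
    have hz : z ∈ 𝓛 := hz'.imp_right .inr
    rw [hM' θ 1 z hz, hl.one θ z (Set.union_subset_union (labs_mono subset_rfl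
      (subset_insert _ _)) (labs_mono subset_rfl (subset_insert _ _)) hz'), f_eq (hne hz θ)]
    simp [modG]
  have hxy := hR.ne (x := .vC l) (y := .v k) (by simp) (by simp) (by simp)
  have hf : ∀ θ, ∀ i ∈ A, f c (p θ (.v k)) (p θ (.u i)) ≠ 0 := fun θ i hi =>
    (hR.vu k (by simp) i hi).f_ne (hne (by simp [hi]) θ)
  convert melem_residue hc κ (φ := fun θ => g c (p θ (.vC l)) (p θ (.v k))) (hR.peeling_ket_v hc hkB hl (by simp))
    (hR.peeling_bra_v hc hlB hl (by simp)) (by simp [hlB]) hk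
    (hR.regOn_left hl (by simp) hsub hk (by simp)) (hR.regOn_right hl (by simp) hsub
      (by simp [hlB]) (by simp)) hM' (fun_sub_mem (hl.mem 2 (.v k) (by simp))
      (hl.mem 2 (.vC l) (by simp))) (fun θ => ?_) (fun θ j hj => ?_) (fun θ i hi => ?_)
    (fun θ i hi => ?_) (fun j hj => ?_) (fun j hj => ?_) ?_ using 1
  · funext θ
    rw [prod_congr rfl fun i hi => hlam1 θ (.u i) (by simp [hi]),
      prod_congr rfl fun i hi => hlam1 θ (.uC i) (by simp [hi])]
    have := prod_ne_zero_iff.2 (hf θ)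
    field_simp
  · refine (vac_pairing_one (M θ) (hxy θ)).trans ?_
    rw [hl.one θ _ (by simp), hl.one θ _ (by simp), one_mul, one_mul]
  · rw [hlam1 θ _ (by simp [hj])]
  · rw [hlam1 θ _ (by simp [hi])]
    exact hf θ i hi
  · rw [hlam1 θ _ (by simp [hi])]
    exact div_ne_zero (huC θ i hi) (sub_ne_zero.2 (hne (by simp [hi]) θ))
  · simp only [hlam1 _ (.vC j) (by simp [hj])]
    exact (hvC j hj).f_inv (hR.pos_mem _ (by simp)) (hR.pos_mem _ (by simp [hj]))
  · simp only [hlam1 _ (.vC j) (by simp [hj])]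
    exact mismatch_left hxy (hR.vvC l (by simp) j (by simp [hj])) (hvC j hj)
  · rw [card_insert_of_notMem hlB, neg_one_pow_choose_succ]

lemma Reg.regular_u_v (hc : c ≠ 0) (κ : Coeffs N) {k : Fin a} {l : Fin b}
    (hkA : k ∉ A) (hlB : l ∉ B')
    (hR : Reg c Ω p (insert k A) B A' (insert l B') (OnlyPair (.vC l) (.u k)))
    (hl : Normalized Ω M p (insert k A) B A' (insert l B')) (hM' : IsModified M M' p 𝓛 0 (.u k)) :
    (fun θ => melem (M θ) (p θ) κ (insert k A) B A' (insert l B')) ∈ Ω := by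
  have hsub : 𝓛 ⊆ allLabs N (insert k A) B A' (insert l B') :=
    allLabs_mono (subset_insert _ _) subset_rfl subset_rfl (subset_insert _ _)
  have := melem_residue_of_peeling hc κ (hR.peeling_ket_u hc hkA hl (by simp))
    (hR.peeling_bra_v hc hlB hl (by simp)) (by simp [hlB]) (by simp [hkA])
    (hR.regOn_left hl (by simp) hsub (by simp [hkA]) (by simp))
    (hR.regOn_right hl (by simp) hsub (by simp [hlB]) (by simp)) hM'
  convert this using 2 with θ
  erw [vac_pairing_one_zero (M θ) (hR.ne (x := .vC l) (y := .u k) (by simp) (by simp) (by simp) θ)]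
  simp

lemma Reg.regular_v_u (hc : c ≠ 0) (κ : Coeffs N) {k : Fin b} {l : Fin a}
    (hkB : k ∉ B) (hlA : l ∉ A')
    (hR : Reg c Ω p A (insert k B) (insert l A') B' (OnlyPair (.uC l) (.v k)))
    (hl : Normalized Ω M p A (insert k B) (insert l A') B') (hM' : IsModified M M' p 𝓛 1 (.v k)) :
    (fun θ => melem (M θ) (p θ) κ A (insert k B) (insert l A') B') ∈ Ω := by
  have hsub : 𝓛 ⊆ allLabs N A (insert k B) (insert l A') B' :=
    allLabs_mono subset_rfl (subset_insert _ _) (subset_insert _ _) subset_rfl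
  have := melem_residue_of_peeling hc κ (hR.peeling_ket_v hc hkB hl (by simp))
    (hR.peeling_bra_u hc hlA hl (by simp)) (by simp [hlA]) (by simp [hkB])
    (hR.regOn_left hl (by simp) hsub (by simp [hkB]) (by simp))
    (hR.regOn_right hl (by simp) hsub (by simp [hlA]) (by simp)) hM'
  convert this using 2 with θ
  erw [vac_pairing_zero_one (M θ) (hR.ne (x := .uC l) (y := .v k) (by simp) (by simp) (by simp) θ)]
  simp

end Reg

/-! ### Models with prescribed vacuum eigenvalues at labelled points -/

section OfLbl

variable {c : ℂ} {a b N : ℕ}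

open Classical in
/-- The model in which the vacuum eigenvalues at the point with label `k` are `l k`. -/
def GeneralizedModel.ofLbl (Γ : GeneralizedModel.{uG} c) (p : Lbl a b N → ℂ)
    (l : Lbl a b N → Pts 3) : Model.{uG} c :=
  Γ.model (pts p) fun i x => if h : ∃ k, p k = x then l h.choose i else 0

lemma GeneralizedModel.lam_ofLbl (Γ : GeneralizedModel.{uG} c) {p : Lbl a b N → ℂ}
    (hp : Function.Injective p) (l : Lbl a b N → Pts 3) (i : Fin 3) (k : Lbl a b N) :
    (Γ.ofLbl p l).lam i (p k) = l k i := by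
  rw [GeneralizedModel.ofLbl, Γ.lam_pts]
  have hx : ∃ k', p k' = p k := ⟨k, rfl⟩
  rw [dif_pos hx, hp hx.choose_spec]

end OfLbl

/-! ### The family of form factors near the diagonal -/

section Family

open MvPolynomial

/-- Labels of the particles. -/
abbrev Part (a b : ℕ) : Type := Fin a ⊕ Fin b

abbrev Parts (a b : ℕ) := Finset (Part a b)

variable {a b N : ℕ}

def lblK (N : ℕ) : Part a b → Lbl a b N := Sum.elim .u .v

def lblC (N : ℕ) : Part a b → Lbl a b N := Sum.elim .uC .vC

/-- The positions of the spectral parameters, the particles of the dual vector being shifted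
by `d`. -/
def posOf (u : Pts a) (v : Pts b) (w : Pts N) (d : Part a b → ℂ) : Lbl a b N → ℂ
  | .u i => u i
  | .v j => v j
  | .uC i => u i + d (.inl i)
  | .vC j => v j + d (.inr j)
  | .w l => w l

/-- Shifts `δ_e ≠ 0` with `‖δ_e‖ < r`, and parameters `y_e`. -/
def Params (a b : ℕ) (r : ℝ) : Type :=
  {x : Part a b ⊕ Part a b → ℂ // ∀ e, x (.inl e) ≠ 0 ∧ ‖x (.inl e)‖ < r}

variable {r : ℝ}

def Params.δ (θ : Params a b r) (e : Part a b) : ℂ := θ.1 (.inl e)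

lemma Params.δ_ne (θ : Params a b r) (e : Part a b) : θ.δ e ≠ 0 := (θ.2 e).1

lemma Params.δ_lt (θ : Params a b r) (e : Part a b) : ‖θ.δ e‖ < r := (θ.2 e).2

def Params.ev (θ : Params a b r) : MvPolynomial (Part a b ⊕ Part a b) ℂ →ₐ[ℂ] ℂ := aeval θ.1

lemma Params.ev_ext (hr : 0 < r) (P Q : MvPolynomial (Part a b ⊕ Part a b) ℂ)
    (h : ∀ θ : Params a b r, θ.ev P = θ.ev Q) : P = Q := by
  refine MvPolynomial.funext_set
    (fun k => Sum.elim (fun _ => Metric.ball (0 : ℂ) r \ {0}) (fun _ => Set.univ) k)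
    (fun k => ?_) fun x hx => ?_
  · rcases k with k | k
    · exact (infinite_of_mem_nhds 0 (Metric.ball_mem_nhds 0 hr)).sdiff (Set.finite_singleton 0)
    · exact Set.infinite_univ
  · have := h ⟨x, fun e => by
      have := hx (.inl e) (Set.mem_univ _)
      simp only [Sum.elim_inl, Set.mem_sdiff, Metric.mem_ball, dist_zero_right,
        Set.mem_singleton_iff] at this
      exact ⟨this.2, this.1⟩⟩
    simpa [Params.ev, coe_aeval_eq_eval] using this

def allShifts (a b : ℕ) : Finset (Part a b ⊕ Part a b) := univ.map .inl

def basePt (y : Part a b → ℂ) : Part a b ⊕ Part a b → ℂ := Sum.elim 0 y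

/-- Rational functions of the parameters whose poles are at most at the hyperplanes `δ_e = 0`,
`e ∈ D`. -/
def polarAlg (r : ℝ) (y : Part a b → ℂ) (D : Finset (Part a b ⊕ Part a b)) :
    Subalgebra ℂ (Params a b r → ℂ) := ratAlg Params.ev (poleMonoid (basePt y) D)

lemma Params.ev_X_ne (θ : Params a b r) {e} (he : e ∈ allShifts a b) : θ.ev (X e) ≠ 0 := by
  obtain ⟨e, _, rfl⟩ := Finset.mem_map.1 he
  simpa [Params.ev] using (θ.2 e).1

variable {y : Part a b → ℂ} {D : Finset (Part a b ⊕ Part a b)}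

lemma polarAlg_mono {D' : Finset (Part a b ⊕ Part a b)} (h : D ⊆ D') (hD : D' ⊆ allShifts a b) :
    polarAlg r y D ≤ polarAlg r y D' :=
  poleMonoid_mono h _ fun θ _ he => θ.ev_X_ne (hD he)

lemma δ_mem_polarAlg (e : Part a b) : (fun θ : Params a b r => θ.δ e) ∈ polarAlg r y D := by
  have := ev_mem_ratAlg (ev := Params.ev (r := r)) (S := poleMonoid (basePt y) D) (X (.inl e))
  simpa [Params.ev, Params.δ, polarAlg] using this

lemma inv_δ_mem_polarAlg (hD : D ⊆ allShifts a b) {e : Part a b} (he : .inl e ∈ D) :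
    (fun θ : Params a b r => (θ.δ e)⁻¹) ∈ polarAlg r y D := by
  have := X_mem_poleMonoid (z₀ := basePt y) he (ev := Params.ev (r := r))
    fun θ _ he => θ.ev_X_ne (hD he)
  simpa [Params.ev, Params.δ, polarAlg] using this

variable {u : Pts a} {v : Pts b} {w : Pts N}

/-- The shift of the point with a given label. -/
def shiftPoly : Lbl a b N → MvPolynomial (Part a b ⊕ Part a b) ℂ
  | .u _ => 0
  | .v _ => 0
  | .uC i => X (.inl (.inl i))
  | .vC j => X (.inl (.inr j))
  | .w _ => 0

lemma posOf_eq (θ : Params a b r) (m : Lbl a b N) :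
    posOf u v w θ.δ m = θ.ev (C (posOf u v w 0 m) + shiftPoly m) := by
  rcases m with m | m | m | m | m <;> simp [posOf, shiftPoly, Params.ev, Params.δ]

lemma norm_shiftPoly (θ : Params a b r) (hr : 0 < r) (m : Lbl a b N) :
    ‖θ.ev (shiftPoly m)‖ < r := by
  rcases m with m | m | m | m | m <;> simp [shiftPoly, Params.ev, hr]
  exacts [θ.δ_lt _, θ.δ_lt _]

lemma eval_shiftPoly (m : Lbl a b N) : eval (basePt y) (shiftPoly m) = 0 := by
  rcases m with m | m | m | m | m <;> simp [shiftPoly, basePt]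

lemma pos_mem_polarAlg (m : Lbl a b N) :
    (fun θ : Params a b r => posOf u v w θ.δ m) ∈ polarAlg r y D := by
  simp only [posOf_eq]
  exact ev_mem_ratAlg _

/-- `r` is smaller than the distances between distinct points. -/
structure SmallR (c : ℂ) (u : Pts a) (v : Pts b) (w : Pts N) (r : ℝ) : Prop extends
    Generic c u v w where
  pos : 0 < r
  sub : ∀ m z : Lbl a b N, posOf u v w 0 m - posOf u v w 0 z ≠ 0 →
    2 * r ≤ ‖posOf u v w 0 m - posOf u v w 0 z‖
  add : ∀ m z : Lbl a b N, posOf u v w 0 m - posOf u v w 0 z + I * c ≠ 0 →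
    2 * r ≤ ‖posOf u v w 0 m - posOf u v w 0 z + I * c‖

instance : Finite (Lbl a b N) :=
  Set.finite_univ_iff.1 ((lblFinset a b N).finite_toSet.subset fun k _ => mem_lblFinset k)

variable {c : ℂ}

lemma exists_small (hg : Generic c u v w) : ∃ r, SmallR c u v w r := by
  have key : ∀ z : ℂ, ∀ᶠ r : ℝ in 𝓝[>] 0, z ≠ 0 → 2 * r ≤ ‖z‖ := by
    intro z
    by_cases hz : z = 0
    · simp [hz]
    · have h1 : ∀ᶠ r : ℝ in 𝓝 0, 2 * r < ‖z‖ := by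
        have : Tendsto (fun r : ℝ => 2 * r) (𝓝 0) (𝓝 (2 * 0)) := tendsto_id.const_mul 2
        refine this.eventually_lt_const ?_
        simpa using hz
      exact (h1.filter_mono nhdsWithin_le_nhds).mono fun r h _ => h.le
  obtain ⟨r, h3, h4, h5⟩ := ((eventually_mem_nhdsWithin).and
    ((eventually_all.2 fun m : Lbl a b N => eventually_all.2 fun z : Lbl a b N => key
      (posOf u v w 0 m - posOf u v w 0 z)).and
    (eventually_all.2 fun m : Lbl a b N => eventually_all.2 fun z : Lbl a b N => key
      (posOf u v w 0 m - posOf u v w 0 z + I * c)))).exists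
  exact ⟨r, hg, h3, h4, h5⟩

lemma invIn_of_base (hr : 0 < r) (m z : Lbl a b N) (C₀ : ℂ)
    (h0 : posOf u v w 0 m - posOf u v w 0 z + C₀ ≠ 0)
    (h : 2 * r ≤ ‖posOf u v w 0 m - posOf u v w 0 z + C₀‖) :
    InvIn (polarAlg r y D) fun θ => posOf u v w θ.δ m - posOf u v w θ.δ z + C₀ := by
  have e : ∀ θ : Params a b r, posOf u v w θ.δ m - posOf u v w θ.δ z + C₀ =
      θ.ev (C (posOf u v w 0 m - posOf u v w 0 z + C₀) + (shiftPoly m - shiftPoly z)) := fun θ => by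
    rw [posOf_eq, posOf_eq]
    simp only [map_add, map_sub]
    have : θ.ev (C C₀) = C₀ := by simp [Params.ev]
    rw [this]
    ring
  have hne : ∀ θ : Params a b r,
      θ.ev (C (posOf u v w 0 m - posOf u v w 0 z + C₀) + (shiftPoly m - shiftPoly z)) ≠ 0 := by
    intro θ h1
    rw [map_add, map_sub, show θ.ev (C (posOf u v w 0 m - posOf u v w 0 z + C₀)) =
      posOf u v w 0 m - posOf u v w 0 z + C₀ by simp [Params.ev], add_eq_zero_iff_eq_neg] at h1
    rw [h1, norm_neg] at h
    have := norm_sub_le (θ.ev (shiftPoly m)) (θ.ev (shiftPoly z))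
    linarith [norm_shiftPoly θ hr m, norm_shiftPoly θ hr z]
  refine ⟨fun θ => (e θ).trans_ne (hne θ), ?_⟩
  simp only [e]
  refine inv_mem_ratAlg (mem_poleMonoid_of_eval_ne ?_) hne
  rw [map_add, map_sub, eval_shiftPoly, eval_shiftPoly]
  simpa using h0

lemma SmallR.invIn_sub (hr : SmallR c u v w r) {m z : Lbl a b N}
    (h : posOf u v w 0 m ≠ posOf u v w 0 z) :
    InvIn (polarAlg r y D) fun θ => posOf u v w θ.δ m - posOf u v w θ.δ z := by
  have h0 := sub_ne_zero.2 h
  have := invIn_of_base (y := y) (D := D) hr.pos m z 0 (by simpa using h0)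
    (by simpa using hr.sub m z h0)
  simpa using this

lemma SmallR.invIn_add (hr : SmallR c u v w r) {m z : Lbl a b N}
    (h : posOf u v w 0 m - posOf u v w 0 z + I * c ≠ 0) :
    InvIn (polarAlg r y D) fun θ => posOf u v w θ.δ m - posOf u v w θ.δ z + I * c :=
  invIn_of_base hr.pos m z _ h (hr.add m z h)

def PairNotIn (N : ℕ) (D : Finset (Part a b ⊕ Part a b)) (m z : Lbl a b N) : Prop :=
  ∃ e : Part a b, .inl e ∉ D ∧ OnlyPair (lblC N e) (lblK N e) m z

lemma base_eq_iff (hg : Generic c u v w) {m z : Lbl a b N}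
    (h : posOf u v w 0 m = posOf u v w 0 z) : m = z ∨ ∃ e, OnlyPair (lblC N e) (lblK N e) m z := by
  have hvu := hg.v_ne_u
  have hwu := hg.w_ne_u
  have hwv := hg.w_ne_v
  rcases m with m | m | m | m | m <;> rcases z with z | z | z | z | z <;>
    simp only [posOf, Pi.zero_apply, add_zero] at h <;>
    first
    | exact absurd h (by first | apply hvu | apply hwu | apply hwv)
    | exact absurd h.symm (by first | apply hvu | apply hwu | apply hwv)
    | exact .inl (congrArg _ (hg.u_inj h))
    | exact .inl (congrArg _ (hg.v_inj h))
    | exact .inl (congrArg _ (hg.w_inj h))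
    | (rw [hg.u_inj h]; exact .inr ⟨.inl z, by simp [OnlyPair, lblC, lblK]⟩)
    | (rw [hg.v_inj h]; exact .inr ⟨.inr z, by simp [OnlyPair, lblC, lblK]⟩)

lemma posOf_lblC_sub (d : Part a b → ℂ) (e : Part a b) :
    posOf u v w d (lblC N e) - posOf u v w d (lblK N e) = d e := by
  rcases e with e | e <;> simp [posOf, lblC, lblK]

lemma posOf_injective (hr : SmallR c u v w r) (θ : Params a b r) :
    Function.Injective (posOf u v w θ.δ) := by
  intro m z h
  by_cases hb : posOf u v w 0 m = posOf u v w 0 z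
  · rcases base_eq_iff hr.1 hb with h1 | ⟨e, ⟨rfl, rfl⟩ | ⟨rfl, rfl⟩⟩
    · exact h1
    all_goals
      have := posOf_lblC_sub (u := u) (v := v) (w := w) θ.δ e
      rw [h, sub_self] at this
      exact absurd this.symm (θ.δ_ne e)
  · exact absurd (sub_eq_zero.2 h) ((hr.invIn_sub (y := 0) (D := ∅) hb).1 θ)

lemma Generic.uu (hg : Generic c u v w) (i l : Fin a) : u i - u l + I * c ≠ 0 :=
  fun h => hg.u_sub_u l i (by linear_combination -h)

lemma Generic.vv (hg : Generic c u v w) (i l : Fin b) : v i - v l + I * c ≠ 0 :=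
  fun h => hg.v_sub_v l i (by linear_combination -h)

lemma Generic.vu (hg : Generic c u v w) (i : Fin b) (l : Fin a) :
    v i - u l + I * c ≠ 0 := fun h => hg.v_sub_u i l (by linear_combination h)

lemma Generic.wu (hg : Generic c u v w) (i : Fin N) (l : Fin a) :
    w i - u l + I * c ≠ 0 := fun h => hg.w_sub_u i l (by linear_combination h)

lemma Generic.vw (hg : Generic c u v w) (i : Fin b) (l : Fin N) :
    v i - w l + I * c ≠ 0 := fun h => hg.v_sub_w i l (by linear_combination h)

lemma reg_polarAlg (hr : SmallR c u v w r) (y : Part a b → ℂ)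
    (hD : D ⊆ allShifts a b) (A : Finset (Fin a)) (B : Finset (Fin b)) :
    Reg c (polarAlg r y D) (fun θ => posOf u v w θ.δ) A B A B (PairNotIn N D) where
  pos_mem m _ := pos_mem_polarAlg m
  inj θ := (posOf_injective hr θ).injOn
  sub m _ z _ hmz hq := by
    by_cases hb : posOf u v w 0 m = posOf u v w 0 z
    · rcases base_eq_iff hr.1 hb with h1 | ⟨e, he⟩
      · exact absurd h1 hmz
      · have hmem := inv_δ_mem_polarAlg (r := r) (y := y) hD
          (by_contra fun h => hq ⟨e, h, he⟩ : .inl e ∈ D)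
        rcases he with ⟨rfl, rfl⟩ | ⟨rfl, rfl⟩
        · simpa only [posOf_lblC_sub] using hmem
        · have e2 : ∀ θ : Params a b r, (posOf u v w θ.δ (lblK N e) -
              posOf u v w θ.δ (lblC N e))⁻¹ = (-1) * (θ.δ e)⁻¹ := fun θ => by
            rw [← neg_sub, posOf_lblC_sub, inv_neg, neg_one_mul]
          simp only [e2]
          exact fun_mul_mem (const_mem _) hmem
    · exact (hr.invIn_sub hb).2
  uu i _ l _ := hr.invIn_add (m := .u i) (z := .u l) (by simpa [posOf] using hr.1.uu i l)
  vv i _ l _ := hr.invIn_add (m := .v i) (z := .v l) (by simpa [posOf] using hr.1.vv i l)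
  vu i _ l _ := hr.invIn_add (m := .v i) (z := .u l) (by simpa [posOf] using hr.1.vu i l)
  uuC i _ l _ := hr.invIn_add (m := .uC i) (z := .uC l) (by simpa [posOf] using hr.1.uu i l)
  vvC i _ l _ := hr.invIn_add (m := .vC i) (z := .vC l) (by simpa [posOf] using hr.1.vv i l)
  vuC i _ l _ := hr.invIn_add (m := .vC i) (z := .uC l) (by simpa [posOf] using hr.1.vu i l)

lemma Reg.prod_bool {Θ : Type} {Ω : FunAlg Θ} {p : Θ → Lbl a b N → ℂ}
    {A A' : Finset (Fin a)} {B B' : Finset (Fin b)} {Q : Lbl a b N → Lbl a b N → Prop}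
    (hR : Reg c Ω p A B A' B' Q) (d : Θ → ℂ) :
    Reg c (pairAlg Ω d) (fun x : Θ × Bool => p x.1) A B A' B' Q where
  pos_mem m hm := mem_pairAlg_of_mem (hR.pos_mem m hm)
  inj x := hR.inj x.1
  sub m hm z hz hmz hq := mem_pairAlg_of_mem (hR.sub m hm z hz hmz hq)
  uu i hi l hl := ⟨fun x => (hR.uu i hi l hl).1 x.1, mem_pairAlg_of_mem (hR.uu i hi l hl).2⟩
  vv i hi l hl := ⟨fun x => (hR.vv i hi l hl).1 x.1, mem_pairAlg_of_mem (hR.vv i hi l hl).2⟩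
  vu i hi l hl := ⟨fun x => (hR.vu i hi l hl).1 x.1, mem_pairAlg_of_mem (hR.vu i hi l hl).2⟩
  uuC i hi l hl := ⟨fun x => (hR.uuC i hi l hl).1 x.1, mem_pairAlg_of_mem (hR.uuC i hi l hl).2⟩
  vvC i hi l hl := ⟨fun x => (hR.vvC i hi l hl).1 x.1, mem_pairAlg_of_mem (hR.vvC i hi l hl).2⟩
  vuC i hi l hl := ⟨fun x => (hR.vuC i hi l hl).1 x.1, mem_pairAlg_of_mem (hR.vuC i hi l hl).2⟩

end Family

section FamilyDef

variable {a b N : ℕ}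

def rap (u : Pts a) (v : Pts b) : Part a b → ℂ := Sum.elim u v

/-- Right-hand side of the Bethe equation of a particle in the system of the particles of `S`. -/
def bethe (c : ℂ) (u : Pts a) (v : Pts b) (S : Parts a b) : Part a b → ℂ :=
  Sum.elim (betheRhs1 c u v S.toLeft S.toRight) (betheRhs3 c u v S.toLeft)

/-- Vacuum eigenvalues for which the Bethe vector of the particles `S` is on-shell, and those of
the dual vector differ from the on-shell values by factors `σ`. -/
def famLam (c : ℂ) (l : Fin 3 → ℂ → ℂ) (u : Pts a) (v : Pts b) (w : Pts N)
    (S : Parts a b) (σ : Part a b → ℂ) : Lbl a b N → Pts 3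
  | .u i => ![bethe c u v S (.inl i), 1, 0]
  | .v j => ![0, 1, bethe c u v S (.inr j)]
  | .uC i => ![bethe c u v S (.inl i) * σ (.inl i), 1, 0]
  | .vC j => ![0, 1, bethe c u v S (.inr j) * σ (.inr j)]
  | .w k => fun i => lamMod c l u v S.toLeftᶜ S.toRightᶜ i (w k)

variable {c : ℂ} (Γ : GeneralizedModel.{uG} c) (l : Fin 3 → ℂ → ℂ)
  (κ : Coeffs N) (u : Pts a) (v : Pts b) (w : Pts N)

def famModel (S : Parts a b) (d σ : Part a b → ℂ) : Model.{uG} c :=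
  Γ.ofLbl (posOf u v w d) (famLam c l u v w S σ)

def famMelem (S : Parts a b) (d σ : Part a b → ℂ) : ℂ :=
  melem (famModel Γ l u v w S d σ) (posOf u v w d) κ S.toLeft S.toRight S.toLeft S.toRight

def famDen (c : ℂ) (S : Parts a b) (d : Part a b → ℂ) : ℂ :=
  prod2 (f c) w univ (fun i => u i + d (.inl i)) S.toLeft *
    prod2 (f c) (fun j => v j + d (.inr j)) S.toRight w univ

def famFF (S : Parts a b) (d σ : Part a b → ℂ) : ℂ :=
  famMelem Γ l κ u v w S d σ / famDen u v w c S d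

/-- The factor that `r₁` or `r₃` at the rapidity `z` of a particle `k` acquires when a particle `e`
with rapidity `y` is removed. -/
def modF (c : ℂ) (e k : Part a b) (y z : ℂ) : ℂ :=
  match e, k with
  | .inl _, .inl _ => f c y z / f c z y
  | .inl _, .inr _ => (f c z y)⁻¹
  | .inr _, .inl _ => (f c y z)⁻¹
  | .inr _, .inr _ => 1

/-- The relative variation of `modF` under a shift of `z` by `δ`, divided by `δ`. -/
def modNu (c : ℂ) (e k : Part a b) (y z δ : ℂ) : ℂ :=
  match e, k with
  | .inl _, .inl _ => 2 * (I * c) * (z + δ - y + I * c)⁻¹ * (z - y - I * c)⁻¹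
  | .inl _, .inr _ => I * c * (z + δ - y + I * c)⁻¹ * (z - y)⁻¹
  | .inr _, .inl _ => -(I * c) * (y - (z + δ) + I * c)⁻¹ * (y - z)⁻¹
  | .inr _, .inr _ => 0

/-- The factor `f` between a particle `e` with rapidity `y` and an argument `x` of the operator. -/
def modW (c : ℂ) (e : Part a b) (y x : ℂ) : ℂ :=
  match e with
  | .inl _ => f c x y
  | .inr _ => f c y x

def ptype : Part a b → Fin 2 := Sum.elim (fun _ => 0) (fun _ => 1)

end FamilyDef

section Compare

variable {a b N : ℕ} {c : ℂ} {u : Pts a} {v : Pts b} {w : Pts N}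

lemma f_ne_zero {x y : ℂ} (h : x - y + I * c ≠ 0) (hxy : x ≠ y) : f c x y ≠ 0 :=
  div_ne_zero h (sub_ne_zero.2 hxy)

lemma Generic.f_uu (hg : Generic c u v w) {i l : Fin a} (h : i ≠ l) : f c (u i) (u l) ≠ 0 :=
  f_ne_zero (hg.uu i l) fun e => h (hg.u_inj e)

lemma Generic.f_vu (hg : Generic c u v w) (i : Fin b) (l : Fin a) : f c (v i) (u l) ≠ 0 :=
  f_ne_zero (hg.vu i l) (hg.v_ne_u i l)

lemma Generic.f_wu (hg : Generic c u v w) (i : Fin N) (l : Fin a) : f c (w i) (u l) ≠ 0 :=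
  f_ne_zero (hg.wu i l) (hg.w_ne_u i l)

lemma Generic.f_vw (hg : Generic c u v w) (i : Fin b) (l : Fin N) : f c (v i) (w l) ≠ 0 :=
  f_ne_zero (hg.vw i l) (hg.w_ne_v l i).symm

lemma bethe_insert (hg : Generic c u v w) {S : Parts a b} {e k : Part a b} (he : e ∉ S)
    (hk : k ∈ S) : bethe c u v (insert e S) k * modF c e k (rap u v e) (rap u v k) =
      bethe c u v S k := by
  rcases e with e | e <;> rcases k with k | k <;>
    simp only [bethe, modF, rap, Sum.elim_inl, Sum.elim_inr, toLeft_insert_inl,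
      toLeft_insert_inr, toRight_insert_inl, toRight_insert_inr, betheRhs1, betheRhs3]
  · have hek : e ≠ k := by rintro rfl; exact he hk
    have heA : e ∉ S.toLeft := by simpa using he
    rw [erase_insert_of_ne hek, prod_insert (by simp [heA]), prod_insert (by simp [heA])]
    have h1 := hg.f_uu hek
    have h2 := hg.f_uu hek.symm
    have h3 : ∏ l ∈ S.toLeft.erase k, f c (u l) (u k) ≠ 0 :=
      prod_ne_zero_iff.2 fun l hl => hg.f_uu (ne_of_mem_erase hl)
    field_simp
  · rw [prod_insert (by simpa using he)]
    have h1 := hg.f_vu k e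
    field_simp
  · rw [prod_insert (by simpa using he)]
    have h1 := hg.f_vu e k
    field_simp
  · ring

lemma modF_shift {e k : Part a b} {y z δ : ℂ} (hz : z ≠ y) (hz' : z + δ ≠ y)
    (h1 : ∀ i, e = .inl i → z - y + I * c ≠ 0 ∧ z + δ - y + I * c ≠ 0)
    (h2 : ∀ i j, e = .inl i → k = .inl j → y - z + I * c ≠ 0) (h3 : ∀ i j, e = .inr i → k = .inl j →
      y - z + I * c ≠ 0 ∧ y - (z + δ) + I * c ≠ 0) :
    modF c e k y (z + δ) = modF c e k y z * (1 + δ * modNu c e k y z δ) := by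
  have d1 := sub_ne_zero.2 hz
  have d2 := sub_ne_zero.2 hz.symm
  have d3 := sub_ne_zero.2 hz'
  have d4 := sub_ne_zero.2 hz'.symm
  rcases e with e | e <;> rcases k with k | k <;> simp only [modF, modNu, f, inv_div]
  · have a1 := (h1 e rfl).1
    have a2 := (h1 e rfl).2
    have a3 := h2 e k rfl rfl
    have a4 : z - y - I * c ≠ 0 := fun h => a3 (by linear_combination -h)
    have e1 : (y - (z + δ) + I * c) / (y - (z + δ)) = (z + δ - y - I * c) / (z + δ - y) := by
      rw [← neg_div_neg_eq]; congr 1 <;> ring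
    have e2 : (y - z + I * c) / (y - z) = (z - y - I * c) / (z - y) := by
      rw [← neg_div_neg_eq]; congr 1 <;> ring
    rw [e1, e2]
    field_simp
    ring
  · have a1 := (h1 e rfl).1
    have a2 := (h1 e rfl).2
    field_simp
    ring
  · have a1 := (h3 e k rfl rfl).1
    have a2 := (h3 e k rfl rfl).2
    field_simp
    ring
  · ring

lemma lamMod_insert (hg : Generic c u v w) (l : Fin 3 → ℂ → ℂ) {S : Parts a b}
    {e : Part a b} (he : e ∉ S) (k : Fin N) (i : Fin 3) : modG (ptype e) (g c (rap u v e) (w k)) i *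
        lamMod c l u v (insert e S).toLeftᶜ (insert e S).toRightᶜ i (w k) =
      modW c e (rap u v e) (w k) * lamMod c l u v S.toLeftᶜ S.toRightᶜ i (w k) := by
  rcases e with e | e
  · have h1 := hg.f_wu k e
    have heA : e ∉ S.toLeft := by simpa using he
    have hc : S.toLeftᶜ = insert e (insert e S.toLeft)ᶜ := by
      rw [compl_insert, insert_erase (by simpa using he)]
    simp only [toLeft_insert_inl, toRight_insert_inl, hc, lamMod, modW, rap,
      Sum.elim_inl, ptype, modG, ← f_eq (hg.w_ne_u k e).symm, one_sub_g (hg.w_ne_u k e).symm]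
    have h2 : ∏ j ∈ (insert e S.toLeft)ᶜ, f c (w k) (u j) ≠ 0 :=
      prod_ne_zero_iff.2 fun j _ => hg.f_wu k j
    have h3 : ∏ j ∈ S.toRightᶜ, f c (v j) (w k) ≠ 0 := prod_ne_zero_iff.2 fun j _ => hg.f_vw j k
    rw [prod_insert (by simp), prod_insert (by simp)]
    fin_cases i <;> simp <;> field_simp
  · have h1 := hg.f_vw e k
    have heA : e ∉ S.toRight := by simpa using he
    have hc : S.toRightᶜ = insert e (insert e S.toRight)ᶜ := by
      rw [compl_insert, insert_erase (by simpa using he)]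
    simp only [toLeft_insert_inr, toRight_insert_inr, hc, lamMod, modW, rap,
      Sum.elim_inr, ptype, modG, ← f_eq (hg.w_ne_v k e).symm]
    have h2 : ∏ j ∈ S.toLeftᶜ, f c (w k) (u j) ≠ 0 := prod_ne_zero_iff.2 fun j _ => hg.f_wu k j
    have h3 : ∏ j ∈ (insert e S.toRight)ᶜ, f c (v j) (w k) ≠ 0 :=
      prod_ne_zero_iff.2 fun j _ => hg.f_vw j k
    rw [prod_insert (by simp)]
    fin_cases i <;> simp <;> field_simp

variable {r : ℝ} (Γ : GeneralizedModel.{uG} c) (l : Fin 3 → ℂ → ℂ)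
  (κ : Coeffs N)

lemma PtReg.ketRegular {K Θ : Type} {Ω : FunAlg Θ} {p : Θ → K → ℂ}
    {ku : Fin a → K} {kv : Fin b → K} {A : Finset (Fin a)} {B : Finset (Fin b)}
    (hp : PtReg c Ω p ku kv A B) (θ : Θ) : KetRegular c (p θ) ku kv A B :=
  ⟨hp.inj θ, hp.hu_ne θ, hp.hv_ne θ, hp.f_ne θ⟩

lemma not_pairNotIn_allShifts (m z : Lbl a b N) : ¬ PairNotIn N (allShifts a b) m z := by
  rintro ⟨e, he, _⟩
  exact he (mem_map_of_mem _ (mem_univ e))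

/-- Vacuum eigenvalues modified by the removal of the particle `e` from `insert e S`. -/
def removedLam (c : ℂ) (l : Fin 3 → ℂ → ℂ) (u : Pts a) (v : Pts b) (w : Pts N)
    (S : Parts a b) (e : Part a b) (d σ : Part a b → ℂ) (m : Lbl a b N) (i : Fin 3) : ℂ :=
  modG (ptype e) (g c (rap u v e) (posOf u v w d m)) i * famLam c l u v w (insert e S) σ m i

lemma modG_ptype_inl (i : Fin a) (x : ℂ) : modG (ptype (.inl i : Part a b)) x = ![1 + x, 1 - x, 1] :=
  rfl

lemma modG_ptype_inr (i : Fin b) (x : ℂ) :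
    modG (ptype (.inr i : Part a b)) x = ![1, 1 + x, 1 + x] := rfl

lemma posOf_lblK (d : Part a b → ℂ) (k : Part a b) : posOf u v w d (lblK N k) = rap u v k := by
  rcases k with k | k <;> rfl

lemma posOf_lblC (d : Part a b → ℂ) (k : Part a b) :
    posOf u v w d (lblC N k) = rap u v k + d k := by
  rcases k with k | k <;> rfl

lemma posOf_ne (hr : SmallR c u v w r) (θ : Params a b r)
    {m z : Lbl a b N} (h : m ≠ z) : posOf u v w θ.δ m ≠ posOf u v w θ.δ z :=
  fun e => h (posOf_injective hr θ e)

lemma add_ic_ne (hr : SmallR c u v w r) (θ : Params a b r) {m z : Lbl a b N}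
    (h : posOf u v w 0 m - posOf u v w 0 z + I * c ≠ 0) :
    posOf u v w θ.δ m - posOf u v w θ.δ z + I * c ≠ 0 :=
  (hr.invIn_add (y := 0) (D := ∅) h).1 θ

lemma rap_ne (hg : Generic c u v w) {e k : Part a b} (h : e ≠ k) : rap u v e ≠ rap u v k := by
  rcases e with e | e <;> rcases k with k | k <;> simp only [rap, Sum.elim_inl, Sum.elim_inr]
  · exact fun h' => h (by rw [hg.u_inj h'])
  · exact (hg.v_ne_u _ _).symm
  · exact hg.v_ne_u _ _
  · exact fun h' => h (by rw [hg.v_inj h'])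

lemma base_lblC (k : Part a b) : posOf u v w 0 (lblC N k) = rap u v k := by
  rw [posOf_lblC, Pi.zero_apply, add_zero]

lemma rap_add_δ_ne (hr : SmallR c u v w r) (θ : Params a b r)
    {e k : Part a b} (h : e ≠ k) : rap u v k + θ.δ k ≠ rap u v e := by
  have := (hr.invIn_sub (y := 0) (D := ∅) (m := lblC N k) (z := lblK N e)
    (by rw [base_lblC, posOf_lblK]; exact rap_ne hr.1 h.symm)).1 θ
  simp only [posOf_lblC, posOf_lblK] at this
  exact sub_ne_zero.1 this

lemma rap_add_δ_add_ne (hr : SmallR c u v w r) (θ : Params a b r)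
    {e k : Part a b} (h : rap u v k - rap u v e + I * c ≠ 0) :
    rap u v k + θ.δ k - rap u v e + I * c ≠ 0 := by
  have := add_ic_ne hr θ (m := lblC N k) (z := lblK N e) (by rwa [base_lblC, posOf_lblK])
  rwa [posOf_lblC, posOf_lblK] at this

lemma rap_sub_add_δ_ne (hr : SmallR c u v w r) (θ : Params a b r)
    {e k : Part a b} (h : rap u v e - rap u v k + I * c ≠ 0) :
    rap u v e - (rap u v k + θ.δ k) + I * c ≠ 0 := by
  have := add_ic_ne hr θ (m := lblK N e) (z := lblC N k) (by rwa [base_lblC, posOf_lblK])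
  rwa [posOf_lblC, posOf_lblK] at this

lemma rap_add_inl (hg : Generic c u v w) (i : Fin a) (k : Part a b) :
    rap u v k - rap u v (.inl i) + I * c ≠ 0 := by
  rcases k with k | k
  exacts [hg.uu k i, hg.vu k i]

lemma rap_add_inr (hg : Generic c u v w) (i : Fin b) (k : Part a b) :
    rap u v (.inr i) - rap u v k + I * c ≠ 0 := by
  rcases k with k | k
  exacts [hg.vu i k, hg.vv i k]

lemma modF_add_δ (hr : SmallR c u v w r) (θ : Params a b r) {e k : Part a b} (h : e ≠ k) :
    modF c e k (rap u v e) (rap u v k + θ.δ k) = modF c e k (rap u v e) (rap u v k) *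
      (1 + θ.δ k * modNu c e k (rap u v e) (rap u v k) (θ.δ k)) := by
  refine modF_shift (rap_ne hr.1 h.symm) (rap_add_δ_ne hr θ h) ?_ ?_ ?_
  · rintro i rfl
    exact ⟨rap_add_inl hr.1 i k, rap_add_δ_add_ne hr θ (rap_add_inl hr.1 i k)⟩
  · rintro i j rfl rfl
    exact hr.1.uu i j
  · rintro i j rfl rfl
    exact ⟨rap_add_inr hr.1 i _, rap_sub_add_δ_ne hr θ (rap_add_inr hr.1 i _)⟩

/-- The index of the eigenvalue that enters the Bethe equation of a particle. -/
def pIdx : Part a b → Fin 3 := Sum.elim (fun _ => 0) (fun _ => 2)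

lemma famLam_lblK (S : Parts a b) (σ : Part a b → ℂ) (k : Part a b) :
    famLam c l u v w S σ (lblK N k) (pIdx k) = bethe c u v S k ∧
      famLam c l u v w S σ (lblK N k) 1 = 1 := by
  rcases k with k | k <;> exact ⟨rfl, rfl⟩

lemma famLam_lblC (S : Parts a b) (σ : Part a b → ℂ) (k : Part a b) :
    famLam c l u v w S σ (lblC N k) (pIdx k) = bethe c u v S k * σ k ∧
      famLam c l u v w S σ (lblC N k) 1 = 1 := by
  rcases k with k | k <;> exact ⟨rfl, rfl⟩

lemma modG_one (e : Part a b) {y z : ℂ} (h : y ≠ z) :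
    modG (ptype e) (g c y z) 1 = modW c e y z := by
  rcases e with e | e
  · rw [modG_ptype_inl]
    exact one_sub_g h
  · rw [modG_ptype_inr]
    exact (f_eq h).symm

lemma modG_ratio (e k : Part a b) {y z : ℂ} (h : y ≠ z) (hne : modW c e y z ≠ 0) :
    modG (ptype e) (g c y z) (pIdx k) / modG (ptype e) (g c y z) 1 = modF c e k y z := by
  rw [modG_one e h]
  rcases e with e | e <;> rcases k with k | k <;>
    simp only [modG_ptype_inl, modG_ptype_inr, pIdx, modF, modW, Sum.elim_inl, Sum.elim_inr] at hne ⊢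
  · rw [f_eq h]
    rfl
  · rw [← one_div]
    rfl
  · rw [← one_div]
    rfl
  · rw [f_eq h] at hne ⊢
    exact div_self hne

lemma modW_rap_ne (hg : Generic c u v w) {e k : Part a b} (h : e ≠ k) :
    modW c e (rap u v e) (rap u v k) ≠ 0 := by
  rcases e with e | e
  · exact f_ne_zero (rap_add_inl hg e k) (rap_ne hg h.symm)
  · exact f_ne_zero (rap_add_inr hg e k) (rap_ne hg h)

lemma modW_rap_add_ne (hr : SmallR c u v w r) (θ : Params a b r)
    {e k : Part a b} (h : e ≠ k) : modW c e (rap u v e) (rap u v k + θ.δ k) ≠ 0 := by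
  rcases e with e | e
  · exact f_ne_zero (rap_add_δ_add_ne hr θ (rap_add_inl hr.1 e k)) (rap_add_δ_ne hr θ h)
  · exact f_ne_zero (rap_sub_add_δ_ne hr θ (rap_add_inr hr.1 e k)) (rap_add_δ_ne hr θ h).symm

lemma melem_ofLbl_modG (hc : c ≠ 0) {p : Lbl a b N → ℂ} (hp : Function.Injective p)
    {S S' : Parts a b} (hK : KetRegular c p .u .v S.toLeft S.toRight)
    (hB : KetRegular c p .uC .vC S'.toLeft S'.toRight) (e : Part a b) (y : ℂ)
    {L L' : Lbl a b N → Pts 3} (z : Pts N)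
    (hL : ∀ k m, (k ∈ S ∧ m = lblK N k ∨ k ∈ S' ∧ m = lblC N k) → y ≠ p m ∧ modW c e y (p m) ≠ 0 ∧
      L m 1 = 1 ∧ L' m 1 = 1 ∧ L m (pIdx k) * modF c e k y (p m) = L' m (pIdx k))
    (hw : ∀ i k, modG (ptype e) (g c y (p (.w k))) i * L (.w k) i = z k * L' (.w k) i) :
    melem (Γ.ofLbl p fun m i => modG (ptype e) (g c y (p m)) i * L m i) p κ
        S.toLeft S.toRight S'.toLeft S'.toRight =
      (∏ k, z k) * melem (Γ.ofLbl p L') p κ S.toLeft S.toRight S'.toLeft S'.toRight := by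
  have k1 : ∀ k m, (k ∈ S ∧ m = lblK N k ∨ k ∈ S' ∧ m = lblC N k) →
      modG (ptype e) (g c y (p m)) 1 * L m 1 ≠ 0 ∧ L' m 1 ≠ 0 := fun k m h => by
    obtain ⟨h1, h2, h3, h4, -⟩ := hL k m h
    rw [h3, h4, mul_one, modG_one e h1]
    exact ⟨h2, one_ne_zero⟩
  have k2 : ∀ k m, (k ∈ S ∧ m = lblK N k ∨ k ∈ S' ∧ m = lblC N k) →
      modG (ptype e) (g c y (p m)) (pIdx k) * L m (pIdx k) /
        (modG (ptype e) (g c y (p m)) 1 * L m 1) = L' m (pIdx k) / L' m 1 := fun k m h => by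
    obtain ⟨h1, h2, h3, h4, h5⟩ := hL k m h
    rw [h3, h4, mul_one, div_one, mul_div_right_comm, modG_ratio e k h1 h2, mul_comm, h5]
  refine melem_congr_smul hc Γ κ hp.injOn hK hB z ?_ ?_ ?_ ?_ ?_ ?_ <;>
    simp only [Model.r1, Model.r3, Γ.lam_ofLbl hp]
  · rintro m ((⟨i, hi, rfl⟩ | ⟨i, hi, rfl⟩) | (⟨i, hi, rfl⟩ | ⟨i, hi, rfl⟩))
    exacts [k1 (.inl i) _ (.inr ⟨by simpa using hi, rfl⟩),
      k1 (.inr i) _ (.inr ⟨by simpa using hi, rfl⟩),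
      k1 (.inl i) _ (.inl ⟨by simpa using hi, rfl⟩),
      k1 (.inr i) _ (.inl ⟨by simpa using hi, rfl⟩)]
  · exact fun i hi => k2 (.inl i) _ (.inl ⟨by simpa using hi, rfl⟩)
  · exact fun i hi => k2 (.inr i) _ (.inl ⟨by simpa using hi, rfl⟩)
  · exact fun i hi => k2 (.inl i) _ (.inr ⟨by simpa using hi, rfl⟩)
  · exact fun i hi => k2 (.inr i) _ (.inr ⟨by simpa using hi, rfl⟩)
  · exact hw

lemma melem_removed (hc : c ≠ 0) (hr : SmallR c u v w r)
    (θ : Params a b r) {S : Parts a b} {e : Part a b} (he : e ∉ S) (σ σ' : Part a b → ℂ)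
    (hσ : ∀ k ∈ S, σ' k = σ k * (1 + θ.δ k * modNu c e k (rap u v e) (rap u v k) (θ.δ k))) :
    melem (Γ.ofLbl (posOf u v w θ.δ) (removedLam c l u v w S e θ.δ σ)) (posOf u v w θ.δ) κ
        S.toLeft S.toRight S.toLeft S.toRight =
      (∏ k, modW c e (rap u v e) (w k)) * famMelem Γ l κ u v w S θ.δ σ' := by
  have hR := reg_polarAlg hr 0 (subset_refl (allShifts a b)) S.toLeft S.toRight
  refine melem_ofLbl_modG Γ κ hc (posOf_injective hr θ)
    ((hR.ptReg_ket hc fun m _ z _ => not_pairNotIn_allShifts m z).ketRegular θ)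
    ((hR.ptReg_bra hc fun m _ z _ => not_pairNotIn_allShifts m z).ketRegular θ) e (rap u v e)
    (fun k => modW c e (rap u v e) (w k)) ?_ fun i k => lamMod_insert hr.1 l he k i
  rintro k m (⟨hk, rfl⟩ | ⟨hk, rfl⟩)
  · have hne : e ≠ k := fun h => he (h ▸ hk)
    rw [posOf_lblK, (famLam_lblK l _ σ k).1, (famLam_lblK l _ σ' k).1, bethe_insert hr.1 he hk]
    exact ⟨rap_ne hr.1 hne, modW_rap_ne hr.1 hne, (famLam_lblK l _ σ k).2, (famLam_lblK l _ σ' k).2, rfl⟩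
  · have hne : e ≠ k := fun h => he (h ▸ hk)
    rw [posOf_lblC, (famLam_lblC l _ σ k).1, (famLam_lblC l _ σ' k).1, modF_add_δ hr θ hne,
      hσ k hk, ← bethe_insert hr.1 he hk]
    exact ⟨(rap_add_δ_ne hr θ hne).symm, modW_rap_add_ne hr θ hne, (famLam_lblC l _ σ k).2,
      (famLam_lblC l _ σ' k).2, by ring⟩

end Compare

section Residue

variable {a b N : ℕ} {c : ℂ} {u : Pts a} {v : Pts b} {w : Pts N}
  {r : ℝ} (Γ : GeneralizedModel.{uG} c) (l : Fin 3 → ℂ → ℂ)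
  (κ : Coeffs N)

def resCoeff (c : ℂ) (u : Pts a) (v : Pts b) (S : Parts a b) (e : Part a b)
    (d : Part a b → ℂ) : ℂ :=
  match e with
  | .inl i => (∏ k ∈ S.toLeft, f c (u k) (u i)) * ∏ k ∈ S.toLeft, f c (u k + d (.inl k)) (u i)
  | .inr j => (-1) ^ S.toRight.card * (∏ k ∈ S.toRight, g c (v j) (v k)) *
      (∏ k ∈ S.toRight, g c (v j + d (.inr j)) (v k + d (.inr k))) *
      ((∏ k ∈ S.toLeft, f c (v j) (u k + d (.inl k))) /
        ∏ k ∈ S.toLeft, f c (v j + d (.inr j)) (u k + d (.inl k)))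

lemma famLam_mem {Θ : Type} {Ω : FunAlg Θ} {S : Parts a b}
    {σ : Θ → Part a b → ℂ} (hσ : ∀ k ∈ S, (fun x => σ x k) ∈ Ω) (i : Fin 3) {m : Lbl a b N}
    (hm : m ∈ allLabs N S.toLeft S.toRight S.toLeft S.toRight) :
    (fun x => famLam c l u v w S (σ x) m i) ∈ Ω := by
  rcases m with m | m | m | m | m
  · exact const_mem _
  · exact const_mem _
  · have := hσ (.inl m) (by simpa using hm)
    fin_cases i
    exacts [fun_mul_mem (const_mem _) this, const_mem _, const_mem _]
  · have := hσ (.inr m) (by simpa using hm)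
    fin_cases i
    exacts [const_mem _, const_mem _, fun_mul_mem (const_mem _) this]
  · exact const_mem _

lemma famLam_one {S S' : Parts a b} {σ : Part a b → ℂ} {m : Lbl a b N}
    (hm : m ∈ braLabs N S'.toLeft S'.toRight ∪ ketLabs N S'.toLeft S'.toRight) :
    famLam c l u v w S σ m 1 = 1 := by
  rcases m with m | m | m | m | m
  iterate 4 rfl
  simp at hm

lemma onlyPair_of_pairNotIn {e : Part a b} {m z : Lbl a b N}
    (h : PairNotIn N ((allShifts a b).erase (.inl e)) m z) :
    OnlyPair (lblC N e) (lblK N e) m z := by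
  obtain ⟨e', he', h⟩ := h
  obtain rfl : e' = e := by_contra fun hne => he' (by simp [allShifts, hne])
  exact h

lemma famMelem_mem (hc : c ≠ 0) (hr : SmallR c u v w r)
    (y : Part a b → ℂ) {D : Finset (Part a b ⊕ Part a b)} (hD : D ⊆ allShifts a b)
    {S : Parts a b} (hS : ∀ e ∈ S, .inl e ∈ D) {σ : Params a b r → Part a b → ℂ}
    (hσ : ∀ k ∈ S, (fun x => σ x k) ∈ polarAlg r y D) :
    (fun θ => famMelem Γ l κ u v w S θ.δ (σ θ)) ∈ polarAlg r y D := by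
  refine Reg.melem_mem hc κ ((reg_polarAlg hr y hD S.toLeft S.toRight).mono subset_rfl subset_rfl
    subset_rfl subset_rfl (Q₁ := fun _ _ => False) ?_) (fun _ _ h => h) (fun θ m hm => ?_)
    fun i m hm => ?_
  · rintro m hm z hz ⟨e, he, h⟩
    have : lblC N e ∈ allLabs N S.toLeft S.toRight S.toLeft S.toRight := by
      rcases h with h | h
      exacts [h.1 ▸ hm, h.2 ▸ hz]
    refine he (hS e ?_)
    rcases e with e | e <;> simpa [lblC] using this
  · rw [famModel, Γ.lam_ofLbl (posOf_injective hr θ)]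
    exact famLam_one l hm
  · simp only [famModel, Γ.lam_ofLbl (posOf_injective hr _)]
    exact famLam_mem l hσ i hm

lemma famMelem_residue (hc : c ≠ 0) (hr : SmallR c u v w r)
    (y : Part a b → ℂ) {S : Parts a b} {e : Part a b} (he : e ∉ S)
    {σ : Params a b r × Bool → Part a b → ℂ} (hσ : ∀ k ∈ insert e S, (fun x => σ x k) ∈
      pairAlg (polarAlg r y ((allShifts a b).erase (.inl e))) fun θ => θ.δ e)
    {σ' : Params a b r × Bool → Part a b → ℂ} (hσ' : ∀ x, ∀ k ∈ S, σ' x k =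
      σ x k * (1 + x.1.δ k * modNu c e k (rap u v e) (rap u v k) (x.1.δ k))) :
    (fun x => famMelem Γ l κ u v w (insert e S) x.1.δ (σ x) -
      g c (rap u v e + x.1.δ e) (rap u v e) *
        (bethe c u v (insert e S) e - bethe c u v (insert e S) e * σ x e) *
        resCoeff c u v S e x.1.δ *
        ((∏ k, modW c e (rap u v e) (w k)) * famMelem Γ l κ u v w S x.1.δ (σ' x))) ∈
      pairAlg (polarAlg r y ((allShifts a b).erase (.inl e))) fun θ => θ.δ e := by
  have hR := (reg_polarAlg hr y (erase_subset (.inl e) (allShifts a b))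
    (insert e S).toLeft (insert e S).toRight).prod_bool fun θ => θ.δ e
  replace hR := hR.mono subset_rfl subset_rfl subset_rfl subset_rfl
    fun m _ z _ h => onlyPair_of_pairNotIn h
  have hinj := fun θ : Params a b r => posOf_injective hr θ
  have hl : Normalized (pairAlg (polarAlg r y ((allShifts a b).erase (.inl e))) fun θ => θ.δ e)
      (fun x : Params a b r × Bool => famModel Γ l u v w (insert e S) x.1.δ (σ x))
      (fun x => posOf u v w x.1.δ) (insert e S).toLeft (insert e S).toRight (insert e S).toLeft
      (insert e S).toRight := by
    refine ⟨fun x m hm => ?_, fun i m hm => ?_⟩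
    · rw [famModel, Γ.lam_ofLbl (hinj _)]
      exact famLam_one l hm
    · simp only [famModel, Γ.lam_ofLbl (hinj _)]
      exact famLam_mem l hσ i hm
  have hrem := fun x : Params a b r × Bool => melem_removed Γ l κ hc hr x.1 he (σ x)
    (σ' x) (hσ' x)
  rcases e with e | e
  · simp only [toLeft_insert_inl, toRight_insert_inl] at hR hl ⊢
    have key := hR.residue_u hc κ (by simpa using he) (by simpa using he) hl
      (M' := fun x => Γ.ofLbl (posOf u v w x.1.δ) (removedLam c l u v w S (.inl e) x.1.δ (σ x)))
      (fun x i m _ => by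
        simp only [famModel, Γ.lam_ofLbl (hinj _)]
        rfl)
      (fun x k hk => (hr.invIn_add (y := y) (D := ∅) (m := .uC k) (z := .u e)
        (by simpa [posOf] using hr.1.uu k e)).1 x.1)
      (fun k hk => ⟨fun x => (hr.invIn_add (y := y) (D := ∅) (m := .vC k) (z := .u e)
        (by simpa [posOf] using hr.1.vu k e)).1 x.1, mem_pairAlg_of_mem (hr.invIn_add (m := .vC k)
        (z := .u e) (by simpa [posOf] using hr.1.vu k e)).2⟩)
    convert key using 1
    funext x
    rw [← hrem x, famMelem]
    simp only [famModel, Γ.lam_ofLbl (hinj _)]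
    simp only [resCoeff, posOf, rap, Sum.elim_inl, famLam, Matrix.cons_val_zero, toLeft_insert_inl,
      toRight_insert_inl]
    ring
  · simp only [toLeft_insert_inr, toRight_insert_inr] at hR hl ⊢
    have key := hR.residue_v hc κ (by simpa using he) (by simpa using he) hl
      (M' := fun x => Γ.ofLbl (posOf u v w x.1.δ) (removedLam c l u v w S (.inr e) x.1.δ (σ x)))
      (fun x i m _ => by
        simp only [famModel, Γ.lam_ofLbl (hinj _)]
        rfl)
      (fun x k hk => (hr.invIn_add (y := y) (D := ∅) (m := .v e) (z := .uC k)
        (by simpa [posOf] using hr.1.vu e k)).1 x.1)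
      (fun k hk => ⟨fun x => (hr.invIn_add (y := y) (D := ∅) (m := .v e) (z := .vC k)
        (by simpa [posOf] using hr.1.vv e k)).1 x.1, mem_pairAlg_of_mem (hr.invIn_add (m := .v e)
        (z := .vC k) (by simpa [posOf] using hr.1.vv e k)).2⟩)
    convert key using 1
    funext x
    rw [← hrem x, famMelem]
    simp only [famModel, Γ.lam_ofLbl (hinj _)]
    simp only [resCoeff, posOf, rap, Sum.elim_inr, famLam, Matrix.cons_val, toLeft_insert_inr,
      toRight_insert_inr]
    ring

end Residue

section Limit

open MvPolynomial

variable {a b N : ℕ} {r : ℝ} {y : Part a b → ℂ}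

def parLim (r : ℝ) (y : Part a b → ℂ) : Filter (Params a b r) := comap Subtype.val (𝓝 (basePt y))

/-- `φ` is rational, regular at the base point, and has the value `z` there. -/
def HasLim (r : ℝ) (y : Part a b → ℂ) (φ : Params a b r → ℂ) (z : ℂ) : Prop :=
  φ ∈ polarAlg r y ∅ ∧ Tendsto φ (parLim r y) (𝓝 z)

lemma tendsto_ev (P : MvPolynomial (Part a b ⊕ Part a b) ℂ) :
    Tendsto (fun θ : Params a b r => θ.ev P) (parLim r y) (𝓝 (eval (basePt y) P)) := by
  simp only [Params.ev]
  exact (P.continuous_eval.tendsto _).comp tendsto_comap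

lemma parLim_neBot (hr : 0 < r) : (parLim r y).NeBot := by
  refine mem_closure_iff_comap_neBot.1 ?_
  have h1 : Continuous fun t : ℂ => (Sum.elim (fun _ => t) y : Part a b ⊕ Part a b → ℂ) :=
    continuous_pi fun k => by rcases k with k | k <;> simp only [Sum.elim_inl, Sum.elim_inr] <;> fun_prop
  refine mem_closure_of_tendsto (f := fun t : ℂ => (Sum.elim (fun _ => t) y : _ → ℂ)) (b := 𝓝[≠] 0)
    ((h1.tendsto 0).mono_left nhdsWithin_le_nhds) ?_
  filter_upwards [self_mem_nhdsWithin, nhdsWithin_le_nhds (Metric.ball_mem_nhds (0 : ℂ) hr)]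
    with t h2 h3 e
  exact ⟨h2, by simpa using h3⟩

variable {φ χ : Params a b r → ℂ} {z z' : ℂ}

lemma HasLim.mul (h : HasLim r y φ z) (h' : HasLim r y χ z') :
    HasLim r y (fun θ => φ θ * χ θ) (z * z') := ⟨fun_mul_mem h.1 h'.1, h.2.mul h'.2⟩

lemma HasLim.add (h : HasLim r y φ z) (h' : HasLim r y χ z') :
    HasLim r y (fun θ => φ θ + χ θ) (z + z') := ⟨fun_add_mem h.1 h'.1, h.2.add h'.2⟩

lemma HasLim.sub (h : HasLim r y φ z) (h' : HasLim r y χ z') :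
    HasLim r y (fun θ => φ θ - χ θ) (z - z') := ⟨fun_sub_mem h.1 h'.1, h.2.sub h'.2⟩

lemma hasLim_const (z : ℂ) : HasLim r y (fun _ => z) z := ⟨const_mem z, tendsto_const_nhds⟩

lemma hasLim_prod {ι : Type*} (s : Finset ι) {φ : ι → Params a b r → ℂ} {z : ι → ℂ}
    (h : ∀ i ∈ s, HasLim r y (φ i) (z i)) : HasLim r y (fun θ => ∏ i ∈ s, φ i θ) (∏ i ∈ s, z i) :=
  ⟨fun_prod_mem s fun i hi => (h i hi).1, tendsto_finsetProd s fun i hi => (h i hi).2⟩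

lemma HasLim.inv (h : HasLim r y φ z) (hi : InvIn (polarAlg r y ∅) φ) (hz : z ≠ 0) :
    HasLim r y (fun θ => (φ θ)⁻¹) z⁻¹ := ⟨hi.2, h.2.inv₀ hz⟩

lemma hasLim_δ (e : Part a b) : HasLim r y (fun θ => θ.δ e) 0 := by
  refine ⟨δ_mem_polarAlg e, ?_⟩
  simpa [Params.ev, Params.δ, basePt] using tendsto_ev (r := r) (y := y) (X (.inl e))

lemma hasLim_param (e : Part a b) : HasLim r y (fun θ => θ.1 (.inr e)) (y e) := by
  refine ⟨?_, ?_⟩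
  · simpa [Params.ev, polarAlg] using ev_mem_ratAlg (S := poleMonoid (basePt y) ∅) (ev := Params.ev (r := r)) (X (.inr e))
  · simpa [Params.ev, basePt] using tendsto_ev (r := r) (y := y) (X (.inr e))

lemma HasLim.exists (h : φ ∈ polarAlg r y ∅) : ∃ z, HasLim r y φ z :=
  (exists_tendsto_of_mem_regular tendsto_ev h).imp fun _ hz => ⟨h, hz⟩

variable {u : Pts a} {v : Pts b} {w : Pts N} {c : ℂ}

lemma hasLim_pos (m : Lbl a b N) : HasLim r y (fun θ => posOf u v w θ.δ m) (posOf u v w 0 m) := by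
  refine ⟨pos_mem_polarAlg m, ?_⟩
  simp only [posOf_eq]
  convert tendsto_ev (r := r) (y := y) _
  simp [eval_shiftPoly]

lemma hasLim_inv_sub (hr : SmallR c u v w r) {m z : Lbl a b N}
    (h : posOf u v w 0 m ≠ posOf u v w 0 z) :
    HasLim r y (fun θ => (posOf u v w θ.δ m - posOf u v w θ.δ z)⁻¹)
      (posOf u v w 0 m - posOf u v w 0 z)⁻¹ :=
  ((hasLim_pos m).sub (hasLim_pos z)).inv (hr.invIn_sub h) (sub_ne_zero.2 h)

lemma hasLim_inv_add (hr : SmallR c u v w r) {m z : Lbl a b N}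
    (h : posOf u v w 0 m - posOf u v w 0 z + I * c ≠ 0) :
    HasLim r y (fun θ => (posOf u v w θ.δ m - posOf u v w θ.δ z + I * c)⁻¹)
      (posOf u v w 0 m - posOf u v w 0 z + I * c)⁻¹ :=
  (((hasLim_pos m).sub (hasLim_pos z)).add (hasLim_const _)).inv (hr.invIn_add h) h

lemma hasLim_f (hr : SmallR c u v w r) {m z : Lbl a b N} (h : posOf u v w 0 m ≠ posOf u v w 0 z) :
    HasLim r y (fun θ => f c (posOf u v w θ.δ m) (posOf u v w θ.δ z))
      (f c (posOf u v w 0 m) (posOf u v w 0 z)) := by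
  simp only [f, div_eq_mul_inv]
  exact (((hasLim_pos m).sub (hasLim_pos z)).add (hasLim_const _)).mul (hasLim_inv_sub hr h)

lemma hasLim_f_inv (hr : SmallR c u v w r) {m z : Lbl a b N}
    (h : posOf u v w 0 m - posOf u v w 0 z + I * c ≠ 0) :
    HasLim r y (fun θ => (f c (posOf u v w θ.δ m) (posOf u v w θ.δ z))⁻¹)
      (f c (posOf u v w 0 m) (posOf u v w 0 z))⁻¹ := by
  simp only [f, inv_div]
  simp only [div_eq_mul_inv]
  exact ((hasLim_pos m).sub (hasLim_pos z)).mul (hasLim_inv_add hr h)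

lemma hasLim_g (hr : SmallR c u v w r) {m z : Lbl a b N} (h : posOf u v w 0 m ≠ posOf u v w 0 z) :
    HasLim r y (fun θ => g c (posOf u v w θ.δ m) (posOf u v w θ.δ z))
      (g c (posOf u v w 0 m) (posOf u v w 0 z)) := by
  simp only [g, div_eq_mul_inv (I * c)]
  exact (hasLim_const _).mul (hasLim_inv_sub hr h)

lemma hasLim_modNu (hr : SmallR c u v w r) {e k : Part a b} :
    HasLim r y (fun θ => modNu c e k (rap u v e) (rap u v k) (θ.δ k))
      (modNu c e k (rap u v e) (rap u v k) 0) := by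
  have key : ∀ k z, rap u v k - rap u v z + I * c ≠ 0 →
      HasLim r y (fun θ => (rap u v k + θ.δ k - rap u v z + I * c)⁻¹)
        (rap u v k + 0 - rap u v z + I * c)⁻¹ := fun k z h => by
    have := hasLim_inv_add (y := y) hr (m := lblC N k) (z := lblK N z)
      (by rwa [base_lblC, posOf_lblK])
    simpa only [posOf_lblC, posOf_lblK, Pi.zero_apply] using this
  have key' : ∀ k z, rap u v z - rap u v k + I * c ≠ 0 →
      HasLim r y (fun θ => (rap u v z - (rap u v k + θ.δ k) + I * c)⁻¹)
        (rap u v z - (rap u v k + 0) + I * c)⁻¹ := fun k z h => by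
    have := hasLim_inv_add (y := y) hr (m := lblK N z) (z := lblC N k)
      (by rwa [base_lblC, posOf_lblK])
    simpa only [posOf_lblC, posOf_lblK, Pi.zero_apply] using this
  rcases e with e | e <;> rcases k with k | k <;> simp only [modNu]
  · exact ((hasLim_const _).mul (key _ _ (rap_add_inl hr.1 e (.inl k)))).mul (hasLim_const _)
  · exact ((hasLim_const _).mul (key _ _ (rap_add_inl hr.1 e (.inr k)))).mul (hasLim_const _)
  · exact ((hasLim_const _).mul (key' _ _ (rap_add_inr hr.1 e (.inl k)))).mul (hasLim_const _)
  · exact hasLim_const _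

def recCoeff (c : ℂ) (u : Pts a) (v : Pts b) (w : Pts N) (S : Parts a b)
    (e : Part a b) (d : Part a b → ℂ) : ℂ :=
  -(I * c) * bethe c u v (insert e S) e * resCoeff c u v S e d *
    ∏ k, (modW c e (rap u v e) (w k) * (modW c e (rap u v e + d e) (w k))⁻¹)

lemma hasLim_recCoeff (hr : SmallR c u v w r) {S : Parts a b} {e : Part a b} (he : e ∉ S) :
    HasLim r y (fun θ => recCoeff c u v w S e θ.δ) (recCoeff c u v w S e 0) := by
  refine ((hasLim_const _).mul ?_).mul (hasLim_prod _ fun k _ => (hasLim_const _).mul ?_)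
  · rcases e with e | e
    · have hne : ∀ k ∈ S.toLeft, k ≠ e := fun k hk h => he (by simpa [h] using hk)
      refine (hasLim_const _).mul (hasLim_prod _ fun k hk => ?_)
      exact hasLim_f hr (m := .uC k) (z := .u e)
        (by simpa [posOf] using fun h => hne k hk (hr.1.u_inj h))
    · have hne : ∀ k ∈ S.toRight, e ≠ k := fun k hk h => he (by simpa [h] using hk)
      simp only [resCoeff, div_eq_mul_inv, ← prod_inv_distrib]
      refine ((hasLim_const _).mul (hasLim_prod _ fun k hk => ?_)).mul
        ((hasLim_prod _ fun k hk => ?_).mul (hasLim_prod _ fun k hk => ?_))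
      · exact hasLim_g hr (m := .vC e) (z := .vC k)
          (by simpa [posOf] using fun h => hne k hk (hr.1.v_inj h))
      · exact hasLim_f hr (m := .v e) (z := .uC k) (by simpa [posOf] using hr.1.v_ne_u e k)
      · exact hasLim_f_inv hr (m := .vC e) (z := .uC k) (by simpa [posOf] using hr.1.vu e k)
  · rcases e with e | e
    · exact hasLim_f_inv hr (m := .w k) (z := .uC e) (by simpa [posOf] using hr.1.wu k e)
    · exact hasLim_f_inv hr (m := .vC e) (z := .w k) (by simpa [posOf] using hr.1.vw e k)

lemma famDen_insert {S : Parts a b} {e : Part a b} (he : e ∉ S) (d : Part a b → ℂ) :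
    famDen u v w c (insert e S) d = famDen u v w c S d * ∏ k, modW c e (rap u v e + d e) (w k) := by
  rcases e with e | e <;>
    simp only [famDen, toLeft_insert_inl, toRight_insert_inl,
      toLeft_insert_inr, toRight_insert_inr, prod2, modW, rap, Sum.elim_inl, Sum.elim_inr]
  · have he' : e ∉ S.toLeft := by simpa using he
    simp only [prod_insert he', prod_mul_distrib]
    ring
  · rw [prod_insert (by simpa using he)]
    ring

lemma invIn_famDen (hr : SmallR c u v w r) (S : Parts a b) {D : Finset (Part a b ⊕ Part a b)} :
    InvIn (polarAlg r y D) fun θ => famDen u v w c S θ.δ := by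
  have h1 : ∀ i k, InvIn (polarAlg r y D) fun θ => f c (w k) (u i + θ.δ (.inl i)) := fun i k =>
    have h := hr.invIn_add (y := y) (D := D) (m := .w k) (z := .uC i)
      (by simpa [posOf] using hr.1.wu k i)
    ⟨fun θ => h.f_ne (posOf_ne hr θ (m := .w k) (z := .uC i) (by simp)),
      h.f_inv (pos_mem_polarAlg _) (pos_mem_polarAlg _)⟩
  have h2 : ∀ i k, InvIn (polarAlg r y D) fun θ => f c (v i + θ.δ (.inr i)) (w k) := fun i k =>
    have h := hr.invIn_add (y := y) (D := D) (m := .vC i) (z := .w k)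
      (by simpa [posOf] using hr.1.vw i k)
    ⟨fun θ => h.f_ne (posOf_ne hr θ (m := .vC i) (z := .w k) (by simp)),
      h.f_inv (pos_mem_polarAlg _) (pos_mem_polarAlg _)⟩
  refine ⟨fun θ => mul_ne_zero (prod_ne_zero_iff.2 fun k _ =>
    prod_ne_zero_iff.2 fun i _ => (h1 i k).1 θ) (prod_ne_zero_iff.2 fun i _ =>
    prod_ne_zero_iff.2 fun k _ => (h2 i k).1 θ), ?_⟩
  exact fun_mul_inv_mem (fun_prod2_inv_mem fun k _ i _ => (h1 i k).2)
    (fun_prod2_inv_mem fun i _ k _ => (h2 i k).2)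

variable (Γ : GeneralizedModel.{uG} c) (l : Fin 3 → ℂ → ℂ) (κ : Coeffs N)

/-- The form factor, with the deviations from the Bethe equations expressed by `η`. -/
def devFF (u : Pts a) (v : Pts b) (w : Pts N) (S : Parts a b)
    (η : Part a b → Params a b r → ℂ) (θ : Params a b r) : ℂ :=
  famFF Γ l κ u v w S θ.δ fun k => 1 + θ.δ k * η k θ

lemma devFF_mem (hc : c ≠ 0) (hr : SmallR c u v w r)
    {D : Finset (Part a b ⊕ Part a b)} (hD : D ⊆ allShifts a b)
    {S : Parts a b} (hS : ∀ e ∈ S, .inl e ∈ D) {η : Part a b → Params a b r → ℂ}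
    (hη : ∀ k, η k ∈ polarAlg r y D) : devFF Γ l κ u v w S η ∈ polarAlg r y D := by
  have := famMelem_mem Γ l κ hc hr y hD hS (σ := fun θ k => 1 + θ.δ k * η k θ)
    fun k _ => fun_add_mem (const_mem 1) (fun_mul_mem (δ_mem_polarAlg k) (hη k))
  exact fun_mul_mem this (invIn_famDen hr S).2

def devRemove (c : ℂ) (u : Pts a) (v : Pts b) (S : Parts a b) (e : Part a b)
    (η : Part a b → Params a b r → ℂ) (k : Part a b) (θ : Params a b r) : ℂ :=
  if k ∈ S then η k θ * (1 + θ.δ k * modNu c e k (rap u v e) (rap u v k) (θ.δ k)) +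
    modNu c e k (rap u v e) (rap u v k) (θ.δ k) else 0

lemma devFF_recursion (hc : c ≠ 0) (hr : SmallR c u v w r)
    {S : Parts a b} {e : Part a b} (he : e ∉ S) {η : Part a b → Params a b r → ℂ}
    (hη : ∀ k, η k ∈ polarAlg r y ((allShifts a b).erase (.inl e))) :
    (fun θ => devFF Γ l κ u v w (insert e S) η θ - recCoeff c u v w S e θ.δ * η e θ *
        devFF Γ l κ u v w S (devRemove c u v S e η) θ) ∈
      polarAlg r y ((allShifts a b).erase (.inl e)) ∧
    ∃ ψ ∈ polarAlg r y ((allShifts a b).erase (.inl e)), ∀ θ,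
      devFF Γ l κ u v w (insert e S) η θ - recCoeff c u v w S e θ.δ * η e θ *
        devFF Γ l κ u v w S (devRemove c u v S e η) θ -
        devFF Γ l κ u v w (insert e S) (Function.update η e 0) θ = θ.δ e * ψ θ := by
  have key := famMelem_residue Γ l κ hc hr y he
    (σ := fun x k => 1 + x.1.δ k * if x.2 then η k x.1 else Function.update η e 0 k x.1)
    (fun k _ => ?_) (σ' := fun x k => if x.2 then 1 + x.1.δ k * devRemove c u v S e η k x.1 else
      1 + x.1.δ k * devRemove c u v S e (Function.update η e 0) k x.1) ?_
  · obtain ⟨h1, h2, ψ, hψ, h3⟩ := key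
    have hden := invIn_famDen (y := y) hr (insert e S) (D := (allShifts a b).erase (.inl e))
    have hne : ∀ θ : Params a b r, ∏ k, modW c e (rap u v e + θ.δ e) (w k) ≠ 0 := fun θ h => by
      have := hden.1 θ
      simp [famDen_insert he, h] at this
    have eq1 : ∀ θ : Params a b r, devFF Γ l κ u v w (insert e S) η θ -
        recCoeff c u v w S e θ.δ * η e θ * devFF Γ l κ u v w S (devRemove c u v S e η) θ =
        (famMelem Γ l κ u v w (insert e S) θ.δ (fun k => 1 + θ.δ k * η k θ) -
          g c (rap u v e + θ.δ e) (rap u v e) * (bethe c u v (insert e S) e -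
            bethe c u v (insert e S) e * (1 + θ.δ e * η e θ)) * resCoeff c u v S e θ.δ *
          ((∏ k, modW c e (rap u v e) (w k)) * famMelem Γ l κ u v w S θ.δ
            (fun k => 1 + θ.δ k * devRemove c u v S e η k θ))) *
          (famDen u v w c (insert e S) θ.δ)⁻¹ := fun θ => by
      have h4 := hne θ
      have h5 := θ.δ_ne e
      have h6 := (invIn_famDen (y := y) (D := ∅) hr S).1 θ
      simp only [devFF, famFF, recCoeff, famDen_insert he, prod_mul_distrib,
        prod_inv_distrib, g, add_sub_cancel_left]
      field_simp
      ring
    simp only [if_true, if_false, Bool.false_eq_true, Function.update_self, Pi.zero_apply, mul_zero,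
      add_zero, mul_one, sub_self, zero_mul, sub_zero] at h1 h3
    refine ⟨?_, _, fun_mul_mem hψ hden.2, fun θ => ?_⟩
    · simp only [eq1]
      exact fun_mul_mem h1 hden.2
    · rw [eq1]
      simp only [devFF, famFF]
      linear_combination (famDen u v w c (insert e S) θ.δ)⁻¹ * h3 θ
  · refine ⟨?_, ?_, ?_⟩
    · exact fun_add_mem (const_mem 1) (fun_mul_mem (δ_mem_polarAlg k) (by simpa using hη k))
    · refine fun_add_mem (const_mem 1) (fun_mul_mem (δ_mem_polarAlg k) ?_)
      rcases eq_or_ne k e with rfl | hk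
      · simpa using const_mem 0
      · simpa [hk] using hη k
    · rcases eq_or_ne k e with rfl | hk
      · exact ⟨_, hη k, fun θ => by simp⟩
      · exact ⟨_, const_mem 0, fun θ => by simp [hk]⟩
  · rintro ⟨θ, _ | _⟩ k hk <;> simp [devRemove, hk] <;> ring

lemma devRemove_mem (hr : SmallR c u v w r) {S : Parts a b}
    {e : Part a b} {η : Part a b → Params a b r → ℂ} {z : Part a b → ℂ}
    (hη : ∀ k, HasLim r y (η k) (z k)) (k : Part a b) : HasLim r y (devRemove c u v S e η k)
      (if k ∈ S then z k + modNu c e k (rap u v e) (rap u v k) 0 else 0) := by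
  have h := hasLim_modNu (y := y) hr (e := e) (k := k)
  by_cases hk : k ∈ S
  · have := ((hη k).mul ((hasLim_const 1).add ((hasLim_δ k).mul h))).add h
    simp only [zero_mul, add_zero, mul_one] at this
    rw [if_pos hk]
    convert this using 1
    exact funext fun θ => if_pos hk
  · rw [if_neg hk]
    convert hasLim_const 0 using 1
    exact funext fun θ => if_neg hk

lemma devFF_regular (hc : c ≠ 0) (hr : SmallR c u v w r)
    (S : Parts a b) : ∀ {η : Part a b → Params a b r → ℂ},
    (∀ k, η k ∈ polarAlg r y ∅) → devFF Γ l κ u v w S η ∈ polarAlg r y ∅ := by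
  induction S using strongInduction with
  | H S ih =>
    intro η hη
    have hη' : ∀ D ⊆ allShifts a b, ∀ k, η k ∈ polarAlg r y D := fun D hD k =>
      polarAlg_mono (empty_subset _) hD (hη k)
    refine mem_regular_of_forall_erase (D := allShifts a b) ?_ (Params.ev_ext hr.pos)
      (devFF_mem Γ l κ hc hr subset_rfl (fun e _ => by simp [allShifts]) (hη' _ subset_rfl)) ?_
    · simp [allShifts, basePt]
    · intro e he
      obtain ⟨e, _, rfl⟩ := Finset.mem_map.1 he
      have hD := erase_subset (.inl e) (allShifts a b)
      by_cases heS : e ∈ S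
      · have h1 := (devFF_recursion Γ l κ hc hr (notMem_erase e S) (hη' _ hD)).1
        rw [insert_erase heS] at h1
        choose z hz using fun k => HasLim.exists (hη k)
        have h2 := ih _ (erase_ssubset heS)
          fun k => (devRemove_mem (S := S.erase e) (e := e) hr hz k).1
        have h3 := fun_mul_mem (fun_mul_mem (hasLim_recCoeff (r := r) (y := y) hr
          (notMem_erase e S)).1 (hη e)) h2
        have h4 := fun_add_mem h1 (polarAlg_mono (empty_subset _) hD h3)
        simp only [sub_add_cancel] at h4
        exact h4
      · exact devFF_mem Γ l κ hc hr hD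
          (fun k hk => by simp [allShifts, (ne_of_mem_of_not_mem hk heS)]) (hη' _ hD)

/-- The limit of the form factor is determined by the recursion. -/
lemma devFF_hasLim (hc : c ≠ 0) (hr : SmallR c u v w r) (F : Parts a b → (Part a b → ℂ) → ℂ)
    (hF0 : ∀ S, HasLim r y (devFF Γ l κ u v w S 0) (F S 0))
    (hF : ∀ S, ∀ e ∉ S, ∀ z, F (insert e S) z = recCoeff c u v w S e 0 * z e *
      F S (fun k => if k ∈ S then z k + modNu c e k (rap u v e) (rap u v k) 0 else 0) +
      F (insert e S) (Function.update z e 0))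
    (S : Parts a b) : ∀ {η : Part a b → Params a b r → ℂ} {z : Part a b → ℂ},
    (∀ k, HasLim r y (η k) (z k)) → (∀ k ∉ S, η k = 0 ∧ z k = 0) →
    HasLim r y (devFF Γ l κ u v w S η) (F S z) := by
  induction S using strongInduction with
  | H S ih =>
    suffices H : ∀ T ⊆ S, ∀ {η : Part a b → Params a b r → ℂ} {z : Part a b → ℂ},
        (∀ k, HasLim r y (η k) (z k)) → (∀ k ∉ T, η k = 0 ∧ z k = 0) →
        HasLim r y (devFF Γ l κ u v w S η) (F S z) from
      fun {_ _} hη h0 => H S subset_rfl hη h0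
    intro T
    induction T using Finset.induction_on with
    | empty =>
      intro _ η z _ h0
      obtain rfl : η = 0 := funext fun k => (h0 k (by simp)).1
      obtain rfl : z = 0 := funext fun k => (h0 k (by simp)).2
      exact hF0 S
    | insert e T he ih' =>
      intro hT η z hη h0
      obtain ⟨heS, hT⟩ := insert_subset_iff.1 hT
      have hD := erase_subset (.inl e) (allShifts a b)
      obtain ⟨-, ψ, hψ, h1⟩ := devFF_recursion Γ l κ hc hr (notMem_erase e S)
        fun k => polarAlg_mono (empty_subset _) hD (hη k).1
      have hF' := hF _ e (notMem_erase e S) z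
      simp only [insert_erase heS] at h1 hF'
      have hup : ∀ k, HasLim r y (Function.update η e 0 k) (Function.update z e 0 k) := fun k => by
        rcases eq_or_ne k e with rfl | hk
        · simp only [Function.update_self]
          exact hasLim_const 0
        · simpa [hk] using hη k
      have h2 := ih' hT hup fun k hk => by
        rcases eq_or_ne k e with rfl | hk'
        · simp
        · simpa [hk'] using h0 k (by simp [hk, hk'])
      have h3 := ((hasLim_recCoeff (r := r) (y := y) hr (notMem_erase e S)).mul
        (hη e)).mul (ih _ (erase_ssubset heS) (devRemove_mem (e := e) hr hη)
        fun k hk => ⟨funext fun θ => if_neg hk, if_neg hk⟩)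
      have h4 := fun_sub_mem (fun_sub_mem (devFF_regular Γ l κ hc hr S fun k => (hη k).1) h3.1)
        h2.1
      have h5 : HasLim r y _ 0 := ⟨h4, tendsto_zero_of_mem_regular tendsto_ev
        (Params.ev_ext hr.pos) (by simp [basePt]) h4 hψ fun θ => by
          rw [h1]; simp [Params.ev, Params.δ]⟩
      rw [hF', add_comm]
      have h6 := (h5.add h2).add h3
      simp only [sub_add_cancel, zero_add] at h6
      exact h6

end Limit

section Expansion

variable {a b N : ℕ} {c : ℂ} {u : Pts a} {v : Pts b} {w : Pts N}

def gaudinW (c : ℂ) (u : Pts a) (v : Pts b) : Part a b → Part a b → ℂ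
  | .inl i, .inl j => K c (u j) (u i)
  | .inl i, .inr j => t c (v j) (u i)
  | .inr i, .inl j => -t c (v i) (u j)
  | .inr _, .inr _ => 0

/-- The Gaudin matrix of the particles `S`, extended by the identity matrix. -/
def gaudinM (c : ℂ) (u : Pts a) (v : Pts b) (S : Parts a b) (Z : Part a b → ℂ) :
    Matrix (Part a b) (Part a b) ℂ :=
  Matrix.of fun j k => if j ∈ S then (if k ∈ S then
    (if j = k then c * Z j - ∑ l ∈ S, gaudinW c u v j l else 0) + gaudinW c u v j k else 0)
    else if j = k then 1 else 0

lemma det_gaudinM_congr {S : Parts a b} {Z Z' : Part a b → ℂ} (h : ∀ k ∈ S, Z k = Z' k) :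
    (gaudinM c u v S Z).det = (gaudinM c u v S Z').det := by
  congr 1
  ext j k
  by_cases hj : j ∈ S <;> simp [gaudinM, hj, h]

lemma det_gaudinM_empty (Z : Part a b → ℂ) : (gaudinM c u v ∅ Z).det = 1 := by
  convert Matrix.det_one (n := Part a b) (R := ℂ)
  ext j k
  simp [gaudinM, Matrix.one_apply]

lemma det_gaudinM_zero {S : Parts a b} (hS : S.Nonempty) : (gaudinM c u v S 0).det = 0 := by
  refine Matrix.exists_mulVec_eq_zero_iff.1 ⟨fun k => if k ∈ S then 1 else 0, fun h => ?_, ?_⟩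
  · obtain ⟨k, hk⟩ := hS
    simpa [hk] using congrFun h k
  · ext j
    by_cases hj : j ∈ S
    · simp [gaudinM, Matrix.mulVec, dotProduct, hj, sum_add_distrib]
    · simp [gaudinM, Matrix.mulVec, dotProduct, hj]

lemma det_gaudinM_insert (hc : c ≠ 0) {S : Parts a b} {e : Part a b} (he : e ∉ S)
    (Z : Part a b → ℂ) : (gaudinM c u v (insert e S) Z).det =
      c * Z e * (gaudinM c u v S fun k => Z k - gaudinW c u v k e / c).det +
        (gaudinM c u v (insert e S) (Function.update Z e 0)).det := by
  have h1 : gaudinM c u v (insert e S) Z = (gaudinM c u v (insert e S) (Function.update Z e 0)).updateRow e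
      ((c * Z e) • Pi.single e 1 + gaudinM c u v (insert e S) (Function.update Z e 0) e) := by
    ext j k
    rcases eq_or_ne j e with rfl | hj
    · rw [Matrix.updateRow_self]
      rcases eq_or_ne j k with rfl | hk
      · simp [gaudinM]
        ring
      · simp [gaudinM, hk, hk.symm]
    · rw [Matrix.updateRow_ne hj]
      simp [gaudinM, hj]
  rw [h1, Matrix.det_updateRow_add, Matrix.det_updateRow_smul, Matrix.updateRow_eq_self]
  congr 2
  refine Matrix.det_eq_of_forall_row_eq_smul_add_const
    (fun i => if i ∈ S then gaudinW c u v i e else 0) e (by simp [he]) fun j k => ?_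
  rcases eq_or_ne j e with rfl | hj
  · rw [Matrix.updateRow_self]
    simp [gaudinM, he, Pi.single_apply, eq_comm]
  · rw [Matrix.updateRow_ne hj]
    by_cases hjS : j ∈ S
    · rcases eq_or_ne k e with rfl | hk
      · simp [gaudinM, hj, hjS, he]
      · by_cases hkS : k ∈ S
        · rcases eq_or_ne j k with rfl | hjk
          · simp [gaudinM, hj, hjS, he, sum_insert he, hk.symm]
            field_simp
            ring
          · simp [gaudinM, hj, hjS, he, hkS, hjk, hk.symm]
        · simp [gaudinM, hjS, he, hkS, hk, hk.symm]
    · simp [gaudinM, hj, hjS, he]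

lemma det_gaudin_eq (Z : Pts a) (Y : Pts b) (S : Parts a b) :
    (gaudin c u v Z Y S.toLeft S.toRight).det = (gaudinM c u v S (Sum.elim Z Y)).det := by
  rw [Matrix.twoBlockTriangular_det _ (· ∈ S) fun i hi j hj => by
    simp [gaudinM, hi, (ne_of_mem_of_not_mem hj hi).symm]]
  have h1 : (gaudinM c u v S (Sum.elim Z Y)).toSquareBlockProp (fun i => ¬ i ∈ S) = 1 := by
    ext ⟨i, hi⟩ ⟨j, hj⟩
    simp [gaudinM, Matrix.toSquareBlockProp, hi, Matrix.one_apply]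
  rw [h1, Matrix.det_one, mul_one]
  let φ : S.toLeft ⊕ S.toRight → {x // x ∈ S} :=
    Sum.elim (fun i => ⟨.inl i.1, mem_toLeft.1 i.2⟩) fun i => ⟨.inr i.1, mem_toRight.1 i.2⟩
  have hφ : Function.Bijective φ := by
    constructor
    · rintro (⟨i, hi⟩ | ⟨i, hi⟩) (⟨j, hj⟩ | ⟨j, hj⟩) h <;> simp [φ] at h ⊢ <;> exact h
    · rintro ⟨x | x, hx⟩
      · exact ⟨.inl ⟨x, mem_toLeft.2 hx⟩, rfl⟩
      · exact ⟨.inr ⟨x, mem_toRight.2 hx⟩, rfl⟩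
  have hdet := Matrix.det_submatrix_equiv_self (Equiv.ofBijective φ hφ)
    ((gaudinM c u v S (Sum.elim Z Y)).toSquareBlockProp (· ∈ S))
  trans
  swap
  · convert hdet
  congr 1
  have hK : ∀ x y, K c x y = K c y x := fun x y => by
    simp only [K]
    rw [← neg_sub y x, neg_sq]
  have hS : ∀ F : Part a b → ℂ, ∑ x ∈ S, F x =
      ∑ i ∈ S.toLeft, F (.inl i) + ∑ i ∈ S.toRight, F (.inr i) := fun F => by
    rw [← sum_disjSum, toLeft_disjSum_toRight]
  ext (⟨i, hi⟩ | ⟨i, hi⟩) (⟨j, hj⟩ | ⟨j, hj⟩)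
  all_goals
    simp only [mem_toLeft, mem_toRight] at hi hj
    simp [gaudin, gaudinM, Matrix.toSquareBlockProp, φ, hi, hj, gaudinW, hS]
  · rcases eq_or_ne i j with rfl | h
    · simp only [if_true, fun l => hK (u l) (u i)]
      ring
    · simp [h]
  · rcases eq_or_ne i j with rfl | h
    · simp
    · simp [h]

/-- The product of `om e k` is the contribution of the particle `e` to `normFactor`. -/
def om (c : ℂ) (u : Pts a) (v : Pts b) : Part a b → Part a b → ℂ
  | .inl i, .inl j => f c (u i) (u j) * f c (u j) (u i)
  | .inl i, .inr j => f c (v j) (u i)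
  | .inr i, .inl j => f c (v i) (u j)
  | .inr i, .inr j => g c (v i) (v j) * g c (v j) (v i)

lemma Delta_mul_Delta' {n : ℕ} (F : ℂ → ℂ → ℂ) (x : Pts n) (A : Finset (Fin n)) :
    Delta F x A * Delta' F x A = ∏ i ∈ A, ∏ j ∈ A.erase i, F (x i) (x j) := by
  rw [Delta, Delta', ← prod_mul_distrib]
  refine prod_congr rfl fun i _ => ?_
  rw [← prod_union (disjoint_filter.2 fun j _ h1 h2 => absurd h1 h2.not_gt)]
  refine prod_congr ?_ fun _ _ => rfl
  ext j
  simp only [mem_union, mem_filter, mem_erase, ne_iff_lt_or_gt]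
  tauto

lemma Delta_mul_Delta'_insert {n : ℕ} (F : ℂ → ℂ → ℂ) (x : Pts n) {A : Finset (Fin n)}
    {e : Fin n} (he : e ∉ A) : Delta F x (insert e A) * Delta' F x (insert e A) =
      (∏ k ∈ A, F (x e) (x k) * F (x k) (x e)) * (Delta F x A * Delta' F x A) := by
  have h : ∀ i ∈ A, ∏ j ∈ (insert e A).erase i, F (x i) (x j) =
      F (x i) (x e) * ∏ j ∈ A.erase i, F (x i) (x j) := fun i hi => by
    have hne : e ≠ i := fun h => he (h ▸ hi)
    rw [erase_insert_of_ne hne, prod_insert (by simp [he])]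
  rw [Delta_mul_Delta', Delta_mul_Delta', prod_insert he, erase_insert he,
    prod_congr rfl h, prod_mul_distrib, prod_mul_distrib]
  ring

def partNorm (c : ℂ) (u : Pts a) (v : Pts b) (S : Parts a b) : ℂ :=
  normFactor c u v S.toLeft S.toRight

lemma partNorm_insert {S : Parts a b} {e : Part a b} (he : e ∉ S) :
    partNorm c u v (insert e S) = -(∏ k ∈ S, om c u v e k) * partNorm c u v S := by
  have hS : ∀ F : Part a b → ℂ, ∏ x ∈ S, F x =
      (∏ i ∈ S.toLeft, F (.inl i)) * ∏ i ∈ S.toRight, F (.inr i) := fun F => by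
    rw [← prod_disjSum, toLeft_disjSum_toRight]
  rw [hS]
  rcases e with e | e
  · have he' : e ∉ S.toLeft := by simpa using he
    have := Delta_mul_Delta'_insert (f c) u he'
    simp only [partNorm, normFactor, om, toLeft_insert_inl, toRight_insert_inl,
      prod2, prod_insert he', prod_mul_distrib, card_insert_of_notMem he', mul_assoc] at this ⊢
    rw [← mul_assoc (Delta _ _ (insert _ _)), this]
    ring
  · have he' : e ∉ S.toRight := by simpa using he
    have := Delta_mul_Delta'_insert (g c) v he'
    simp only [partNorm, normFactor, om, toLeft_insert_inr, toRight_insert_inr,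
      prod2, prod_insert he', prod_mul_distrib, card_insert_of_notMem he', mul_assoc] at this ⊢
    rw [this]
    ring

lemma om_ne_zero (hc : c ≠ 0) (hg : Generic c u v w) {e k : Part a b} (h : e ≠ k) :
    om c u v e k ≠ 0 := by
  have hgn : ∀ x y, x ≠ y → g c x y ≠ 0 := fun x y hxy =>
    div_ne_zero (ic_ne_zero hc) (sub_ne_zero.2 hxy)
  rcases e with e | e <;> rcases k with k | k
  · have h' : e ≠ k := fun h' => h (h' ▸ rfl)
    exact mul_ne_zero (hg.f_uu h') (hg.f_uu h'.symm)
  · exact hg.f_vu _ _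
  · exact hg.f_vu _ _
  · have h' : v e ≠ v k := fun h' => h (hg.v_inj h' ▸ rfl)
    exact mul_ne_zero (hgn _ _ h') (hgn _ _ h'.symm)

lemma partNorm_empty : partNorm c u v ∅ = 1 := by
  have h1 : (∅ : Parts a b).toLeft = ∅ := rfl
  have h2 : (∅ : Parts a b).toRight = ∅ := rfl
  simp [h1, h2, partNorm, normFactor, prod2, Delta, Delta']

lemma partNorm_ne_zero (hc : c ≠ 0) (hg : Generic c u v w) (S : Parts a b) :
    partNorm c u v S ≠ 0 := by
  induction S using Finset.induction_on with
  | empty => rw [partNorm_empty]; exact one_ne_zero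
  | insert e S he ih =>
    rw [partNorm_insert he]
    exact mul_ne_zero (neg_ne_zero.2 (prod_ne_zero_iff.2 fun k hk =>
      om_ne_zero hc hg fun h => he (h ▸ hk))) ih

lemma recCoeff_zero (hg : Generic c u v w) {S : Parts a b} {e : Part a b} (he : e ∉ S) :
    recCoeff c u v w S e 0 = -(I * c) * ∏ k ∈ S, om c u v e k := by
  have hS : ∀ F : Part a b → ℂ, ∏ x ∈ S, F x =
      (∏ i ∈ S.toLeft, F (.inl i)) * ∏ i ∈ S.toRight, F (.inr i) := fun F => by
    rw [← prod_disjSum, toLeft_disjSum_toRight]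
  have hW : ∀ k, modW c e (rap u v e) (w k) ≠ 0 := fun k => by
    rcases e with e | e
    exacts [hg.f_wu k e, hg.f_vw e k]
  rw [hS, recCoeff, prod_eq_one fun k _ => by
    rw [Pi.zero_apply, add_zero]; exact mul_inv_cancel₀ (hW k), mul_one]
  rcases e with e | e
  · have he' : e ∉ S.toLeft := by simpa using he
    have h1 : ∏ k ∈ S.toLeft, f c (u k) (u e) ≠ 0 :=
      prod_ne_zero_iff.2 fun k hk => hg.f_uu fun h => he' (h ▸ hk)
    simp only [bethe, betheRhs1, resCoeff, om, Sum.elim_inl, toLeft_insert_inl,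
      toRight_insert_inl, erase_insert he', Pi.zero_apply, add_zero, prod_mul_distrib]
    field_simp
  · have h1 : ∏ k ∈ S.toLeft, f c (v e) (u k) ≠ 0 := prod_ne_zero_iff.2 fun k hk => hg.f_vu _ _
    simp only [bethe, betheRhs3, resCoeff, om, Sum.elim_inr, toLeft_insert_inr,
      Pi.zero_apply, add_zero, prod_mul_distrib, div_self h1,
      fun k => g_swap c (v e) (v k), prod_neg]
    ring

lemma I_mul_modNu (hc : c ≠ 0) (hg : Generic c u v w) {e k : Part a b} (h : e ≠ k) :
    I * modNu c e k (rap u v e) (rap u v k) 0 = -gaudinW c u v k e / c := by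
  have h1 := sub_ne_zero.2 (rap_ne hg h)
  have h2 := sub_ne_zero.2 (rap_ne hg h.symm)
  rcases e with e | e <;> rcases k with k | k <;>
    simp only [modNu, gaudinW, rap, Sum.elim_inl, Sum.elim_inr, add_zero, K, t, g, GL21.h] at h1 h2 ⊢
  · have h3 := hg.uu k e
    have h4 : u k - u e - I * c ≠ 0 := fun h => hg.uu e k (by linear_combination -h)
    have h5 : (u e - u k) ^ 2 + c ^ 2 = (u k - u e + I * c) * (u k - u e - I * c) := by
      linear_combination c ^ 2 * Complex.I_sq
    rw [h5]
    field_simp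
    linear_combination Complex.I_sq
  · have h3 := hg.vu k e
    field_simp
  · have h3 := hg.vu e k
    field_simp
  · simp

def expansion (c : ℂ) (u : Pts a) (v : Pts b) (L : Parts a b → ℂ)
    (S : Parts a b) (z : Part a b → ℂ) : ℂ :=
  ∑ J ∈ S.powerset, partNorm c u v S / partNorm c u v (S \ J) *
    (gaudinM c u v J fun k => I * z k).det * L (S \ J)

lemma expansion_zero (hc : c ≠ 0) (hg : Generic c u v w) (L : Parts a b → ℂ)
    (S : Parts a b) : expansion c u v L S 0 = L S := by
  rw [expansion, sum_eq_single_of_mem ∅ (by simp) fun J _ hJ => ?_]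
  · simp [det_gaudinM_empty, partNorm_ne_zero hc hg S]
  · have := det_gaudinM_zero (c := c) (u := u) (v := v) (nonempty_iff_ne_empty.2 hJ)
    simp only [Pi.zero_apply, mul_zero]
    erw [this]
    ring

lemma expansion_insert (hc : c ≠ 0) (hg : Generic c u v w) (L : Parts a b → ℂ)
    (S : Parts a b) (e : Part a b) (he : e ∉ S) (z : Part a b → ℂ) :
    expansion c u v L (insert e S) z = recCoeff c u v w S e 0 * z e * expansion c u v L S
        (fun k => if k ∈ S then z k + modNu c e k (rap u v e) (rap u v k) 0 else 0) +
      expansion c u v L (insert e S) (Function.update z e 0) := by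
  have hd : Disjoint S.powerset (S.powerset.image (insert e)) := by
    rw [disjoint_left]
    intro J hJ hJ'
    obtain ⟨J', -, rfl⟩ := mem_image.1 hJ'
    exact he (mem_powerset.1 hJ (mem_insert_self _ _))
  have hinj : Set.InjOn (insert e) (S.powerset : Set (Parts a b)) := fun J hJ J' hJ' h => by
    have h1 : e ∉ J := fun h => he (mem_powerset.1 hJ h)
    have h2 : e ∉ J' := fun h => he (mem_powerset.1 hJ' h)
    rw [← erase_insert h1, ← erase_insert h2]
    exact congrArg (·.erase e) h
  simp only [expansion, powerset_insert, sum_union hd, sum_image hinj, mul_sum]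
  have k1 : ∀ J ∈ S.powerset, partNorm c u v (insert e S) / partNorm c u v (insert e S \ J) *
      (gaudinM c u v J fun k => I * z k).det * L (insert e S \ J) =
      partNorm c u v (insert e S) / partNorm c u v (insert e S \ J) *
      (gaudinM c u v J fun k => I * Function.update z e 0 k).det * L (insert e S \ J) :=
    fun J hJ => by rw [det_gaudinM_congr (Z' := fun k => I * Function.update z e 0 k) fun k hk => by
        rw [Function.update_of_ne (ne_of_mem_of_not_mem (mem_powerset.1 hJ hk) he)]]
  rw [sum_congr rfl k1, add_left_comm, add_right_inj, ← sum_add_distrib]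
  refine sum_congr rfl fun J hJ => ?_
  have hJS := mem_powerset.1 hJ
  have heJ : e ∉ J := fun h => he (hJS h)
  have h1 : insert e S \ insert e J = S \ J := by
    rw [insert_sdiff_insert]; exact sdiff_insert_of_notMem he J
  have h2 : (gaudinM c u v J fun k => I * z k - gaudinW c u v k e / c).det =
      (gaudinM c u v J fun k => I *
        if k ∈ S then z k + modNu c e k (rap u v e) (rap u v k) 0 else 0).det :=
    det_gaudinM_congr fun k hk => by
      rw [if_pos (hJS hk), mul_add, I_mul_modNu hc hg (ne_of_mem_of_not_mem hk heJ).symm]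
      ring
  have h3 : (fun k => I * Function.update z e 0 k) = Function.update (fun k => I * z k) e 0 := by
    ext k
    rcases eq_or_ne k e with rfl | hk <;> simp [*]
  have h4 := partNorm_ne_zero hc hg S
  have h5 := partNorm_ne_zero hc hg (S \ J)
  rw [h1, det_gaudinM_insert hc heJ, h2, h3, recCoeff_zero hg he, partNorm_insert he]
  field_simp
  ring

end Expansion

/-! ### Decay of scalar products at infinity -/

section Decay

variable {Θ : Type} {l : Filter Θ}

/-- The functions that have a finite limit along `l`. -/
def limAlg (l : Filter Θ) : FunAlg Θ where
  carrier := {φ | ∃ z, Tendsto φ l (𝓝 z)}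
  mul_mem' := fun ⟨z, h⟩ ⟨z', h'⟩ => ⟨z * z', h.mul h'⟩
  add_mem' := fun ⟨z, h⟩ ⟨z', h'⟩ => ⟨z + z', h.add h'⟩
  algebraMap_mem' z := ⟨z, tendsto_const_nhds⟩

lemma tendsto_limAlg_mul_zero {φ χ : Θ → ℂ} (hφ : φ ∈ limAlg l) (hχ : Tendsto χ l (𝓝 0)) :
    Tendsto (fun θ => φ θ * χ θ) l (𝓝 0) := by
  obtain ⟨z, hz⟩ := hφ
  simpa using hz.mul hχ

variable {c : ℂ} {K : Type} {M : Θ → Model.{uM} c} {p : Θ → K → ℂ} {s sB : Set K}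

lemma tendsto_vevF_upper (hs : RegOn (limAlg l) M p s) {k : K}
    (hg : ∀ x ∈ sB, Tendsto (fun θ => g c (p θ x) (p θ k)) l (𝓝 0)) {i j : Fin 3} (hij : i < j)
    (V W : Word K) (hV : ∀ x ∈ V, x.2.2 ∈ sB) (hO : Over s (V ++ (i, j, k) :: W)) :
    Tendsto (vevF M p (V ++ (i, j, k) :: W)) l (𝓝 0) := by
  induction V using List.reverseRecOn generalizing W with
  | nil =>
    have : vevF M p ([] ++ (i, j, k) :: W) = fun _ => 0 := funext fun θ => vev_upper _ _ i j k W hij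
    rw [this]
    exact tendsto_const_nhds
  | append_singleton V x ih =>
    obtain ⟨i', j', x⟩ := x
    rw [List.append_assoc, List.singleton_append] at hO ⊢
    obtain ⟨hx, hk, hxk⟩ := over_pair_ne hO
    rw [vevF_rtt hs i' j' i j x k hx hk hxk V W]
    have h1 := ih ((i', j', x) :: W) (fun y hy => hV y (by simp [hy])) (hO.swap i' j' i j)
    obtain ⟨z₁, h2⟩ := vevF_mem hs (hO.swap i' j i j')
    obtain ⟨z₂, h3⟩ := vevF_mem hs (hO.congr_pair i j' i' j)
    have h4 := (hg x (hV (i', j', x) (by simp))).mul (h2.sub h3)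
    have h5 := (h1.const_smul (exSign i' j' i j)).add (h4.const_smul (rttSign i' i j))
    simp only [zero_mul, smul_zero, add_zero] at h5
    refine h5.congr fun θ => ?_
    simp only [sub_smul_def, gF, coe_toSub (hs.g_mem x hx k hk hxk), Pi.add_apply, Pi.smul_apply,
      Pi.mul_apply, Pi.sub_apply]

variable {a b : ℕ} {ku : Fin a → K} {kv : Fin b → K} {A : Finset (Fin a)} {B : Finset (Fin b)}

lemma over_sort_map {k : Fin a → K} (hk : Function.Injective k) (i j : Fin 3)
    (X : Finset (Fin a)) : Over (k '' X) (X.sort.map fun l => (i, j, k l)) :=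
  ⟨by simpa [Function.comp_def] using (sort_nodup X (· ≤ ·)).map hk, by simp [hk.eq_iff]⟩

lemma opProd_eq_word (M : Model.{uM} c) (q : K → ℂ) (k : Fin a → K) (i j : Fin 3)
    (X : Finset (Fin a)) :
    opProd M i j (fun l => q (k l)) X = word M q (X.sort.map fun l => (i, j, k l)) := by
  simp [word, opProd, Function.comp_def]

lemma tendsto_toDual_ket (hk : IsLabelling ku kv) (hp : PtReg c (limAlg l) p ku kv A B)
    (hl : LamReg (limAlg l) M M p (labs ku kv A B)) (hd : Disjoint sB (labs ku kv A B))
    (hs : RegOn (limAlg l) M p (sB ∪ labs ku kv A B))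
    (hg : ∀ x ∈ sB, ∀ k ∈ labs ku kv A B, Tendsto (fun θ => g c (p θ x) (p θ k)) l (𝓝 0))
    (hne : A.Nonempty ∨ B.Nonempty) {L L' : Ops M}
    (hL : PairOp (limAlg l) M M p sB L L') :
    Tendsto (fun θ => (M θ).covac (L θ (ket (M θ) (fun i => p θ (ku i)) (fun j => p θ (kv j)) A B)))
      l (𝓝 0) := by
  simp only [ket_eq_ketOp, ketOp, lsum_apply, lsmul_apply, map_sum, map_smul, smul_eq_mul]
  refine tendsto_limAlg_mul_zero (fun_prod_inv_mem _ fun i hi => hl.inv_mem _ (mem_labs_u hi)) ?_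
  have e0 : (0 : ℂ) = ∑ A₁ ∈ A.powerset, ∑ B₁ ∈ B.powerset with B₁.card = A₁.card, 0 := by simp
  rw [e0]
  refine tendsto_finsetSum _ fun A₁ hA₁ => tendsto_finsetSum _ fun B₁ hB₁ => ?_
  have hA := mem_powerset.1 hA₁
  obtain ⟨hB, hcard⟩ := mem_filter.1 hB₁
  rw [mem_powerset] at hB
  refine tendsto_limAlg_mul_zero (fun_mul_mem (hp.partCoeff_mem hk hA hB)
    (fun_prod_mem _ fun j hj => hl.inv_mem _ (mem_labs_v (sdiff_subset hj)))) ?_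
  simp only [symT3, opProd_eq_word, smul_mul_assoc, mul_smul_comm, lsmul_apply, map_smul,
    smul_eq_mul, ← word_append]
  refine tendsto_limAlg_mul_zero (fun_prod_inv_mem _ fun i hi => fun_prod_inv_mem _ fun m hm =>
    hp.hv_inv i (sdiff_subset hi) m (Finset.mem_sdiff.1 (mem_filter.1 hm).1).1) ?_
  refine tendsto_limAlg_mul_zero (fun_prod_inv_mem _ fun i hi => fun_prod_inv_mem _ fun m hm =>
    hp.hu_inv i (hA hi) m (hA (mem_filter.1 hm).1)) ?_
  set W := A₁.sort.map (fun m => ((0 : Fin 3), (2 : Fin 3), ku m)) ++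
    (A \ A₁).sort.map (fun m => ((0 : Fin 3), (1 : Fin 3), ku m)) ++
    (B \ B₁).sort.map (fun m => ((1 : Fin 3), (2 : Fin 3), kv m)) with hW
  have hO : Over (labs ku kv A B) W := by
    refine (((over_sort_map hk.u_inj 0 2 A₁).append (over_sort_map hk.u_inj 0 1 (A \ A₁)) ?_).append
      (over_sort_map hk.v_inj 1 2 (B \ B₁)) ?_).mono ?_
    · rw [Set.disjoint_image_iff hk.u_inj, disjoint_coe]
      exact disjoint_sdiff
    · rw [← Set.image_union, ← coe_union]
      exact labs_disjoint hk _ _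
    · rw [← Set.image_union, ← coe_union]
      exact labs_mono (union_subset hA sdiff_subset) sdiff_subset
  have hup : ∀ x ∈ W, x.1 < x.2.1 := by
    intro x hx
    simp only [hW, List.mem_append, List.mem_map] at hx
    rcases hx with (⟨m, _, rfl⟩ | ⟨m, _, rfl⟩) | ⟨m, _, rfl⟩ <;> simp
  have hlen : W.length ≠ 0 := by
    have h1 := card_sdiff_add_card_eq_card hA
    have h2 := card_sdiff_add_card_eq_card hB
    have h3 : 0 < A.card ∨ 0 < B.card := by simpa only [card_pos]
    simp only [hW, List.length_append, List.length_map, length_sort]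
    omega
  clear_value W
  obtain _ | ⟨⟨i, j, k⟩, W⟩ := W
  · exact absurd rfl hlen
  clear hlen
  have hkl := hO.2 _ List.mem_cons_self
  induction hL with
  | word V hV =>
    have h1 := tendsto_vevF_upper hs (fun x hx => hg x hx k hkl) (hup _ List.mem_cons_self) V W hV.2
      (hV.append hO hd)
    refine h1.congr fun θ => ?_
    rw [vevF, vev, word_append, mul_apply]
  | add _ _ ih1 ih2 => simpa only [ladd_apply, map_add, add_zero] using ih1.add ih2
  | smul φ hφ _ ih =>
    simp only [lsmul_apply, map_smul, smul_eq_mul]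
    exact tendsto_limAlg_mul_zero hφ ih

lemma tendsto_melem_zero {a b : ℕ} {p : Θ → Lbl a b 0 → ℂ} {A A' : Finset (Fin a)}
    {B B' : Finset (Fin b)} (hc : c ≠ 0) (κ : (Fin 0 → Fin 3 × Fin 3) → ℂ)
    (hK : PtReg c (limAlg l) p .u .v A B) (hB : PtReg c (limAlg l) p .uC .vC A' B')
    (hs : RegOn (limAlg l) M p (braLabs 0 A' B' ∪ ketLabs 0 A B))
    (h1 : ∀ θ, ∀ m ∈ braLabs 0 A' B' ∪ ketLabs 0 A B, (M θ).lam 1 (p θ m) = 1)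
    (hg : ∀ x ∈ braLabs 0 A' B', ∀ k ∈ ketLabs 0 A B,
      Tendsto (fun θ => g c (p θ x) (p θ k)) l (𝓝 0)) (hne : A.Nonempty ∨ B.Nonempty) :
    Tendsto (fun θ => melem (M θ) (p θ) κ A B A' B') l (𝓝 0) := by
  have hlB := lamReg_of_eq_one (Ω := limAlg l) fun θ m hm => h1 θ m (.inl hm)
  have hlK := lamReg_of_eq_one (Ω := limAlg l) fun θ m hm => h1 θ m (.inr hm)
  obtain ⟨L, L', h2, h3, -⟩ := (pair_ket isLabelling_bra hB hlB.dual).toDual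
  have h4 := tendsto_toDual_ket isLabelling_ket hK hlK (disjoint_bra_ket A A' B B') hs hg hne h2
  have h5 := h4.const_mul (((-1) ^ (B'.card * (B'.card - 1) / 2)) * κ Fin.elim0)
  rw [mul_zero] at h5
  refine h5.congr fun θ => ?_
  rw [melem_eq hc _ _ _ _ _ (hB.admissible_u isLabelling_bra θ) (hB.admissible_v isLabelling_bra θ),
    h3, mul_assoc]
  congr 1
  simp [operator, Subsingleton.elim _ Fin.elim0]

end Decay

/-! ### Orthogonality of on-shell Bethe vectors -/

section Orth

open Polynomial

variable {a b : ℕ}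

/-- The shifts `t` of the rapidities `ū'`, `v̄'` for which they are in general position with respect
to `ū`, `v̄`. -/
abbrev Shift (c : ℂ) (u : Pts a) (v : Pts b) (u' : Pts a) (v' : Pts b) : Type :=
  {t : ℂ // ∀ e' e : Part a b, rap u' v' e' + t - rap u v e ≠ 0 ∧
    rap u' v' e' + t - rap u v e + I * c ≠ 0 ∧ rap u v e - (rap u' v' e' + t) + I * c ≠ 0}

/-- The positions of the rapidities, those of the dual vector being shifted by `t`. -/
def pos2 (u : Pts a) (v : Pts b) (u' : Pts a) (v' : Pts b) (t : ℂ) : Lbl a b 0 → ℂ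
  | .u i => u i
  | .v j => v j
  | .uC i => u' i + t
  | .vC j => v' j + t
  | .w k => k.elim0

/-- Vacuum eigenvalues for which the Bethe vector of the particles `S` is on-shell, and those of
the dual vector of the particles `S'` differ from the on-shell values by factors `σ`. -/
def orthLam (c : ℂ) (u : Pts a) (v : Pts b) (u' : Pts a) (v' : Pts b)
    (S S' : Parts a b) (σ : Part a b → ℂ) : Lbl a b 0 → Pts 3
  | .u i => ![bethe c u v S (.inl i), 1, 0]
  | .v j => ![0, 1, bethe c u v S (.inr j)]
  | .uC i => ![bethe c u' v' S' (.inl i) * σ (.inl i), 1, 0]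
  | .vC j => ![0, 1, bethe c u' v' S' (.inr j) * σ (.inr j)]
  | .w _ => 0

variable {c : ℂ} (Γ : GeneralizedModel.{uG} c) (κ : (Fin 0 → Fin 3 × Fin 3) → ℂ)
  {u : Pts a} {v : Pts b} {u' : Pts a} {v' : Pts b}

variable (u v u' v') in
def orthModel (S S' : Parts a b) (t : ℂ) (σ : Part a b → ℂ) : Model.{uG} c :=
  Γ.ofLbl (pos2 u v u' v' t) (orthLam c u v u' v' S S' σ)

variable (u v u' v') in
def orthMelem (S S' : Parts a b) (t : ℂ) (σ : Part a b → ℂ) : ℂ :=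
  melem (orthModel Γ u v u' v' S S' t σ) (pos2 u v u' v' t) κ
    S.toLeft S.toRight S'.toLeft S'.toRight

lemma pos2_lblK (t : ℂ) (k : Part a b) : pos2 u v u' v' t (lblK 0 k) = rap u v k := by
  rcases k with k | k <;> rfl

lemma pos2_lblC (t : ℂ) (k : Part a b) : pos2 u v u' v' t (lblC 0 k) = rap u' v' k + t := by
  rcases k with k | k <;> rfl

lemma lbl_cases (m : Lbl a b 0) : (∃ k, m = lblK 0 k) ∨ ∃ k, m = lblC 0 k := by
  rcases m with m | m | m | m | m
  exacts [.inl ⟨.inl m, rfl⟩, .inl ⟨.inr m, rfl⟩, .inr ⟨.inl m, rfl⟩, .inr ⟨.inr m, rfl⟩,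
    m.elim0]

lemma pos2_injective (hg : Generic c u v Fin.elim0)
    (hg' : Generic c u' v' Fin.elim0) (t : Shift c u v u' v') :
    Function.Injective (pos2 u v u' v' t.1) := by
  intro m z h
  rcases lbl_cases m with ⟨k, rfl⟩ | ⟨k, rfl⟩ <;> rcases lbl_cases z with ⟨e, rfl⟩ | ⟨e, rfl⟩ <;>
    simp only [pos2_lblK, pos2_lblC] at h
  · rw [not_ne_iff.1 fun hke : k ≠ e => rap_ne hg hke h]
  · exact absurd (sub_eq_zero.2 h.symm) (t.2 e k).1
  · exact absurd (sub_eq_zero.2 h) (t.2 k e).1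
  · rw [not_ne_iff.1 fun hke : k ≠ e => rap_ne hg' hke (add_right_cancel h)]

def Shift.ev (t : Shift c u v u' v') : ℂ[X] →ₐ[ℂ] ℂ := aeval t.1

lemma eventually_shift : ∀ᶠ t in Bornology.cobounded ℂ, ∀ e' e : Part a b,
    rap u' v' e' + t - rap u v e ≠ 0 ∧ rap u' v' e' + t - rap u v e + I * c ≠ 0 ∧
    rap u v e - (rap u' v' e' + t) + I * c ≠ 0 := by
  have key : ∀ z : ℂ, ∀ᶠ t in Bornology.cobounded ℂ, t ≠ z := fun z =>
    Bornology.le_cofinite ℂ (Set.finite_singleton z).compl_mem_cofinite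
  refine eventually_all.2 fun e' => eventually_all.2 fun e => ?_
  filter_upwards [key (rap u v e - rap u' v' e'), key (rap u v e - rap u' v' e' - I * c),
    key (rap u v e - rap u' v' e' + I * c)] with t h1 h2 h3
  exact ⟨fun h => h1 (by linear_combination h), fun h => h2 (by linear_combination h),
    fun h => h3 (by linear_combination -h)⟩

variable (c u v u' v') in
def shiftLim : Filter (Shift c u v u' v') := comap Subtype.val (Bornology.cobounded ℂ)

instance : (shiftLim c u v u' v').NeBot :=
  comap_coe_neBot_of_le_principal (le_principal_iff.2 eventually_shift)

lemma Shift.ev_ext (P Q : ℂ[X]) (h : ∀ t : Shift c u v u' v', t.ev P = t.ev Q) : P = Q := by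
  refine eq_of_infinite_eval_eq P Q fun hfin => ?_
  have h1 := (eventually_shift (c := c) (u := u) (v := v) (u' := u') (v' := v')).and
    (Bornology.le_cofinite ℂ hfin.compl_mem_cofinite)
  obtain ⟨t, h2, h3⟩ := h1.exists
  exact h3 (by simpa [Shift.ev, coe_aeval_eq_eval] using h ⟨t, h2⟩)

section RegPos

variable {Ω : Subalgebra ℂ (Shift c u v u' v' → ℂ)}

lemma invIn_const {Θ : Type} {Ω : FunAlg Θ} {z : ℂ} (h : z ≠ 0) :
    InvIn Ω fun _ => z := ⟨fun _ => h, const_mem _⟩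

lemma mem_of_lblK {S S' : Parts a b} {k : Part a b}
    (h : lblK 0 k ∈ allLabs 0 S.toLeft S.toRight S'.toLeft S'.toRight) : k ∈ S := by
  rcases k with k | k <;> simpa [lblK] using h

lemma mem_of_lblC {S S' : Parts a b} {k : Part a b}
    (h : lblC 0 k ∈ allLabs 0 S.toLeft S.toRight S'.toLeft S'.toRight) : k ∈ S' := by
  rcases k with k | k <;> simpa [lblC] using h

lemma reg_pos2 (hg : Generic c u v Fin.elim0)
    (hg' : Generic c u' v' Fin.elim0) (hX : (fun t => t.1) ∈ Ω)
    {Q : Lbl a b 0 → Lbl a b 0 → Prop} (hQ : ∀ m z, Q m z → Q z m)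
    {S S' : Parts a b} (hcross : ∀ e' ∈ S', ∀ e ∈ S, ¬ Q (lblC 0 e') (lblK 0 e) →
      (fun t => (rap u' v' e' + t.1 - rap u v e)⁻¹) ∈ Ω) :
    Reg c Ω (fun t => pos2 u v u' v' t.1) S.toLeft S.toRight S'.toLeft S'.toRight Q where
  pos_mem m _ := by
    rcases lbl_cases m with ⟨k, rfl⟩ | ⟨k, rfl⟩ <;> simp only [pos2_lblK, pos2_lblC]
    exacts [const_mem _, fun_add_mem (const_mem _) hX]
  inj t := (pos2_injective hg hg' t).injOn
  sub m hm z hz _ hq := by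
    rcases lbl_cases m with ⟨k, rfl⟩ | ⟨k, rfl⟩ <;> rcases lbl_cases z with ⟨e, rfl⟩ | ⟨e, rfl⟩ <;>
      simp only [pos2_lblK, pos2_lblC, add_sub_add_right_eq_sub]
    · exact const_mem _
    · have := fun_mul_mem (const_mem (-1)) (hcross e (mem_of_lblC hz) k (mem_of_lblK hm) fun h => hq (hQ _ _ h))
      convert this using 2
      rw [← neg_sub, inv_neg, neg_one_mul]
    · exact hcross k (mem_of_lblC hm) e (mem_of_lblK hz) hq
    · exact const_mem _
  uu i _ l _ := invIn_const (hg.uu i l)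
  vv i _ l _ := invIn_const (hg.vv i l)
  vu i _ l _ := invIn_const (hg.vu i l)
  uuC i _ l _ := by simpa only [pos2, add_sub_add_right_eq_sub] using invIn_const (hg'.uu i l)
  vvC i _ l _ := by simpa only [pos2, add_sub_add_right_eq_sub] using invIn_const (hg'.vv i l)
  vuC i _ l _ := by simpa only [pos2, add_sub_add_right_eq_sub] using invIn_const (hg'.vu i l)

lemma orthLam_mem {Θ : Type} {Ω : FunAlg Θ} {S S' : Parts a b}
    {σ : Θ → Part a b → ℂ} (hσ : ∀ k ∈ S', (fun x => σ x k) ∈ Ω) (i : Fin 3) {m : Lbl a b 0}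
    (hm : m ∈ allLabs 0 S.toLeft S.toRight S'.toLeft S'.toRight) :
    (fun x => orthLam c u v u' v' S S' (σ x) m i) ∈ Ω := by
  rcases m with m | m | m | m | m
  · exact const_mem _
  · exact const_mem _
  · have := hσ (.inl m) (by simpa using hm)
    fin_cases i
    exacts [fun_mul_mem (const_mem _) this, const_mem _, const_mem _]
  · have := hσ (.inr m) (by simpa using hm)
    fin_cases i
    exacts [const_mem _, const_mem _, fun_mul_mem (const_mem _) this]
  · exact const_mem _

lemma orthLam_one {S S' : Parts a b} {σ : Part a b → ℂ} (m : Lbl a b 0) :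
    orthLam c u v u' v' S S' σ m 1 = 1 := by
  rcases m with m | m | m | m | m
  iterate 4 rfl
  exact m.elim0

end RegPos

def evalMonoid (z : ℂ) : Submonoid ℂ[X] where
  carrier := {T | T.eval z ≠ 0}
  one_mem' := by simp
  mul_mem' h h' := by simpa using ⟨h, h'⟩

variable (c u v u' v') in
/-- The rational functions of the shift that are regular at `z`. -/
def locAlg (z : ℂ) : Subalgebra ℂ (Shift c u v u' v' → ℂ) := ratAlg Shift.ev (evalMonoid z)

lemma val_mem_ratAlg {T : Submonoid ℂ[X]} :
    (fun t : Shift c u v u' v' => t.1) ∈ ratAlg Shift.ev T := by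
  simpa [Shift.ev] using ev_mem_ratAlg (ev := Shift.ev (c := c) (u := u) (v := v) (u' := u')
    (v' := v')) (S := T) X

lemma invIn_locAlg {z : ℂ} (φ : ℂ → ℂ) (α β : ℂ) (hφ : ∀ t, φ t = α + β * t) (h0 : φ z ≠ 0)
    (h : ∀ t : Shift c u v u' v', φ t.1 ≠ 0) : InvIn (locAlg c u v u' v' z) fun t => φ t.1 := by
  have e : ∀ t : Shift c u v u' v', φ t.1 = t.ev (C α + C β * X) := fun t => by simp [Shift.ev, hφ]
  refine ⟨h, ?_⟩
  simp only [e]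
  exact inv_mem_ratAlg (show eval z _ ≠ 0 by simpa [hφ] using h0) fun t => e t ▸ h t

section Loc

variable {e e' : Part a b}

lemma locAlg_sub (hd : ∀ e' e k' k : Part a b, rap u' v' e' - rap u v e =
      rap u' v' k' - rap u v k → e' = k' ∧ e = k) {k k' : Part a b} (h : ¬ (k' = e' ∧ k = e)) :
    InvIn (locAlg c u v u' v' (rap u v e - rap u' v' e')) fun t => rap u' v' k' + t.1 - rap u v k :=
  invIn_locAlg (fun t => rap u' v' k' + t - rap u v k) (rap u' v' k' - rap u v k) 1
    (fun t => by ring) (fun h0 => h (hd _ _ _ _ (by linear_combination h0))) fun t => (t.2 k' k).1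

lemma locAlg_add {k : Part a b} (h : rap u' v' k - rap u' v' e' + I * c ≠ 0) :
    InvIn (locAlg c u v u' v' (rap u v e - rap u' v' e')) fun t =>
      rap u' v' k + t.1 - rap u v e + I * c :=
  invIn_locAlg (fun t => rap u' v' k + t - rap u v e + I * c)
    (rap u' v' k - rap u v e + I * c) 1 (fun t => by ring)
    (fun h0 => h (by linear_combination h0)) fun t => (t.2 k e).2.1

lemma locAlg_sub_add {k : Part a b} (h : rap u' v' e' - rap u' v' k + I * c ≠ 0) :
    InvIn (locAlg c u v u' v' (rap u v e - rap u' v' e')) fun t =>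
      rap u v e - (rap u' v' k + t.1) + I * c :=
  invIn_locAlg (fun t => rap u v e - (rap u' v' k + t) + I * c)
    (rap u v e - rap u' v' k + I * c) (-1) (fun t => by ring)
    (fun h0 => h (by linear_combination h0)) fun t => (t.2 k e).2.2

variable (u v u' v' c e e') in
/-- The relative variation of the Bethe equations when the particle `e'` of the dual vector is
replaced by the particle `e` of the vector. -/
def orthNu (k : Part a b) (t : ℂ) : ℂ :=
  modNu c e' k (rap u' v' e' + t) (rap u' v' k + t) (rap u' v' e' + t - rap u v e)

lemma orthNu_mem (hg' : Generic c u' v' Fin.elim0) (k : Part a b) :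
    (fun t => orthNu c u v u' v' e e' k t.1) ∈ locAlg c u v u' v' (rap u v e - rap u' v' e') := by
  have h1 : ∀ t, rap u' v' k + t + (rap u' v' e' + t - rap u v e) - (rap u' v' e' + t) =
      rap u' v' k + t - rap u v e := fun t => by ring
  have h2 : ∀ t, rap u' v' e' + t - (rap u' v' k + t + (rap u' v' e' + t - rap u v e)) =
      rap u v e - (rap u' v' k + t) := fun t => by ring
  rcases e' with e' | e' <;> rcases k with k | k <;>
    simp only [orthNu, modNu, h1, h2, add_sub_add_right_eq_sub]
  · exact fun_mul_mem (fun_mul_mem (const_mem _) (locAlg_add (rap_add_inl hg' e' _)).2)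
      (const_mem _)
  · exact fun_mul_mem (fun_mul_mem (const_mem _) (locAlg_add (rap_add_inl hg' e' _)).2)
      (const_mem _)
  · exact fun_mul_mem (fun_mul_mem (const_mem _) (locAlg_sub_add (rap_add_inr hg' e' _)).2)
      (const_mem _)
  · exact const_mem _

variable {S S' : Parts a b}

lemma modF_translate (k : Part a b) (y z s : ℂ) : modF c e k (y + s) (z + s) = modF c e k y z := by
  rcases e with e | e <;> rcases k with k | k <;>
    simp only [modF, f, add_sub_add_right_eq_sub]

lemma modF_orth (hg' : Generic c u' v' Fin.elim0) (h : ptype e = ptype e')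
    {k : Part a b} (hk : e' ≠ k) (t : Shift c u v u' v') :
    modF c e k (rap u v e) (rap u' v' k + t.1) = modF c e' k (rap u' v' e') (rap u' v' k) *
      (1 + (rap u' v' e' + t.1 - rap u v e) * orthNu c u v u' v' e e' k t.1) := by
  have h0 : modF c e k (rap u v e) (rap u' v' k + t.1) =
      modF c e' k (rap u v e) (rap u' v' k + t.1) := by
    rcases e with e | e <;> rcases e' with e' | e' <;>
      rcases k with k | k <;> first | rfl | simp [ptype] at h
  have h1 : rap u' v' k + t.1 + (rap u' v' e' + t.1 - rap u v e) - (rap u' v' e' + t.1) =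
      rap u' v' k + t.1 - rap u v e := by ring
  have h2 : rap u' v' e' + t.1 - (rap u' v' k + t.1 + (rap u' v' e' + t.1 - rap u v e)) =
      rap u v e - (rap u' v' k + t.1) := by ring
  rw [h0, ← modF_translate k (rap u v e) _ (rap u' v' e' + t.1 - rap u v e), add_sub_cancel,
    modF_shift, modF_translate]
  · rfl
  · simpa using rap_ne hg' hk.symm
  · rw [← sub_ne_zero, h1]
    exact (t.2 k e).1
  · rintro i rfl
    rw [h1, add_sub_add_right_eq_sub]
    exact ⟨rap_add_inl hg' i k, (t.2 k e).2.1⟩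
  · rintro i j rfl rfl
    rw [add_sub_add_right_eq_sub]
    exact hg'.uu i j
  · rintro i j rfl rfl
    rw [h2, add_sub_add_right_eq_sub]
    exact ⟨rap_add_inr hg' i _, (t.2 _ e).2.2⟩

end Loc

end Orth

section OrthRes

open Polynomial

variable {a b : ℕ} {c : ℂ} (Γ : GeneralizedModel.{uG} c) (κ : (Fin 0 → Fin 3 × Fin 3) → ℂ)
  {u : Pts a} {v : Pts b} {u' : Pts a} {v' : Pts b} {S S' : Parts a b}
  {e e' : Part a b}

lemma lam_orthModel (hg : Generic c u v Fin.elim0)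
    (hg' : Generic c u' v' Fin.elim0) (t : Shift c u v u' v') (σ : Part a b → ℂ)
    (i : Fin 3) (m : Lbl a b 0) : (orthModel Γ u v u' v' S S' t.1 σ).lam i (pos2 u v u' v' t.1 m) =
      orthLam c u v u' v' S S' σ m i := Γ.lam_ofLbl (pos2_injective hg hg' t) _ _ _

variable (u v u' v' S S' e e') in
/-- The model in which the particles `e` and `e'` are replaced by their effect on the vacuum
eigenvalues. -/
def orthRemoved (t : ℂ) : Model.{uG} c :=
  Γ.ofLbl (pos2 u v u' v' t) fun m i => modG (ptype e) (g c (rap u v e) (pos2 u v u' v' t m)) i *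
    orthLam c u v u' v' (insert e S) (insert e' S') 1 m i

lemma orthMelem_removed (hc : c ≠ 0) (hg : Generic c u v Fin.elim0)
    (hg' : Generic c u' v' Fin.elim0) (t : Shift c u v u' v') (he : e ∉ S)
    (he' : e' ∉ S') (h : ptype e = ptype e') :
    melem (orthRemoved Γ u v u' v' S S' e e' t.1) (pos2 u v u' v' t.1) κ S.toLeft S.toRight S'.toLeft S'.toRight =
      orthMelem Γ κ u v u' v' S S' t.1 fun k =>
        1 + (rap u' v' e' + t.1 - rap u v e) * orthNu c u v u' v' e e' k t.1 := by
  have hR := reg_pos2 (Ω := ⊤) hg hg' Algebra.mem_top (Q := fun _ _ => False) (fun _ _ h => h)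
    (S := S) (S' := S') fun _ _ _ _ _ => Algebra.mem_top
  rw [orthRemoved, melem_ofLbl_modG Γ κ hc (pos2_injective hg hg' t)
    ((hR.ptReg_ket hc fun _ _ _ _ h => h).ketRegular t)
    ((hR.ptReg_bra hc fun _ _ _ _ h => h).ketRegular t) e (rap u v e) 1
    (L' := orthLam c u v u' v' S S' fun k =>
      1 + (rap u' v' e' + t.1 - rap u v e) * orthNu c u v u' v' e e' k t.1) ?_ fun i k => k.elim0]
  · simp [orthMelem, orthModel]
  rintro k m (⟨hk, rfl⟩ | ⟨hk, rfl⟩)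
  · have hne : e ≠ k := fun h => he (h ▸ hk)
    have h1 : ∀ T T' σ, orthLam c u v u' v' T T' σ (lblK 0 k) (pIdx k) = bethe c u v T k := by
      rcases k with k | k <;> exact fun _ _ _ => rfl
    rw [h1, h1, pos2_lblK, bethe_insert hg he hk]
    exact ⟨rap_ne hg hne, modW_rap_ne hg hne, orthLam_one _, orthLam_one _, rfl⟩
  · have hne : e' ≠ k := fun h => he' (h ▸ hk)
    have h1 : ∀ T T' σ, orthLam c u v u' v' T T' σ (lblC 0 k) (pIdx k) =
        bethe c u' v' T' k * σ k := by
      rcases k with k | k <;> exact fun _ _ _ => rfl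
    obtain ⟨t1, t2, t3⟩ := t.2 k e
    rw [h1, h1, pos2_lblC, modF_orth hg' h hne, ← bethe_insert hg' he' hk, Pi.one_apply, mul_one,
      mul_assoc]
    refine ⟨(sub_ne_zero.1 t1).symm, ?_, orthLam_one _, orthLam_one _, rfl⟩
    rcases e with e | e
    exacts [f_ne_zero t2 (sub_ne_zero.1 t1), f_ne_zero t3 (sub_ne_zero.1 t1).symm]

lemma orthMelem_mem (hc : c ≠ 0) (hg : Generic c u v Fin.elim0)
    (hg' : Generic c u' v' Fin.elim0) {Ω : Subalgebra ℂ (Shift c u v u' v' → ℂ)}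
    (hR : Reg c Ω (fun t => pos2 u v u' v' t.1) S.toLeft S.toRight S'.toLeft S'.toRight
      fun _ _ => False) (σ : Shift c u v u' v' → Part a b → ℂ)
    (hσ : ∀ k ∈ S', (fun t => σ t k) ∈ Ω) :
    (fun t => orthMelem Γ κ u v u' v' S S' t.1 (σ t)) ∈ Ω := by
  refine hR.melem_mem hc κ (fun _ _ h => h) (fun t m _ => ?_) fun i m hm => ?_
  · rw [lam_orthModel Γ hg hg', orthLam_one]
  · simp only [lam_orthModel Γ hg hg']
    exact orthLam_mem hσ i hm

/-- Near the coincidence of two particles of the same type, the matrix element without these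
particles vanishes. -/
lemma orthMelem_div_mem (hc : c ≠ 0) (hg : Generic c u v Fin.elim0)
    (hg' : Generic c u' v' Fin.elim0) (hR : Reg c (locAlg c u v u' v' (rap u v e - rap u' v' e'))
      (fun t => pos2 u v u' v' t.1) S.toLeft S.toRight S'.toLeft S'.toRight fun _ _ => False)
    (h0 : ∀ t : Shift c u v u' v', orthMelem Γ κ u v u' v' S S' t.1 1 = 0) :
    (fun t => g c (rap u' v' e' + t.1) (rap u v e) * orthMelem Γ κ u v u' v' S S' t.1 fun k =>
        1 + (rap u' v' e' + t.1 - rap u v e) * orthNu c u v u' v' e e' k t.1) ∈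
      locAlg c u v u' v' (rap u v e - rap u' v' e') := by
  set Ω := locAlg c u v u' v' (rap u v e - rap u' v' e')
  set d : Shift c u v u' v' → ℂ := fun t => rap u' v' e' + t.1 - rap u v e
  set σ : Shift c u v u' v' × Bool → Part a b → ℂ :=
    fun x k => 1 + d x.1 * (if x.2 then orthNu c u v u' v' e e' k x.1.1 else 0) with hσ
  have hd : d ∈ Ω := fun_sub_mem (fun_add_mem (const_mem _) val_mem_ratAlg) (const_mem _)
  have hσm : ∀ k, (fun x => σ x k) ∈ pairAlg Ω d := fun k => by
    have hν := orthNu_mem (e := e) (e' := e') (u := u) (v := v) hg' k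
    refine ⟨fun_add_mem (const_mem 1) (fun_mul_mem hd ?_), fun_add_mem (const_mem 1)
      (fun_mul_mem hd ?_), _, hν, fun t => ?_⟩
    · simpa using hν
    · simpa using const_mem 0
    · simp [hσ]
  have key : (fun x : Shift c u v u' v' × Bool => orthMelem Γ κ u v u' v' S S' x.1.1 (σ x)) ∈
      pairAlg Ω d := by
    refine (hR.prod_bool d).melem_mem hc κ (fun _ _ h => h) (fun t m _ => ?_) fun i m hm => ?_
    · rw [lam_orthModel Γ hg hg', orthLam_one]
    · simp only [lam_orthModel Γ hg hg']
      exact orthLam_mem (fun k _ => hσm k) i hm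
  obtain ⟨-, -, ψ, hψ, h⟩ := key
  convert fun_mul_mem (const_mem (I * c)) hψ using 2 with t
  have h1 := h t
  have h2 : σ (t, false) = 1 := by
    funext k
    simp [hσ]
  simp only [h2, h0, sub_zero] at h1
  simp only [hσ, if_true] at h1
  rw [h1, g, ← mul_assoc, div_mul_cancel₀ _ (t.2 e' e).1]

lemma bethe_singleton (u : Pts a) (v : Pts b) (e : Part a b) : bethe c u v {e} e = 1 := by
  have h1 : ∀ i, ({Sum.inl i} : Parts a b).toLeft = {i} := fun i => by ext; simp
  have h2 : ∀ i, ({Sum.inl i} : Parts a b).toRight = ∅ := fun i => by ext; simp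
  have h3 : ∀ i, ({Sum.inr i} : Parts a b).toLeft = ∅ := fun i => by ext; simp
  rcases e with e | e <;> simp [bethe, betheRhs1, betheRhs3, h1, h2, h3]

lemma OnlyPair.symm {N : ℕ} {x y m z : Lbl a b N} (h : OnlyPair x y m z) : OnlyPair x y z m :=
  h.elim (fun h => .inr ⟨h.2, h.1⟩) fun h => .inl ⟨h.2, h.1⟩

lemma onlyPair_self {N : ℕ} (x y : Lbl a b N) : OnlyPair x y x y := .inl ⟨rfl, rfl⟩

lemma mem_of_sub_mem {Θ : Type} {Ω : FunAlg Θ} {F G : Θ → ℂ}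
    (h : (fun t => F t - G t) ∈ Ω) (hG : G ∈ Ω) : F ∈ Ω := by
  simpa using fun_add_mem h hG

lemma InvIn.f_mem {Θ : Type} {Ω : FunAlg Θ} {x y : Θ → ℂ}
    (h : InvIn Ω fun t => x t - y t) : (fun t => f c (x t) (y t)) ∈ Ω := by
  simp only [f_eq (sub_ne_zero.1 (h.1 _))]
  exact fun_add_mem (const_mem _) h.g_mem

lemma InvIn.sub_symm {Θ : Type} {Ω : FunAlg Θ} {x y : Θ → ℂ}
    (h : InvIn Ω fun t => x t - y t) : InvIn Ω fun t => y t - x t := by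
  refine ⟨fun t => sub_ne_zero.2 (sub_ne_zero.1 (h.1 t)).symm, ?_⟩
  convert fun_mul_mem (const_mem (-1)) h.2 using 2
  beta_reduce
  rw [← neg_sub, inv_neg, neg_one_mul]

lemma orthMelem_mem_locAlg (hc : c ≠ 0) (hg : Generic c u v Fin.elim0)
    (hg' : Generic c u' v' Fin.elim0) (hd : ∀ e' e k' k : Part a b, rap u' v' e' - rap u v e =
      rap u' v' k' - rap u v k → e' = k' ∧ e = k) (he : e ∉ S) (he' : e' ∉ S')
    (hcard : S.card = S'.card) (ih : S.Nonempty → ∀ t : Shift c u v u' v',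
      orthMelem Γ κ u v u' v' S S' t.1 1 = 0) :
    (fun t => orthMelem Γ κ u v u' v' (insert e S) (insert e' S') t.1 1) ∈
      locAlg c u v u' v' (rap u v e - rap u' v' e') := by
  set Ω := locAlg c u v u' v' (rap u v e - rap u' v' e') with hΩ
  have hR := reg_pos2 (Ω := Ω) hg hg' val_mem_ratAlg (Q := OnlyPair (lblC 0 e') (lblK 0 e))
    (fun _ _ => OnlyPair.symm) (S := insert e S) (S' := insert e' S') (fun k' _ k _ h => (locAlg_sub hd fun h1 => h (by
      rw [h1.1, h1.2]
      exact onlyPair_self _ _)).2)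
  have hR0 : Reg c Ω (fun t => pos2 u v u' v' t.1) S.toLeft S.toRight S'.toLeft S'.toRight
      fun _ _ => False := reg_pos2 hg hg' val_mem_ratAlg (fun _ _ h => h) fun k' hk' k _ _ =>
    (locAlg_sub hd (k := k) (k' := k') fun h => by
      rw [h.1] at hk'
      exact he' hk').2
  have hl : Normalized Ω (fun t : Shift c u v u' v' =>
      orthModel Γ u v u' v' (insert e S) (insert e' S') t.1 1) (fun t => pos2 u v u' v' t.1)
      (insert e S).toLeft (insert e S).toRight (insert e' S').toLeft (insert e' S').toRight := by
    refine ⟨fun t m _ => by rw [lam_orthModel Γ hg hg', orthLam_one], fun i m hm => ?_⟩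
    simp only [lam_orthModel Γ hg hg']
    exact orthLam_mem (σ := fun _ => 1) (fun _ _ => const_mem 1) i hm
  have hmod : IsModified (fun t : Shift c u v u' v' =>
      orthModel Γ u v u' v' (insert e S) (insert e' S') t.1 1)
      (fun t : Shift c u v u' v' => orthRemoved Γ u v u' v' S S' e e' t.1)
      (fun t : Shift c u v u' v' => pos2 u v u' v' t.1)
      (allLabs 0 S.toLeft S.toRight S'.toLeft S'.toRight) (ptype e) (lblK 0 e) :=
    fun t i m _ => by
      beta_reduce
      rw [orthRemoved, Γ.lam_ofLbl (pos2_injective hg hg' t), lam_orthModel Γ hg hg', pos2_lblK]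
  have hrem := fun (h : ptype e = ptype e') (t : Shift c u v u' v') =>
    orthMelem_removed Γ κ hc hg hg' t he he' h
  have hsub : ∀ k, k ≠ e' → InvIn Ω fun t => rap u' v' k + t.1 - rap u v e :=
    fun k hk => locAlg_sub hd fun h => hk h.1
  have hS : S.Nonempty ∨ S = ∅ ∧ S' = ∅ := by
    rcases S.eq_empty_or_nonempty with h | h
    · refine .inr ⟨h, card_eq_zero.1 ?_⟩
      rw [← hcard, h, card_empty]
    · exact .inl h
  simp only [orthMelem] at hrem ⊢
  rcases e with e | e <;> rcases e' with e' | e' <;>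
    simp only [toLeft_insert_inl, toRight_insert_inl, toLeft_insert_inr,
      toRight_insert_inr] at hR hl ⊢
  · have h2 : e ∉ S.toLeft := by simpa using he
    have h3 : e' ∉ S'.toLeft := by simpa using he'
    have key := hR.residue_u hc κ h2 h3 hl hmod
      (fun t k _ => (t.2 (.inl k) (.inl e)).2.1)
      (fun j _ => locAlg_add (k := .inr j) (hg'.vu j e'))
    refine mem_of_sub_mem key ?_
    rcases hS with hS | ⟨rfl, rfl⟩
    · have h4 := orthMelem_div_mem Γ κ hc hg hg' hR0 (ih hS)
      simp only [orthMelem, ← hrem rfl] at h4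
      have h5 : ∀ i ∈ S'.toLeft, (fun t : Shift c u v u' v' =>
          f c (pos2 u v u' v' t.1 (.uC i)) (pos2 u v u' v' t.1 (.u e))) ∈ Ω := fun i hi =>
        (hsub (.inl i) (by rintro ⟨⟩; exact h3 hi)).f_mem
      have := fun_mul_mem (fun_mul_mem (fun_mul_mem h4 (fun_sub_mem
        (hl.mem 0 (.u e) (by simp)) (hl.mem 0 (.uC e') (by simp))))
        (const_mem (∏ i ∈ S.toLeft, f c (u i) (u e)))) (fun_prod_mem _ h5)
      convert this using 2 with t
      simp only [pos2, rap, Sum.elim_inl]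
      ring
    · convert const_mem (0 : ℂ) using 2 with t
      simp [lam_orthModel Γ hg hg', orthLam, bethe_singleton]
  · have h2 : e ∉ S.toLeft := by simpa using he
    have h3 : e' ∉ S'.toRight := by simpa using he'
    exact hR.regular_u_v hc κ h2 h3 hl hmod
  · have h2 : e ∉ S.toRight := by simpa using he
    have h3 : e' ∉ S'.toLeft := by simpa using he'
    exact hR.regular_v_u hc κ h2 h3 hl hmod
  · have h2 : e ∉ S.toRight := by simpa using he
    have h3 : e' ∉ S'.toRight := by simpa using he'
    have key := hR.residue_v hc κ h2 h3 hl hmod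
      (fun t k _ => (t.2 (.inl k) (.inr e)).2.2)
      (fun j _ => locAlg_sub_add (k := .inr j) (hg'.vv e' j))
    refine mem_of_sub_mem key ?_
    rcases hS with hS | ⟨rfl, rfl⟩
    · have h4 := orthMelem_div_mem Γ κ hc hg hg' hR0 (ih hS)
      simp only [orthMelem, ← hrem rfl] at h4
      have h5 : ∀ i ∈ S'.toLeft, (fun t : Shift c u v u' v' =>
          f c (pos2 u v u' v' t.1 (.v e)) (pos2 u v u' v' t.1 (.uC i))) ∈ Ω := fun i hi =>
        (hsub (.inl i) (by simp)).sub_symm.f_mem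
      have := fun_mul_mem (fun_mul_mem (fun_mul_mem h4 (fun_sub_mem
        (hl.mem 2 (.v e) (by simp)) (hl.mem 2 (.vC e') (by simp))))
        (const_mem ((-1) ^ S'.toRight.card * (∏ j ∈ S.toRight, g c (v e) (v j)) *
          (∏ j ∈ S'.toRight, g c (v' e') (v' j)) * (∏ i ∈ S'.toLeft, f c (v' e') (u' i))⁻¹)))
        (fun_prod_mem _ h5)
      convert this using 2 with t
      simp only [pos2, rap, Sum.elim_inr, g, f, add_sub_add_right_eq_sub]
      ring
    · convert const_mem (0 : ℂ) using 2 with t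
      simp [lam_orthModel Γ hg hg', orthLam, bethe_singleton]

end OrthRes

section OrthZero

open Polynomial

variable {a b : ℕ} {c : ℂ} (Γ : GeneralizedModel.{uG} c) (κ : (Fin 0 → Fin 3 × Fin 3) → ℂ)
  {u : Pts a} {v : Pts b} {u' : Pts a} {v' : Pts b} {S S' : Parts a b}

/-- A rational function without poles is a polynomial. -/
lemma exists_eq_of_forall_mem_locAlg {φ : Shift c u v u' v' → ℂ}
    (h : ∀ z, φ ∈ locAlg c u v u' v' z) : ∃ P : ℂ[X], ∀ t, φ t = t.ev P := by
  let I : Ideal ℂ[X] :=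
    { carrier := {T | ∃ P, ∀ t, φ t * t.ev T = t.ev P}
      zero_mem' := ⟨0, by simp⟩
      add_mem' := fun ⟨P, hP⟩ ⟨Q, hQ⟩ => ⟨P + Q, fun t => by rw [map_add, map_add, mul_add, hP, hQ]⟩
      smul_mem' := fun R _ ⟨P, hP⟩ => ⟨R * P, fun t => by
        rw [smul_eq_mul, map_mul, map_mul, ← hP]
        ring⟩ }
  suffices hI : I = ⊤ by
    obtain ⟨P, hP⟩ := (I.eq_top_iff_one.1 hI)
    exact ⟨P, fun t => by simpa using hP t⟩
  obtain ⟨T, hT⟩ := IsPrincipalIdealRing.principal I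
  have hz : ∀ z, T.eval z ≠ 0 := fun z h0 => by
    obtain ⟨P, T', hT', h'⟩ := h z
    have h1 : T' ∈ I := ⟨P, fun t => (h' t).2⟩
    rw [hT, Ideal.submodule_span_eq, Ideal.mem_span_singleton] at h1
    exact hT' (eval_eq_zero_of_dvd_of_eval_eq_zero h1 h0)
  have h2 : IsUnit T := isUnit_iff_degree_eq_zero.2 (by
    by_contra h3
    obtain ⟨z, h4⟩ := IsAlgClosed.exists_root T h3
    exact hz z h4)
  rw [hT, Ideal.submodule_span_eq, Ideal.span_singleton_eq_top]
  exact h2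

lemma orthMelem_forall_mem (hc : c ≠ 0) (hg : Generic c u v Fin.elim0)
    (hg' : Generic c u' v' Fin.elim0) (hd : ∀ e' e k' k : Part a b, rap u' v' e' - rap u v e =
      rap u' v' k' - rap u v k → e' = k' ∧ e = k) (hcard : S.card = S'.card)
    (ih : ∀ e ∈ S, ∀ e' ∈ S', (S.erase e).Nonempty → ∀ t : Shift c u v u' v',
      orthMelem Γ κ u v u' v' (S.erase e) (S'.erase e') t.1 1 = 0) (z : ℂ) :
    (fun t => orthMelem Γ κ u v u' v' S S' t.1 1) ∈ locAlg c u v u' v' z := by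
  by_cases h : ∃ e ∈ S, ∃ e' ∈ S', z = rap u v e - rap u' v' e'
  · obtain ⟨e, he, e', he', rfl⟩ := h
    have := orthMelem_mem_locAlg Γ κ hc hg hg' hd (notMem_erase e S)
      (notMem_erase e' S') (by
        rw [card_erase_of_mem he, card_erase_of_mem he', hcard]) (ih e he e' he')
    rwa [insert_erase he, insert_erase he'] at this
  · push Not at h
    exact orthMelem_mem Γ κ hc hg hg' (reg_pos2 hg hg' val_mem_ratAlg (fun _ _ h => h)
      fun e' he' e he _ => (invIn_locAlg (fun t => rap u' v' e' + t - rap u v e)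
        (rap u' v' e' - rap u v e) 1 (fun t => by ring)
        (fun h0 => h e he e' he' (by linear_combination h0)) fun t => (t.2 e' e).1).2)
      _ fun _ _ => const_mem 1

lemma PtReg.of_shift {Θ K : Type} {Ω : FunAlg Θ} {p : Θ → K → ℂ} {q : K → ℂ}
    {ku : Fin a → K} {kv : Fin b → K} {A : Finset (Fin a)} {B : Finset (Fin b)}
    (hp : PtReg c ⊤ p ku kv A B)
    (hs : ∀ θ k l, k ∈ labs ku kv A B → l ∈ labs ku kv A B → p θ k - p θ l = q k - q l) :
    PtReg c Ω p ku kv A B where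
  inj := hp.inj
  sub_mem k hk l hl := by
    simp only [hs _ k l hk hl]
    exact const_mem _
  g_mem k hk l hl _ := by
    simp only [g, hs _ k l hk hl]
    exact const_mem _
  hu_ne := hp.hu_ne
  hu_inv i hi l hl := by
    simp only [h, hs _ _ _ (mem_labs_u hi) (mem_labs_u hl)]
    exact const_mem _
  hv_ne := hp.hv_ne
  hv_inv i hi l hl := by
    simp only [h, hs _ _ _ (mem_labs_v hi) (mem_labs_v hl)]
    exact const_mem _
  f_ne := hp.f_ne
  f_inv j hj i hi := by
    simp only [f, hs _ _ _ (mem_labs_v hj) (mem_labs_u hi)]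
    exact const_mem _

lemma ketLabs_cases {A : Finset (Fin a)} {B : Finset (Fin b)} {m : Lbl a b 0}
    (hm : m ∈ ketLabs 0 A B) : ∃ k, m = lblK 0 k := by
  rcases lbl_cases m with h | ⟨k | k, rfl⟩
  exacts [h, by simp [lblC] at hm, by simp [lblC] at hm]

lemma braLabs_cases {A : Finset (Fin a)} {B : Finset (Fin b)} {m : Lbl a b 0}
    (hm : m ∈ braLabs 0 A B) : ∃ k, m = lblC 0 k := by
  rcases lbl_cases m with ⟨k | k, rfl⟩ | h
  exacts [by simp [lblK] at hm, by simp [lblK] at hm, h]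

lemma tendsto_g_shiftLim (e e' : Part a b) : Tendsto (fun t : Shift c u v u' v' =>
    g c (rap u' v' e' + t.1) (rap u v e)) (shiftLim c u v u' v') (𝓝 0) := by
  have h1 : Tendsto (fun t : Shift c u v u' v' => t.1) (shiftLim c u v u' v')
    (Bornology.cobounded ℂ) := tendsto_comap
  have h2 : Tendsto (fun t : ℂ => rap u' v' e' + t - rap u v e) (Bornology.cobounded ℂ)
      (Bornology.cobounded ℂ) :=
    (tendsto_sub_const_cobounded _).comp (tendsto_const_add_cobounded _)
  simpa [g, div_eq_mul_inv] using
    ((tendsto_inv₀_cobounded.comp (h2.comp h1)).const_mul (I * c))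

/-- Off-shell coefficients at infinity: the scalar product of two Bethe vectors decays when the
rapidities of one of them tend to infinity. -/
lemma tendsto_orthMelem (hc : c ≠ 0) (hg : Generic c u v Fin.elim0)
    (hg' : Generic c u' v' Fin.elim0) (hS : S.Nonempty) :
    Tendsto (fun t => orthMelem Γ κ u v u' v' S S' t.1 1) (shiftLim c u v u' v') (𝓝 0) := by
  have hR := reg_pos2 (Ω := ⊤) hg hg' Algebra.mem_top (Q := fun _ _ => False) (fun _ _ h => h)
    (S := S) (S' := S') fun _ _ _ _ _ => Algebra.mem_top
  have hg0 : ∀ e e' : Part a b, Tendsto (fun t : Shift c u v u' v' =>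
    g c (rap u v e) (rap u' v' e' + t.1)) (shiftLim c u v u' v') (𝓝 0) := fun e e' => by
    simp only [g_swap c (rap u' v' e' + _) (rap u v e)]
    simpa using (tendsto_g_shiftLim e e').neg
  refine tendsto_melem_zero hc κ
    (PtReg.of_shift (q := pos2 u v u' v' 0)
      (hR.ptReg_ket hc fun _ _ _ _ h => h) ?_)
    (PtReg.of_shift (q := pos2 u v u' v' 0)
      (hR.ptReg_bra hc fun _ _ _ _ h => h) ?_) ⟨fun t =>
      (pos2_injective hg hg' t).injOn, ?_, ?_⟩ (fun t m _ => ?_) ?_ ?_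
  · intro t m z hm hz
    obtain ⟨k, rfl⟩ := ketLabs_cases hm
    obtain ⟨e, rfl⟩ := ketLabs_cases hz
    simp only [pos2_lblK]
  · intro t m z hm hz
    obtain ⟨k, rfl⟩ := braLabs_cases hm
    obtain ⟨e, rfl⟩ := braLabs_cases hz
    simp only [pos2_lblC]
    ring
  · intro m hm z hz hne
    rcases lbl_cases m with ⟨k, rfl⟩ | ⟨k, rfl⟩ <;> rcases lbl_cases z with ⟨e, rfl⟩ | ⟨e, rfl⟩ <;>
      simp only [pos2_lblK, pos2_lblC]
    · exact const_mem _
    · exact ⟨0, hg0 k e⟩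
    · exact ⟨0, tendsto_g_shiftLim e k⟩
    · simp only [g, add_sub_add_right_eq_sub]
      exact const_mem _
  · intro i m hm
    simp only [lam_orthModel Γ hg hg']
    exact orthLam_mem (σ := fun _ => 1) (fun _ _ => const_mem 1) i (hm.imp id .inr)
  · rw [lam_orthModel Γ hg hg', orthLam_one]
  · intro m hm z hz
    obtain ⟨k, rfl⟩ := braLabs_cases hm
    obtain ⟨e, rfl⟩ := ketLabs_cases hz
    simp only [pos2_lblK, pos2_lblC]
    exact tendsto_g_shiftLim e k
  · obtain ⟨e | e, he⟩ := hS
    exacts [.inl ⟨e, by simpa using he⟩, .inr ⟨e, by simpa using he⟩]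

lemma orthMelem_eq_zero (hc : c ≠ 0) (hg : Generic c u v Fin.elim0)
    (hg' : Generic c u' v' Fin.elim0) (hd : ∀ e' e k' k : Part a b, rap u' v' e' - rap u v e =
      rap u' v' k' - rap u v k → e' = k' ∧ e = k) (hS : S.Nonempty) (hcard : S.card = S'.card)
    (t : Shift c u v u' v') : orthMelem Γ κ u v u' v' S S' t.1 1 = 0 := by
  induction hn : S.card using Nat.strong_induction_on generalizing S S' t with
  | _ n ih =>
  obtain ⟨P, hP⟩ := exists_eq_of_forall_mem_locAlg
    (orthMelem_forall_mem Γ κ hc hg hg' hd hcard fun e he e' he' hne t =>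
      ih _ (hn ▸ card_erase_lt_of_mem he) hne (by
        rw [card_erase_of_mem he, card_erase_of_mem he', hcard]) t rfl)
  have h1 := tendsto_orthMelem (S' := S') Γ κ hc hg hg' hS
  simp only [hP] at h1
  rw [hP]
  have h2 : Tendsto (fun t : Shift c u v u' v' => ‖t.1‖) (shiftLim c u v u' v') atTop :=
    tendsto_norm_cobounded_atTop.comp tendsto_comap
  by_cases hdeg : 0 < P.degree
  · have h3 := tendsto_norm_atTop P hdeg h2
    refine absurd h1.norm (not_tendsto_nhds_of_tendsto_atTop ?_ _)
    simpa [Shift.ev, coe_aeval_eq_eval] using h3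
  · obtain ⟨z, rfl⟩ : ∃ z, P = C z := ⟨_, eq_C_of_degree_le_zero (not_lt.1 hdeg)⟩
    simp only [Shift.ev, aeval_C] at h1 ⊢
    exact tendsto_nhds_unique tendsto_const_nhds h1

end OrthZero

section OrthDiag

open MvPolynomial

variable {a b : ℕ} {c : ℂ} (Γ : GeneralizedModel.{uG} c) (l : Fin 3 → ℂ → ℂ)
  (κ : (Fin 0 → Fin 3 × Fin 3) → ℂ) {u : Pts a} {v : Pts b} {S : Parts a b}
  {r : ℝ} {y : Part a b → ℂ}

lemma HasLim.tendsto_path {X : Type*} {L : Filter X} {φ : Params a b r → ℂ} {z : ℂ}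
    (h : HasLim r y φ z) {p : X → Part a b ⊕ Part a b → ℂ} (hp : Tendsto p L (𝓝 (basePt y)))
    {G : X → ℂ} (hG : ∀ᶠ x in L, ∃ θ : Params a b r, θ.1 = p x ∧ G x = φ θ) :
    Tendsto G L (𝓝 z) := by
  intro U hU
  obtain ⟨V, hV, hVU⟩ := h.2 hU
  change ∀ᶠ x in L, G x ∈ U
  filter_upwards [hG, hp hV] with x ⟨θ, h1, h2⟩ h3
  rw [h2]
  exact hVU (show θ.1 ∈ V by rwa [h1])

variable (a b) in
def unifShift (y : Part a b → ℂ) (t : ℂ) : Part a b ⊕ Part a b → ℂ := Sum.elim (fun _ => t) y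

lemma tendsto_unifShift (y : Part a b → ℂ) : Tendsto (unifShift a b y) (𝓝[≠] 0) (𝓝 (basePt y)) := by
  have h1 : Continuous (unifShift a b y) := continuous_pi fun k => by
    rcases k with k | k <;> simp only [unifShift, Sum.elim_inl, Sum.elim_inr] <;> fun_prop
  exact (h1.tendsto 0).mono_left nhdsWithin_le_nhds

lemma eventually_unifShift (hr : 0 < r) (y : Part a b → ℂ) :
    ∀ᶠ t in 𝓝[≠] 0, ∃ θ : Params a b r, θ.1 = unifShift a b y t := by
  filter_upwards [self_mem_nhdsWithin, nhdsWithin_le_nhds (Metric.ball_mem_nhds (0 : ℂ) hr)]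
    with t h2 h3
  exact ⟨⟨unifShift a b y t, fun e => ⟨h2, by simpa [unifShift] using h3⟩⟩, rfl⟩

def diffPoly (u : Pts a) (v : Pts b) (e' e : Part a b) :
    MvPolynomial (Part a b ⊕ Part a b) ℂ := C (rap u v e' - rap u v e) + X (.inl e')

lemma ev_diffPoly (θ : Params a b r) (e' e : Part a b) :
    θ.ev (diffPoly u v e' e) = rap u v e' + θ.δ e' - rap u v e := by
  simp only [diffPoly, Params.ev, Params.δ, map_add, aeval_C, aeval_X, Algebra.algebraMap_self,
    RingHom.id_apply]
  ring

/-- The polynomial of the shifts that vanishes where the shifted and the original rapidities are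
not in general position. -/
def crossPoly (c : ℂ) (u : Pts a) (v : Pts b) : MvPolynomial (Part a b ⊕ Part a b) ℂ :=
  (∏ e', ∏ e, diffPoly u v e' e * (diffPoly u v e' e + C (I * c)) *
    (C (I * c) - diffPoly u v e' e)) *
  ∏ e', ∏ e, ∏ k', ∏ k, if e' = k' then 1 else diffPoly u v e' e - diffPoly u v k' k

lemma crossPoly_ne_zero (u : Pts a) (v : Pts b) : crossPoly c u v ≠ 0 := by
  refine mul_ne_zero (prod_ne_zero_iff.2 fun e' _ => prod_ne_zero_iff.2 fun e _ =>
    mul_ne_zero (mul_ne_zero ?_ ?_) ?_) (prod_ne_zero_iff.2 fun e' _ =>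
    prod_ne_zero_iff.2 fun e _ => prod_ne_zero_iff.2 fun k' _ => prod_ne_zero_iff.2 fun k _ => ?_)
  · intro h
    simpa [diffPoly] using congrArg (eval fun _ => 1 - (rap u v e' - rap u v e)) h
  · intro h
    simpa [diffPoly] using
      congrArg (eval fun _ => 1 - I * c - (rap u v e' - rap u v e)) h
  · intro h
    simpa [diffPoly] using
      congrArg (eval fun _ => I * c - 1 - (rap u v e' - rap u v e)) h
  · split_ifs with hk
    · exact one_ne_zero
    · intro h
      have := congrArg (eval (Pi.single (.inl e')
        (1 - (rap u v e' - rap u v e) + (rap u v k' - rap u v k)))) h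
      simp [diffPoly, Ne.symm hk] at this
      exact one_ne_zero (α := ℂ) (by linear_combination this)

lemma bethe_ne_zero {N : ℕ} {w : Pts N} (hg : Generic c u v w) (S : Parts a b)
    (k : Part a b) : bethe c u v S k ≠ 0 := by
  have h1 : ∀ i l, i ≠ l → f c (u i) (u l) ≠ 0 := fun i l h => f_ne_zero (hg.uu i l) (hg.u_inj.ne h)
  have h2 : ∀ i l, f c (v i) (u l) ≠ 0 := fun i l => f_ne_zero (hg.vu i l) (hg.v_ne_u i l)
  rcases k with k | k
  · refine mul_ne_zero (div_ne_zero (prod_ne_zero_iff.2 fun i hi => h1 _ _ ?_)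
      (prod_ne_zero_iff.2 fun i hi => h1 _ _ ?_)) (prod_ne_zero_iff.2 fun i _ => h2 _ _)
    exacts [(ne_of_mem_erase hi).symm, ne_of_mem_erase hi]
  · exact prod_ne_zero_iff.2 fun i _ => h2 _ _

section Shifted

variable (u v) in
def uSh (θ : Params a b r) (i : Fin a) : ℂ := u i + θ.δ (.inl i)

variable (u v) in
def vSh (θ : Params a b r) (j : Fin b) : ℂ := v j + θ.δ (.inr j)

lemma bethe_shift_mem (hr : SmallR c u v Fin.elim0 r) (k : Part a b) :
    (fun θ : Params a b r => bethe c (uSh u θ) (vSh v θ) S k) ∈ polarAlg r y ∅ := by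
  have h1 : ∀ i l, i ≠ l → HasLim r y (fun θ => f c (uSh u θ i) (uSh u θ l)) (f c (u i) (u l)) :=
    fun i l h => by
      simpa [posOf, uSh] using hasLim_f (y := y) hr (m := .uC i) (z := .uC l)
        (by simpa [posOf] using hr.1.u_inj.ne h)
  have h2 : ∀ i l, i ≠ l → HasLim r y (fun θ => (f c (uSh u θ i) (uSh u θ l))⁻¹)
      (f c (u i) (u l))⁻¹ := fun i l h => by
      simpa [posOf, uSh] using hasLim_f_inv (y := y) hr (m := .uC i) (z := .uC l)
        (by simpa [posOf] using hr.1.uu i l)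
  have h3 : ∀ i l, HasLim r y (fun θ => f c (vSh v θ i) (uSh u θ l)) (f c (v i) (u l)) :=
    fun i l => by
      simpa [posOf, uSh, vSh] using hasLim_f (y := y) hr (m := .vC i) (z := .uC l)
        (by simpa [posOf] using hr.1.v_ne_u i l)
  rcases k with k | k
  · simp only [bethe, Sum.elim_inl, betheRhs1, div_eq_mul_inv]
    exact fun_mul_mem (fun_mul_mem (fun_prod_mem _ fun i hi =>
      (h1 _ _ (ne_of_mem_erase hi).symm).1) (fun_prod_inv_mem _ fun i hi =>
      (h2 _ _ (ne_of_mem_erase hi)).1)) (fun_prod_mem _ fun i _ => (h3 _ _).1)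
  · exact fun_prod_mem _ fun i _ => (h3 _ _).1

lemma generic_shift (hr : SmallR c u v Fin.elim0 r) (θ : Params a b r) :
    Generic c (uSh u θ) (vSh v θ) Fin.elim0 where
  u_inj i l h := by simpa using posOf_injective hr θ (a₁ := .uC i) (a₂ := .uC l) h
  v_inj i l h := by simpa using posOf_injective hr θ (a₁ := .vC i) (a₂ := .vC l) h
  w_inj i := i.elim0
  v_ne_u i l h := by simpa using posOf_injective hr θ (a₁ := .vC i) (a₂ := .uC l) h
  w_ne_u i := i.elim0
  w_ne_v i := i.elim0
  u_sub_u i l h := (hr.invIn_add (y := 0) (D := ∅) (m := .uC l) (z := .uC i)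
    (by simpa [posOf] using hr.1.uu l i)).1 θ (by
      simp only [posOf, uSh] at h ⊢
      linear_combination -h)
  v_sub_v i l h := (hr.invIn_add (y := 0) (D := ∅) (m := .vC l) (z := .vC i)
    (by simpa [posOf] using hr.1.vv l i)).1 θ (by
      simp only [posOf, vSh] at h ⊢
      linear_combination -h)
  v_sub_u i l h := (hr.invIn_add (y := 0) (D := ∅) (m := .vC i) (z := .uC l)
    (by simpa [posOf] using hr.1.vu i l)).1 θ (by
      simp only [posOf, uSh, vSh] at h ⊢
      linear_combination h)
  w_sub_u i := i.elim0
  v_sub_w _ i := i.elim0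

variable (c u v S) in
/-- The factors for which the dual vector with the shifted rapidities is on-shell. -/
def onShellRatio (θ : Params a b r) (k : Part a b) : ℂ :=
  bethe c (uSh u θ) (vSh v θ) S k / bethe c u v S k

lemma famMelem_eq_orthMelem (hg : Generic c u v Fin.elim0) (θ : Params a b r) :
    famMelem Γ l κ u v Fin.elim0 S θ.δ (onShellRatio c u v S θ) =
      orthMelem Γ κ u v (uSh u θ) (vSh v θ) S S 0 1 := by
  have h1 : posOf u v Fin.elim0 θ.δ = pos2 u v (uSh u θ) (vSh v θ) 0 := by
    funext m
    rcases m with m | m | m | m | m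
    exacts [rfl, rfl, (add_zero _).symm, (add_zero _).symm, m.elim0]
  have h2 : ∀ k, bethe c u v S k * onShellRatio c u v S θ k =
      bethe c (uSh u θ) (vSh v θ) S k * 1 := fun k => by
    rw [onShellRatio, mul_div_cancel₀ _ (bethe_ne_zero hg S k), mul_one]
  have h3 : famLam c l u v Fin.elim0 S (onShellRatio c u v S θ) =
      orthLam c u v (uSh u θ) (vSh v θ) S S 1 := by
    funext m
    rcases m with m | m | m | m | m
    · rfl
    · rfl
    · simp only [famLam, h2]
      rfl
    · simp only [famLam, h2]
      rfl
    · exact m.elim0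
  rw [famMelem, famModel, h1, h3]
  rfl

lemma famMelem_onShellRatio (hc : c ≠ 0) (hr : SmallR c u v Fin.elim0 r) (hS : S.Nonempty) (θ : Params a b r) :
    famMelem Γ l κ u v Fin.elim0 S θ.δ (onShellRatio c u v S θ) = 0 := by
  have hmem : (fun θ : Params a b r => famMelem Γ l κ u v Fin.elim0 S θ.δ
      (onShellRatio c u v S θ)) ∈ polarAlg r 0 (allShifts a b) :=
    famMelem_mem Γ l κ hc hr 0 subset_rfl (fun e _ => by simp [allShifts]) fun k _ =>
      polarAlg_mono (empty_subset _) subset_rfl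
        (by
          simp only [onShellRatio, div_eq_mul_inv]
          exact fun_mul_mem (bethe_shift_mem hr k) (const_mem _))
  obtain ⟨P, T, -, h⟩ := hmem
  suffices hP : P = 0 by
    have := (h θ).2
    rw [hP, map_zero] at this
    exact (mul_eq_zero.1 this).resolve_right (h θ).1
  refine (mul_eq_zero.1 (Params.ev_ext hr.pos _ 0 fun θ => ?_)).resolve_right
    (crossPoly_ne_zero (c := c) u v)
  rw [map_mul, map_zero, ← (h θ).2]
  by_cases h0 : θ.ev (crossPoly c u v) = 0
  · rw [h0, mul_zero]
  have hC : θ.ev (C I) * θ.ev (C c) = I * c := by simp [Params.ev]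
  rw [crossPoly, map_mul] at h0
  simp only [map_prod, map_mul, map_add, map_sub, ev_diffPoly, hC] at h0
  have h1 := left_ne_zero_of_mul h0
  have h2 := right_ne_zero_of_mul h0
  simp only [prod_ne_zero_iff, mem_univ, true_imp_iff] at h1 h2
  have hr1 : ∀ e, rap (uSh u θ) (vSh v θ) e = rap u v e + θ.δ e := fun e => by
    rcases e with e | e <;> rfl
  beta_reduce
  rw [famMelem_eq_orthMelem Γ l κ hr.1, orthMelem_eq_zero Γ κ hc hr.1 (generic_shift hr θ) ?_ hS rfl
    ⟨0, fun e' e => ?_⟩, zero_mul, zero_mul]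
  · intro e' e k' k hd
    simp only [hr1] at hd
    have h3 := h2 e' e k' k
    split_ifs at h3 with h4
    · subst h4
      refine ⟨rfl, not_ne_iff.1 fun h5 => rap_ne hr.1 h5 (by linear_combination -hd)⟩
    · refine absurd ?_ h3
      rw [map_sub, ev_diffPoly, ev_diffPoly, hd, sub_self]
  · have h3 := h1 e' e
    rw [hr1, add_zero]
    refine ⟨left_ne_zero_of_mul (left_ne_zero_of_mul h3),
      right_ne_zero_of_mul (left_ne_zero_of_mul h3), fun h4 => right_ne_zero_of_mul h3 ?_⟩
    linear_combination h4

end Shifted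

/-- The scalar product of two on-shell Bethe vectors that differ by a shift tends to zero. -/
lemma devFF_hasLim_zero (hc : c ≠ 0) (hr : SmallR c u v Fin.elim0 r) (hS : S.Nonempty) {z : ℂ}
    (h : HasLim r y (devFF Γ l κ u v Fin.elim0 S 0) z) : z = 0 := by
  refine tendsto_nhds_unique (h.tendsto_path (tendsto_unifShift y) (G := fun _ => 0) ?_)
    tendsto_const_nhds
  filter_upwards [eventually_unifShift hr.pos y] with t ⟨θ, hθ⟩
  refine ⟨θ, hθ, ?_⟩
  have hδ : ∀ e, θ.δ e = t := fun e => congrFun hθ (.inl e)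
  have h1 : onShellRatio c u v S θ = 1 := by
    funext k
    refine (div_eq_one_iff_eq (bethe_ne_zero hr.1 S k)).2 ?_
    rcases k with k | k <;>
      simp only [bethe, Sum.elim_inl, Sum.elim_inr, betheRhs1, betheRhs3, uSh, vSh, hδ, f,
        add_sub_add_right_eq_sub]
  have h2 := famMelem_onShellRatio Γ l κ hc hr hS θ
  rw [h1] at h2
  have h3 : (fun k => 1 + θ.δ k * (0 : Part a b → Params a b r → ℂ) k θ) = 1 := by
    funext k
    simp
  rw [devFF, famFF, h3, h2, zero_div]

lemma melem_empty (M : Model.{uM} c) (p : Lbl a b 0 → ℂ) : melem M p κ ∅ ∅ ∅ ∅ = κ Fin.elim0 := by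
  rw [Subsingleton.elim Fin.elim0 default]
  simp [melem, prod2, operator, ket, bra, betheCoeff, symT3, symT3', opProd, Delta, Delta',
    filter_singleton, M.covac_vac]
  exact congrArg κ (Subsingleton.elim _ _)

lemma devFF_hasLim_empty (hr : SmallR c u v Fin.elim0 r) {z : ℂ}
    (h : HasLim r y (devFF Γ l κ u v Fin.elim0 ∅ 0) z) : z = κ Fin.elim0 := by
  have := parLim_neBot (y := y) hr.pos
  have h1 : (∅ : Parts a b).toLeft = ∅ := by ext; simp
  have h2 : (∅ : Parts a b).toRight = ∅ := by ext; simp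
  refine tendsto_nhds_unique h.2 (tendsto_const_nhds.congr fun θ => ?_)
  simp [devFF, famFF, famDen, famMelem, h1, h2, melem_empty, prod2]

end OrthDiag

section Limits

variable {a b N : ℕ} {c : ℂ} (Γ : GeneralizedModel.{uG} c) (l : Fin 3 → ℂ → ℂ)
  (κ : Coeffs N) {u : Pts a} {v : Pts b} {w : Pts N}
  {S : Parts a b} {r : ℝ} {y : Part a b → ℂ}

/-- The ratio of vacuum eigenvalues, `r₁` or `r₃`, in the Bethe equation of a particle. -/
def Model.ratio (M : Model.{uM} c) : Part a b → ℂ → ℂ := Sum.elim (fun _ => M.r1) fun _ => M.r3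

/-- The form factor depends on the model only through the ratios at the rapidities and the
eigenvalues at the arguments of the operator. -/
lemma formFactor_eq_famFF (hc : c ≠ 0) (hr : SmallR c u v w r)
    (M : Model.{uM} c) (θ : Params a b r) (σ : Part a b → ℂ)
    (hne : ∀ k ∈ S, M.lam 1 (rap u v k) ≠ 0 ∧ M.lam 1 (rap u v k + θ.δ k) ≠ 0)
    (hK : ∀ k ∈ S, M.ratio k (rap u v k) = bethe c u v S k)
    (hC : ∀ k ∈ S, M.ratio k (rap u v k + θ.δ k) = bethe c u v S k * σ k)
    (hw : ∀ i m, M.lam i (w m) = lamMod c l u v S.toLeftᶜ S.toRightᶜ i (w m)) :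
    formFactor M w κ S.toLeft S.toRight (fun i => u i + θ.δ (.inl i)) (fun j => v j + θ.δ (.inr j))
      u v = famFF Γ l κ u v w S θ.δ σ := by
  change melem M (posOf u v w θ.δ) κ S.toLeft S.toRight S.toLeft S.toRight / famDen u v w c S θ.δ = _
  have hp := posOf_injective hr θ
  have hR := reg_polarAlg hr 0 (subset_refl (allShifts a b)) S.toLeft S.toRight
  rw [famFF, famMelem, melem_congr hc Γ κ hp.injOn
    ((hR.ptReg_ket hc fun m _ z _ => not_pairNotIn_allShifts m z).ketRegular θ)
    ((hR.ptReg_bra hc fun m _ z _ => not_pairNotIn_allShifts m z).ketRegular θ)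
    ⟨?_, ?_, ?_, ?_, ?_, ?_⟩]
  · intro m hm
    rw [famModel, Γ.lam_ofLbl hp, famLam_one l hm]
    refine ⟨?_, one_ne_zero⟩
    rcases m with m | m | m | m | m
    exacts [(hne (.inl m) (by simpa using hm)).1, (hne (.inr m) (by simpa using hm)).1,
      (hne (.inl m) (by simpa using hm)).2, (hne (.inr m) (by simpa using hm)).2, by simp at hm]
  · intro i hi
    rw [Model.r1, Model.r1, famModel, Γ.lam_ofLbl hp, Γ.lam_ofLbl hp]
    exact (hK (.inl i) (by simpa using hi)).trans (div_one _).symm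
  · intro i hi
    rw [Model.r3, Model.r3, famModel, Γ.lam_ofLbl hp, Γ.lam_ofLbl hp]
    exact (hK (.inr i) (by simpa using hi)).trans (div_one _).symm
  · intro i hi
    rw [Model.r1, Model.r1, famModel, Γ.lam_ofLbl hp, Γ.lam_ofLbl hp]
    exact (hC (.inl i) (by simpa using hi)).trans (div_one _).symm
  · intro i hi
    rw [Model.r3, Model.r3, famModel, Γ.lam_ofLbl hp, Γ.lam_ofLbl hp]
    exact (hC (.inr i) (by simpa using hi)).trans (div_one _).symm
  · intro i m
    rw [famModel, Γ.lam_ofLbl hp]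
    exact hw i m

lemma tendsto_shiftedFormFactor (hc : c ≠ 0) (hr : SmallR c u v w r)
    {z : ℂ} (h : HasLim r y (devFF Γ l κ u v w S 0) z) :
    Tendsto (shiftedFormFactor Γ (lamMod c l u v S.toLeftᶜ S.toRightᶜ) w κ u v S.toLeft S.toRight)
      (𝓝[≠] 0) (𝓝 z) := by
  refine h.tendsto_path (tendsto_unifShift y) ?_
  filter_upwards [eventually_unifShift hr.pos y] with t ⟨θ, hθ⟩
  refine ⟨θ, hθ, ?_⟩
  have hδ : ∀ e, θ.δ e = t := fun e => congrFun hθ (.inl e)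
  have hp := posOf_injective hr θ
  have huu : ∀ i j, u i = u j ↔ i = j := fun i j => hr.1.u_inj.eq_iff
  have hvv : ∀ i j, v i = v j ↔ i = j := fun i j => hr.1.v_inj.eq_iff
  have huC : ∀ i j, u i ≠ u j + t := fun i j h => by
    simpa using hp (a₁ := .u i) (a₂ := .uC j) (by simpa [posOf, hδ] using h)
  have hvC : ∀ i j, v i ≠ v j + t := fun i j h => by
    simpa using hp (a₁ := .v i) (a₂ := .vC j) (by simpa [posOf, hδ] using h)
  have hwu : ∀ i j, w i ≠ u j := hr.1.w_ne_u
  have hwv : ∀ i j, w i ≠ v j := hr.1.w_ne_v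
  have hwuC : ∀ i j, w i ≠ u j + t := fun i j h => by
    simpa using hp (a₁ := .w i) (a₂ := .uC j) (by simpa [posOf, hδ] using h)
  have hwvC : ∀ i j, w i ≠ v j + t := fun i j h => by
    simpa using hp (a₁ := .w i) (a₂ := .vC j) (by simpa [posOf, hδ] using h)
  have hlam : ∀ i, ∀ x ∈ symPoints w u v S.toLeft S.toRight t,
    (Γ.model (symPoints w u v S.toLeft S.toRight t) (lamSym c (lamMod c l u v S.toLeftᶜ S.toRightᶜ)
      w u v S.toLeft S.toRight t)).lam i x = lamSym c (lamMod c l u v S.toLeftᶜ S.toRightᶜ)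
      w u v S.toLeft S.toRight t i x := fun i x hx => Γ.lam_model _ _ i x hx
  have hK : ∀ k ∈ S, rap u v k ∈ symPoints w u v S.toLeft S.toRight t := by
    rintro (k | k) hk <;> simp only [symPoints, mem_union, mem_image]
    exacts [.inl (.inr (.inl ⟨k, by simpa using hk, rfl⟩)),
      .inr (.inl ⟨k, by simpa using hk, rfl⟩)]
  have hC : ∀ k ∈ S, rap u v k + t ∈ symPoints w u v S.toLeft S.toRight t := by
    rintro (k | k) hk <;> simp only [symPoints, mem_union, mem_image]
    exacts [.inl (.inr (.inr ⟨k, by simpa using hk, rfl⟩)),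
      .inr (.inr ⟨k, by simpa using hk, rfl⟩)]
  have hKw : ∀ k, rap u v k ∉ univ.image w := by rintro (k | k) <;> simp [rap, hwu, hwv]
  have hCw : ∀ k, rap u v k + t ∉ univ.image w := by rintro (k | k) <;> simp [rap, hwuC, hwvC]
  have := formFactor_eq_famFF Γ l κ hc hr (Γ.model (symPoints w u v S.toLeft S.toRight t)
    (lamSym c (lamMod c l u v S.toLeftᶜ S.toRightᶜ) w u v S.toLeft S.toRight t)) θ
    (fun k => 1 + θ.δ k * (0 : Part a b → Params a b r → ℂ) k θ) (S := S) ?_ ?_ ?_ ?_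
  · rw [devFF, ← this]
    simp only [hδ]
    rfl
  · intro k hk
    rw [hδ, hlam _ _ (hK k hk), hlam _ _ (hC k hk), lamSym, if_neg (hKw k), lamSym, if_neg (hCw k)]
    simp
  · rintro (k | k) hk <;> simp only [Model.ratio, Sum.elim_inl, Sum.elim_inr, Model.r1, Model.r3] <;>
      rw [hlam _ _ (hK _ hk), hlam _ _ (hK _ hk)] <;>
      simp only [lamSym, if_neg (hKw _)]
    · have : k ∈ S.toLeft := by simpa using hk
      simp [rap, huu, huC, bethe, this]
    · have : k ∈ S.toRight := by simpa using hk
      simp [rap, hvv, hvC, bethe, this]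
  · rintro (k | k) hk <;> simp only [Model.ratio, Sum.elim_inl, Sum.elim_inr, Model.r1, Model.r3] <;>
      rw [hδ, hlam _ _ (hC _ hk), hlam _ _ (hC _ hk)] <;>
      simp only [lamSym, if_neg (hCw _)]
    · have : k ∈ S.toLeft := by simpa using hk
      simp [rap, huu, (huC _ _).symm, bethe, this, betheRhs1, f]
    · have : k ∈ S.toRight := by simpa using hk
      simp [rap, hvv, (hvC _ _).symm, bethe, this, betheRhs3, f]
  · intro i m
    rw [hlam _ _ (by simp [symPoints]), lamSym, if_pos (by simp)]

lemma tendsto_formFactor (hc : c ≠ 0) (hr : SmallR c u v w r)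
    (M : Model.{uM} c) (hshell : M.OnShell u v)
    (hlam : ∀ k : Part a b, ∀ᶠ x in 𝓝 (rap u v k), M.lam 1 x ≠ 0)
    (hdiff : ∀ k : Part a b, DifferentiableAt ℂ (M.ratio k) (rap u v k))
    {L : Parts a b → ℂ} (hL : ∀ S, HasLim r
      (fun k => logDeriv (M.ratio k) (rap u v k)) (devFF Γ M.lam κ u v w S 0) (L S)) :
    Tendsto (fun p => formFactor M w κ univ univ p.1 p.2 u v) (diagLimit u v)
      (𝓝 (expansion c u v L univ fun k => logDeriv (M.ratio k) (rap u v k))) := by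
  set y : Part a b → ℂ := fun k => logDeriv (M.ratio k) (rap u v k) with hy
  have hF : HasLim r y (devFF Γ M.lam κ u v w univ fun k θ => θ.1 (.inr k))
      (expansion c u v L univ y) :=
    devFF_hasLim Γ M.lam κ hc hr (expansion c u v L)
      (fun S => by rw [expansion_zero hc hr.1]; exact hL S)
      (fun S e he z => expansion_insert hc hr.1 L S e he z) univ
      (fun k => hasLim_param k) fun k hk => absurd (mem_univ k) hk
  have hb : ∀ k : Part a b, M.ratio k (rap u v k) = bethe c u v univ k := by
    rintro (k | k)
    exacts [by simpa [bethe] using! hshell.1 k, by simpa [bethe] using! hshell.2 k]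
  have hb0 : ∀ k : Part a b, M.ratio k (rap u v k) ≠ 0 := fun k => by
    rw [hb]
    exact bethe_ne_zero hr.1 _ k
  have hlim : ∀ k : Part a b, Tendsto (fun p : (Pts a) × (Pts b) => rap p.1 p.2 k)
      (diagLimit u v) (𝓝[≠] (rap u v k)) := by
    intro k
    refine tendsto_nhdsWithin_iff.2 ⟨?_, ?_⟩
    · have : Continuous fun p : (Pts a) × (Pts b) => rap p.1 p.2 k := by
        rcases k with k | k <;> simp only [rap, Sum.elim_inl, Sum.elim_inr] <;> fun_prop
      exact (this.tendsto (u, v)).mono_left nhdsWithin_le_nhds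
    · filter_upwards [self_mem_nhdsWithin] with p hp
      rcases k with k | k
      exacts [hp.1 k, hp.2 k]
  refine hF.tendsto_path (p := fun p => Sum.elim (fun k => rap p.1 p.2 k - rap u v k) fun k =>
    (M.ratio k (rap p.1 p.2 k) / M.ratio k (rap u v k) - 1) / (rap p.1 p.2 k - rap u v k)) ?_ ?_
  · refine tendsto_pi_nhds.2 ?_
    rintro (k | k) <;> simp only [Sum.elim_inl, Sum.elim_inr, basePt, Pi.zero_apply]
    · simpa using ((hlim k).mono_right nhdsWithin_le_nhds).sub_const (rap u v k)
    · have h1 := ((hdiff k).hasDerivAt.tendsto_slope.comp (hlim k)).mul_const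
        (M.ratio k (rap u v k))⁻¹
      rw [← div_eq_mul_inv] at h1
      refine h1.congr fun p => ?_
      simp only [Function.comp, slope, vsub_eq_sub, smul_eq_mul]
      field_simp [hb0 k]
  · have h1 : ∀ᶠ p in diagLimit u v, ∀ k : Part a b, M.lam 1 (rap p.1 p.2 k) ≠ 0 :=
      eventually_all.2 fun k => ((hlim k).mono_right nhdsWithin_le_nhds).eventually (hlam k)
    have h2 : ∀ᶠ p in diagLimit u v, ∀ k : Part a b, rap p.1 p.2 k ∈ Metric.ball (rap u v k) r :=
      eventually_all.2 fun k => ((hlim k).mono_right nhdsWithin_le_nhds).eventually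
        (Metric.ball_mem_nhds _ hr.pos)
    have h3 : ∀ᶠ p in diagLimit u v, ∀ k : Part a b, rap p.1 p.2 k ≠ rap u v k :=
      eventually_all.2 fun k => (hlim k).eventually self_mem_nhdsWithin
    filter_upwards [h1, h2, h3] with p h1 h2 h3
    set θ : Params a b r := ⟨Sum.elim (fun k => rap p.1 p.2 k - rap u v k) fun k =>
      (M.ratio k (rap p.1 p.2 k) / M.ratio k (rap u v k) - 1) / (rap p.1 p.2 k - rap u v k), fun k => ⟨sub_ne_zero.2 (h3 k),
      by simpa [dist_eq_norm] using h2 k⟩⟩ with hθ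
    have hδ : ∀ k, rap u v k + θ.δ k = rap p.1 p.2 k := fun k => add_sub_cancel _ _
    refine ⟨θ, rfl, ?_⟩
    have := formFactor_eq_famFF Γ M.lam κ hc hr M θ (fun k => 1 + θ.δ k * θ.1 (.inr k))
      (S := univ) ?_ ?_ ?_ ?_
    · rw [devFF, ← this, toLeft_univ, toRight_univ]
      congr 1 <;> funext k
      exacts [(hδ (.inl k)).symm, (hδ (.inr k)).symm]
    · exact fun k _ => ⟨(hlam k).self_of_nhds, by rw [hδ]; exact h1 k⟩
    · exact fun k _ => hb k
    · intro k _
      have h4 : θ.δ k * θ.1 (.inr k) = M.ratio k (rap p.1 p.2 k) / M.ratio k (rap u v k) - 1 :=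
        mul_div_cancel₀ _ (sub_ne_zero.2 (h3 k))
      rw [hδ, h4, ← hb, add_sub_cancel, mul_div_cancel₀ _ (hb0 k)]
    · intro i m
      fin_cases i <;> simp [lamMod]

end Limits

section Main

variable {a b N : ℕ} {c : ℂ} {u : Pts a} {v : Pts b} {w : Pts N}

lemma Delta_mul_Delta'_union {n : ℕ} (F : ℂ → ℂ → ℂ) (x : Pts n) {A B : Finset (Fin n)}
    (h : Disjoint A B) : Delta F x (A ∪ B) * Delta' F x (A ∪ B) =
      Delta F x A * Delta' F x A * (Delta F x B * Delta' F x B) * prod2 F x A x B *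
        prod2 F x B x A := by
  induction A using Finset.induction_on with
  | empty => simp [Delta, Delta', prod2]
  | insert e A he ih =>
    rw [disjoint_insert_left] at h
    have he' : e ∉ A ∪ B := by simp [he, h.1]
    rw [insert_union, Delta_mul_Delta'_insert F x he', Delta_mul_Delta'_insert F x he,
      ih h.2, prod_union h.2]
    simp only [prod2, prod_insert he, prod_mul_distrib]
    ring

lemma expansionCoeff_eq (hc : c ≠ 0) (hg : Generic c u v w) (Z : Pts a) (Y : Pts b)
    (I : Finset (Fin a)) (J : Finset (Fin b)) :
    expansionCoeff c u v Z Y I J = normFactor c u v univ univ /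
      normFactor c u v Iᶜ Jᶜ * (gaudin c u v Z Y I J).det := by
  have h0 : normFactor c u v Iᶜ Jᶜ ≠ 0 := by
    simpa [partNorm] using partNorm_ne_zero hc hg (Iᶜ.disjSum Jᶜ)
  have hI := Delta_mul_Delta'_union (f c) u (disjoint_compl_right (a := I))
  have hJ := Delta_mul_Delta'_union (g c) v (disjoint_compl_right (a := J))
  rw [union_compl] at hI hJ
  have h1 : ∀ A, prod2 (f c) v univ u A = prod2 (f c) v J u A * prod2 (f c) v Jᶜ u A :=
    fun A => by rw [← union_compl J, prod2, prod_union disjoint_compl_right]; rfl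
  have h2 : prod2 (f c) v Jᶜ u univ = prod2 (f c) v Jᶜ u I * prod2 (f c) v Jᶜ u Iᶜ := by
    simp only [prod2, ← prod_mul_distrib]
    exact prod_congr rfl fun j _ => by rw [← prod_union disjoint_compl_right, union_compl]
  have h3 : (-1 : ℂ) ^ ((univ : Finset (Fin a)).card + (univ : Finset (Fin b)).card) =
      (-1) ^ (I.card + J.card) * (-1) ^ (Iᶜ.card + Jᶜ.card) := by
    rw [← pow_add, card_univ, card_univ, ← card_add_card_compl I, ← card_add_card_compl J]
    congr 1
    ring
  have key : normFactor c u v univ univ = (-1) ^ (I.card + J.card) *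
      prod2 (f c) v J u univ * prod2 (f c) v Jᶜ u I *
      Delta (f c) u I * Delta' (f c) u I * Delta (g c) v J * Delta' (g c) v J *
      prod2 (f c) u I u Iᶜ * prod2 (f c) u Iᶜ u I * prod2 (g c) v Jᶜ v J * prod2 (g c) v J v Jᶜ *
      normFactor c u v Iᶜ Jᶜ := by
    rw [normFactor, normFactor, h3, h1, h2]
    linear_combination (exp := 1) (-1) ^ (I.card + J.card) * (-1) ^ (Iᶜ.card + Jᶜ.card) *
      (prod2 (f c) v J u univ * (prod2 (f c) v Jᶜ u I * prod2 (f c) v Jᶜ u Iᶜ)) *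
      (Delta (g c) v univ * Delta' (g c) v univ * hI + Delta (f c) u I * Delta' (f c) u I *
        (Delta (f c) u Iᶜ * Delta' (f c) u Iᶜ) * prod2 (f c) u I u Iᶜ * prod2 (f c) u Iᶜ u I * hJ)
  rw [key, mul_div_cancel_right₀ _ h0]
  rfl

lemma expansion_univ (L : Parts a b → ℂ) {Z : Pts a} {Y : Pts b}
    {z : Part a b → ℂ} (hz : ∀ k, I * z k = Sum.elim Z Y k) :
    expansion c u v L univ z = ∑ I : Finset (Fin a), ∑ J : Finset (Fin b),
      normFactor c u v univ univ / normFactor c u v Iᶜ Jᶜ *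
        (gaudin c u v Z Y I J).det * L (Iᶜ.disjSum Jᶜ) := by
  rw [← Fintype.sum_prod_type', expansion, powerset_univ]
  refine Fintype.sum_equiv sumEquiv.toEquiv _ _ fun S => ?_
  have h1 : univ \ S = S.toLeftᶜ.disjSum S.toRightᶜ := by ext (k | k) <;> simp
  simp only [hz]
  rw [← det_gaudin_eq, h1, partNorm, partNorm, toLeft_univ, toRight_univ,
    toLeft_disjSum, toRight_disjSum]
  rfl

lemma scalarProduct_eq_formFactor (M : Model.{uM} c) (uC : Pts a) (vC : Pts b)
    (u : Pts a) (v : Pts b) : scalarProduct M uC vC u v =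
      formFactor M Fin.elim0 (fun _ => 1) univ univ uC vC u v := by
  simp [scalarProduct, formFactor, operator, prod2]

lemma diagLimit_neBot (u : Pts a) (v : Pts b) : (diagLimit u v).NeBot := by
  refine mem_closure_iff_nhdsWithin_neBot.1 ?_
  have h1 : Continuous fun t : ℂ => ((fun j => u j + t, fun j => v j + t) :
    (Pts a) × (Pts b)) := by fun_prop
  have h2 := (h1.tendsto 0).mono_left (nhdsWithin_le_nhds (s := {0}ᶜ))
  simp only [add_zero] at h2
  refine mem_closure_of_tendsto h2 ?_
  filter_upwards [self_mem_nhdsWithin] with t ht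
  exact ⟨fun j => by simpa using ht, fun j => by simpa using ht⟩

/-- The squared norm of an on-shell Bethe vector is the Gaudin determinant. -/
lemma tendsto_scalarProduct (hc : c ≠ 0) (𝒢 : GeneralizedModel.{uG} c)
    (hg : Generic c u v Fin.elim0) (M : Model.{uM} c) (hshell : M.OnShell u v)
    (hlam : ∀ k : Part a b, ∀ᶠ x in 𝓝 (rap u v k), M.lam 1 x ≠ 0)
    (hdiff : ∀ k : Part a b, DifferentiableAt ℂ (M.ratio k) (rap u v k)) {Z : Pts a} {Y : Pts b}
    (hz : ∀ k, I * logDeriv (M.ratio k) (rap u v k) = Sum.elim Z Y k) :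
    Tendsto (fun p => scalarProduct M p.1 p.2 u v) (diagLimit u v) (𝓝 (normFactor c u v univ univ *
        (gaudin c u v Z Y univ univ).det)) := by
  obtain ⟨r, hr⟩ := exists_small hg
  choose L hL using fun S => HasLim.exists (devFF_regular (y := fun k : Part a b =>
    logDeriv (M.ratio k) (rap u v k)) 𝒢 M.lam (fun _ => 1) hc hr S (η := 0) fun _ => zero_mem _)
  have h := tendsto_formFactor 𝒢 (fun _ => 1) hc hr M hshell hlam hdiff hL
  have h0 : expansion c u v L univ (fun k => logDeriv (M.ratio k) (rap u v k)) =
      normFactor c u v univ univ * (gaudin c u v Z Y univ univ).det := by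
    rw [expansion, sum_eq_single_of_mem univ (by simp)]
    · rw [Finset.sdiff_self, devFF_hasLim_empty 𝒢 M.lam (fun _ => 1) hr (hL ∅), partNorm_empty,
        div_one, mul_one, partNorm, toLeft_univ, toRight_univ]
      simp only [hz]
      rw [← det_gaudin_eq, toLeft_univ, toRight_univ]
    · intro J hJ hne
      rw [devFF_hasLim_zero 𝒢 M.lam (fun _ => 1) hc hr ?_ (hL _), mul_zero]
      rw [sdiff_nonempty]
      exact fun h => hne (univ_subset_iff.1 h)
  rw [h0] at h
  simpa only [scalarProduct_eq_formFactor] using h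

end Main

end
end GL21

open GL21 in
theorem mainTheorem1 {c : ℂ} (hc : c ≠ 0) (M : GL21.Model.{uM} c)
    (𝒢 : GL21.GeneralizedModel.{uG} c) {a b N : ℕ}
    (w : Fin N → ℂ) (κ : (Fin N → Fin 3 × Fin 3) → ℂ)
    (u : Fin a → ℂ) (v : Fin b → ℂ) (Z : Fin a → ℂ) (Y : Fin b → ℂ)
    (hgen : GL21.Generic c u v w) (hshell : M.OnShell u v)
    (hlam_u : ∀ j, ∀ᶠ x in 𝓝 (u j), M.lam 1 x ≠ 0)
    (hlam_v : ∀ j, ∀ᶠ x in 𝓝 (v j), M.lam 1 x ≠ 0)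
    (hr1 : ∀ j, DifferentiableAt ℂ M.r1 (u j)) (hr3 : ∀ j, DifferentiableAt ℂ M.r3 (v j))
    (hZ : ∀ j, Z j = M.Z (u j)) (hY : ∀ j, Y j = M.Y (v j)) :
    -- the limits that define the symmetric form factors, the diagonal form factor and the norm exist
    (∀ (I : Finset (Fin a)) (J : Finset (Fin b)),
      Tendsto
        (GL21.shiftedFormFactor 𝒢 (GL21.lamMod c M.lam u v I J) w κ u v Iᶜ Jᶜ)
        (𝓝[≠] 0)
        (𝓝 (GL21.symFormFactor 𝒢 (GL21.lamMod c M.lam u v I J) w κ u v Iᶜ Jᶜ))) ∧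
    Tendsto
      (fun p => GL21.formFactor M w κ univ univ p.1 p.2 u v)
      (GL21.diagLimit u v) (𝓝 (GL21.diagFormFactor M w κ u v)) ∧
    Tendsto (fun p => GL21.scalarProduct M p.1 p.2 u v)
      (GL21.diagLimit u v) (𝓝 (GL21.normSq M u v)) ∧
    -- the expansion of the diagonal form factor
    GL21.diagFormFactor M w κ u v =
      ∑ I : Finset (Fin a), ∑ J : Finset (Fin b),
        GL21.expansionCoeff c u v Z Y I J *
          GL21.symFormFactor 𝒢 (GL21.lamMod c M.lam u v I J) w κ u v Iᶜ Jᶜ ∧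
    -- the normalized expansion
    ((GL21.gaudin c u v Z Y univ univ).det ≠ 0 →
      GL21.normSq M u v ≠ 0 ∧
      GL21.diagFormFactor M w κ u v / GL21.normSq M u v =
        (∑ I : Finset (Fin a), ∑ J : Finset (Fin b),
          (GL21.gaudin c u v Z Y I J).det *
            (GL21.symFormFactor 𝒢 (GL21.lamMod c M.lam u v I J) w κ u v Iᶜ Jᶜ /
              GL21.normFactor c u v Iᶜ Jᶜ)) /
          (GL21.gaudin c u v Z Y univ univ).det) := by
  obtain ⟨r, hr⟩ := exists_small hgen
  have hlam : ∀ k : Part a b, ∀ᶠ x in 𝓝 (rap u v k), M.lam 1 x ≠ 0 := by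
    rintro (k | k)
    exacts [hlam_u k, hlam_v k]
  have hdiff : ∀ k : Part a b, DifferentiableAt ℂ (M.ratio k) (rap u v k) := by
    rintro (k | k)
    exacts [hr1 k, hr3 k]
  have hz : ∀ k : Part a b, I * logDeriv (M.ratio k) (rap u v k) = Sum.elim Z Y k := by
    rintro (k | k)
    exacts [(hZ k).symm, (hY k).symm]
  choose L hL using fun S => HasLim.exists (devFF_regular (y := fun k : Part a b =>
    logDeriv (M.ratio k) (rap u v k)) 𝒢 M.lam κ hc hr S (η := 0) fun _ => zero_mem _)
  have hsym : ∀ I J, Tendsto (shiftedFormFactor 𝒢 (lamMod c M.lam u v I J) w κ u v Iᶜ Jᶜ)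
      (𝓝[≠] 0) (𝓝 (L (Iᶜ.disjSum Jᶜ))) := fun I J => by
    simpa using tendsto_shiftedFormFactor 𝒢 M.lam κ hc hr (hL (Iᶜ.disjSum Jᶜ))
  have hsymL : ∀ I J, symFormFactor 𝒢 (lamMod c M.lam u v I J) w κ u v Iᶜ Jᶜ =
      L (Iᶜ.disjSum Jᶜ) := fun I J => (hsym I J).limUnder_eq
  have hdiag := tendsto_formFactor 𝒢 κ hc hr M hshell hlam hdiff hL
  rw [expansion_univ L hz] at hdiag
  have hgen0 : Generic c u v Fin.elim0 :=
    { hgen with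
      w_inj := fun i => i.elim0
      w_ne_u := fun i => i.elim0
      w_ne_v := fun i => i.elim0
      w_sub_u := fun i => i.elim0
      v_sub_w := fun _ i => i.elim0 }
  have hnorm := tendsto_scalarProduct hc 𝒢 hgen0 M hshell hlam hdiff hz
  have := diagLimit_neBot u v
  have hdiagL : diagFormFactor M w κ u v = _ := hdiag.limUnder_eq
  have hnormL : normSq M u v = _ := hnorm.limUnder_eq
  have hn : normFactor c u v univ univ ≠ 0 := by
    simpa [partNorm] using partNorm_ne_zero hc hgen (univ : Parts a b)
  refine ⟨fun I J => hsymL I J ▸ hsym I J, hdiagL ▸ hdiag, hnormL ▸ hnorm, ?_, fun hdet => ?_⟩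
  · simp only [hdiagL, hsymL, expansionCoeff_eq hc hgen]
  · simp only [hnormL, hdiagL, hsymL]
    refine ⟨mul_ne_zero hn hdet, ?_⟩
    rw [← div_div, div_left_inj' hdet, div_eq_iff hn]
    simp only [sum_mul]
    refine sum_congr rfl fun I _ => sum_congr rfl fun J _ => ?_
    ring
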